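/- Let $P$ be a simple polygon in the plane (a closed region) whose boundary $\partial P$ is directed clockwise. A chord is a segment $pq\subseteq P$ with endpoints $p\neq q$ on $\partial P$; the half-polygon $H$ with ordered defining chord $(p,q)$ is the closed part of $P$ on that side of the chord which contains the boundary path clockwise from $p$ to $q$. Let $a\in\partial P$, and let $H_1,\dots,H_{k}$ be half-polygons with defining chords $(p_i,q_i)$ such that no $H_i$ contains $a$, no $H_i$ contains another $H_j$, and the $H_i$ are sorted by their first endpoints $p_i$ in clockwise order along $\partial P$ starting at $a$. Let $\pi(a,H_i)$ be the shortest path in $P$ from $a$ to $H_i$, and let $\bar T_a$ be the plane tree with root $a$ formed by the shortest paths in $P$ from $a$ to the vertices of $P$, to all $p_i$ and $q_i$, and to all $H_i$, where the edges leaving a node are ordered clockwise around that node, starting at the edge to the parent (at the root $a$: starting at the boundary edge along which one leaves $a$ clockwise). Then the paths $\pi(a,H_1),\dots,\pi(a,H_{k})$ occur in $\bar T_a$ in this order: for all $i<j$, either one of $\pi(a,H_i)$, $\pi(a,H_j)$ is an initial part of the other (possibly they are equal), or the two paths coincide up to a node of $\bar T_a$ and leave that node along different edges, the edge of $\pi(a,H_i)$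 preceding the edge of $\pi(a,H_j)$ in the order at that node. -/

import Mathlib

/-- The vertices of a polygon as a periodic family indexed by the integers. -/
def Polygon.cyclicVertex {n : ℕ} [NeZero n] (poly : Polygon ℂ n) (i : ℤ) : ℂ :=
  poly (Fin.ofNat n (i % (n : ℤ)).toNat)

/-- The closed polygonal curve through the vertices, with period `n`: the parameter `t` gives the
point at fraction `t - ⌊t⌋` of the directed edge from vertex number `⌊t⌋` to the next vertex. -/
noncomputable def Polygon.bdryPoint {n : ℕ} [NeZero n] (poly : Polygon ℂ n) (t : ℝ) : ℂ :=
  AffineMap.lineMap (poly.cyclicVertex ⌊t⌋) (poly.cyclicVertex (⌊t⌋ + 1)) (Int.fract t)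

/-- A simple polygon with `n` vertices in the plane (identified with `ℂ`), listed in clockwise
order. -/
structure SimplePolygon (n : ℕ) [NeZero n] extends Polygon ℂ n where
  three_le : 3 ≤ n
  /-- the closed polygonal curve through the vertices is simple -/
  simple : Set.InjOn toPolygon.bdryPoint (Set.Ico (0 : ℝ) (n : ℝ))
  /-- the curve runs clockwise: its signed area (shoelace formula) is negative -/
  clockwise : ∑ i ∈ Finset.range n,
    ((starRingEnd ℂ) (toPolygon.cyclicVertex i) * toPolygon.cyclicVertex (i + 1)).im < 0

/-- A parametrized path in the plane: only the values of `curve` on `[0, length]` matter. -/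
structure PlanePath where
  /-- the length of the parameter interval -/
  length : ℝ
  /-- the parametrization -/
  curve : ℝ → ℂ

/-- The geodesic distance of `x` and `y` in `S`: the infimum of the lengths of all continuous
curves in `S` from `x` to `y`. -/
noncomputable def geodesicDist (S : Set ℂ) (x y : ℂ) : ENNReal :=
  ⨅ (γ : ℝ → ℂ) (_ : ContinuousOn γ (Set.Icc 0 1) ∧ Set.MapsTo γ (Set.Icc 0 1) S ∧
    γ 0 = x ∧ γ 1 = y), eVariationOn γ (Set.Icc 0 1)

/-- The geodesic distance in `S` from `x` to a set `T`. -/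
noncomputable def geodesicDistTo (S : Set ℂ) (x : ℂ) (T : Set ℂ) : ENNReal :=
  ⨅ y ∈ T, geodesicDist S x y

/-- `σ` is a shortest path in `S` from `x` to the set `T`, parametrized by arc length. -/
structure IsShortestPath (S : Set ℂ) (x : ℂ) (T : Set ℂ) (σ : PlanePath) : Prop where
  length_nonneg : 0 ≤ σ.length
  continuousOn : ContinuousOn σ.curve (Set.Icc 0 σ.length)
  mapsTo : Set.MapsTo σ.curve (Set.Icc 0 σ.length) S
  source : σ.curve 0 = x
  target : σ.curve σ.length ∈ T
  unitSpeed : HasUnitSpeedOn σ.curve (Set.Icc 0 σ.length)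
  minimal : ENNReal.ofReal σ.length = geodesicDistTo S x T

/-- `σ` is an initial part of `τ`. -/
def PlanePath.IsInitialPart (σ τ : PlanePath) : Prop :=
  σ.length ≤ τ.length ∧ ∀ r ∈ Set.Icc 0 σ.length, σ.curve r = τ.curve r

/-- After the parameter value `s`, the path `σ` starts with a straight segment of direction `x`. -/
def PlanePath.LeavesAlong (σ : PlanePath) (s : ℝ) (x : ℂ) : Prop :=
  ∃ δ > 0, s + δ ≤ σ.length ∧ ∀ r ∈ Set.Icc 0 δ, σ.curve (s + r) = σ.curve s + r * x

/-- Just before the parameter value `s`, the path `σ` runs straight, and the direction *back*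
along `σ` from the point at `s` is `d`. -/
def PlanePath.ArrivesFrom (σ : PlanePath) (s : ℝ) (d : ℂ) : Prop :=
  ∃ δ > 0, δ ≤ s ∧ ∀ r ∈ Set.Icc 0 δ, σ.curve (s - r) = σ.curve s + r * d

/-- Turning clockwise from the direction of `d`, by less than one full turn, one meets the
direction of `x` strictly before the direction of `y`. -/
def ClockwiseBefore (d x y : ℂ) : Prop :=
  d ≠ 0 ∧ ∃ α β r s : ℝ, 0 ≤ α ∧ α < β ∧ β < 2 * Real.pi ∧ 0 < r ∧ 0 < s ∧
    x = r * Complex.exp (-(α * Complex.I)) * d ∧ y = s * Complex.exp (-(β * Complex.I)) * d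

namespace SimplePolygon

/-- The boundary `∂P`, the union of the edges. -/
def boundary {n : ℕ} [NeZero n] (P : SimplePolygon n) : Set ℂ := P.toPolygon.boundary ℝ

/-- The polygon as a closed region: the boundary together with the bounded components of its
complement. -/
def region {n : ℕ} [NeZero n] (P : SimplePolygon n) : Set ℂ :=
  P.boundary ∪
    {x | x ∉ P.boundary ∧ Bornology.IsBounded (connectedComponentIn P.boundaryᶜ x)}

/-- The part of the boundary passed when going clockwise from `p` to `q` (less than one round). -/
def cwArc {n : ℕ} [NeZero n] (P : SimplePolygon n) (p q : ℂ) : Set ℂ :=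
  {x | ∃ s t u : ℝ, s ≤ t ∧ t ≤ u ∧ u < s + n ∧
    P.bdryPoint s = p ∧ P.bdryPoint t = x ∧ P.bdryPoint u = q}

/-- `e` is the direction of the boundary edge along which one leaves the boundary point `a` in
clockwise direction. -/
def IsForwardDirection {n : ℕ} [NeZero n] (P : SimplePolygon n) (a e : ℂ) : Prop :=
  ∃ s : ℝ, P.bdryPoint s = a ∧
    e = P.cyclicVertex (⌊s⌋ + 1) - P.cyclicVertex ⌊s⌋

/-- A half-polygon, specified by its defining chord: an ordered pair of distinct boundary points
whose segment lies inside the polygon. -/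
structure HalfPolygon {n : ℕ} [NeZero n] (P : SimplePolygon n) where
  /-- the first endpoint of the chord -/
  p : ℂ
  /-- the second endpoint of the chord -/
  q : ℂ
  p_mem : p ∈ P.boundary
  q_mem : q ∈ P.boundary
  ne : p ≠ q
  chord_subset : segment ℝ p q ⊆ P.region

/-- The half-polygon as a closed set: of the two sides of the chord, the one that contains the
boundary path clockwise from `p` to `q`, including the chord itself.  (The chord may touch or
overlap the boundary; the set is then only weakly simple.) -/
def HalfPolygon.carrier {n : ℕ} [NeZero n] {P : SimplePolygon n} (H : P.HalfPolygon) : Set ℂ :=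
  segment ℝ H.p H.q ∪
    {x | ∃ y ∈ P.cwArc H.p H.q, JoinedIn (P.region \ segment ℝ H.p H.q) x y}

/-- The shortest path tree with root `a`, augmented by the shortest paths to the half-polygons,
given by its paths from the root to the nodes: the shortest paths in `P` from `a` to itself (the
root), to the vertices of `P`, to the endpoints of all chords, and to the half-polygons `H i`. -/
def augmentedTree {n : ℕ} [NeZero n] (P : SimplePolygon n) (a : ℂ) {k : ℕ} (H : Fin k → P.HalfPolygon) :
    Set PlanePath :=
  {σ | IsShortestPath P.region a {a} σ ∨
    (∃ v, IsShortestPath P.region a {P.vertices v} σ) ∨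
    (∃ i, IsShortestPath P.region a {(H i).p} σ) ∨
    (∃ i, IsShortestPath P.region a {(H i).q} σ) ∨
    (∃ i, IsShortestPath P.region a (H i).carrier σ)}

/-- In a plane tree `T` with root `a ∈ ∂P`, given by its root paths, the root path `σ` branches off
before (to the left of) the root path `τ`: they coincide up to a node of `T`, which is not the end
of either, and leave that node along edges of different directions, that of `σ` coming first in
the clockwise order of the edges around that node.  This order starts at the edge to the parent;
at the root it starts at the boundary edge along which one leaves `a` clockwise. -/
def BranchesBefore {n : ℕ} [NeZero n] (P : SimplePolygon n) (a : ℂ) (T : Set PlanePath)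
    (σ τ : PlanePath) : Prop :=
  ∃ s : ℝ, 0 ≤ s ∧ s < σ.length ∧ s < τ.length ∧
    (⟨s, σ.curve⟩ : PlanePath) ∈ T ∧
    (∀ r ∈ Set.Icc 0 s, σ.curve r = τ.curve r) ∧
    ∃ d x y : ℂ, σ.LeavesAlong s x ∧ τ.LeavesAlong s y ∧
      ((s = 0 ∧ P.IsForwardDirection a d) ∨ (0 < s ∧ σ.ArrivesFrom s d)) ∧
      ClockwiseBefore d x y

/-- The order of the root paths `σ`, `τ` of an ordered plane tree `T` with root `a ∈ ∂P`: `σ`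
branches off before `τ`, or one is an initial part of the other (the left-to-right order of a tree
does not separate a node from itself or from its ancestors). -/
def TreeLE {n : ℕ} [NeZero n] (P : SimplePolygon n) (a : ℂ) (T : Set PlanePath) (σ τ : PlanePath) : Prop :=
  σ ∈ T ∧ τ ∈ T ∧
    (P.BranchesBefore a T σ τ ∨ σ.IsInitialPart τ ∨ τ.IsInitialPart σ)

end SimplePolygon

/-! ### View angles and winding numbers of polygonal loops -/

section
open Complex Set Filter Topology

/-! A shortest path in the polygon is taut: it is straight on both sides of every parameter and
admits no local short cut. Two taut curves cannot bound a bigon, because a point of the bigon that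
is extreme for a linear functional would be a corner across which a short cut stays inside the
polygon. Hence two shortest paths that leave a point in different directions never meet again
(`IsTautOn.no_bigon`, `IsTautOn.ne_of_leaves`).

Suppose that two of the paths branch. Each one is prolonged straight beyond its chord until it hits
the boundary, and the hit lies on the boundary arc of its own half-polygon
(`IsShortestPath.exists_exit`). The prolonged curves are disjoint after the branching point, so
planarity translates the clockwise order of the branches into the order of the two ends on the
boundary (`IsTautOn.lt_of_cwAng_lt` at the root, `IsTautOn.lt_of_branch` elsewhere). It remains to
show that the ends are sorted like the half-polygons. Since neither half-polygon contains the other,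
their second chord endpoints are sorted like the first ones, and the ends can be reversed only
inside the overlap of the two arcs.

In that case each curve crosses the chord of the other (`IsCrossing`). In the triangle formed by the
two curves and a chord, the curve that is shortest to the chord meets it at a non-acute angle, so
the other curve makes an acute angle with it (`IsTautOn.triangle_angles`). If no curve meets its own
chord strictly before the foreign one, comparing lengths forces all four crossing lengths to agree,
and one angle is both acute and non-acute. If a curve meets its own chord first, the angles locate
the intersection of the chords, and a bent path through it joins two boundary points which that
curve separates. This is `HalfPolygon.false_of_order`.

The Jordan-type facts come from winding numbers, written as sums of view angles; they jump by a full
turn at a corner, which yields `SimplePolygon.separation`. That the polygon lies to the right of its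
boundary is derived from the sign of the shoelace sum by integrating the total view angle over the
plane (`sum_planeDet_nonneg`). Finally, taut curves branch only at the root or at vertices
(`IsTautOn.exists_vertex`), so the branching point is a node of the tree. -/

theorem div_sub_mem_slitPlane {z u v : ℂ} (h : z ∉ segment ℝ u v) :
    (v - z) / (u - z) ∈ slitPlane := by
  by_contra hs
  have huz : u - z ≠ 0 := fun h0 => h (by rw [← sub_eq_zero.1 h0]; exact left_mem_segment ℝ u v)
  obtain ⟨l, hl, hle⟩ : ∃ l : ℝ, 0 ≤ l ∧ (v - z) / (u - z) = -(l : ℂ) := by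
    rw [mem_slitPlane_iff, not_or, not_lt, not_not] at hs
    exact ⟨-((v - z) / (u - z)).re, by linarith [hs.1], by
      apply Complex.ext <;> simp [hs.2]⟩
  rw [div_eq_iff huz] at hle
  apply h
  -- The weights come from solving `v - z = -l (u - z)` for `z`.
  refine ⟨l / (1 + l), 1 / (1 + l), by positivity, by positivity, by field_simp; ring, ?_⟩
  have h1 : (1 + (l : ℂ)) ≠ 0 := by
    have : (0 : ℝ) < 1 + l := by positivity
    exact_mod_cast this.ne'
  simp only [Complex.real_smul]
  push_cast
  field_simp
  linear_combination hle

/-- The signed angle under which the segment from `u` to `v` is seen from `z`. -/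
noncomputable def viewAngle (z u v : ℂ) : ℝ := arg ((v - z) / (u - z))

theorem continuousAt_viewAngle {z u v : ℂ} (h : z ∉ segment ℝ u v) :
    ContinuousAt (fun z => viewAngle z u v) z := by
  have huz : u - z ≠ 0 := fun h0 => h (by rw [← sub_eq_zero.1 h0]; exact left_mem_segment ℝ u v)
  exact ContinuousAt.comp (g := arg) (continuousAt_arg (div_sub_mem_slitPlane h))
    (ContinuousAt.div (by fun_prop) (by fun_prop) huz)

theorem coe_viewAngle {z u v : ℂ} (hu : u ≠ z) (hv : v ≠ z) :
    (viewAngle z u v : Real.Angle) = arg (v - z) - arg (u - z) :=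
  arg_div_coe_angle (sub_ne_zero.2 hv) (sub_ne_zero.2 hu)

/-- After multiplication by `c` both arguments lie strictly between -π/2 and π/2, so their
difference needs no reduction modulo 2π. Sums of view angles of a closed path therefore telescope to
0 when the path lies in an open half-plane whose boundary line passes through the view point. -/
theorem arg_div_of_re_pos {c u v : ℂ} (hu : 0 < (c * u).re) (hv : 0 < (c * v).re) :
    arg (v / u) = arg (c * v) - arg (c * u) := by
  have hc : c ≠ 0 := by rintro rfl; simp at hu
  have hu0 : c * u ≠ 0 := by intro h; simp [h] at hu
  have hv0 : c * v ≠ 0 := by intro h; simp [h] at hv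
  have e : v / u = (c * v) / (c * u) := by rw [mul_div_mul_left _ _ hc]
  have hu' := abs_lt.1 (abs_arg_lt_pi_div_two_iff.2 (Or.inl hu))
  have hv' := abs_lt.1 (abs_arg_lt_pi_div_two_iff.2 (Or.inl hv))
  have h := arg_div_coe_angle hv0 hu0
  rw [← Real.Angle.coe_sub, arg_coe_angle_eq_iff_eq_toReal,
    Real.Angle.toReal_coe_eq_self_iff.2 ⟨by linarith, by linarith⟩] at h
  rw [e, h]

theorem viewAngle_of_re_pos {c z u v : ℂ} (hu : 0 < (c * (u - z)).re)
    (hv : 0 < (c * (v - z)).re) :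
    viewAngle z u v = arg (c * (v - z)) - arg (c * (u - z)) := arg_div_of_re_pos hu hv

/-- `x` and `y` are joined by a polygonal path in `S`. -/
def PolyJoined (S : Set ℂ) : ℂ → ℂ → Prop :=
  Relation.ReflTransGen fun x y => segment ℝ x y ⊆ S

theorem PolyJoined.symm {S : Set ℂ} {x y : ℂ} (h : PolyJoined S x y) : PolyJoined S y x := by
  induction h with
  | refl => exact Relation.ReflTransGen.refl
  | tail _ hbc ih => exact Relation.ReflTransGen.head (by rwa [segment_symm]) ih

theorem PolyJoined.mono {S T : Set ℂ} (hST : S ⊆ T) {x y : ℂ} (h : PolyJoined S x y) :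
    PolyJoined T x y :=
  Relation.ReflTransGen.mono (fun _ _ hab => Set.Subset.trans hab hST) _ _ h

theorem PolyJoined.trans {S : Set ℂ} {x y z : ℂ} (h : PolyJoined S x y) (h' : PolyJoined S y z) :
    PolyJoined S x z := Relation.ReflTransGen.trans h h'

theorem PolyJoined.of_segment {S : Set ℂ} {x y : ℂ} (h : segment ℝ x y ⊆ S) :
    PolyJoined S x y := Relation.ReflTransGen.single h

/-- The variation of the angle along a polygonal path, as a function of the view point. -/
theorem PolyJoined.exists_angle {S : Set ℂ} {x y : ℂ} (h : PolyJoined S x y) :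
    ∃ W : ℂ → ℝ, (∀ z ∉ S, ContinuousAt W z) ∧
      (∀ z ∉ S, (W z : Real.Angle) = arg (y - z) - arg (x - z)) ∧
      ∀ z c, (∀ w ∈ S, 0 < (c * (w - z)).re) → W z = arg (c * (y - z)) - arg (c * (x - z)) := by
  induction h with
  | refl => exact ⟨fun _ => 0, fun _ _ => continuousAt_const, by simp, by simp⟩
  | @tail b c _ hbc ih =>
    obtain ⟨W, h1, h2, h3⟩ := ih
    refine ⟨fun z => W z + viewAngle z b c, fun z hz => (h1 z hz).add
      (continuousAt_viewAngle fun h => hz (hbc h)), fun z hz => ?_, fun z d hd => ?_⟩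
    · have hb : b ≠ z := fun h => hz (hbc (h ▸ left_mem_segment ℝ _ _))
      have hc : c ≠ z := fun h => hz (hbc (h ▸ right_mem_segment ℝ _ _))
      rw [Real.Angle.coe_add, h2 z hz, coe_viewAngle hb hc]; abel
    · dsimp only
      rw [h3 z d hd, viewAngle_of_re_pos (hd b (hbc (left_mem_segment ℝ _ _)))
        (hd c (hbc (right_mem_segment ℝ _ _)))]; ring

/-- `L` contains a closed polygonal path which arrives at `v` from `v + p`, leaves `v` for `v + q`,
and does not return to `v` in between. -/
structure IsCornerLoop (L : Set ℂ) (v p q : ℂ) : Prop where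
  left_ne : p ≠ 0
  right_ne : q ≠ 0
  left_subset : segment ℝ v (v + p) ⊆ L
  right_subset : segment ℝ v (v + q) ⊆ L
  rest : ∃ S, IsClosed S ∧ v ∉ S ∧ S ⊆ L ∧ PolyJoined S (v + q) (v + p)

/-- The jump of the winding number at a corner. -/
noncomputable def cornerAngle (p q z : ℂ) : ℝ := arg (-z / p) + arg (-q / z)

/-- `N` adds up the view angles of the two edges at `v` and of the rest of the loop; off `L` it is
2π times a winding number. On approaching `v` in direction `z`, the rest tends to its value `K` at
`v`, because `v ∉ S`, while the edges contribute the limits `arg (-q / z)` and `arg (-z / p)`, which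
depend on directions only. -/
theorem IsCornerLoop.exists_winding {L : Set ℂ} {v p q : ℂ} (h : IsCornerLoop L v p q) :
    ∃ (N : ℂ → ℝ) (K : ℝ), (∀ z ∉ L, ContinuousAt N z) ∧
      (∀ z ∉ L, (N z : Real.Angle) = 0) ∧
      (∀ z c, (∀ w ∈ L, 0 < (c * (w - z)).re) → N z = 0) ∧
      ∀ z, -z / p ∈ slitPlane → -q / z ∈ slitPlane →
        Tendsto (fun r : ℝ => N (v + r * z)) (𝓝[>] 0) (𝓝 (K + cornerAngle p q z)) := by
  obtain ⟨S, hSc, hvS, hSL, hS⟩ := h.rest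
  obtain ⟨W, h1, h2, h3⟩ := hS.exists_angle
  have hv : v ∈ L := h.left_subset (left_mem_segment ℝ _ _)
  have hvp : v + p ∈ L := h.left_subset (right_mem_segment ℝ _ _)
  have hvq : v + q ∈ L := h.right_subset (right_mem_segment ℝ _ _)
  refine ⟨fun z => viewAngle z v (v + q) + W z + viewAngle z (v + p) v, W v, fun z hz => ?_,
    fun z hz => ?_, fun z c hc => ?_, fun z hzp hzq => ?_⟩
  · refine ((continuousAt_viewAngle fun h' => hz (h.right_subset h')).add
      (h1 z fun h' => hz (hSL h'))).add (continuousAt_viewAngle fun h' => hz (h.left_subset ?_))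
    rwa [segment_symm]
  · have a1 : v ≠ z := fun e => hz (e ▸ hv)
    have a2 : v + p ≠ z := fun e => hz (e ▸ hvp)
    have a3 : v + q ≠ z := fun e => hz (e ▸ hvq)
    rw [Real.Angle.coe_add, Real.Angle.coe_add, coe_viewAngle a1 a3, coe_viewAngle a2 a1,
      h2 z fun h' => hz (hSL h')]
    abel
  · dsimp only
    rw [h3 z c fun w hw => hc w (hSL hw), viewAngle_of_re_pos (hc _ hv) (hc _ hvq),
      viewAngle_of_re_pos (hc _ hvp) (hc _ hv)]
    ring
  · have hz0 : z ≠ 0 := by rintro rfl; simp at hzq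
    have e : ∀ r : ℝ, 0 < r → viewAngle (v + r * z) v (v + q) + W (v + r * z) +
        viewAngle (v + r * z) (v + p) v =
        arg ((r * z - q) / z) + W (v + r * z) + arg (-z / (p - r * z)) := by
      intro r hr
      have hr' : (r : ℂ) ≠ 0 := by exact_mod_cast hr.ne'
      unfold viewAngle
      congr 1
      · congr 1
        rw [← arg_mul_real hr]
        congr 1
        field_simp
        ring
      · have : (v - (v + r * z)) / (v + p - (v + r * z)) = -z / (p - r * z) * r := by ring
        rw [this, arg_mul_real hr]
    have lim : Tendsto (fun r : ℝ => arg ((r * z - q) / z) + W (v + r * z) +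
        arg (-z / (p - r * z))) (𝓝[>] 0) (𝓝 (arg (-q / z) + W v + arg (-z / p))) := by
      have c0 : ∀ (f : ℝ → ℂ), Continuous f → Tendsto f (𝓝[>] 0) (𝓝 (f 0)) := fun f hf =>
        (hf.tendsto 0).mono_left nhdsWithin_le_nhds
      refine Tendsto.add (Tendsto.add ?_ ?_) ?_
      · refine (continuousAt_arg hzq).tendsto.comp ?_
        have := c0 (fun r : ℝ => ((r : ℂ) * z - q) / z) (by fun_prop)
        simpa using this
      · refine (h1 v hvS).tendsto.comp ?_
        have := c0 (fun r : ℝ => v + (r : ℂ) * z) (by fun_prop)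
        simpa using this
      · refine (continuousAt_arg hzp).tendsto.comp ?_
        have h0 := c0 (fun r : ℝ => p - (r : ℂ) * z) (by fun_prop)
        have h0' := (tendsto_const_nhds (x := -z) (f := 𝓝[>] (0:ℝ))).div h0
          (by simpa using h.left_ne)
        simpa [Pi.div_def] using h0'
    have e2 : W v + cornerAngle p q z = arg (-q / z) + W v + arg (-z / p) := by
      unfold cornerAngle; ring
    rw [e2]
    refine lim.congr' ?_
    filter_upwards [self_mem_nhdsWithin] with r hr using (e r hr).symm

/-- A real multiple of a full turn is locally constant where it is continuous. -/
theorem winding_const_of_isPreconnected {L C : Set ℂ} {N : ℂ → ℝ} (hc : ∀ z ∉ L, ContinuousAt N z)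
    (hN : ∀ z ∉ L, (N z : Real.Angle) = 0) (hC : IsPreconnected C) (hCL : Disjoint C L) {x y : ℂ}
    (hx : x ∈ C) (hy : y ∈ C) : N x = N y := by
  have hd : ∀ z ∈ C, z ∉ L := fun z hz hzL => Set.disjoint_left.1 hCL hz hzL
  have hcont : ContinuousOn (fun z => N z / (2 * Real.pi)) C := fun z hz =>
    ((hc z (hd z hz)).div_const _).continuousWithinAt
  have hint : ∀ z ∈ C, ∃ k : ℤ, N z = k * (2 * Real.pi) := fun z hz => by
    obtain ⟨k, hk⟩ := Real.Angle.angle_eq_iff_two_pi_dvd_sub.1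
      ((hN z (hd z hz)).trans Real.Angle.coe_zero.symm)
    exact ⟨k, by linarith⟩
  have hpc := (hC.image _ hcont)
  by_contra hne
  have key : ∀ x ∈ C, ∀ y ∈ C, N x < N y → False := by
    intro x hx y hy hlt
    obtain ⟨k, hk⟩ := hint x hx
    obtain ⟨l, hl⟩ := hint y hy
    have hpi := Real.pi_pos
    have hkl : k < l := by
      by_contra hcon
      have : (l : ℝ) ≤ k := by exact_mod_cast not_lt.1 hcon
      nlinarith
    have hkl' : (k : ℝ) + 1 ≤ l := by exact_mod_cast hkl
    have hoc := hpc.ordConnected.out ⟨x, hx, rfl⟩ ⟨y, hy, rfl⟩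
    -- A preconnected image containing two different integers contains a half-integer between them,
    -- which is not a value.
    have : (k : ℝ) + 1 / 2 ∈ Icc (N x / (2 * Real.pi)) (N y / (2 * Real.pi)) := by
      rw [hk, hl]
      constructor <;> field_simp <;> linarith
    obtain ⟨z, hz, hze⟩ := hoc this
    obtain ⟨m, hm⟩ := hint z hz
    dsimp only at hze
    rw [hm] at hze
    field_simp at hze
    have : (2 * m : ℤ) = 2 * k + 1 := by exact_mod_cast (by linarith : (2 * m : ℝ) = 2 * k + 1)
    omega
  rcases lt_or_gt_of_ne hne with h | h
  · exact key x hx y hy h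
  · exact key y hy x hx h

/-- At a convex corner the winding number differs between the outside and the inside. -/
theorem cornerAngle_ne {p q c : ℂ} (hpq : (q / p).im ≠ 0) (hp : (c * p).re < 0)
    (hq : (c * q).re ≤ 0) {α β : ℝ} (hα : 0 < α) (hβ : 0 < β) :
    (-(starRingEnd ℂ c) / p ∈ slitPlane ∧ -q / (starRingEnd ℂ c) ∈ slitPlane) ∧
    (-(α * p + β * q) / p ∈ slitPlane ∧ -q / (α * p + β * q) ∈ slitPlane) ∧
    cornerAngle p q (starRingEnd ℂ c) ≠ cornerAngle p q (α * p + β * q) := by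
  have hp0 : p ≠ 0 := by rintro rfl; simp at hp
  have hq0 : q ≠ 0 := by rintro rfl; simp at hpq
  have hc0 : c ≠ 0 := by rintro rfl; simp at hp
  have hcs : starRingEnd ℂ c ≠ 0 := by simpa using hc0
  have hnp : 0 < normSq p := normSq_pos.2 hp0
  have hnc : 0 < normSq c := normSq_pos.2 hc0
  have hre1 : 0 < (-(starRingEnd ℂ c) / p).re := by
    have : (-(starRingEnd ℂ c) / p).re = -(c * p).re / normSq p := by
      simp [div_re, mul_re]; ring
    rw [this]; apply div_pos <;> linarith
  have hre2 : 0 ≤ (-q / (starRingEnd ℂ c)).re := by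
    have : (-q / (starRingEnd ℂ c)).re = -(c * q).re / normSq c := by
      simp [div_re, mul_re]; ring
    rw [this]; apply div_nonneg <;> linarith
  have hne2 : -q / (starRingEnd ℂ c) ≠ 0 := div_ne_zero (neg_ne_zero.2 hq0) hcs
  have hsl2 : -q / (starRingEnd ℂ c) ∈ slitPlane := by
    rw [mem_slitPlane_iff]
    rcases hre2.lt_or_eq with h | h
    · exact Or.inl h
    · right; intro h2; exact hne2 (Complex.ext h.symm h2)
  have ha1 := abs_lt.1 (abs_arg_lt_pi_div_two_iff.2 (Or.inl hre1))
  have ha2 := abs_le.1 (abs_arg_le_pi_div_two_iff.2 hre2)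
  -- Both arguments are at most π/2 in absolute value, one of them strictly, so their sum is the
  -- principal argument of the product.
  have hval : cornerAngle p q (starRingEnd ℂ c) = arg (q / p) := by
    have h1 := arg_mul_coe_angle (div_ne_zero (neg_ne_zero.2 hcs) hp0) hne2
    have e : -(starRingEnd ℂ c) / p * (-q / (starRingEnd ℂ c)) = q / p := by field_simp
    rw [e, ← Real.Angle.coe_add, arg_coe_angle_eq_iff_eq_toReal,
      Real.Angle.toReal_coe_eq_self_iff.2 ⟨by linarith, by linarith⟩] at h1
    exact h1.symm
  have hz0 : (α * p + β * q) / p ≠ 0 := by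
    intro h
    have : ((α * p + β * q) / p).im = β * (q / p).im := by
      have : (α * p + β * q) / p = α + β * (q / p) := by field_simp
      rw [this]; simp
    rw [h] at this
    simp [hβ.ne', hpq] at this
  have hz : α * p + β * q ≠ 0 := fun h => hz0 (by rw [h]; simp)
  have him1 : (-(α * p + β * q) / p).im = -β * (q / p).im := by
    have : -(α * p + β * q) / p = -(α + β * (q / p)) := by field_simp
    rw [this]; simp
  have him2 : (-q / (α * p + β * q)).im = -(α * (q / p).im) / normSq (α + β * (q / p)) := by
    have : -q / (α * p + β * q) = -((q / p) / (α + β * (q / p))) := by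
      field_simp
    rw [this]; simp [div_im]; ring
  have hns : 0 < normSq (α + β * (q / p)) := by
    apply normSq_pos.2
    have : (α : ℂ) + β * (q / p) = (α * p + β * q) / p := by field_simp
    rw [this]; exact hz0
  refine ⟨⟨Or.inl hre1, hsl2⟩, ?_, ?_⟩
  · constructor
    · exact Or.inr (by rw [him1]; exact mul_ne_zero (neg_ne_zero.2 hβ.ne') hpq)
    · exact Or.inr (by rw [him2]; exact div_ne_zero (neg_ne_zero.2 (mul_ne_zero hα.ne' hpq)) hns.ne')
  -- Inside the cone both arguments have the sign opposite to that of `arg (q / p)`, so their sum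
  -- cannot equal it.
  · rw [hval]
    rcases lt_or_gt_of_ne hpq with h | h
    · have b1 : 0 < (-(α * p + β * q) / p).im := by rw [him1]; nlinarith
      have b2 : 0 < (-q / (α * p + β * q)).im := by rw [him2]; apply div_pos _ hns; nlinarith
      have c1 := arg_nonneg_iff.2 b1.le
      have c2 := arg_nonneg_iff.2 b2.le
      have c3 := arg_neg_iff.2 h
      unfold cornerAngle; intro h; linarith
    · have b1 : (-(α * p + β * q) / p).im < 0 := by rw [him1]; nlinarith
      have b2 : (-q / (α * p + β * q)).im < 0 := by
        rw [him2]; apply div_neg_of_neg_of_pos _ hns; nlinarith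
      have c1 := arg_neg_iff.2 b1
      have c2 := arg_neg_iff.2 b2
      have c3 := arg_nonneg_iff.2 h.le
      unfold cornerAngle; intro h; linarith

end

/-! ### The periodic parametrization of the boundary -/

section
open Complex Set Filter Topology

namespace SimplePolygon
variable {n : ℕ} [NeZero n] (P : SimplePolygon n)

theorem natCast_pos : (0 : ℝ) < n := by exact_mod_cast Nat.pos_of_ne_zero (NeZero.ne n)

theorem three_le_cast {n : ℕ} [NeZero n] (P : SimplePolygon n) : (3 : ℝ) ≤ n := by
  exact_mod_cast P.three_le

theorem cyclicVertex_add (i : ℤ) : P.cyclicVertex (i + n) = P.cyclicVertex i := by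
  simp [Polygon.cyclicVertex]

/-- The right end `t = k + 1` is included although the floor jumps there: both edge formulas give
the common vertex. -/
theorem bdryPoint_eq {k : ℤ} {t : ℝ} (h1 : (k : ℝ) ≤ t) (h2 : t ≤ k + 1) :
    P.bdryPoint t =
      P.cyclicVertex k + ((t - k : ℝ) : ℂ) * (P.cyclicVertex (k + 1) - P.cyclicVertex k) := by
  rcases h2.lt_or_eq with h | h
  · have hf : ⌊t⌋ = k := Int.floor_eq_iff.2 ⟨h1, h⟩
    rw [Polygon.bdryPoint, hf, AffineMap.lineMap_apply, Int.fract, hf]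
    simp [add_comm]
  · have hf : ⌊t⌋ = k + 1 := by rw [h]; simp
    rw [Polygon.bdryPoint, hf, Int.fract, hf, h]
    simp

theorem bdryPoint_intCast (k : ℤ) : P.bdryPoint k = P.cyclicVertex k := by
  rw [P.bdryPoint_eq (k := k) le_rfl (by linarith)]; simp

theorem bdryPoint_add (t : ℝ) : P.bdryPoint (t + n) = P.bdryPoint t := by
  have hf : ⌊t + n⌋ = ⌊t⌋ + n := by exact_mod_cast Int.floor_add_natCast t n
  have e : ⌊t⌋ + (n : ℤ) + 1 = ⌊t⌋ + 1 + n := by ring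
  rw [Polygon.bdryPoint, hf, e, P.cyclicVertex_add, P.cyclicVertex_add, Int.fract_add_natCast]
  rfl

theorem bdryPoint_add_int (t : ℝ) (m : ℤ) : P.bdryPoint (t + m * n) = P.bdryPoint t := by
  have hp : Function.Periodic P.bdryPoint (n : ℝ) := P.bdryPoint_add
  exact hp.int_mul m t

theorem exists_bdryPoint_Ico (t s : ℝ) : ∃ u ∈ Ico s (s + n), P.bdryPoint u = P.bdryPoint t ∧
    ∃ m : ℤ, u = t + m * n := by
  have hn : (0 : ℝ) < n := natCast_pos
  refine ⟨toIcoMod hn s t, toIcoMod_mem_Ico hn s t, ?_, -toIcoDiv hn s t, ?_⟩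
  · have := P.bdryPoint_add_int t (-toIcoDiv hn s t)
    rw [← this]; congr 1; simp [toIcoMod, sub_eq_add_neg]
  · simp [toIcoMod, sub_eq_add_neg]

theorem bdryPoint_eq_iff {s t : ℝ} :
    P.bdryPoint s = P.bdryPoint t ↔ ∃ m : ℤ, s = t + m * n := by
  constructor
  · intro h
    obtain ⟨u, hu, hus, a, ha⟩ := P.exists_bdryPoint_Ico s 0
    obtain ⟨w, hw, hwt, b, hb⟩ := P.exists_bdryPoint_Ico t 0
    rw [zero_add] at hu hw
    have := P.simple hu hw (by rw [hus, hwt, h])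
    exact ⟨b - a, by push_cast; linarith⟩
  · rintro ⟨m, rfl⟩; exact P.bdryPoint_add_int t m

/-- The working form of simplicity: it applies to any two parameters less than one period apart,
wherever they lie. -/
theorem bdryPoint_inj {s t : ℝ} (h : P.bdryPoint s = P.bdryPoint t) (h1 : s < t + n)
    (h2 : t < s + n) : s = t := by
  obtain ⟨m, hm⟩ := P.bdryPoint_eq_iff.1 h
  have hn : (0 : ℝ) < n := natCast_pos
  have a1 : (m : ℝ) < 1 := by by_contra hc; push Not at hc; nlinarith
  have a2 : (-1 : ℝ) < m := by by_contra hc; push Not at hc; nlinarith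
  have : m = 0 := by
    have : m < 1 := by exact_mod_cast a1
    have : -1 < m := by exact_mod_cast a2
    omega
  simpa [this] using hm

/-- The direction of the edge along which the boundary leaves the point with parameter `t`. -/
noncomputable def fwd (t : ℝ) : ℂ := P.cyclicVertex (⌊t⌋ + 1) - P.cyclicVertex ⌊t⌋

/-- The direction back along the edge by which the boundary reaches the point with parameter `t`. -/
noncomputable def bwd (t : ℝ) : ℂ := P.cyclicVertex (⌈t⌉ - 1) - P.cyclicVertex ⌈t⌉

theorem bdryPoint_add_fwd {t h : ℝ} (h0 : 0 ≤ h) (h1 : t + h ≤ ⌊t⌋ + 1) :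
    P.bdryPoint (t + h) = P.bdryPoint t + h * P.fwd t := by
  have := Int.floor_le t
  rw [P.bdryPoint_eq (k := ⌊t⌋) (by linarith) h1, P.bdryPoint_eq (k := ⌊t⌋) this (by linarith), fwd]
  push_cast; ring

theorem bdryPoint_sub_bwd {t h : ℝ} (h0 : 0 ≤ h) (h1 : (⌈t⌉ : ℝ) - 1 ≤ t - h) :
    P.bdryPoint (t - h) = P.bdryPoint t + h * P.bwd t := by
  have := Int.le_ceil t
  have e : ((⌈t⌉ - 1 : ℤ) : ℝ) = (⌈t⌉ : ℝ) - 1 := by push_cast; ring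
  have e2 : ((⌈t⌉ - 1 : ℤ) : ℂ) = (⌈t⌉ : ℂ) - 1 := by push_cast; ring
  rw [P.bdryPoint_eq (k := ⌈t⌉ - 1) (by rw [e]; linarith) (by rw [e]; linarith),
    P.bdryPoint_eq (k := ⌈t⌉ - 1) (by rw [e]; linarith) (by rw [e]; linarith), bwd]
  simp only [sub_add_cancel]
  push_cast; ring

theorem exists_straight (t : ℝ) : ∃ δ : ℝ, 0 < δ ∧ δ < 1 ∧
    (∀ h ∈ Icc 0 δ, P.bdryPoint (t + h) = P.bdryPoint t + h * P.fwd t) ∧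
    ∀ h ∈ Icc 0 δ, P.bdryPoint (t - h) = P.bdryPoint t + h * P.bwd t := by
  have h1 : 0 < (⌊t⌋ : ℝ) + 1 - t := by linarith [Int.lt_floor_add_one t]
  have h2 : 0 < t - ((⌈t⌉ : ℝ) - 1) := by linarith [Int.ceil_lt_add_one t]
  refine ⟨min (1/2) (min ((⌊t⌋ : ℝ) + 1 - t) (t - ((⌈t⌉ : ℝ) - 1))), by positivity,
    by linarith [min_le_left (1/2 : ℝ) (min ((⌊t⌋ : ℝ) + 1 - t) (t - ((⌈t⌉ : ℝ) - 1)))], ?_, ?_⟩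
  · rintro h ⟨h0, hh⟩
    exact P.bdryPoint_add_fwd h0 (by
      linarith [hh.trans ((min_le_right _ _).trans (min_le_left _ _))])
  · rintro h ⟨h0, hh⟩
    exact P.bdryPoint_sub_bwd h0 (by
      linarith [hh.trans ((min_le_right _ _).trans (min_le_right _ _))])

theorem continuous_bdryPoint : Continuous P.bdryPoint := by
  rw [continuous_iff_continuousAt]
  intro t
  obtain ⟨δ, hδ, -, hf, hb⟩ := P.exists_straight t
  rw [continuousAt_iff_continuous_left_right]
  constructor
  · have : ContinuousWithinAt (fun s : ℝ => P.bdryPoint t + ((t - s : ℝ) : ℂ) * P.bwd t) (Iic t) t := by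
      apply Continuous.continuousWithinAt; fun_prop
    refine this.congr_of_eventuallyEq ?_ (by simp)
    filter_upwards [self_mem_nhdsWithin, mem_nhdsWithin_of_mem_nhds (Ioi_mem_nhds
      (show t - δ < t by linarith))] with s hs hs'
    have := hb (t - s) ⟨sub_nonneg.2 hs, by linarith [mem_Ioi.1 hs']⟩
    rw [← this]; congr 1; ring
  · have : ContinuousWithinAt (fun s : ℝ => P.bdryPoint t + ((s - t : ℝ) : ℂ) * P.fwd t) (Ici t) t := by
      apply Continuous.continuousWithinAt; fun_prop
    refine this.congr_of_eventuallyEq ?_ (by simp)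
    filter_upwards [self_mem_nhdsWithin, mem_nhdsWithin_of_mem_nhds (Iio_mem_nhds
      (show t < t + δ by linarith))] with s hs hs'
    have := hf (s - t) ⟨sub_nonneg.2 hs, by linarith [mem_Iio.1 hs']⟩
    rw [← this]; congr 1; ring

theorem fwd_ne_zero (t : ℝ) : P.fwd t ≠ 0 := by
  obtain ⟨δ, hδ, hδ1, hf, -⟩ := P.exists_straight t
  intro h
  have h1 := hf δ ⟨hδ.le, le_rfl⟩
  rw [h, mul_zero, add_zero] at h1
  have h3 := P.three_le_cast
  have := P.bdryPoint_inj h1 (by linarith) (by linarith)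
  linarith

theorem bwd_ne_zero (t : ℝ) : P.bwd t ≠ 0 := by
  obtain ⟨δ, hδ, hδ1, -, hf⟩ := P.exists_straight t
  intro h
  have h1 := hf δ ⟨hδ.le, le_rfl⟩
  rw [h, mul_zero, add_zero] at h1
  have h3 := P.three_le_cast
  have := P.bdryPoint_inj h1 (by linarith) (by linarith)
  linarith

/-- If both edges at a point had the same direction they would overlap near it, and two close
parameters would share a boundary point. -/
theorem bwd_ne_smul_fwd (t : ℝ) {r : ℝ} (hr : 0 < r) : P.bwd t ≠ r * P.fwd t := by
  obtain ⟨δ, hδ, hδ1, hf, hb⟩ := P.exists_straight t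
  intro h
  -- This step length keeps both the backward step and the `r` times longer forward step within `δ`.
  have hm : 0 < min δ (δ / r) := by positivity
  have h1 := hb (min δ (δ / r)) ⟨hm.le, min_le_left _ _⟩
  have h2 := hf (r * min δ (δ / r)) ⟨by positivity, by
    calc r * min δ (δ / r) ≤ r * (δ / r) := by gcongr; exact min_le_right _ _
      _ = δ := by field_simp⟩
  have e : P.bdryPoint (t - min δ (δ / r)) = P.bdryPoint (t + r * min δ (δ / r)) := by
    rw [h1, h2, h]; push_cast; ring
  have h3 := P.three_le_cast
  have h4 : r * min δ (δ / r) ≤ δ := by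
    calc r * min δ (δ / r) ≤ r * (δ / r) := by gcongr; exact min_le_right _ _
      _ = δ := by field_simp
  have h5 : 0 < r * min δ (δ / r) := by positivity
  have := P.bdryPoint_inj e (by linarith) (by linarith [min_le_left δ (δ / r)])
  linarith

theorem vertices_eq_cyclicVertex (i : Fin n) : P.vertices i = P.cyclicVertex (i : ℕ) := by
  simp only [Polygon.cyclicVertex]
  congr 1
  ext
  simp [Fin.ofNat, ← Int.natCast_mod, Nat.mod_eq_of_lt i.2]

theorem vertices_finRotate (i : Fin n) :
    P.vertices (finRotate n i) = P.cyclicVertex ((i : ℕ) + 1) := by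
  simp only [Polygon.cyclicVertex]
  congr 1
  ext
  have : (((i : ℕ) : ℤ) + 1) % (n : ℤ) = (((i : ℕ) + 1) % n : ℕ) := by
    push_cast; rfl
  simp only [Fin.ofNat, finRotate_apply, Fin.val_add, this, Int.toNat_natCast, Nat.mod_mod]
  simp

theorem boundary_eq_range : P.boundary = range P.bdryPoint := by
  ext x
  simp only [boundary, Polygon.boundary, mem_iUnion, Polygon.edgeSet, mem_range]
  constructor
  · rintro ⟨i, hx⟩
    obtain ⟨r, hr, rfl⟩ := hx
    refine ⟨(i : ℕ) + r, ?_⟩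
    rw [P.vertices_eq_cyclicVertex, P.vertices_finRotate,
      P.bdryPoint_eq (k := (i : ℕ)) (by push_cast; linarith [hr.1]) (by push_cast; linarith [hr.2]),
      AffineMap.lineMap_apply]
    push_cast
    simp only [vsub_eq_sub, vadd_eq_add, real_smul]
    ring
  · rintro ⟨t, rfl⟩
    obtain ⟨u, hu, hut, -⟩ := P.exists_bdryPoint_Ico t 0
    rw [zero_add] at hu
    rw [← hut]
    have h0 : 0 ≤ ⌊u⌋ := Int.floor_nonneg.2 hu.1
    have h1 : ⌊u⌋ < n := Int.floor_lt.2 (by exact_mod_cast hu.2)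
    refine ⟨⟨⌊u⌋.toNat, by omega⟩, Int.fract u, ⟨Int.fract_nonneg u, (Int.fract_lt_one u).le⟩, ?_⟩
    rw [P.vertices_eq_cyclicVertex, P.vertices_finRotate, Polygon.bdryPoint]
    simp [Int.toNat_of_nonneg h0]

theorem bdryPoint_mem (t : ℝ) : P.bdryPoint t ∈ P.boundary := by
  rw [boundary_eq_range]; exact mem_range_self t

theorem exists_param {x : ℂ} (hx : x ∈ P.boundary) (s : ℝ) :
    ∃ t ∈ Ico s (s + n), P.bdryPoint t = x := by
  rw [boundary_eq_range] at hx
  obtain ⟨t, rfl⟩ := hx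
  obtain ⟨u, hu, hut, -⟩ := P.exists_bdryPoint_Ico t s
  exact ⟨u, hu, hut⟩

theorem boundary_eq_image (s : ℝ) : P.boundary = P.bdryPoint '' Icc s (s + n) := by
  ext x
  constructor
  · intro hx
    obtain ⟨t, ht, rfl⟩ := P.exists_param hx s
    exact ⟨t, Ico_subset_Icc_self ht, rfl⟩
  · rintro ⟨t, -, rfl⟩; exact P.bdryPoint_mem t

theorem isCompact_boundary : IsCompact P.boundary := by
  rw [P.boundary_eq_image 0]; exact isCompact_Icc.image P.continuous_bdryPoint

theorem isClosed_boundary : IsClosed P.boundary := P.isCompact_boundary.isClosed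

/-- Near the point with parameter `t`, the boundary consists of two straight pieces. -/
theorem exists_local_boundary (t : ℝ) {ε : ℝ} (hε : 0 < ε) (hε1 : ε < 1) : ∃ ρ > 0, ∀ x ∈ P.boundary,
    dist x (P.bdryPoint t) < ρ → ∃ h ∈ Icc 0 ε, x = P.bdryPoint (t + h) ∨ x = P.bdryPoint (t - h) := by
  have h3 := P.three_le_cast
  have hK : IsCompact (P.bdryPoint '' Icc (t + ε) (t - ε + n)) :=
    isCompact_Icc.image P.continuous_bdryPoint
  -- By simplicity the rest of the boundary misses the point; being compact, it stays at a positive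
  -- distance.
  have hn : P.bdryPoint t ∉ P.bdryPoint '' Icc (t + ε) (t - ε + n) := by
    rintro ⟨s, hs, he⟩
    have := P.bdryPoint_inj he (by linarith [hs.2]) (by linarith [hs.1])
    linarith [hs.1]
  obtain ⟨ρ, hρ, hb⟩ := Metric.isOpen_iff.1 hK.isClosed.isOpen_compl _ hn
  refine ⟨ρ, hρ, fun x hx hxd => ?_⟩
  obtain ⟨s, hs, rfl⟩ := P.exists_param hx (t - ε)
  have hns : s ∉ Icc (t + ε) (t - ε + n) := fun h => hb (Metric.mem_ball.2 hxd) ⟨s, h, rfl⟩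
  have hs' : s < t + ε := by
    by_contra hcon
    exact hns ⟨not_lt.1 hcon, hs.2.le⟩
  rcases le_total t s with h | h
  · exact ⟨s - t, ⟨by linarith, by linarith⟩, Or.inl (by congr 1; ring)⟩
  · exact ⟨t - s, ⟨by linarith, by linarith [hs.1]⟩, Or.inr (by congr 1; ring)⟩

end SimplePolygon

end

/-! ### Clockwise angles and the sectors at a boundary point -/

section
open Complex Set Filter Topology

theorem arg_ofReal_mul_exp {r θ : ℝ} (hr : 0 < r) (hθ : θ ∈ Ioc (-Real.pi) Real.pi) :
    arg (r * exp (θ * I)) = θ := by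
  rw [exp_mul_I]; exact arg_mul_cos_add_sin_mul_I hr hθ

/-- The clockwise angle from the direction `q` to the direction `z`. -/
noncomputable def cwAng (q z : ℂ) : ℝ := toIcoMod Real.two_pi_pos 0 (-(arg (z / q)))

theorem cwAng_nonneg (q z : ℂ) : 0 ≤ cwAng q z := (toIcoMod_mem_Ico _ _ _).1

theorem cwAng_lt (q z : ℂ) : cwAng q z < 2 * Real.pi := by
  have := (toIcoMod_mem_Ico Real.two_pi_pos 0 (-(arg (z / q)))).2
  simpa [cwAng] using this

theorem cwAng_spec {q : ℂ} (hq : q ≠ 0) (z : ℂ) :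
    z = ((‖z‖ / ‖q‖ : ℝ) : ℂ) * exp (-(cwAng q z * I)) * q := by
  have h1 : exp (-(cwAng q z * I)) = exp (arg (z / q) * I) := by
    rw [exp_eq_exp_iff_exists_int]
    refine ⟨toIcoDiv Real.two_pi_pos 0 (-(arg (z / q))), ?_⟩
    simp only [cwAng, toIcoMod]
    push_cast
    simp only [zsmul_eq_mul]
    ring
  rw [h1, ← norm_div, norm_mul_exp_arg_mul_I, div_mul_cancel₀ _ hq]

theorem cwAng_eq {q : ℂ} (hq : q ≠ 0) {r α : ℝ} (hr : 0 < r) (h0 : 0 ≤ α) (h1 : α < 2 * Real.pi) :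
    cwAng q (r * exp (-(α * I)) * q) = α := by
  have e : (r * exp (-(α * I)) * q) / q = r * (Real.cos (-α) + Real.sin (-α) * I) := by
    rw [mul_div_cancel_right₀ _ hq]
    rw [show -((α : ℂ) * I) = ((-α : ℝ) : ℂ) * I by push_cast; ring, exp_mul_I]
    push_cast; ring
  obtain ⟨k, hk⟩ := Real.Angle.angle_eq_iff_two_pi_dvd_sub.1
    ((arg_mul_cos_add_sin_mul_I_coe_angle hr (-α : ℝ)))
  rw [Real.Angle.cos_coe, Real.Angle.sin_coe, ← e] at hk
  rw [cwAng]
  rw [(toIcoMod_eq_iff Real.two_pi_pos)]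
  refine ⟨⟨h0, by linarith⟩, -k, ?_⟩
  rw [zsmul_eq_mul]; push_cast; linarith

theorem cwAng_smul {q : ℂ} (hq : q ≠ 0) {z : ℂ} (hz : z ≠ 0) {r : ℝ} (hr : 0 < r) :
    cwAng q (r * z) = cwAng q z := by
  have h := cwAng_spec hq z
  have hp : 0 < ‖z‖ / ‖q‖ := div_pos (norm_pos_iff.2 hz) (norm_pos_iff.2 hq)
  have e : (r : ℂ) * z = ((r * (‖z‖ / ‖q‖) : ℝ) : ℂ) * exp (-(cwAng q z * I)) * q := by
    conv_lhs => rw [h]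
    push_cast; ring
  rw [e]
  exact cwAng_eq hq (by positivity) (cwAng_nonneg _ _) (cwAng_lt _ _)

theorem exists_pos_mul_of_cwAng_eq {q z w : ℂ} (hq : q ≠ 0) (hz : z ≠ 0) (hw : w ≠ 0)
    (h : cwAng q z = cwAng q w) : ∃ r : ℝ, 0 < r ∧ z = r * w := by
  have h1 := cwAng_spec hq z
  have h2 := cwAng_spec hq w
  rw [h] at h1
  have a1 : 0 < ‖z‖ := norm_pos_iff.2 hz
  have a2 : 0 < ‖w‖ := norm_pos_iff.2 hw
  have a3 : 0 < ‖q‖ := norm_pos_iff.2 hq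
  refine ⟨‖z‖ / ‖w‖, by positivity, ?_⟩
  have e : (‖z‖ / ‖q‖ : ℝ) = (‖z‖ / ‖w‖) * (‖w‖ / ‖q‖) := by field_simp
  rw [e, ofReal_mul] at h1
  linear_combination h1 - ((‖z‖ / ‖w‖ : ℝ) : ℂ) * h2

theorem cwAng_self {q : ℂ} (hq : q ≠ 0) : cwAng q q = 0 := by
  have := cwAng_eq hq one_pos le_rfl Real.two_pi_pos
  simpa using this

theorem cwAng_neg_self {q : ℂ} (hq : q ≠ 0) : cwAng q (-q) = Real.pi := by
  have := cwAng_eq hq one_pos Real.pi_pos.le (by linarith [Real.pi_pos])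
  simpa [Complex.exp_neg, exp_pi_mul_I] using this

/-- Rotating by an angle changes the clockwise angle accordingly. -/
theorem cwAng_rotate {q w : ℂ} (hq : q ≠ 0) (hw : w ≠ 0) {r η : ℝ} (hr : 0 < r)
    (h0 : 0 ≤ cwAng q w + η) (h1 : cwAng q w + η < 2 * Real.pi) :
    cwAng q (r * exp (-(η * I)) * w) = cwAng q w + η := by
  have h := cwAng_spec hq w
  have hp : 0 < ‖w‖ / ‖q‖ := div_pos (norm_pos_iff.2 hw) (norm_pos_iff.2 hq)
  have e : (r : ℂ) * exp (-(η * I)) * w =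
      ((r * (‖w‖ / ‖q‖) : ℝ) : ℂ) * exp (-((cwAng q w + η : ℝ) * I)) * q := by
    conv_lhs => rw [h]
    push_cast
    rw [show -(((cwAng q w : ℂ) + η) * I) = -(η * I) + -(cwAng q w * I) by ring, Complex.exp_add]
    ring
  rw [e]
  exact cwAng_eq hq (by positivity) h0 h1

theorem neg_div_rotate {q : ℂ} (hq : q ≠ 0) {a : ℝ} (ha : a ≠ 0) (θ : ℝ) :
    -q / (a * exp (-(θ * I)) * q) = ((1 / a : ℝ) : ℂ) * exp ((θ - Real.pi : ℝ) * I) := by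
  rw [show ((θ - Real.pi : ℝ) : ℂ) * I = θ * I - Real.pi * I by push_cast; ring, Complex.exp_sub,
    exp_pi_mul_I, Complex.exp_neg]
  have : (a : ℂ) ≠ 0 := by exact_mod_cast ha
  have := Complex.exp_ne_zero (θ * I)
  push_cast
  field_simp

theorem neg_rotate_div {q : ℂ} (hq : q ≠ 0) {a b : ℝ} (hb : b ≠ 0) (θ φ : ℝ) :
    -(a * exp (-(θ * I)) * q) / (b * exp (-(φ * I)) * q) =
      ((a / b : ℝ) : ℂ) * exp ((φ - θ + Real.pi : ℝ) * I) := by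
  rw [show ((φ - θ + Real.pi : ℝ) : ℂ) * I = φ * I - θ * I + Real.pi * I by push_cast; ring,
    Complex.exp_add, Complex.exp_sub, exp_pi_mul_I, Complex.exp_neg, Complex.exp_neg]
  have : (b : ℂ) ≠ 0 := by exact_mod_cast hb
  have := Complex.exp_ne_zero (θ * I)
  have := Complex.exp_ne_zero (φ * I)
  push_cast
  field_simp

/-- With `θ` and `φ` the clockwise angles of `z` and `p` from `q`, the two arguments are `θ - π` and
`φ - θ + π`, and `θ` cancels. On the other side of `p`, in `cornerAngle_of_gt`, the second argument
is smaller by 2π; this is the jump of the winding number. -/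
theorem cornerAngle_of_lt {p q z : ℂ} (hp : p ≠ 0) (hq : q ≠ 0) (hz : z ≠ 0)
    (h : cwAng q p < cwAng q z) :
    -z / p ∈ slitPlane ∧ -q / z ∈ slitPlane ∧ cornerAngle p q z = cwAng q p := by
  have hzs := cwAng_spec hq z
  have hps := cwAng_spec hq p
  have a1 : 0 < ‖z‖ / ‖q‖ := div_pos (norm_pos_iff.2 hz) (norm_pos_iff.2 hq)
  have a2 : 0 < ‖p‖ / ‖q‖ := div_pos (norm_pos_iff.2 hp) (norm_pos_iff.2 hq)
  have b1 := cwAng_nonneg q p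
  have b2 := cwAng_lt q z
  set θ := cwAng q z
  set φ := cwAng q p
  have e1 : -q / z = ((1 / (‖z‖ / ‖q‖) : ℝ) : ℂ) * exp ((θ - Real.pi : ℝ) * I) := by
    conv_lhs => rw [hzs]
    exact neg_div_rotate hq a1.ne' θ
  have e2 : -z / p = (((‖z‖ / ‖q‖) / (‖p‖ / ‖q‖) : ℝ) : ℂ) * exp ((φ - θ + Real.pi : ℝ) * I) := by
    conv_lhs => rw [hzs, hps]
    exact neg_rotate_div hq a2.ne' θ φ
  have r1 : arg (-q / z) = θ - Real.pi := by
    rw [e1]; exact arg_ofReal_mul_exp (by positivity) ⟨by linarith, by linarith⟩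
  have r2 : arg (-z / p) = φ - θ + Real.pi := by
    rw [e2]; exact arg_ofReal_mul_exp (by positivity) ⟨by linarith, by linarith⟩
  refine ⟨?_, ?_, ?_⟩
  · rw [mem_slitPlane_iff_arg, r2]
    exact ⟨by intro h'; linarith, div_ne_zero (neg_ne_zero.2 hz) hp⟩
  · rw [mem_slitPlane_iff_arg, r1]
    exact ⟨by intro h'; linarith, div_ne_zero (neg_ne_zero.2 hq) hz⟩
  · rw [cornerAngle, r1, r2]; ring

theorem cornerAngle_of_gt {p q z : ℂ} (hp : p ≠ 0) (hq : q ≠ 0) (hz : z ≠ 0)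
    (h0 : 0 < cwAng q z) (h : cwAng q z < cwAng q p) :
    -z / p ∈ slitPlane ∧ -q / z ∈ slitPlane ∧
      cornerAngle p q z = cwAng q p - 2 * Real.pi := by
  have hzs := cwAng_spec hq z
  have hps := cwAng_spec hq p
  have a1 : 0 < ‖z‖ / ‖q‖ := div_pos (norm_pos_iff.2 hz) (norm_pos_iff.2 hq)
  have a2 : 0 < ‖p‖ / ‖q‖ := div_pos (norm_pos_iff.2 hp) (norm_pos_iff.2 hq)
  have b1 := cwAng_lt q p
  set θ := cwAng q z
  set φ := cwAng q p
  have e1 : -q / z = ((1 / (‖z‖ / ‖q‖) : ℝ) : ℂ) * exp ((θ - Real.pi : ℝ) * I) := by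
    conv_lhs => rw [hzs]
    exact neg_div_rotate hq a1.ne' θ
  have e2 : -z / p = (((‖z‖ / ‖q‖) / (‖p‖ / ‖q‖) : ℝ) : ℂ) * exp ((φ - θ - Real.pi : ℝ) * I) := by
    conv_lhs => rw [hzs, hps]
    -- Here `φ - θ + π` exceeds π, so a full turn is taken off to reach the principal range.
    rw [neg_rotate_div hq a2.ne' θ φ]
    congr 1
    rw [exp_eq_exp_iff_exists_int]
    exact ⟨1, by push_cast; ring⟩
  have r1 : arg (-q / z) = θ - Real.pi := by
    rw [e1]; exact arg_ofReal_mul_exp (by positivity) ⟨by linarith, by linarith⟩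
  have r2 : arg (-z / p) = φ - θ - Real.pi := by
    rw [e2]; exact arg_ofReal_mul_exp (by positivity) ⟨by linarith, by linarith⟩
  refine ⟨?_, ?_, ?_⟩
  · rw [mem_slitPlane_iff_arg, r2]
    exact ⟨by intro h'; linarith, div_ne_zero (neg_ne_zero.2 hz) hp⟩
  · rw [mem_slitPlane_iff_arg, r1]
    exact ⟨by intro h'; linarith, div_ne_zero (neg_ne_zero.2 hq) hz⟩
  · rw [cornerAngle, r1, r2]; ring

/-- The open circular sector at `v` of radius `ρ` swept clockwise from angle `α` to angle `β`,
measured from the direction `q`. -/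
def sector (v q : ℂ) (α β ρ : ℝ) : Set ℂ :=
  {z | z ≠ v ∧ ‖z - v‖ < ρ ∧ α < cwAng q (z - v) ∧ cwAng q (z - v) < β}

/-- In polar coordinates around `v` the sector is the continuous image of a rectangle; the bounds on
`α` and `β` ensure that `cwAng` recovers the angle coordinate. -/
theorem isPreconnected_sector {v q : ℂ} (hq : q ≠ 0) {α β ρ : ℝ} (hα : 0 ≤ α)
    (hβ : β ≤ 2 * Real.pi) : IsPreconnected (sector v q α β ρ) := by
  have hq' : 0 < ‖q‖ := norm_pos_iff.2 hq
  have e : sector v q α β ρ = (fun x : ℝ × ℝ => v + (x.1 / ‖q‖ : ℝ) * exp (-(x.2 * I)) * q) ''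
      (Ioo 0 ρ ×ˢ Ioo α β) := by
    ext z
    constructor
    · rintro ⟨h1, h2, h3, h4⟩
      refine ⟨(‖z - v‖, cwAng q (z - v)), ⟨⟨norm_pos_iff.2 (sub_ne_zero.2 h1), h2⟩, h3, h4⟩, ?_⟩
      dsimp only
      rw [← cwAng_spec hq]; ring
    · rintro ⟨⟨r, θ⟩, ⟨⟨h1, h2⟩, h3, h4⟩, rfl⟩
      dsimp only at *
      have hr : 0 < r / ‖q‖ := by positivity
      have hn : ‖v + (r / ‖q‖ : ℝ) * exp (-(θ * I)) * q - v‖ = r := by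
        rw [add_sub_cancel_left, norm_mul, norm_mul, Complex.norm_real,
          show -((θ : ℂ) * I) = ((-θ : ℝ) : ℂ) * I by push_cast; ring, norm_exp_ofReal_mul_I,
          Real.norm_of_nonneg hr.le]
        field_simp
      refine ⟨?_, by rw [hn]; exact h2, ?_⟩
      · intro h; rw [h, sub_self, norm_zero] at hn; linarith
      · rw [add_sub_cancel_left, cwAng_eq hq hr (by linarith) (by linarith)]
        exact ⟨h3, h4⟩
  rw [e]
  refine (isPreconnected_Ioo.prod isPreconnected_Ioo).image _ (Continuous.continuousOn ?_)
  fun_prop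

namespace SimplePolygon
variable {n : ℕ} [NeZero n] (P : SimplePolygon n)

/-- The interior angle (with respect to the clockwise orientation) at the parameter `t`. -/
noncomputable def openAngle (t : ℝ) : ℝ := cwAng (P.fwd t) (P.bwd t)

theorem openAngle_pos (t : ℝ) : 0 < P.openAngle t := by
  refine (cwAng_nonneg _ _).lt_of_ne fun h => ?_
  obtain ⟨r, hr, he⟩ := exists_pos_mul_of_cwAng_eq (P.fwd_ne_zero t) (P.bwd_ne_zero t)
    (P.fwd_ne_zero t) (by rw [cwAng_self (P.fwd_ne_zero t)]; exact h.symm)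
  exact P.bwd_ne_smul_fwd t hr he

theorem openAngle_lt (t : ℝ) : P.openAngle t < 2 * Real.pi := cwAng_lt _ _

/-- Close to the point only the two adjacent straight pieces occur. They leave it at the clockwise
angles 0 and `openAngle`, and the radius is small enough that points at these angles lie on the
pieces. -/
theorem exists_sectors (t : ℝ) : ∃ ρ > 0, ∀ z, z ≠ P.bdryPoint t → ‖z - P.bdryPoint t‖ < ρ →
    (z ∈ P.boundary ↔ cwAng (P.fwd t) (z - P.bdryPoint t) = 0 ∨
      cwAng (P.fwd t) (z - P.bdryPoint t) = P.openAngle t) := by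
  obtain ⟨δ, hδ, hδ1, hf, hb⟩ := P.exists_straight t
  obtain ⟨ρ, hρ, hl⟩ := P.exists_local_boundary t hδ hδ1
  have nf : 0 < ‖P.fwd t‖ := norm_pos_iff.2 (P.fwd_ne_zero t)
  have nb : 0 < ‖P.bwd t‖ := norm_pos_iff.2 (P.bwd_ne_zero t)
  refine ⟨min ρ (min (δ * ‖P.fwd t‖) (δ * ‖P.bwd t‖)), by positivity, fun z hz hzn => ?_⟩
  have hz0 : z - P.bdryPoint t ≠ 0 := sub_ne_zero.2 hz
  constructor
  · intro hzb
    obtain ⟨h, hh, h1 | h1⟩ := hl z hzb (by rw [dist_eq_norm]; exact hzn.trans_le (min_le_left _ _))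
    · left
      rw [hf h hh] at h1
      have h0 : 0 < h := hh.1.lt_of_ne (by rintro rfl; simp at h1; exact hz h1)
      rw [h1, add_sub_cancel_left, cwAng_smul (P.fwd_ne_zero t) (P.fwd_ne_zero t) h0,
        cwAng_self (P.fwd_ne_zero t)]
    · right
      rw [hb h hh] at h1
      have h0 : 0 < h := hh.1.lt_of_ne (by rintro rfl; simp at h1; exact hz h1)
      rw [h1, add_sub_cancel_left, cwAng_smul (P.fwd_ne_zero t) (P.bwd_ne_zero t) h0]; rfl
  · rintro (h | h)
    · obtain ⟨r, hr, he⟩ := exists_pos_mul_of_cwAng_eq (P.fwd_ne_zero t) hz0 (P.fwd_ne_zero t)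
        (by rw [cwAng_self (P.fwd_ne_zero t)]; exact h)
      have hrd : r ≤ δ := by
        have := hzn.trans_le ((min_le_right _ _).trans (min_le_left _ _))
        rw [he, norm_mul, Complex.norm_real, Real.norm_of_nonneg hr.le] at this
        exact (lt_of_mul_lt_mul_right this nf.le).le
      rw [show z = P.bdryPoint (t + r) by rw [hf r ⟨hr.le, hrd⟩, ← he]; ring]
      exact P.bdryPoint_mem _
    · obtain ⟨r, hr, he⟩ := exists_pos_mul_of_cwAng_eq (P.fwd_ne_zero t) hz0 (P.bwd_ne_zero t) h
      have hrd : r ≤ δ := by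
        have := hzn.trans_le ((min_le_right _ _).trans (min_le_right _ _))
        rw [he, norm_mul, Complex.norm_real, Real.norm_of_nonneg hr.le] at this
        exact (lt_of_mul_lt_mul_right this nb.le).le
      rw [show z = P.bdryPoint (t - r) by rw [hb r ⟨hr.le, hrd⟩, ← he]; ring]
      exact P.bdryPoint_mem _

/-- The part near the point with parameter `t` to the right of the boundary. -/
def rightSector (t ρ : ℝ) : Set ℂ := sector (P.bdryPoint t) (P.fwd t) 0 (P.openAngle t) ρ

/-- The part near the point with parameter `t` to the left of the boundary. -/
def leftSector (t ρ : ℝ) : Set ℂ :=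
  sector (P.bdryPoint t) (P.fwd t) (P.openAngle t) (2 * Real.pi) ρ

theorem isPreconnected_rightSector (t ρ : ℝ) : IsPreconnected (P.rightSector t ρ) :=
  isPreconnected_sector (P.fwd_ne_zero t) le_rfl (P.openAngle_lt t).le

theorem isPreconnected_leftSector (t ρ : ℝ) : IsPreconnected (P.leftSector t ρ) :=
  isPreconnected_sector (P.fwd_ne_zero t) (P.openAngle_pos t).le le_rfl

theorem exists_sector_radius (t : ℝ) : ∃ ρ > 0, Disjoint (P.rightSector t ρ) P.boundary ∧
    Disjoint (P.leftSector t ρ) P.boundary ∧ ∀ z ∉ P.boundary, ‖z - P.bdryPoint t‖ < ρ →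
      z ∈ P.rightSector t ρ ∨ z ∈ P.leftSector t ρ := by
  obtain ⟨ρ, hρ, h⟩ := P.exists_sectors t
  refine ⟨ρ, hρ, Set.disjoint_left.2 ?_, Set.disjoint_left.2 ?_, fun z hz hzn => ?_⟩
  · rintro z ⟨h1, h2, h3, h4⟩ hz
    rcases (h z h1 h2).1 hz with h5 | h5 <;> linarith
  · rintro z ⟨h1, h2, h3, h4⟩ hz
    have := P.openAngle_pos t
    rcases (h z h1 h2).1 hz with h5 | h5 <;> linarith
  · have h1 : z ≠ P.bdryPoint t := fun e => hz (e ▸ P.bdryPoint_mem t)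
    have h2 := not_or.1 (fun h' => hz ((h z h1 hzn).2 h'))
    rcases lt_or_gt_of_ne h2.2 with h3 | h3
    · exact Or.inl ⟨h1, hzn, (cwAng_nonneg _ _).lt_of_ne (Ne.symm h2.1), h3⟩
    · exact Or.inr ⟨h1, hzn, h3, cwAng_lt _ _⟩

end SimplePolygon

end

/-! ### The closed region: boundedness, winding numbers, local shape -/

section
open Complex Set Filter Topology

namespace SimplePolygon
variable {n : ℕ} [NeZero n] (P : SimplePolygon n)

theorem boundary_subset_region : P.boundary ⊆ P.region := subset_union_left

theorem notMem_region_iff {x : ℂ} : x ∉ P.region ↔ x ∉ P.boundary ∧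
    ¬ Bornology.IsBounded (connectedComponentIn P.boundaryᶜ x) := by
  simp only [region, mem_union, mem_ofPred_eq]; tauto

/-- Off the boundary, membership in the region depends only on the connected component of the
complement of the boundary. -/
theorem disjoint_region_of_isPreconnected {C : Set ℂ} (hC : IsPreconnected C)
    (hd : Disjoint C P.boundary) {x : ℂ} (hx : x ∈ C) (hxR : x ∉ P.region) :
    Disjoint C P.region := by
  have hsub : C ⊆ connectedComponentIn P.boundaryᶜ x :=
    hC.subset_connectedComponentIn hx (Set.disjoint_left.1 hd)
  refine Set.disjoint_left.2 fun y hy => P.notMem_region_iff.2 ⟨Set.disjoint_left.1 hd hy, ?_⟩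
  rw [← connectedComponentIn_eq (hsub hy)]
  exact (P.notMem_region_iff.1 hxR).2

theorem subset_region_of_isPreconnected {C : Set ℂ} (hC : IsPreconnected C)
    (hd : Disjoint C P.boundary) {x : ℂ} (hx : x ∈ C) (hxR : x ∈ P.region) : C ⊆ P.region := by
  intro y hy
  by_contra hyR
  exact Set.disjoint_left.1 (P.disjoint_region_of_isPreconnected hC hd hy hyR) hx hxR

theorem isClosed_region : IsClosed P.region := by
  rw [← isOpen_compl_iff, Metric.isOpen_iff]
  intro x hx
  obtain ⟨ε, hε, hb⟩ := Metric.isOpen_iff.1 P.isClosed_boundary.isOpen_compl x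
    (P.notMem_region_iff.1 hx).1
  refine ⟨ε, hε, ?_⟩
  have := P.disjoint_region_of_isPreconnected (convex_ball x ε).isPreconnected
    (Set.disjoint_left.2 hb) (Metric.mem_ball_self hε) hx
  exact Set.disjoint_left.1 this

/-- From a point at least as far out as `M`, the outward ray avoids the boundary, so the component
of this point is unbounded. -/
theorem exists_norm_lt_of_mem_region : ∃ M : ℝ, 0 < M ∧ ∀ z ∈ P.region, ‖z‖ < M := by
  obtain ⟨M, hM0, hM⟩ := P.isCompact_boundary.isBounded.exists_pos_norm_lt
  refine ⟨M, hM0, fun z hz => ?_⟩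
  by_contra hcon
  rw [not_lt] at hcon
  have hd : Disjoint ((fun s : ℝ => (s : ℂ) * z) '' Ici 1) P.boundary := by
    refine Set.disjoint_left.2 ?_
    rintro _ ⟨s, hs, rfl⟩ h
    have := hM _ h
    rw [norm_mul, Complex.norm_real, Real.norm_of_nonneg (zero_le_one.trans hs)] at this
    have hs' : (1 : ℝ) ≤ s := hs
    nlinarith
  have hpc : IsPreconnected ((fun s : ℝ => (s : ℂ) * z) '' Ici 1) :=
    isPreconnected_Ici.image _ (by fun_prop)
  have hz1 : z ∈ (fun s : ℝ => (s : ℂ) * z) '' Ici 1 := ⟨1, by simp, by simp⟩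
  refine P.notMem_region_iff.2 ⟨Set.disjoint_left.1 hd hz1, fun hb => ?_⟩ hz
  obtain ⟨K, hK0, hK⟩ := hb.exists_pos_norm_lt
  have h2 := hK (((K / M + 1 : ℝ) : ℂ) * z) (hpc.subset_connectedComponentIn hz1
    (Set.disjoint_left.1 hd) ⟨K / M + 1, by simp only [mem_Ici]; linarith [div_pos hK0 hM0], rfl⟩)
  have h3 : 0 < K / M + 1 := by positivity
  rw [norm_mul, Complex.norm_real, Real.norm_of_nonneg h3.le] at h2
  have : (K / M + 1) * M ≤ (K / M + 1) * ‖z‖ := by gcongr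
  have e : (K / M + 1) * M = K + M := by field_simp
  linarith

/-- Winding numbers of closed curves in the region vanish outside the region. -/
theorem winding_eq_zero {L : Set ℂ} {N : ℂ → ℝ} (hL : L ⊆ P.region)
    (hc : ∀ z ∉ L, ContinuousAt N z) (hN : ∀ z ∉ L, (N z : Real.Angle) = 0)
    (h0 : ∀ z c, (∀ w ∈ L, 0 < (c * (w - z)).re) → N z = 0) {z : ℂ} (hz : z ∉ P.region) :
    N z = 0 := by
  obtain ⟨M, hM0, hM⟩ := P.exists_norm_lt_of_mem_region
  obtain ⟨hzb, hzu⟩ := P.notMem_region_iff.1 hz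
  have hzC : z ∈ connectedComponentIn P.boundaryᶜ z := mem_connectedComponentIn hzb
  have hd : Disjoint (connectedComponentIn P.boundaryᶜ z) P.boundary :=
    Set.disjoint_left.2 (connectedComponentIn_subset _ _)
  have hdR := P.disjoint_region_of_isPreconnected isPreconnected_connectedComponentIn hd hzC hz
  -- The component of `z` is unbounded, so it contains a point `y` with norm at least `M`. Seen from
  -- `y`, the whole region lies in an open half-plane, whence `N y = 0`, and `N` is constant on the
  -- component.
  obtain ⟨y, hy, hyM⟩ : ∃ y ∈ connectedComponentIn P.boundaryᶜ z, M ≤ ‖y‖ := by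
    by_contra! hcon
    exact hzu (isBounded_iff_forall_norm_le.2 ⟨M, fun y hy => (hcon y hy).le⟩)
  rw [winding_const_of_isPreconnected hc hN isPreconnected_connectedComponentIn
    (hdR.mono_right hL) hzC hy]
  refine h0 y (-(starRingEnd ℂ y)) fun w hw => ?_
  have h1 : (starRingEnd ℂ y * w).re ≤ ‖y‖ * ‖w‖ := by
    refine (re_le_norm _).trans ?_
    rw [norm_mul, norm_conj]
  have h2 := hM w (hL hw)
  have h3 : (-(starRingEnd ℂ y) * (w - y)).re = ‖y‖ ^ 2 - (starRingEnd ℂ y * w).re := by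
    rw [← normSq_eq_norm_sq, normSq_apply]; simp; ring
  rw [h3]
  nlinarith

/-- The region is a cone near each of its points. -/
theorem exists_conic (c : ℂ) : ∃ ρ > 0, ∀ z, ‖z‖ < ρ → ∀ r : ℝ, 0 < r → r ≤ 1 →
    (c + r * z ∈ P.region ↔ c + z ∈ P.region) := by
  have hbd : ∃ ρ > 0, ∀ z, ‖z‖ < ρ → ∀ r : ℝ, 0 < r → r ≤ 1 →
      (c + r * z ∈ P.boundary ↔ c + z ∈ P.boundary) := by
    by_cases hcb : c ∈ P.boundary
    · obtain ⟨t, -, rfl⟩ := P.exists_param hcb 0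
      obtain ⟨ρ, hρ, h⟩ := P.exists_sectors t
      refine ⟨ρ, hρ, fun z hz r hr hr1 => ?_⟩
      rcases eq_or_ne z 0 with rfl | hz0
      · simp
      have hr0 : (r : ℂ) ≠ 0 := by exact_mod_cast hr.ne'
      rw [h (P.bdryPoint t + r * z) (by simp [hr0, hz0]) (by
        rw [add_sub_cancel_left, norm_mul, Complex.norm_real, Real.norm_of_nonneg hr.le]
        nlinarith [norm_nonneg z]), h (P.bdryPoint t + z) (by simp [hz0]) (by simpa using hz)]
      rw [add_sub_cancel_left, add_sub_cancel_left, cwAng_smul (P.fwd_ne_zero t) hz0 hr]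
    · obtain ⟨ε, hε, hb⟩ := Metric.isOpen_iff.1 P.isClosed_boundary.isOpen_compl c hcb
      refine ⟨ε, hε, fun z hz r hr hr1 => iff_of_false (hb ?_) (hb ?_)⟩
      · rw [mem_ball_iff_norm, add_sub_cancel_left, norm_mul, Complex.norm_real,
          Real.norm_of_nonneg hr.le]
        nlinarith [norm_nonneg z]
      · simpa [mem_ball_iff_norm] using hz
  obtain ⟨ρ, hρ, h⟩ := hbd
  refine ⟨ρ, hρ, fun z hz r hr hr1 => ?_⟩
  by_cases hzb : c + z ∈ P.boundary
  · exact iff_of_true (P.boundary_subset_region ((h z hz r hr hr1).2 hzb))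
      (P.boundary_subset_region hzb)
  -- The half-open segment from `c` to `c + z` misses the boundary, by the conical shape of the
  -- boundary, so it lies either entirely inside or entirely outside the region.
  have hpc : IsPreconnected ((fun s : ℝ => c + (s : ℂ) * z) '' Ioc 0 1) :=
    isPreconnected_Ioc.image _ (by fun_prop)
  have hd : Disjoint ((fun s : ℝ => c + (s : ℂ) * z) '' Ioc 0 1) P.boundary := by
    refine Set.disjoint_left.2 ?_
    rintro _ ⟨s, hs, rfl⟩ hsb
    exact hzb ((h z hz s hs.1 hs.2).1 hsb)
  have m1 : c + z ∈ (fun s : ℝ => c + (s : ℂ) * z) '' Ioc 0 1 := ⟨1, by simp, by simp⟩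
  have m2 : c + r * z ∈ (fun s : ℝ => c + (s : ℂ) * z) '' Ioc 0 1 := ⟨r, ⟨hr, hr1⟩, rfl⟩
  exact ⟨fun hR => P.subset_region_of_isPreconnected hpc hd m2 hR m1,
    fun hR => P.subset_region_of_isPreconnected hpc hd m1 hR m2⟩

/-- Each point off the boundary can be joined to a sector at some boundary point. -/
theorem exists_joined_sector {x : ℂ} (hx : x ∉ P.boundary) : ∃ t ∈ Ico (0 : ℝ) n, ∀ ρ > 0,
    ∃ C, IsPreconnected C ∧ Disjoint C P.boundary ∧ x ∈ C ∧
      ∃ z ∈ C, z ∈ P.rightSector t ρ ∨ z ∈ P.leftSector t ρ := by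
  -- The segment from `x` to a nearest boundary point meets the boundary only at its end.
  obtain ⟨y, hy, hmin⟩ := P.isCompact_boundary.exists_isMinOn ⟨_, P.bdryPoint_mem 0⟩
    (f := fun y => dist y x) (by fun_prop)
  obtain ⟨t, ht, rfl⟩ := P.exists_param hy 0
  rw [zero_add] at ht
  obtain ⟨ρ₀, hρ₀, -, -, hcov⟩ := P.exists_sector_radius t
  refine ⟨t, ht, fun ρ hρ => ?_⟩
  have hxy : x - P.bdryPoint t ≠ 0 := sub_ne_zero.2 fun h => hx (h ▸ P.bdryPoint_mem t)
  have hpos : 0 < ‖x - P.bdryPoint t‖ := norm_pos_iff.2 hxy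
  have hd : Disjoint ((fun s : ℝ => P.bdryPoint t + (s : ℂ) * (x - P.bdryPoint t)) '' Ioc 0 1)
      P.boundary := by
    refine Set.disjoint_left.2 ?_
    rintro _ ⟨s, hs, rfl⟩ hsb
    have h1 : dist (P.bdryPoint t) x ≤
      dist (P.bdryPoint t + (s : ℂ) * (x - P.bdryPoint t)) x := hmin hsb
    have e : P.bdryPoint t + (s : ℂ) * (x - P.bdryPoint t) - x =
      ((1 - s : ℝ) : ℂ) * (P.bdryPoint t - x) := by push_cast; ring
    rw [dist_eq_norm, dist_eq_norm, e, norm_mul, Complex.norm_real,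
      Real.norm_of_nonneg (by linarith [hs.2])] at h1
    rw [norm_sub_rev] at hpos
    nlinarith [hs.1]
  refine ⟨_, isPreconnected_Ioc.image _ (by fun_prop), hd, ⟨1, by simp, by simp⟩, ?_⟩
  set s := min 1 (min ρ ρ₀ / (2 * ‖x - P.bdryPoint t‖)) with hs
  have hs0 : 0 < s := by positivity
  have hsn : s * ‖x - P.bdryPoint t‖ < min ρ ρ₀ := by
    have : s * ‖x - P.bdryPoint t‖ ≤ min ρ ρ₀ / (2 * ‖x - P.bdryPoint t‖) * ‖x - P.bdryPoint t‖ := by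
      gcongr; exact min_le_right _ _
    have e : min ρ ρ₀ / (2 * ‖x - P.bdryPoint t‖) * ‖x - P.bdryPoint t‖ = min ρ ρ₀ / 2 := by
      field_simp
    have : 0 < min ρ ρ₀ := by positivity
    linarith
  have hmem : P.bdryPoint t + (s : ℂ) * (x - P.bdryPoint t) ∈
    (fun s : ℝ => P.bdryPoint t + (s : ℂ) * (x - P.bdryPoint t)) '' Ioc 0 1 :=
    ⟨s, ⟨hs0, min_le_left _ _⟩, rfl⟩
  have hn : ‖P.bdryPoint t + (s : ℂ) * (x - P.bdryPoint t) - P.bdryPoint t‖ =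
      s * ‖x - P.bdryPoint t‖ := by
    rw [add_sub_cancel_left, norm_mul, Complex.norm_real, Real.norm_of_nonneg hs0.le]
  refine ⟨_, hmem, ?_⟩
  have hlt : ‖P.bdryPoint t + (s : ℂ) * (x - P.bdryPoint t) - P.bdryPoint t‖ < ρ := by
    rw [hn]; exact hsn.trans_le (min_le_left _ _)
  rcases hcov _ (Set.disjoint_left.1 hd hmem)
    (by rw [hn]; exact hsn.trans_le (min_le_right _ _)) with h | h
  · exact Or.inl ⟨h.1, hlt, h.2.2⟩
  · exact Or.inr ⟨h.1, hlt, h.2.2⟩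

end SimplePolygon

end

/-! ### The view angle of a triangle -/

section
open Complex Set Filter Topology MeasureTheory

/-- The determinant of two plane vectors. -/
noncomputable def planeDet (u w : ℂ) : ℝ := (starRingEnd ℂ u * w).im

theorem planeDet_apply (u w : ℂ) : planeDet u w = u.re * w.im - u.im * w.re := by
  simp [planeDet]; ring

theorem im_div_eq_planeDet (u w : ℂ) : (w / u).im = planeDet u w / normSq u := by
  rw [planeDet_apply, div_im]; ring

/-- The total view angle of the boundary of the triangle `0, u, w`. -/
noncomputable def triangleAngle (u w z : ℂ) : ℝ :=
  viewAngle z u w + viewAngle z w 0 + viewAngle z 0 u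

theorem triangleAngle_of_re_pos {u w z c : ℂ} (h0 : 0 < (c * (0 - z)).re)
    (hu : 0 < (c * (u - z)).re) (hw : 0 < (c * (w - z)).re) : triangleAngle u w z = 0 := by
  rw [triangleAngle, viewAngle_of_re_pos hu hw, viewAngle_of_re_pos hw h0,
    viewAngle_of_re_pos h0 hu]; ring

/-- The linear map taking the standard basis to `u, w`. -/
noncomputable def basisMap (u w : ℂ) : ℂ →ₗ[ℝ] ℂ :=
  reLm.smulRight u + imLm.smulRight w

theorem basisMap_apply (u w ζ : ℂ) : basisMap u w ζ = ζ.re * u + ζ.im * w := by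
  simp [basisMap]

theorem det_basisMap (u w : ℂ) : LinearMap.det (basisMap u w) = planeDet u w := by
  rw [← LinearMap.det_toMatrix basisOneI, Matrix.det_fin_two, planeDet_apply]
  simp [LinearMap.toMatrix_apply, basisMap_apply]
  ring

/-- The standard open triangle. -/
def stdTriangle : Set ℂ := {ζ | 0 < ζ.re ∧ 0 < ζ.im ∧ ζ.re + ζ.im < 1}

theorem isOpen_stdTriangle : IsOpen stdTriangle :=
  (isOpen_lt continuous_const continuous_re).inter
    ((isOpen_lt continuous_const continuous_im).inter
      (isOpen_lt (continuous_re.add continuous_im) continuous_const))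

theorem volume_stdTriangle_pos : 0 < volume stdTriangle := by
  refine isOpen_stdTriangle.measure_pos _ ⟨⟨1 / 4, 1 / 4⟩, ?_⟩
  simp only [stdTriangle, mem_ofPred_eq]
  norm_num

theorem volume_stdTriangle_lt_top : volume stdTriangle < ⊤ := by
  refine (measure_mono (fun ζ hζ => ?_)).trans_lt
    (measure_closedBall_lt_top (x := (0 : ℂ)) (r := 2))
  simp only [stdTriangle, mem_ofPred_eq] at hζ
  rw [mem_closedBall_zero_iff]
  refine (norm_le_abs_re_add_abs_im ζ).trans ?_
  rw [abs_of_pos hζ.1, abs_of_pos hζ.2.1]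
  linarith [hζ.2.2]

/-- Inside the triangle the three view angles have the sign of the determinant and add up to a
multiple of 2π, which is nonzero and less than 4π in absolute value. Outside, one of the edge lines
separates the point from the triangle and the angles cancel. The excluded `ζ` are those on the three
edge lines. -/
theorem triangleAngle_eq {u w ζ : ℂ} (hd : planeDet u w ≠ 0) (h1 : ζ.re ≠ 0) (h2 : ζ.im ≠ 0)
    (h3 : ζ.re + ζ.im ≠ 1) : triangleAngle u w (basisMap u w ζ) =
      (stdTriangle.indicator (fun _ => SignType.sign (planeDet u w) * (2 * Real.pi)) ζ : ℝ) := by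
  set z := basisMap u w ζ with hz
  rw [basisMap_apply] at hz
  set d := planeDet u w with hd'
  have hdd := hd'
  rw [planeDet_apply] at hdd
  have sep : ∀ c : ℂ, 0 < (c * (0 - z)).re → 0 < (c * (u - z)).re → 0 < (c * (w - z)).re →
      triangleAngle u w z = 0 := fun c => triangleAngle_of_re_pos
  by_cases hin : ζ ∈ stdTriangle
  · obtain ⟨a, b, ab⟩ := hin
    rw [indicator_of_mem (show ζ ∈ stdTriangle from ⟨a, b, ab⟩)]
    have c1 : planeDet (u - z) (w - z) = (1 - ζ.re - ζ.im) * d := by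
      rw [planeDet_apply, hdd, hz]; simp; ring
    have c2 : planeDet (w - z) (0 - z) = ζ.re * d := by
      rw [planeDet_apply, hdd, hz]; simp; ring
    have c3 : planeDet (0 - z) (u - z) = ζ.im * d := by
      rw [planeDet_apply, hdd, hz]; simp; ring
    have n1 : u - z ≠ 0 := by
      intro h; rw [h, planeDet_apply] at c1; simp at c1
      rcases c1 with c1 | c1
      · linarith
      · exact hd c1
    have n2 : w - z ≠ 0 := by
      intro h; rw [h, planeDet_apply] at c2; simp at c2
      rcases c2 with c2 | c2
      · exact h1 c2
      · exact hd c2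
    have n3 : 0 - z ≠ 0 := by
      intro h; rw [h, planeDet_apply] at c3; simp at c3
      rcases c3 with c3 | c3
      · exact h2 c3
      · exact hd c3
    have hang : (triangleAngle u w z : Real.Angle) = 0 := by
      have m1 := sub_ne_zero.1 n1
      have m2 := sub_ne_zero.1 n2
      have m3 := sub_ne_zero.1 n3
      rw [triangleAngle, Real.Angle.coe_add, Real.Angle.coe_add, coe_viewAngle m1 m2,
        coe_viewAngle m2 m3, coe_viewAngle m3 m1]
      abel
    obtain ⟨k, hk⟩ := Real.Angle.angle_eq_iff_two_pi_dvd_sub.1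
      (hang.trans Real.Angle.coe_zero.symm)
    have hpi := Real.pi_pos
    have s1 := normSq_pos.2 n1
    have s2 := normSq_pos.2 n2
    have s3 := normSq_pos.2 n3
    have i1 : ((w - z) / (u - z)).im = (1 - ζ.re - ζ.im) * d / normSq (u - z) := by
      rw [im_div_eq_planeDet, c1]
    have i2 : ((0 - z) / (w - z)).im = ζ.re * d / normSq (w - z) := by
      rw [im_div_eq_planeDet, c2]
    have i3 : ((u - z) / (0 - z)).im = ζ.im * d / normSq (0 - z) := by
      rw [im_div_eq_planeDet, c3]
    have l1 : 0 < 1 - ζ.re - ζ.im := by linarith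
    rcases lt_or_gt_of_ne hd with hneg | hpos
    · rw [sign_neg hneg]
      have a1 := arg_neg_iff.2 (show ((w - z) / (u - z)).im < 0 by
        rw [i1]; exact div_neg_of_neg_of_pos (mul_neg_of_pos_of_neg l1 hneg) s1)
      have a2 := arg_neg_iff.2 (show ((0 - z) / (w - z)).im < 0 by
        rw [i2]; exact div_neg_of_neg_of_pos (mul_neg_of_pos_of_neg a hneg) s2)
      have a3 := arg_neg_iff.2 (show ((u - z) / (0 - z)).im < 0 by
        rw [i3]; exact div_neg_of_neg_of_pos (mul_neg_of_pos_of_neg b hneg) s3)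
      have b1 := neg_pi_lt_arg ((w - z) / (u - z))
      have b2 := neg_pi_lt_arg ((0 - z) / (w - z))
      have b3 := neg_pi_lt_arg ((u - z) / (0 - z))
      have hk' : triangleAngle u w z = 2 * Real.pi * k := by linarith
      have ht : triangleAngle u w z = arg ((w - z) / (u - z)) + arg ((0 - z) / (w - z)) +
        arg ((u - z) / (0 - z)) := rfl
      have k1 : (k : ℝ) < 0 := by by_contra h; push Not at h; nlinarith
      have k2 : (-2 : ℝ) < k := by by_contra h; push Not at h; nlinarith
      have : k = -1 := by
        have : k < 0 := by exact_mod_cast k1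
        have : -2 < k := by exact_mod_cast k2
        omega
      rw [hk', this]; simp
    · rw [sign_pos hpos]
      have a1 := arg_nonneg_iff.2 (show 0 ≤ ((w - z) / (u - z)).im by
        rw [i1]; positivity)
      have a2 := arg_nonneg_iff.2 (show 0 ≤ ((0 - z) / (w - z)).im by
        rw [i2]; positivity)
      have a3 := arg_nonneg_iff.2 (show 0 ≤ ((u - z) / (0 - z)).im by
        rw [i3]; positivity)
      have a1' : arg ((w - z) / (u - z)) ≠ 0 := fun h => by
        have := (arg_eq_zero_iff.1 h).2
        rw [i1] at this; exact (by positivity : (1 - ζ.re - ζ.im) * d / normSq (u - z) ≠ 0) this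
      have b1 := arg_le_pi ((w - z) / (u - z))
      have b2 := arg_le_pi ((0 - z) / (w - z))
      have b3 := arg_le_pi ((u - z) / (0 - z))
      have hk' : triangleAngle u w z = 2 * Real.pi * k := by linarith
      have ht : triangleAngle u w z = arg ((w - z) / (u - z)) + arg ((0 - z) / (w - z)) +
        arg ((u - z) / (0 - z)) := rfl
      have a1'' := a1.lt_of_ne (Ne.symm a1')
      have k1 : (0 : ℝ) < k := by by_contra h; push Not at h; nlinarith
      have k2 : (k : ℝ) < 2 := by by_contra h; push Not at h; nlinarith
      have : k = 1 := by
        have : 0 < k := by exact_mod_cast k1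
        have : k < 2 := by exact_mod_cast k2
        omega
      rw [hk', this]; simp
  · rw [indicator_of_notMem hin]
    simp only [stdTriangle, mem_ofPred_eq, not_and_or, not_lt] at hin
    -- the functional `x ↦ planeDet x y / d` as multiplication by a complex number
    have fre : ∀ (y x : ℂ) (s : ℝ), (((s * y.im : ℝ) + (s * y.re : ℝ) * I) * x).re =
        s * (x.re * y.im - x.im * y.re) := by intro y x s; simp; ring
    rcases hin with h | h | h
    · have h' := h.lt_of_ne h1
      refine sep (((1 / d * w.im : ℝ)) + (1 / d * w.re : ℝ) * I) ?_ ?_ ?_ <;> rw [fre, hz]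
      · have : 1 / d * ((0 - (ζ.re * u + ζ.im * w)).re * w.im - (0 - (ζ.re * u + ζ.im * w)).im * w.re)
            = -ζ.re := by field_simp; rw [hdd]; simp; ring
        linarith
      · have : 1 / d * ((u - (ζ.re * u + ζ.im * w)).re * w.im - (u - (ζ.re * u + ζ.im * w)).im * w.re)
            = 1 - ζ.re := by field_simp; rw [hdd]; simp; ring
        linarith
      · have : 1 / d * ((w - (ζ.re * u + ζ.im * w)).re * w.im - (w - (ζ.re * u + ζ.im * w)).im * w.re)
            = -ζ.re := by field_simp; rw [hdd]; simp; ring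
        linarith
    · have h' := h.lt_of_ne h2
      refine sep (((-1 / d * u.im : ℝ)) + (-1 / d * u.re : ℝ) * I) ?_ ?_ ?_ <;> rw [fre, hz]
      · have : -1 / d * ((0 - (ζ.re * u + ζ.im * w)).re * u.im - (0 - (ζ.re * u + ζ.im * w)).im * u.re)
            = -ζ.im := by field_simp; rw [hdd]; simp; ring
        linarith
      · have : -1 / d * ((u - (ζ.re * u + ζ.im * w)).re * u.im - (u - (ζ.re * u + ζ.im * w)).im * u.re)
            = -ζ.im := by field_simp; rw [hdd]; simp; ring
        linarith
      · have : -1 / d * ((w - (ζ.re * u + ζ.im * w)).re * u.im - (w - (ζ.re * u + ζ.im * w)).im * u.re)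
            = 1 - ζ.im := by field_simp; rw [hdd]; simp; ring
        linarith
    · have h' := h.lt_of_ne (Ne.symm h3)
      refine sep (((1 / d * (u - w).im : ℝ)) + (1 / d * (u - w).re : ℝ) * I) ?_ ?_ ?_ <;>
        rw [fre, hz]
      · have : 1 / d * ((0 - (ζ.re * u + ζ.im * w)).re * (u - w).im -
            (0 - (ζ.re * u + ζ.im * w)).im * (u - w).re) = ζ.re + ζ.im := by
          field_simp; rw [hdd]; simp; ring
        linarith
      · have : 1 / d * ((u - (ζ.re * u + ζ.im * w)).re * (u - w).im -
            (u - (ζ.re * u + ζ.im * w)).im * (u - w).re) = ζ.re + ζ.im - 1 := by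
          field_simp; rw [hdd]; simp; ring
        linarith
      · have : 1 / d * ((w - (ζ.re * u + ζ.im * w)).re * (u - w).im -
            (w - (ζ.re * u + ζ.im * w)).im * (u - w).re) = ζ.re + ζ.im - 1 := by
          field_simp; rw [hdd]; simp; ring
        linarith

end

/-! ### Integrating view angles: the signed area -/

section
open Complex Set Filter Topology MeasureTheory

theorem volume_level_eq_zero (f : ℂ →ₗ[ℝ] ℝ) (hf : f ≠ 0) (a : ℝ) :
    volume {x | f x = a} = 0 := by
  obtain ⟨y, hy⟩ : ∃ y, f y ≠ 0 := by
    by_contra! h; exact hf (LinearMap.ext h)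
  have h0 : volume (LinearMap.ker f : Set ℂ) = 0 := by
    refine Measure.addHaar_submodule _ _ fun h => hy ?_
    have : y ∈ LinearMap.ker f := h ▸ Submodule.mem_top
    simpa using this
  have : {x | f x = a} = (fun x => x + -((a / f y) • y)) ⁻¹' (LinearMap.ker f : Set ℂ) := by
    ext x
    simp only [mem_ofPred_eq, mem_preimage, SetLike.mem_coe, LinearMap.mem_ker, map_add, map_neg,
      map_smul, smul_eq_mul]
    rw [div_mul_cancel₀ _ hy]
    constructor <;> intro h <;> linarith
  rw [this, measure_preimage_add_right, h0]

/-- For dependent `u`, `w` all corners lie on one line, and from any point off this line they are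
seen within a half-plane, so the angle is 0 almost everywhere. Otherwise the function is almost
everywhere `±2π` on the image of the standard triangle, whose area scales with `|planeDet u w|`; the
sign turns this into `planeDet u w`. -/
theorem integral_triangleAngle (u w : ℂ) : Integrable (triangleAngle u w) ∧
    ∫ z, triangleAngle u w z = 2 * Real.pi * volume.real stdTriangle * planeDet u w := by
  by_cases hd : planeDet u w = 0
  · have hae : triangleAngle u w =ᵐ[volume] 0 := by
      obtain ⟨e, he, a, b, hu, hw⟩ : ∃ e : ℂ, e ≠ 0 ∧ ∃ a b : ℝ, u = a * e ∧ w = b * e := by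
        rcases eq_or_ne u 0 with rfl | hu
        · rcases eq_or_ne w 0 with rfl | hw
          · exact ⟨1, one_ne_zero, 0, 0, by simp, by simp⟩
          · exact ⟨w, hw, 0, 1, by simp, by simp⟩
        · refine ⟨u, hu, 1, (w / u).re, by simp, ?_⟩
          have : ((w / u).re : ℂ) = w / u := by
            apply Complex.ext
            · simp
            · rw [im_div_eq_planeDet, hd]; simp
          rw [this, div_mul_cancel₀ _ hu]
      let f : ℂ →ₗ[ℝ] ℝ := e.re • imLm - e.im • reLm
      have hf : f ≠ 0 := by
        intro h
        have h1 := LinearMap.congr_fun h (I * e)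
        simp [f] at h1
        have : normSq e = 0 := by rw [normSq_apply]; linarith
        exact he (normSq_eq_zero.1 this)
      have hfv : ∀ x, f x = e.re * x.im - e.im * x.re := fun x => by simp [f]
      have h0 := volume_level_eq_zero f hf 0
      rw [Filter.EventuallyEq, ae_iff]
      refine measure_mono_null (fun z hz => ?_) h0
      simp only [mem_ofPred_eq] at hz ⊢
      by_contra hz0
      refine hz ?_
      have key : ∀ s : ℝ, ∀ v : ℂ, (∃ a : ℝ, v = a * e) →
          (((s * e.im : ℝ) + (s * e.re : ℝ) * I) * (v - z)).re = s * f z := by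
        rintro s v ⟨a, rfl⟩; rw [hfv]; simp; ring
      have key2 : 0 < (f z)⁻¹ * f z := by rw [inv_mul_cancel₀ hz0]; exact one_pos
      refine triangleAngle_of_re_pos (c := ((f z)⁻¹ * e.im : ℝ) + ((f z)⁻¹ * e.re : ℝ) * I) ?_ ?_ ?_
      · rw [key _ _ ⟨0, by simp⟩]; exact key2
      · rw [key _ _ ⟨a, hu⟩]; exact key2
      · rw [key _ _ ⟨b, hw⟩]; exact key2
    exact ⟨(integrable_zero _ _ _).congr hae.symm, by rw [integral_congr_ae hae, hd]; simp⟩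
  · have hdet : LinearMap.det (basisMap u w) ≠ 0 := by rwa [det_basisMap]
    have hinj : Function.Injective (basisMap u w) := (LinearMap.equivOfDetNeZero _ hdet).injective
    have hsurj : Function.Surjective (basisMap u w) :=
      (LinearMap.equivOfDetNeZero _ hdet).surjective
    have hcont : Continuous (basisMap u w) := LinearMap.continuous_of_finiteDimensional _
    have hmeas : MeasurableSet (basisMap u w '' stdTriangle) :=
      isOpen_stdTriangle.measurableSet.image_of_continuousOn_injOn hcont.continuousOn hinj.injOn
    have hvol : volume (basisMap u w '' stdTriangle) =
        ENNReal.ofReal |planeDet u w| * volume stdTriangle := by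
      rw [Measure.addHaar_image_linearMap, det_basisMap]
    have hae : triangleAngle u w =ᵐ[volume] (basisMap u w '' stdTriangle).indicator
        (fun _ => SignType.sign (planeDet u w) * (2 * Real.pi)) := by
      have n1 := volume_level_eq_zero reLm (fun h => by
        have := LinearMap.congr_fun h 1; simp at this) 0
      have n2 := volume_level_eq_zero imLm (fun h => by
        have := LinearMap.congr_fun h I; simp at this) 0
      have n3 := volume_level_eq_zero (reLm + imLm) (fun h => by
        have := LinearMap.congr_fun h 1; simp at this) 1
      have hnull : volume (basisMap u w '' ({x | reLm x = 0} ∪ {x | imLm x = 0} ∪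
          {x | (reLm + imLm) x = 1})) = 0 := by
        rw [Measure.addHaar_image_linearMap, measure_union_null (measure_union_null n1 n2) n3,
          mul_zero]
      rw [Filter.EventuallyEq, ae_iff]
      refine measure_mono_null (fun z hz => ?_) hnull
      obtain ⟨ζ, rfl⟩ := hsurj z
      refine ⟨ζ, ?_, rfl⟩
      by_contra hcon
      simp only [mem_union, mem_ofPred_eq, not_or] at hcon
      refine hz ?_
      rw [triangleAngle_eq hd hcon.1.1 hcon.1.2 hcon.2]
      by_cases hζ : ζ ∈ stdTriangle
      · rw [indicator_of_mem hζ, indicator_of_mem (mem_image_of_mem _ hζ)]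
      · rw [indicator_of_notMem hζ, indicator_of_notMem (by rwa [hinj.mem_set_image])]
    have hlt : volume (basisMap u w '' stdTriangle) < ⊤ := by
      rw [hvol]; exact ENNReal.mul_lt_top ENNReal.ofReal_lt_top volume_stdTriangle_lt_top
    refine ⟨Integrable.congr ?_ hae.symm, ?_⟩
    · rw [integrable_indicator_iff hmeas]
      exact integrableOn_const hlt.ne
    · rw [integral_congr_ae hae, integral_indicator_const _ hmeas, Measure.real, hvol,
        ENNReal.toReal_mul, ENNReal.toReal_ofReal (abs_nonneg _), ← Measure.real, smul_eq_mul]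
      have := sign_mul_abs (planeDet u w)
      linear_combination (2 * Real.pi * volume.real stdTriangle) * this

/-- If the total angle under which a closed polygon is seen is almost nowhere negative, then
so is its signed area. -/
theorem sum_planeDet_nonneg (v : ℤ → ℂ) (n : ℕ) (hv : v n = v 0)
    (h : ∀ᵐ z, 0 ≤ ∑ i ∈ Finset.range n, viewAngle z (v i) (v (i + 1))) :
    0 ≤ ∑ i ∈ Finset.range n, planeDet (v i) (v (i + 1)) := by
  have hnull : ∀ w : ℂ, volume (segment ℝ 0 w) = 0 := by
    intro w
    refine measure_mono_null ?_ (Measure.addHaar_submodule volume (Submodule.span ℝ {w}) ?_)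
    · rw [segment_subset_iff]
      intro a b _ _ _
      exact Submodule.mem_span_singleton.2 ⟨b, by simp⟩
    · intro ht
      have h1 : Module.finrank ℝ (Submodule.span ℝ {w}) ≤ 1 :=
        (finrank_span_le_card ({w} : Set ℂ)).trans (by simp)
      rw [ht, finrank_top, Complex.finrank_real_complex] at h1
      omega
  -- Fan decomposition from the origin: the view angles of the spokes cancel in pairs. Points on the
  -- spokes are excluded, since there reversing a spoke need not negate its principal angle.
  have hae : ∀ᵐ z, ∑ i ∈ Finset.range n, viewAngle z (v i) (v (i + 1)) =
      ∑ i ∈ Finset.range n, triangleAngle (v i) (v (i + 1)) z := by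
    have h1 : ∀ᵐ z : ℂ, ∀ i : ℕ, z ∉ segment ℝ 0 (v i) := by
      rw [ae_all_iff]; intro i
      exact measure_eq_zero_iff_ae_notMem.1 (hnull _)
    filter_upwards [h1] with z hz
    have h2 : ∀ i : ℕ, viewAngle z (v i) 0 = - viewAngle z 0 (v i) := by
      intro i
      have h3 := mem_slitPlane_iff_arg.1 (div_sub_mem_slitPlane (hz i))
      rw [viewAngle, viewAngle, ← inv_div, arg_inv, if_neg h3.1]
    have h4 : ∀ i ∈ Finset.range n, triangleAngle (v i) (v (i + 1)) z =
        viewAngle z (v i) (v (i + 1)) -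
          (viewAngle z 0 (v ((i + 1 : ℕ) : ℤ)) - viewAngle z 0 (v (i : ℕ))) := by
      intro i _
      have := h2 (i + 1)
      push_cast at this ⊢
      rw [triangleAngle, this]; ring
    rw [Finset.sum_congr rfl h4, Finset.sum_sub_distrib,
      Finset.sum_range_sub (fun i : ℕ => viewAngle z 0 (v i))]
    simp [hv]
  have hint : ∫ z, ∑ i ∈ Finset.range n, triangleAngle (v i) (v (i + 1)) z =
      2 * Real.pi * volume.real stdTriangle *
        ∑ i ∈ Finset.range n, planeDet (v i) (v (i + 1)) := by
    rw [integral_finsetSum _ fun i _ => (integral_triangleAngle _ _).1, Finset.mul_sum]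
    exact Finset.sum_congr rfl fun i _ => (integral_triangleAngle _ _).2
  have hnn : 0 ≤ ∫ z, ∑ i ∈ Finset.range n, triangleAngle (v i) (v (i + 1)) z := by
    refine integral_nonneg_of_ae ?_
    filter_upwards [h, hae] with z h1 h2
    rw [← h2]; exact h1
  rw [hint] at hnn
  have hk : 0 < 2 * Real.pi * volume.real stdTriangle := by
    have := ENNReal.toReal_pos volume_stdTriangle_pos.ne' volume_stdTriangle_lt_top.ne
    have := Real.pi_pos
    unfold Measure.real
    positivity
  exact nonneg_of_mul_nonneg_right hnn hk

end

/-! ### Overlap of neighbouring boundary sectors -/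

section
open Complex Set Filter Topology

theorem sector_mono {v q : ℂ} {α β ρ ρ' : ℝ} (h : ρ' ≤ ρ) : sector v q α β ρ' ⊆ sector v q α β ρ :=
  fun _ hz => ⟨hz.1, hz.2.1.trans_le h, hz.2.2⟩

theorem mem_sector_add {v q z : ℂ} {α β ρ : ℝ} (hz : z ≠ 0) (h : ‖z‖ < ρ) (h1 : α < cwAng q z)
    (h2 : cwAng q z < β) : v + z ∈ sector v q α β ρ := by
  refine ⟨by simpa using hz, by simpa using h, ?_⟩
  rw [add_sub_cancel_left]; exact ⟨h1, h2⟩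

/-- Points of the form `h ± r i` have a small angle. -/
theorem exists_polar_near {h η : ℝ} (hh : 0 < h) (hη : 0 < η) : ∃ r₀ > 0, ∀ r : ℝ, 0 < r → r < r₀ →
    ∃ φ ∈ Ioo 0 η, ∃ R > 0, ((h : ℂ) - r * I) = (R : ℝ) * exp (-((φ : ℝ) * I)) ∧
      ((h : ℂ) + r * I) = (R : ℝ) * exp (-((-φ : ℝ) * I)) := by
  have hc : Tendsto (fun r : ℝ => arg ((h : ℂ) + r * I)) (𝓝 0) (𝓝 0) := by
    have h1 : ContinuousAt arg (h : ℂ) := continuousAt_arg (Or.inl (by simpa using hh))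
    have h2 : Tendsto (fun r : ℝ => (h : ℂ) + r * I) (𝓝 0) (𝓝 h) := by
      have : Continuous (fun r : ℝ => (h : ℂ) + r * I) := by fun_prop
      simpa using this.tendsto 0
    have h3 := h1.tendsto.comp h2
    rwa [arg_ofReal_of_nonneg hh.le] at h3
  obtain ⟨r₀, hr₀, hb⟩ := Metric.eventually_nhds_iff.1 (hc.eventually (gt_mem_nhds hη))
  refine ⟨r₀, hr₀, fun r hr hr1 => ?_⟩
  have hlt := hb (show dist r 0 < r₀ by rwa [Real.dist_eq, sub_zero, abs_of_pos hr])
  have him : ((h : ℂ) + r * I).im = r := by simp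
  have hpos : 0 < arg ((h : ℂ) + r * I) := by
    refine (arg_nonneg_iff.2 (by rw [him]; exact hr.le)).lt_of_ne fun h0 => ?_
    have := (arg_eq_zero_iff.1 h0.symm).2
    rw [him] at this; exact hr.ne' this
  have hne : (h : ℂ) + r * I ≠ 0 := fun h0 => by rw [h0] at him; simp at him; exact hr.ne him
  have e := norm_mul_exp_arg_mul_I ((h : ℂ) + r * I)
  refine ⟨_, ⟨hpos, hlt⟩, ‖(h : ℂ) + r * I‖, norm_pos_iff.2 hne, ?_, ?_⟩
  · have e2 := congrArg (starRingEnd ℂ) e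
    rw [map_mul, ← exp_conj, map_mul, conj_ofReal, conj_ofReal, conj_I, map_add, map_mul, conj_I,
      conj_ofReal, conj_ofReal] at e2
    rw [← mul_neg, e2]; ring
  · rw [ofReal_neg, neg_mul, neg_neg, e]

namespace SimplePolygon
variable {n : ℕ} [NeZero n] (P : SimplePolygon n)

theorem fwd_add {t h : ℝ} (h0 : 0 ≤ h) (h1 : t + h < ⌊t⌋ + 1) : P.fwd (t + h) = P.fwd t := by
  have : ⌊t + h⌋ = ⌊t⌋ := Int.floor_eq_iff.2 ⟨by linarith [Int.floor_le t], h1⟩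
  rw [fwd, this]; rfl

theorem bwd_add {t h : ℝ} (h0 : 0 < h) (h1 : t + h ≤ ⌊t⌋ + 1) : P.bwd (t + h) = -P.fwd t := by
  have : ⌈t + h⌉ = ⌊t⌋ + 1 := Int.ceil_eq_iff.2
    ⟨by push_cast; linarith [Int.floor_le t], by push_cast; exact h1⟩
  rw [bwd, this, fwd]; simp

theorem bwd_sub {t h : ℝ} (h0 : 0 ≤ h) (h1 : (⌈t⌉ : ℝ) - 1 < t - h) : P.bwd (t - h) = P.bwd t := by
  have : ⌈t - h⌉ = ⌈t⌉ := Int.ceil_eq_iff.2 ⟨h1, by linarith [Int.le_ceil t]⟩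
  rw [bwd, this]; rfl

theorem fwd_sub {t h : ℝ} (h0 : 0 < h) (h1 : (⌈t⌉ : ℝ) - 1 ≤ t - h) : P.fwd (t - h) = -P.bwd t := by
  have : ⌊t - h⌋ = ⌈t⌉ - 1 := Int.floor_eq_iff.2
    ⟨by push_cast; exact h1, by push_cast; linarith [Int.le_ceil t]⟩
  rw [bwd, fwd, this]; simp

theorem openAngle_add {t h : ℝ} (h0 : 0 < h) (h1 : t + h < ⌊t⌋ + 1) :
    P.openAngle (t + h) = Real.pi := by
  rw [openAngle, P.fwd_add h0.le h1, P.bwd_add h0 h1.le, cwAng_neg_self (P.fwd_ne_zero t)]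

theorem openAngle_sub {t h : ℝ} (h0 : 0 < h) (h1 : (⌈t⌉ : ℝ) - 1 < t - h) :
    P.openAngle (t - h) = Real.pi := by
  rw [openAngle, P.bwd_sub h0.le h1, P.fwd_sub h0 h1.le]
  have := cwAng_neg_self (neg_ne_zero.2 (P.bwd_ne_zero t))
  rwa [neg_neg] at this

theorem cwAng_mul_I {q : ℂ} (hq : q ≠ 0) : cwAng q (I * q) = 3 * Real.pi / 2 := by
  have := cwAng_eq hq one_pos (α := 3 * Real.pi / 2) (by linarith [Real.pi_pos])
    (by linarith [Real.pi_pos])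
  rw [← this]
  congr 1
  rw [show -(((3 * Real.pi / 2 : ℝ) : ℂ) * I) = Real.pi / 2 * I - 2 * Real.pi * I by push_cast; ring,
    Complex.exp_sub, exp_two_pi_mul_I, exp_pi_div_two_mul_I]
  simp

theorem cwAng_neg_mul_I {q : ℂ} (hq : q ≠ 0) : cwAng q (-I * q) = Real.pi / 2 := by
  have := cwAng_eq hq one_pos (α := Real.pi / 2) (by linarith [Real.pi_pos])
    (by linarith [Real.pi_pos])
  rw [← this]
  congr 1
  rw [show -(((Real.pi / 2 : ℝ) : ℂ) * I) = -(Real.pi / 2 * I) by push_cast; ring,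
    Complex.exp_neg, exp_pi_div_two_mul_I]
  simp

theorem norm_small_mul_I {q : ℂ} {r : ℝ} (hr : 0 < r) : ‖(r : ℂ) * (I * q)‖ = r * ‖q‖ := by
  rw [norm_mul, norm_mul, Complex.norm_real, Real.norm_of_nonneg hr.le, norm_I, one_mul]

theorem norm_small_neg_mul_I {q : ℂ} {r : ℝ} (hr : 0 < r) : ‖(r : ℂ) * (-I * q)‖ = r * ‖q‖ := by
  rw [norm_mul, norm_mul, Complex.norm_real, Real.norm_of_nonneg hr.le, norm_neg, norm_I, one_mul]

/-- The sectors on either side of the boundary at nearby points overlap. -/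
theorem exists_sectors_overlap (t : ℝ) {ρ : ℝ} (hρ : 0 < ρ) : ∃ ε > 0, ∀ h, 0 < h → h < ε →
    (∃ r₀ > 0, ∀ r : ℝ, 0 < r → r < r₀ →
      (P.bdryPoint (t + h) + r * (I * P.fwd (t + h)) ∈ P.leftSector t ρ ∧
        P.bdryPoint (t + h) + r * (-I * P.fwd (t + h)) ∈ P.rightSector t ρ) ∧
      (P.bdryPoint (t - h) + r * (I * P.fwd (t - h)) ∈ P.leftSector t ρ ∧
        P.bdryPoint (t - h) + r * (-I * P.fwd (t - h)) ∈ P.rightSector t ρ)) ∧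
    P.openAngle (t + h) = Real.pi ∧ P.openAngle (t - h) = Real.pi := by
  have hf0 := P.fwd_ne_zero t
  have hb0 := P.bwd_ne_zero t
  have nf : 0 < ‖P.fwd t‖ := norm_pos_iff.2 hf0
  have nb : 0 < ‖P.bwd t‖ := norm_pos_iff.2 hb0
  have h1 : 0 < (⌊t⌋ : ℝ) + 1 - t := by linarith [Int.lt_floor_add_one t]
  have h2 : 0 < t - ((⌈t⌉ : ℝ) - 1) := by linarith [Int.ceil_lt_add_one t]
  have hw := P.openAngle_pos t
  have hw2 := P.openAngle_lt t
  refine ⟨min (min ((⌊t⌋ : ℝ) + 1 - t) (t - ((⌈t⌉ : ℝ) - 1)))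
    (min (ρ / (2 * ‖P.fwd t‖)) (ρ / (2 * ‖P.bwd t‖))), by positivity, fun h hh0 hh => ?_⟩
  have a1 : t + h < ⌊t⌋ + 1 := by
    linarith [hh.trans_le ((min_le_left _ _).trans (min_le_left _ _))]
  have a2 : (⌈t⌉ : ℝ) - 1 < t - h := by
    linarith [hh.trans_le ((min_le_left _ _).trans (min_le_right _ _))]
  have a3 : h * ‖P.fwd t‖ < ρ / 2 := by
    have := hh.trans_le ((min_le_right _ _).trans (min_le_left _ _))
    rw [lt_div_iff₀ (by positivity)] at this; linarith
  have a4 : h * ‖P.bwd t‖ < ρ / 2 := by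
    have := hh.trans_le ((min_le_right _ _).trans (min_le_right _ _))
    rw [lt_div_iff₀ (by positivity)] at this; linarith
  refine ⟨?_, P.openAngle_add hh0 a1, P.openAngle_sub hh0 a2⟩
  -- The points to be located are `(h ± r I)` times an edge direction, that is, this direction
  -- turned by a small angle `φ`. Taking `φ` below both `openAngle` and its complement prevents it
  -- from passing the other edge.
  obtain ⟨r₀, hr₀, hpol⟩ := exists_polar_near hh0
    (show 0 < min (P.openAngle t) (2 * Real.pi - P.openAngle t) by
      apply lt_min hw; linarith)
  refine ⟨min r₀ h, lt_min hr₀ hh0, fun r hr hr1 => ?_⟩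
  obtain ⟨φ, ⟨hφ0, hφ⟩, R, hR, e1, e2⟩ := hpol r hr (hr1.trans_le (min_le_left _ _))
  have hφ1 := hφ.trans_le (min_le_left _ _)
  have hφ2 := hφ.trans_le (min_le_right _ _)
  have hrh := hr1.trans_le (min_le_right _ _)
  have n1 : ∀ w : ℂ, ‖((h : ℂ) + r * I) * w‖ ≤ 2 * (h * ‖w‖) := fun w => by
    rw [norm_mul]
    have : ‖(h : ℂ) + r * I‖ ≤ h + r := by
      refine (norm_add_le _ _).trans ?_
      rw [norm_mul, norm_I, Complex.norm_real, Complex.norm_real, Real.norm_of_nonneg hh0.le,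
        Real.norm_of_nonneg hr.le, mul_one]
    nlinarith [norm_nonneg w]
  have n2 : ∀ w : ℂ, ‖((h : ℂ) - r * I) * w‖ ≤ 2 * (h * ‖w‖) := fun w => by
    rw [norm_mul]
    have : ‖(h : ℂ) - r * I‖ ≤ h + r := by
      refine (norm_sub_le _ _).trans ?_
      rw [norm_mul, norm_I, Complex.norm_real, Complex.norm_real, Real.norm_of_nonneg hh0.le,
        Real.norm_of_nonneg hr.le, mul_one]
    nlinarith [norm_nonneg w]
  have z1 : ∀ w : ℂ, w ≠ 0 → ((h : ℂ) + r * I) * w ≠ 0 := fun w hw => by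
    refine mul_ne_zero (fun h0 => ?_) hw
    have := congrArg im h0; simp at this; exact hr.ne' this
  have z2 : ∀ w : ℂ, w ≠ 0 → ((h : ℂ) - r * I) * w ≠ 0 := fun w hw => by
    refine mul_ne_zero (fun h0 => ?_) hw
    have := congrArg im h0; simp at this; exact hr.ne' this
  rw [P.fwd_add hh0.le a1, P.fwd_sub hh0 a2.le, P.bdryPoint_add_fwd hh0.le a1.le,
    P.bdryPoint_sub_bwd hh0.le a2.le]
  have c1 : cwAng (P.fwd t) (((h : ℂ) + r * I) * P.fwd t) = 2 * Real.pi - φ := by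
    have : ((h : ℂ) + r * I) * P.fwd t = R * exp (-((2 * Real.pi - φ : ℝ) * I)) * P.fwd t := by
      rw [e2]
      congr 2
      rw [exp_eq_exp_iff_exists_int]
      exact ⟨1, by push_cast; ring⟩
    rw [this, cwAng_eq hf0 hR (by linarith) (by linarith)]
  have c2 : cwAng (P.fwd t) (((h : ℂ) - r * I) * P.fwd t) = φ := by
    rw [e1, cwAng_eq hf0 hR hφ0.le (by linarith)]
  have c3 : cwAng (P.fwd t) (((h : ℂ) - r * I) * P.bwd t) = P.openAngle t + φ := by
    have h0 : cwAng (P.fwd t) (P.bwd t) = P.openAngle t := rfl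
    rw [e1, cwAng_rotate hf0 hb0 hR (by rw [h0]; linarith) (by rw [h0]; linarith), h0]
  have c4 : cwAng (P.fwd t) (((h : ℂ) + r * I) * P.bwd t) = P.openAngle t - φ := by
    have h0 : cwAng (P.fwd t) (P.bwd t) = P.openAngle t := rfl
    rw [e2, cwAng_rotate hf0 hb0 hR (by rw [h0]; linarith) (by rw [h0]; linarith), h0]
    ring
  refine ⟨⟨?_, ?_⟩, ?_, ?_⟩
  · rw [show P.bdryPoint t + h * P.fwd t + r * (I * P.fwd t) =
      P.bdryPoint t + ((h : ℂ) + r * I) * P.fwd t by ring]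
    exact mem_sector_add (z1 _ hf0) (by linarith [n1 (P.fwd t)]) (by rw [c1]; linarith)
      (by rw [c1]; linarith)
  · rw [show P.bdryPoint t + h * P.fwd t + r * (-I * P.fwd t) =
      P.bdryPoint t + ((h : ℂ) - r * I) * P.fwd t by ring]
    exact mem_sector_add (z2 _ hf0) (by linarith [n2 (P.fwd t)]) (by rw [c2]; exact hφ0)
      (by rw [c2]; exact hφ1)
  · rw [show P.bdryPoint t + h * P.bwd t + r * (I * -P.bwd t) =
      P.bdryPoint t + ((h : ℂ) - r * I) * P.bwd t by ring]
    exact mem_sector_add (z2 _ hb0) (by linarith [n2 (P.bwd t)]) (by rw [c3]; linarith)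
      (by rw [c3]; linarith)
  · rw [show P.bdryPoint t + h * P.bwd t + r * (-I * -P.bwd t) =
      P.bdryPoint t + ((h : ℂ) + r * I) * P.bwd t by ring]
    exact mem_sector_add (z1 _ hb0) (by linarith [n1 (P.bwd t)]) (by rw [c4]; linarith)
      (by rw [c4]; linarith)

theorem mem_sectors_of_openAngle_eq_pi {t : ℝ} (ht : P.openAngle t = Real.pi) {ρ r : ℝ} (hr : 0 < r)
    (hrρ : r * ‖P.fwd t‖ < ρ) : P.bdryPoint t + r * (I * P.fwd t) ∈ P.leftSector t ρ ∧
      P.bdryPoint t + r * (-I * P.fwd t) ∈ P.rightSector t ρ := by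
  have hf0 := P.fwd_ne_zero t
  have hr0 : (r : ℂ) ≠ 0 := by exact_mod_cast hr.ne'
  have hpi := Real.pi_pos
  constructor
  · have e : cwAng (P.fwd t) (r * (I * P.fwd t)) = 3 * Real.pi / 2 := by
      rw [cwAng_smul hf0 (by simp [hf0]) hr, cwAng_mul_I hf0]
    exact mem_sector_add (by simp [hf0, hr0]) (by rwa [norm_small_mul_I hr])
      (by rw [e, ht]; linarith) (by rw [e]; linarith)
  · have e : cwAng (P.fwd t) (r * (-I * P.fwd t)) = Real.pi / 2 := by
      rw [cwAng_smul hf0 (by simp [hf0]) hr, cwAng_neg_mul_I hf0]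
    exact mem_sector_add (by simp [hf0, hr0]) (by rwa [norm_small_neg_mul_I hr])
      (by rw [e]; linarith) (by rw [e, ht]; linarith)

end SimplePolygon

end

/-! ### The region lies to the right of the boundary -/

section
open Complex Set Filter Topology MeasureTheory

theorem volume_segment_eq_zero (u w : ℂ) : volume (segment ℝ u w) = 0 := by
  have h0 : volume (segment ℝ 0 (w - u)) = 0 := by
    refine measure_mono_null ?_
      (Measure.addHaar_submodule volume (Submodule.span ℝ {w - u}) fun ht => ?_)
    · rw [segment_subset_iff]
      intro a b _ _ _
      exact Submodule.mem_span_singleton.2 ⟨b, by simp⟩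
    · have h1 : Module.finrank ℝ (Submodule.span ℝ {w - u}) ≤ 1 :=
        (finrank_span_le_card ({w - u} : Set ℂ)).trans (by simp)
      rw [ht, finrank_top, Complex.finrank_real_complex] at h1
      omega
  have : segment ℝ u w = (fun x => x + -u) ⁻¹' segment ℝ 0 (w - u) := by
    ext x
    have := mem_segment_translate ℝ (-u) (x := x) (b := u) (c := w)
    rw [mem_preimage, ← this]
    simp [add_comm, sub_eq_add_neg]
  rw [this, measure_preimage_add_right, h0]

namespace SimplePolygon
variable {n : ℕ} [NeZero n] (P : SimplePolygon n)

/-- A small left sector is connected and misses the boundary, so it is entirely inside or entirely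
outside the region. Sectors at neighbouring parameters overlap, so the alternative is locally
constant in `t`, hence constant on the line. -/
theorem leftSector_dichotomy : (∀ t, ∃ ρ > 0, Disjoint (P.leftSector t ρ) P.region) ∨
    ∀ t, ∃ ρ > 0, P.leftSector t ρ ⊆ P.region := by
  choose ρ hρ hdr hdl hcov using P.exists_sector_radius
  have hdich : ∀ t, ∀ z ∈ P.leftSector t (ρ t), z ∈ P.region → P.leftSector t (ρ t) ⊆ P.region :=
    fun t z hz hzR => P.subset_region_of_isPreconnected (P.isPreconnected_leftSector t _) (hdl t)
      hz hzR
  have hloc : IsLocallyConstant fun t => P.leftSector t (ρ t) ⊆ P.region := by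
    rw [IsLocallyConstant.iff_eventually_eq]
    intro t
    obtain ⟨ε, hε, hov⟩ := P.exists_sectors_overlap t (hρ t)
    have key : ∀ s z, z ∈ P.leftSector t (ρ t) → z ∈ P.leftSector s (ρ s) →
        (P.leftSector s (ρ s) ⊆ P.region) = (P.leftSector t (ρ t) ⊆ P.region) := by
      intro s z h1 h2
      exact propext ⟨fun h => hdich t z h1 (h h2), fun h => hdich s z h2 (h h1)⟩
    filter_upwards [Ioo_mem_nhds (show t - ε < t by linarith) (show t < t + ε by linarith)]
      with s hs
    rcases lt_trichotomy s t with hlt | rfl | hlt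
    · obtain ⟨⟨r₀, hr₀, h1⟩, -, h3⟩ := hov (t - s) (by linarith) (by linarith [hs.1])
      rw [show t - (t - s) = s by ring] at h1 h3
      have hf : 0 < ‖P.fwd s‖ := norm_pos_iff.2 (P.fwd_ne_zero s)
      obtain ⟨r, hr0, hr⟩ := exists_between (lt_min hr₀ (div_pos (hρ s) hf))
      exact key s _ (h1 r hr0 (hr.trans_le (min_le_left _ _))).2.1
        (P.mem_sectors_of_openAngle_eq_pi h3 hr0
          ((lt_div_iff₀ hf).1 (hr.trans_le (min_le_right _ _)))).1
    · rfl
    · obtain ⟨⟨r₀, hr₀, h1⟩, h3, -⟩ := hov (s - t) (by linarith) (by linarith [hs.2])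
      rw [show t + (s - t) = s by ring] at h1 h3
      have hf : 0 < ‖P.fwd s‖ := norm_pos_iff.2 (P.fwd_ne_zero s)
      obtain ⟨r, hr0, hr⟩ := exists_between (lt_min hr₀ (div_pos (hρ s) hf))
      exact key s _ (h1 r hr0 (hr.trans_le (min_le_left _ _))).1.1
        (P.mem_sectors_of_openAngle_eq_pi h3 hr0
          ((lt_div_iff₀ hf).1 (hr.trans_le (min_le_right _ _)))).1
  by_cases h : P.leftSector 0 (ρ 0) ⊆ P.region
  · right
    intro t
    have := hloc.apply_eq_of_isPreconnected isPreconnected_univ (mem_univ t) (mem_univ 0)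
    exact ⟨ρ t, hρ t, this.symm ▸ h⟩
  · left
    intro t
    have := hloc.apply_eq_of_isPreconnected isPreconnected_univ (mem_univ t) (mem_univ 0)
    have h' : ¬ P.leftSector t (ρ t) ⊆ P.region := fun h'' => h (this ▸ h'')
    exact ⟨ρ t, hρ t, Set.disjoint_left.2 fun z hz hzR => h' (hdich t z hz hzR)⟩

theorem rightSector_dichotomy : (∀ t, ∃ ρ > 0, Disjoint (P.rightSector t ρ) P.region) ∨
    ∀ t, ∃ ρ > 0, P.rightSector t ρ ⊆ P.region := by
  choose ρ hρ hdr hdl hcov using P.exists_sector_radius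
  have hdich : ∀ t, ∀ z ∈ P.rightSector t (ρ t), z ∈ P.region →
      P.rightSector t (ρ t) ⊆ P.region :=
    fun t z hz hzR => P.subset_region_of_isPreconnected (P.isPreconnected_rightSector t _) (hdr t)
      hz hzR
  have hloc : IsLocallyConstant fun t => P.rightSector t (ρ t) ⊆ P.region := by
    rw [IsLocallyConstant.iff_eventually_eq]
    intro t
    obtain ⟨ε, hε, hov⟩ := P.exists_sectors_overlap t (hρ t)
    have key : ∀ s z, z ∈ P.rightSector t (ρ t) → z ∈ P.rightSector s (ρ s) →
        (P.rightSector s (ρ s) ⊆ P.region) = (P.rightSector t (ρ t) ⊆ P.region) := by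
      intro s z h1 h2
      exact propext ⟨fun h => hdich t z h1 (h h2), fun h => hdich s z h2 (h h1)⟩
    filter_upwards [Ioo_mem_nhds (show t - ε < t by linarith) (show t < t + ε by linarith)]
      with s hs
    rcases lt_trichotomy s t with hlt | rfl | hlt
    · obtain ⟨⟨r₀, hr₀, h1⟩, -, h3⟩ := hov (t - s) (by linarith) (by linarith [hs.1])
      rw [show t - (t - s) = s by ring] at h1 h3
      have hf : 0 < ‖P.fwd s‖ := norm_pos_iff.2 (P.fwd_ne_zero s)
      obtain ⟨r, hr0, hr⟩ := exists_between (lt_min hr₀ (div_pos (hρ s) hf))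
      exact key s _ (h1 r hr0 (hr.trans_le (min_le_left _ _))).2.2
        (P.mem_sectors_of_openAngle_eq_pi h3 hr0
          ((lt_div_iff₀ hf).1 (hr.trans_le (min_le_right _ _)))).2
    · rfl
    · obtain ⟨⟨r₀, hr₀, h1⟩, h3, -⟩ := hov (s - t) (by linarith) (by linarith [hs.2])
      rw [show t + (s - t) = s by ring] at h1 h3
      have hf : 0 < ‖P.fwd s‖ := norm_pos_iff.2 (P.fwd_ne_zero s)
      obtain ⟨r, hr0, hr⟩ := exists_between (lt_min hr₀ (div_pos (hρ s) hf))
      exact key s _ (h1 r hr0 (hr.trans_le (min_le_left _ _))).1.2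
        (P.mem_sectors_of_openAngle_eq_pi h3 hr0
          ((lt_div_iff₀ hf).1 (hr.trans_le (min_le_right _ _)))).2
  by_cases h : P.rightSector 0 (ρ 0) ⊆ P.region
  · right
    intro t
    have := hloc.apply_eq_of_isPreconnected isPreconnected_univ (mem_univ t) (mem_univ 0)
    exact ⟨ρ t, hρ t, this.symm ▸ h⟩
  · left
    intro t
    have := hloc.apply_eq_of_isPreconnected isPreconnected_univ (mem_univ t) (mem_univ 0)
    have h' : ¬ P.rightSector t (ρ t) ⊆ P.region := fun h'' => h (this ▸ h'')
    exact ⟨ρ t, hρ t, Set.disjoint_left.2 fun z hz hzR => h' (hdich t z hz hzR)⟩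

theorem segment_cyclicVertex (k : ℤ) : segment ℝ (P.cyclicVertex k) (P.cyclicVertex (k + 1)) =
    P.bdryPoint '' Icc k (k + 1) := by
  rw [segment_eq_image']
  ext x
  constructor
  · rintro ⟨θ, hθ, rfl⟩
    refine ⟨k + θ, ⟨by linarith [hθ.1], by linarith [hθ.2]⟩, ?_⟩
    rw [P.bdryPoint_eq (k := k) (by linarith [hθ.1]) (by linarith [hθ.2])]
    simp
  · rintro ⟨t, ht, rfl⟩
    refine ⟨t - k, ⟨by linarith [ht.1], by linarith [ht.2]⟩, ?_⟩
    rw [P.bdryPoint_eq ht.1 ht.2]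
    simp

theorem segment_cyclicVertex_subset (k : ℤ) :
    segment ℝ (P.cyclicVertex k) (P.cyclicVertex (k + 1)) ⊆ P.boundary := by
  rw [segment_cyclicVertex]
  rintro _ ⟨t, -, rfl⟩
  exact P.bdryPoint_mem t

theorem volume_boundary : volume P.boundary = 0 := by
  have : P.boundary = ⋃ k : ℤ, segment ℝ (P.cyclicVertex k) (P.cyclicVertex (k + 1)) := by
    refine Subset.antisymm (fun x hx => ?_) (iUnion_subset P.segment_cyclicVertex_subset)
    rw [boundary_eq_range] at hx
    obtain ⟨t, rfl⟩ := hx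
    refine mem_iUnion.2 ⟨⌊t⌋, ?_⟩
    rw [segment_cyclicVertex]
    exact ⟨t, ⟨Int.floor_le t, (Int.lt_floor_add_one t).le⟩, rfl⟩
  rw [this]
  exact measure_iUnion_null fun k => volume_segment_eq_zero _ _

/-- The total angle under which the boundary is seen. -/
noncomputable def totalAngle (z : ℂ) : ℝ :=
  ∑ i ∈ Finset.range n, viewAngle z (P.cyclicVertex i) (P.cyclicVertex (i + 1))

theorem cyclicVertex_mem (k : ℤ) : P.cyclicVertex k ∈ P.boundary :=
  P.segment_cyclicVertex_subset k (left_mem_segment ℝ _ _)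

theorem cyclicVertex_natCast_self : P.cyclicVertex n = P.cyclicVertex 0 := by
  simpa using P.cyclicVertex_add 0

theorem continuousAt_totalAngle {z : ℂ} (hz : z ∉ P.boundary) : ContinuousAt P.totalAngle z :=
  tendsto_finsetSum _ fun i _ =>
    (continuousAt_viewAngle fun h => hz (P.segment_cyclicVertex_subset i h)).tendsto

theorem coe_totalAngle {z : ℂ} (hz : z ∉ P.boundary) : (P.totalAngle z : Real.Angle) = 0 := by
  have hne : ∀ k, P.cyclicVertex k ≠ z := fun k h => hz (h ▸ P.cyclicVertex_mem k)
  have h := Finset.sum_range_sub (fun i : ℕ => (arg (P.cyclicVertex i - z) : Real.Angle)) n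
  rw [totalAngle, ← Real.Angle.coe_coeHom, map_sum]
  simp only [Real.Angle.coe_coeHom]
  rw [Finset.sum_congr rfl fun (i : ℕ) _ => coe_viewAngle (hne (i : ℤ)) (hne ((i : ℤ) + 1))]
  push_cast at h
  rw [h, cyclicVertex_natCast_self]; simp

theorem totalAngle_of_re_pos {z c : ℂ} (h : ∀ w ∈ P.boundary, 0 < (c * (w - z)).re) :
    P.totalAngle z = 0 := by
  have h1 := Finset.sum_range_sub (fun i : ℕ => (arg (c * (P.cyclicVertex i - z)))) n
  rw [totalAngle, Finset.sum_congr rfl fun (i : ℕ) _ => viewAngle_of_re_pos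
    (h _ (P.cyclicVertex_mem (i : ℤ))) (h _ (P.cyclicVertex_mem ((i : ℤ) + 1)))]
  push_cast at h1
  rw [h1, cyclicVertex_natCast_self]; simp

theorem totalAngle_eq_zero {z : ℂ} (hz : z ∉ P.region) : P.totalAngle z = 0 :=
  P.winding_eq_zero P.boundary_subset_region (fun _ h => P.continuousAt_totalAngle h)
    (fun _ h => P.coe_totalAngle h) (fun _ _ h => P.totalAngle_of_re_pos h) hz

/-- If the right side is outside, a point of the region off the boundary is connected to a left
sector. Across an edge only the view angle of this edge jumps; it is at most 0 on the right, where
the total vanishes, and at least 0 on the left. -/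
theorem totalAngle_nonneg_of_right_out
    (h : ∀ t, ∃ ρ > 0, Disjoint (P.rightSector t ρ) P.region) {z : ℂ} (hz : z ∉ P.boundary) :
    0 ≤ P.totalAngle z := by
  by_cases hzR : z ∉ P.region
  · exact (P.totalAngle_eq_zero hzR).ge
  rw [not_not] at hzR
  obtain ⟨t, ht, hjoin⟩ := P.exists_joined_sector hz
  obtain ⟨ρ₁, hρ₁, hd₁⟩ := h t
  obtain ⟨ρ₀, hρ₀, -, hdl, -⟩ := P.exists_sector_radius t
  have hρ : 0 < min ρ₀ ρ₁ := lt_min hρ₀ hρ₁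
  obtain ⟨C, hC, hCb, hzC, z', hz'C, hz'⟩ := hjoin _ hρ
  have hz'l : z' ∈ P.leftSector t (min ρ₀ ρ₁) := by
    refine hz'.resolve_left fun hr => ?_
    exact Set.disjoint_left.1 hd₁ (sector_mono (min_le_right _ _) hr)
      (P.subset_region_of_isPreconnected hC hCb hzC hzR hz'C)
  have hN : ∀ w ∈ P.leftSector t (min ρ₀ ρ₁), P.totalAngle w = P.totalAngle z := by
    intro w hw
    rw [winding_const_of_isPreconnected (fun _ h => P.continuousAt_totalAngle h)
      (fun _ h => P.coe_totalAngle h) hC hCb hzC hz'C]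
    exact winding_const_of_isPreconnected (fun _ h => P.continuousAt_totalAngle h)
      (fun _ h => P.coe_totalAngle h) (P.isPreconnected_leftSector t _)
      (hdl.mono_left (sector_mono (min_le_left _ _))) hw hz'l
  -- The parameter `t` may be a vertex; the jump is computed at `s = t + h'`, in the interior of the
  -- edge that follows.
  obtain ⟨ε, hε, hov⟩ := P.exists_sectors_overlap t hρ
  obtain ⟨h', hh0, hh⟩ := exists_between (lt_min hε (lt_min
    (show 0 < (⌊t⌋ : ℝ) + 1 - t by linarith [Int.lt_floor_add_one t])
    (show 0 < (n : ℝ) - t by linarith [ht.2])))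
  obtain ⟨⟨r₀, hr₀, hmem⟩, -, -⟩ := hov h' hh0 (hh.trans_le (min_le_left _ _))
  have hs1 : t + h' < ⌊t⌋ + 1 := by
    linarith [hh.trans_le ((min_le_right _ _).trans (min_le_left _ _))]
  have hs2 : t + h' < n := by
    linarith [hh.trans_le ((min_le_right _ _).trans (min_le_right _ _))]
  have hs0 : (⌊t⌋ : ℝ) < t + h' := by linarith [Int.floor_le t]
  set s := t + h' with hs
  have hfl : ⌊s⌋ = ⌊t⌋ := Int.floor_eq_iff.2 ⟨hs0.le, hs1⟩
  have hk0 : 0 ≤ ⌊s⌋ := Int.floor_nonneg.2 (by linarith [ht.1])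
  obtain ⟨k, hk⟩ := Int.eq_ofNat_of_zero_le hk0
  have hkn : k < n := by
    have : ⌊s⌋ < n := Int.floor_lt.2 (by exact_mod_cast hs2)
    omega
  have hks : (k : ℝ) < s := by
    have : (⌊t⌋ : ℝ) = k := by rw [← hfl, hk]; simp
    rw [← this]; exact hs0
  have hks1 : s < k + 1 := by
    have : (⌊t⌋ : ℝ) = k := by rw [← hfl, hk]; simp
    rw [← this]; exact hs1
  -- the other edges do not contribute to the jump
  let rest : ℂ → ℝ := fun z => ∑ i ∈ (Finset.range n).erase k,
    viewAngle z (P.cyclicVertex i) (P.cyclicVertex (i + 1))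
  have hrest : ContinuousAt rest (P.bdryPoint s) := by
    refine tendsto_finsetSum _ fun i hi => (continuousAt_viewAngle fun hmem => ?_).tendsto
    obtain ⟨hik, hin⟩ := Finset.mem_erase.1 hi
    rw [segment_cyclicVertex] at hmem
    obtain ⟨u, hu, hue⟩ := hmem
    have hin' : ((i : ℤ) : ℝ) + 1 ≤ n := by exact_mod_cast Finset.mem_range.1 hin
    have hi0 : (0 : ℝ) ≤ ((i : ℤ) : ℝ) := by positivity
    have hus := P.bdryPoint_inj hue (by linarith [hu.2, ht.1]) (by linarith [hu.1])
    rw [hus] at hu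
    push_cast at hu
    have a1 : (i : ℝ) < k + 1 := lt_of_le_of_lt hu.1 hks1
    have a2 : (k : ℝ) < i + 1 := lt_of_lt_of_le hks hu.2
    have a1' : i < k + 1 := by exact_mod_cast a1
    have a2' : k < i + 1 := by exact_mod_cast a2
    omega
  have hsplit : ∀ z, P.totalAngle z =
      viewAngle z (P.cyclicVertex k) (P.cyclicVertex (k + 1)) + rest z := fun z =>
    (Finset.add_sum_erase _ _ (Finset.mem_range.2 hkn)).symm
  have hfwd : P.fwd s = P.cyclicVertex (k + 1) - P.cyclicVertex k := by rw [fwd, hk]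
  have hBs : P.bdryPoint s = P.cyclicVertex k + ((s - k : ℝ) : ℂ) * P.fwd s := by
    rw [P.bdryPoint_eq (k := k) (by exact_mod_cast hks.le) (by exact_mod_cast hks1.le), hfwd]
    simp
  have hf0 := P.fwd_ne_zero s
  have hview : ∀ a : ℂ, viewAngle (P.bdryPoint s + a * P.fwd s) (P.cyclicVertex k)
      (P.cyclicVertex (k + 1)) = arg (((1 - (s - k) : ℝ) - a) / (-(s - k : ℝ) - a)) := by
    intro a
    have e1 : P.cyclicVertex (k + 1) - (P.bdryPoint s + a * P.fwd s) =
        ((1 - (s - k) : ℝ) - a) * P.fwd s := by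
      rw [hBs]; push_cast; linear_combination -hfwd
    have e2 : P.cyclicVertex k - (P.bdryPoint s + a * P.fwd s) =
        (-(s - k : ℝ) - a) * P.fwd s := by
      rw [hBs]; push_cast; ring
    rw [viewAngle, e1, e2, mul_div_mul_right _ _ hf0]
  have hl : ∀ r : ℝ, 0 < r → 0 ≤ viewAngle (P.bdryPoint s + r * (I * P.fwd s)) (P.cyclicVertex k)
      (P.cyclicVertex (k + 1)) := by
    intro r hr
    rw [← mul_assoc, hview, arg_nonneg_iff, im_div_eq_planeDet]
    refine div_nonneg ?_ (normSq_nonneg _)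
    rw [planeDet_apply]; simp; nlinarith
  have hr : ∀ r : ℝ, 0 < r → viewAngle (P.bdryPoint s + r * (-I * P.fwd s)) (P.cyclicVertex k)
      (P.cyclicVertex (k + 1)) ≤ 0 := by
    intro r hr
    rw [← mul_assoc, hview]
    have hneg : ((((1 - (s - k) : ℝ) : ℂ) - r * -I) / (-((s - k : ℝ) : ℂ) - r * -I)).im < 0 := by
      rw [im_div_eq_planeDet]
      refine div_neg_of_neg_of_pos ?_ (normSq_pos.2 fun h0 => ?_)
      · rw [planeDet_apply]; simp; nlinarith
      · have := congrArg im h0; simp at this; exact hr.ne' this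
    exact (arg_neg_iff.2 hneg).le
  have hlim : ∀ d : ℂ, Tendsto (fun r : ℝ => rest (P.bdryPoint s + r * d)) (𝓝[>] 0)
      (𝓝 (rest (P.bdryPoint s))) := by
    intro d
    refine hrest.tendsto.comp (Tendsto.mono_left ?_ nhdsWithin_le_nhds)
    have : Continuous fun r : ℝ => P.bdryPoint s + r * d := by fun_prop
    simpa using this.tendsto 0
  have hlim2 := (hlim (I * P.fwd s)).sub (hlim (-I * P.fwd s))
  rw [sub_self] at hlim2
  -- The difference of `rest` between the two sides tends to 0 and is bounded above by the total
  -- angle at `z`.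
  refine le_of_tendsto hlim2 ?_
  filter_upwards [Ioo_mem_nhdsGT hr₀] with r hr'
  obtain ⟨⟨m1, m2⟩, -⟩ := hmem r hr'.1 hr'.2
  have hout : P.totalAngle (P.bdryPoint s + r * (-I * P.fwd s)) = 0 :=
    P.totalAngle_eq_zero (Set.disjoint_left.1 hd₁ (sector_mono (min_le_right _ _) m2))
  have hin := hN _ m1
  rw [hsplit] at hout hin
  linarith [hl r hr'.1, hr r hr'.1]

/-- The region lies to the right of the boundary. -/
theorem exists_rightSector_subset (t : ℝ) : ∃ ρ > 0, P.rightSector t ρ ⊆ P.region := by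
  refine (P.rightSector_dichotomy.resolve_left fun h => ?_) t
  have hae : ∀ᵐ z, z ∉ P.boundary := measure_eq_zero_iff_ae_notMem.1 P.volume_boundary
  -- With the right side outside, the total angle would be nonnegative almost everywhere, hence so
  -- would the signed area, against the clockwise orientation.
  have h1 := sum_planeDet_nonneg P.cyclicVertex n P.cyclicVertex_natCast_self
    (hae.mono fun z hz => P.totalAngle_nonneg_of_right_out h hz)
  exact absurd P.clockwise (not_lt.2 h1)

/-- Every point off the boundary is joined to some sector. If left sectors also belonged to the
region, so would every point of the plane, contrary to boundedness. -/
theorem exists_leftSector_disjoint (t : ℝ) : ∃ ρ > 0, Disjoint (P.leftSector t ρ) P.region := by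
  refine (P.leftSector_dichotomy.resolve_right fun h => ?_) t
  obtain ⟨M, hM0, hM⟩ := P.exists_norm_lt_of_mem_region
  have he : (M : ℂ) ∉ P.region := fun h' => by
    have := hM _ h'
    rw [Complex.norm_real, Real.norm_of_nonneg hM0.le] at this
    exact lt_irrefl _ this
  obtain ⟨s, -, hs⟩ := P.exists_joined_sector (P.notMem_region_iff.1 he).1
  obtain ⟨ρ₁, hρ₁, h₁⟩ := h s
  obtain ⟨ρ₂, hρ₂, h₂⟩ := P.exists_rightSector_subset s
  obtain ⟨C, hC, hCb, hMC, z, hzC, hz⟩ := hs (min ρ₁ ρ₂) (lt_min hρ₁ hρ₂)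
  have := P.disjoint_region_of_isPreconnected hC hCb hMC he
  rcases hz with hz | hz
  · exact Set.disjoint_left.1 this hzC (h₂ (sector_mono (min_le_right _ _) hz))
  · exact Set.disjoint_left.1 this hzC (h₁ (sector_mono (min_le_left _ _) hz))

/-- The structure of the region near a boundary point. -/
theorem exists_local_region (t : ℝ) : ∃ ρ > 0,
    P.rightSector t ρ ⊆ P.region \ P.boundary ∧ Disjoint (P.leftSector t ρ) P.region ∧
    (∀ z ∈ P.region \ P.boundary, ‖z - P.bdryPoint t‖ < ρ → z ∈ P.rightSector t ρ) ∧
    ∀ z ∈ P.region, ‖z - P.bdryPoint t‖ < ρ →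
      cwAng (P.fwd t) (z - P.bdryPoint t) ≤ P.openAngle t := by
  obtain ⟨ρ₁, hρ₁, h₁⟩ := P.exists_rightSector_subset t
  obtain ⟨ρ₂, hρ₂, h₂⟩ := P.exists_leftSector_disjoint t
  obtain ⟨ρ₃, hρ₃, hr, hl, hcov⟩ := P.exists_sector_radius t
  refine ⟨min ρ₁ (min ρ₂ ρ₃), by positivity, fun z hz => ?_, ?_, fun z hz hzn => ?_,
    fun z hz hzn => ?_⟩
  · exact ⟨h₁ (sector_mono (min_le_left _ _) hz), Set.disjoint_left.1 hr
      (sector_mono ((min_le_right _ _).trans (min_le_right _ _)) hz)⟩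
  · exact h₂.mono_left (sector_mono ((min_le_right _ _).trans (min_le_left _ _)))
  · rcases hcov z hz.2 (hzn.trans_le ((min_le_right _ _).trans (min_le_right _ _))) with h | h
    · exact ⟨h.1, hzn, h.2.2⟩
    · exact absurd hz.1 (Set.disjoint_left.1 h₂
        ⟨h.1, hzn.trans_le ((min_le_right _ _).trans (min_le_left _ _)), h.2.2⟩)
  · by_contra hcon
    rw [not_le] at hcon
    refine Set.disjoint_left.1 h₂ ⟨fun h => ?_, hzn.trans_le ((min_le_right _ _).trans
      (min_le_left _ _)), hcon, cwAng_lt _ _⟩ hz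
    have : cwAng (P.fwd t) (z - P.bdryPoint t) = 0 := by
      rw [h, sub_self, cwAng, zero_div, arg_zero, neg_zero]
      exact toIcoMod_apply_left _ _
    linarith [P.openAngle_pos t]

end SimplePolygon

end

/-! ### Piecewise straight curves and the separation of boundary arcs -/

section
open Complex Set Filter Topology

/-- The curve `γ` is straight on both sides of each parameter in `[a, b]`. -/
structure IsLocallyStraight (γ : ℝ → ℂ) (a b : ℝ) : Prop where
  right : ∀ r ∈ Ico a b, ∃ δ > 0, ∃ x : ℂ, r + δ ≤ b ∧ ∀ h ∈ Icc 0 δ, γ (r + h) = γ r + h * x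
  left : ∀ r ∈ Ioc a b, ∃ δ > 0, ∃ d : ℂ, a ≤ r - δ ∧ ∀ h ∈ Icc 0 δ, γ (r - h) = γ r + h * d

theorem segment_subset_image_of_right {γ : ℝ → ℂ} {r δ : ℝ} {x : ℂ} (hδ : 0 ≤ δ)
    (h : ∀ h ∈ Icc 0 δ, γ (r + h) = γ r + h * x) :
    segment ℝ (γ r) (γ (r + δ)) ⊆ γ '' Icc r (r + δ) := by
  rw [segment_eq_image']
  rintro _ ⟨θ, hθ, rfl⟩
  have h1 : θ * δ ≤ δ := by nlinarith [hθ.2]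
  have h2 : 0 ≤ θ * δ := mul_nonneg hθ.1 hδ
  refine ⟨r + θ * δ, ⟨by linarith, by linarith⟩, ?_⟩
  rw [h _ ⟨h2, h1⟩, h _ ⟨hδ, le_rfl⟩]
  simp only [real_smul]; push_cast; ring

theorem segment_subset_image_of_left {γ : ℝ → ℂ} {r δ : ℝ} {x : ℂ} (hδ : 0 ≤ δ)
    (h : ∀ h ∈ Icc 0 δ, γ (r - h) = γ r + h * x) :
    segment ℝ (γ r) (γ (r - δ)) ⊆ γ '' Icc (r - δ) r := by
  rw [segment_eq_image']
  rintro _ ⟨θ, hθ, rfl⟩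
  have h1 : θ * δ ≤ δ := by nlinarith [hθ.2]
  have h2 : 0 ≤ θ * δ := mul_nonneg hθ.1 hδ
  refine ⟨r - θ * δ, ⟨by linarith, by linarith⟩, ?_⟩
  rw [h _ ⟨h2, h1⟩, h _ ⟨hδ, le_rfl⟩]
  simp only [real_smul]; push_cast; ring

/-- No finite number of pieces is assumed. The supremum of the parameters reachable by a polygonal
path is itself reached, along the straight arrival, and before `t` it could be surpassed, along the
straight departure. -/
theorem IsLocallyStraight.polyJoined {γ : ℝ → ℂ} {a b : ℝ} (h : IsLocallyStraight γ a b) {s t : ℝ}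
    (has : a ≤ s) (hst : s ≤ t) (htb : t ≤ b) : PolyJoined (γ '' Icc s t) (γ s) (γ t) := by
  set A : Set ℝ := {u | u ∈ Icc s t ∧ PolyJoined (γ '' Icc s t) (γ s) (γ u)} with hA
  have hsA : s ∈ A := ⟨⟨le_rfl, hst⟩, Relation.ReflTransGen.refl⟩
  have hbdd : BddAbove A := ⟨t, fun u hu => hu.1.2⟩
  set c := sSup A
  have hsc : s ≤ c := le_csSup hbdd hsA
  have hct : c ≤ t := csSup_le ⟨s, hsA⟩ fun u hu => hu.1.2
  have hcA : c ∈ A := by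
    rcases hsc.eq_or_lt with he | hlt
    · rw [← he]; exact hsA
    obtain ⟨δ, hδ, d, -, hd⟩ := h.left c ⟨has.trans_lt hlt, hct.trans htb⟩
    obtain ⟨u, hu, huc⟩ := exists_lt_of_lt_csSup ⟨s, hsA⟩ (show c - δ < c by linarith)
    have huc' : u ≤ c := le_csSup hbdd hu
    refine ⟨⟨hsc, hct⟩, hu.2.trans (PolyJoined.of_segment ?_).symm⟩
    have := segment_subset_image_of_left (γ := γ) (r := c) (δ := c - u) (x := d) (by linarith)
      (fun h hh => hd h ⟨hh.1, by linarith [hh.2]⟩)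
    rw [sub_sub_cancel] at this
    exact this.trans (image_mono (Icc_subset_Icc hu.1.1 hct))
  rcases hct.eq_or_lt with he | hlt
  · rw [← he]; exact he ▸ hcA.2
  exfalso
  obtain ⟨δ, hδ, x, -, hx⟩ := h.right c ⟨has.trans hsc, hlt.trans_le htb⟩
  have hm : 0 < min δ (t - c) := lt_min hδ (by linarith)
  have hle : c + min δ (t - c) ≤ t := by linarith [min_le_right δ (t - c)]
  have : c + min δ (t - c) ∈ A := by
    refine ⟨⟨by linarith, hle⟩, hcA.2.trans (PolyJoined.of_segment ?_)⟩
    exact (segment_subset_image_of_right (x := x) hm.le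
      (fun h hh => hx h ⟨hh.1, hh.2.trans (min_le_left _ _)⟩)).trans
      (image_mono (Icc_subset_Icc hsc hle))
  linarith [le_csSup hbdd this]

/-- At the corner the limits of the winding function on the two sides differ by 2π, so they cannot
both be 0: vanishing arbitrarily close to `v` on one side excludes vanishing near `v` on the other.
-/
theorem IsCornerLoop.exists_side {L : Set ℂ} {v p q : ℂ} (h : IsCornerLoop L v p q) :
    ∃ N : ℂ → ℝ, (∀ z ∉ L, ContinuousAt N z) ∧ (∀ z ∉ L, (N z : Real.Angle) = 0) ∧
      (∀ z c, (∀ w ∈ L, 0 < (c * (w - z)).re) → N z = 0) ∧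
      ∀ z₁ z₂ : ℂ, z₁ ≠ 0 → z₂ ≠ 0 → cwAng q p < cwAng q z₁ → 0 < cwAng q z₂ →
        cwAng q z₂ < cwAng q p →
        ((∃ᶠ r : ℝ in 𝓝[>] 0, N (v + r * z₁) = 0) → ∀ᶠ r : ℝ in 𝓝[>] 0, N (v + r * z₂) ≠ 0) ∧
        ((∃ᶠ r : ℝ in 𝓝[>] 0, N (v + r * z₂) = 0) → ∀ᶠ r : ℝ in 𝓝[>] 0, N (v + r * z₁) ≠ 0) := by
  obtain ⟨N, K, h1, h2, h3, h4⟩ := h.exists_winding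
  refine ⟨N, h1, h2, h3, fun z₁ z₂ hz₁ hz₂ ha hb hc => ?_⟩
  obtain ⟨a1, a2, a3⟩ := cornerAngle_of_lt h.left_ne h.right_ne hz₁ ha
  obtain ⟨b1, b2, b3⟩ := cornerAngle_of_gt h.left_ne h.right_ne hz₂ hb hc
  have l1 := h4 z₁ a1 a2
  have l2 := h4 z₂ b1 b2
  rw [a3] at l1
  rw [b3] at l2
  have hpi := Real.pi_pos
  constructor
  · intro hz
    have : K + cwAng q p = 0 := by
      by_contra hne
      obtain ⟨r, hr1, hr2⟩ := (hz.and_eventually (l1.eventually_ne hne)).exists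
      exact hr2 hr1
    exact l2.eventually_ne (by intro h; linarith)
  · intro hz
    have : K + (cwAng q p - 2 * Real.pi) = 0 := by
      by_contra hne
      obtain ⟨r, hr1, hr2⟩ := (hz.and_eventually (l2.eventually_ne hne)).exists
      exact hr2 hr1
    exact l1.eventually_ne (by intro h; linarith)

namespace SimplePolygon
variable {n : ℕ} [NeZero n] (P : SimplePolygon n)

theorem isLocallyStraight_bdryPoint (a b : ℝ) : IsLocallyStraight P.bdryPoint a b := by
  constructor
  · intro r hr
    obtain ⟨δ, hδ, -, hf, -⟩ := P.exists_straight r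
    exact ⟨min δ (b - r), lt_min hδ (by linarith [hr.2]), P.fwd r,
      by linarith [min_le_right δ (b - r)], fun h hh => hf h ⟨hh.1, hh.2.trans (min_le_left _ _)⟩⟩
  · intro r hr
    obtain ⟨δ, hδ, -, -, hf⟩ := P.exists_straight r
    exact ⟨min δ (r - a), lt_min hδ (by linarith [hr.1]), P.bwd r,
      by linarith [min_le_right δ (r - a)], fun h hh => hf h ⟨hh.1, hh.2.trans (min_le_left _ _)⟩⟩

/-- The interior of the region. -/
def inner : Set ℂ := P.region \ P.boundary

theorem isOpen_inner : IsOpen P.inner := by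
  rw [Metric.isOpen_iff]
  intro x hx
  obtain ⟨ε, hε, hb⟩ := Metric.isOpen_iff.1 P.isClosed_boundary.isOpen_compl x hx.2
  exact ⟨ε, hε, fun y hy => ⟨P.subset_region_of_isPreconnected (convex_ball x ε).isPreconnected
    (Set.disjoint_left.2 hb) (Metric.mem_ball_self hε) hx.1 hy, hb hy⟩⟩

/-- Directions from a boundary point into the interior. -/
theorem eventually_mem_inner {t : ℝ} {z : ℂ} (hz : z ≠ 0) (h0 : 0 < cwAng (P.fwd t) z)
    (h1 : cwAng (P.fwd t) z < P.openAngle t) :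
    ∀ᶠ r : ℝ in 𝓝[>] 0, P.bdryPoint t + r * z ∈ P.inner := by
  obtain ⟨ρ, hρ, hr, -⟩ := P.exists_local_region t
  filter_upwards [Ioo_mem_nhdsGT (div_pos hρ (norm_pos_iff.2 hz))] with r hr'
  refine hr (mem_sector_add ?_ ?_ ?_ ?_)
  · simp [hz, hr'.1.ne']
  · rw [norm_mul, Complex.norm_real, Real.norm_of_nonneg hr'.1.le]
    exact (lt_div_iff₀ (norm_pos_iff.2 hz)).1 hr'.2
  · rwa [cwAng_smul (P.fwd_ne_zero t) hz hr'.1]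
  · rwa [cwAng_smul (P.fwd_ne_zero t) hz hr'.1]

theorem eventually_notMem_region {t : ℝ} {z : ℂ} (hz : z ≠ 0)
    (h1 : P.openAngle t < cwAng (P.fwd t) z) :
    ∀ᶠ r : ℝ in 𝓝[>] 0, P.bdryPoint t + r * z ∉ P.region := by
  obtain ⟨ρ, hρ, -, hl, -⟩ := P.exists_local_region t
  filter_upwards [Ioo_mem_nhdsGT (div_pos hρ (norm_pos_iff.2 hz))] with r hr'
  refine Set.disjoint_left.1 hl (mem_sector_add ?_ ?_ ?_ (cwAng_lt _ _))
  · simp [hz, hr'.1.ne']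
  · rw [norm_mul, Complex.norm_real, Real.norm_of_nonneg hr'.1.le]
    exact (lt_div_iff₀ (norm_pos_iff.2 hz)).1 hr'.2
  · rwa [cwAng_smul (P.fwd_ne_zero t) hz hr'.1]

theorem exists_cwAng_eq {q : ℂ} (hq : q ≠ 0) {α : ℝ} (h0 : 0 ≤ α) (h1 : α < 2 * Real.pi) :
    ∃ z : ℂ, z ≠ 0 ∧ cwAng q z = α := by
  refine ⟨(1 : ℝ) * exp (-(α * I)) * q, by simp [hq], cwAng_eq hq one_pos h0 h1⟩

theorem tendsto_add_mul (v z : ℂ) : Tendsto (fun r : ℝ => v + r * z) (𝓝[>] 0) (𝓝 v) := by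
  have : Continuous fun r : ℝ => v + r * z := by fun_prop
  exact Tendsto.mono_left (by simpa using this.tendsto 0) nhdsWithin_le_nhds

theorem mem_closure_inner {z : ℂ} (hz : z ∈ P.region) : (𝓝[P.inner] z).NeBot := by
  rw [← mem_closure_iff_nhdsWithin_neBot]
  by_cases hb : z ∈ P.boundary
  · obtain ⟨t, -, rfl⟩ := P.exists_param hb 0
    have := P.openAngle_pos t
    obtain ⟨w, hw, hwa⟩ := exists_cwAng_eq (P.fwd_ne_zero t) (α := P.openAngle t / 2)
      (by linarith) (by linarith [P.openAngle_lt t])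
    exact mem_closure_of_tendsto (tendsto_add_mul _ w)
      (P.eventually_mem_inner hw (by rw [hwa]; linarith) (by rw [hwa]; linarith))
  · exact subset_closure ⟨hz, hb⟩

theorem frequently_notMem_region (t : ℝ) : ∃ᶠ w in 𝓝 (P.bdryPoint t), w ∉ P.region := by
  have h1 := P.openAngle_pos t
  have h2 := P.openAngle_lt t
  obtain ⟨w, hw, hwa⟩ := exists_cwAng_eq (P.fwd_ne_zero t)
    (α := (P.openAngle t + 2 * Real.pi) / 2) (by linarith) (by linarith)
  exact (tendsto_add_mul _ w).frequently
    (P.eventually_notMem_region hw (by rw [hwa]; linarith)).frequently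

theorem winding_eventually_eq {L : Set ℂ} {N : ℂ → ℝ} (hLc : IsClosed L)
    (hc : ∀ z ∉ L, ContinuousAt N z) (hN : ∀ z ∉ L, (N z : Real.Angle) = 0) {z : ℂ} (hz : z ∉ L) :
    ∀ᶠ w in 𝓝 z, N w = N z := by
  obtain ⟨ε, hε, hb⟩ := Metric.isOpen_iff.1 hLc.isOpen_compl z hz
  filter_upwards [Metric.ball_mem_nhds z hε] with w hw
  exact winding_const_of_isPreconnected hc hN (convex_ball z ε).isPreconnected
    (Set.disjoint_left.2 hb) hw (Metric.mem_ball_self hε)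

/-- A winding function of a loop which consists of boundary points and of `S`, is constant on the
interior near each point off `S`. -/
theorem exists_eventually_eq {S L : Set ℂ} (hS : IsClosed S) (hLS : L ⊆ P.boundary ∪ S)
    {N : ℂ → ℝ} (hc : ∀ z ∉ L, ContinuousAt N z) (hN : ∀ z ∉ L, (N z : Real.Angle) = 0) {z : ℂ}
    (hz : z ∈ P.region) (hzS : z ∉ S) : ∃ c, ∀ᶠ w in 𝓝[P.inner] z, N w = c := by
  obtain ⟨ε, hε, hb⟩ := Metric.isOpen_iff.1 hS.isOpen_compl z hzS
  by_cases hzb : z ∈ P.boundary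
  · obtain ⟨t, -, rfl⟩ := P.exists_param hzb 0
    obtain ⟨ρ, hρ, hr, -, hcov, -⟩ := P.exists_local_region t
    have hd : Disjoint (P.rightSector t (min ρ ε)) L := by
      refine Set.disjoint_left.2 fun w hw hwL => ?_
      rcases hLS hwL with h | h
      · exact (hr (sector_mono (min_le_left _ _) hw)).2 h
      · exact hb (mem_ball_iff_norm.2 (hw.2.1.trans_le (min_le_right _ _))) h
    have hcov' : ∀ w ∈ P.inner, ‖w - P.bdryPoint t‖ < min ρ ε → w ∈ P.rightSector t (min ρ ε) :=
      fun w hw hwn => by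
        have := hcov w hw (hwn.trans_le (min_le_left _ _))
        exact ⟨this.1, hwn, this.2.2⟩
    have hball : Metric.ball (P.bdryPoint t) (min ρ ε) ∈ 𝓝 (P.bdryPoint t) :=
      Metric.ball_mem_nhds _ (lt_min hρ hε)
    have := P.mem_closure_inner hz
    obtain ⟨w₀, hw₀b, hw₀⟩ := (inter_mem (mem_nhdsWithin_of_mem_nhds hball)
      (self_mem_nhdsWithin (s := P.inner)) |> this.nonempty_of_mem)
    refine ⟨N w₀, ?_⟩
    filter_upwards [mem_nhdsWithin_of_mem_nhds hball, self_mem_nhdsWithin] with w hwb hw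
    exact winding_const_of_isPreconnected hc hN (P.isPreconnected_rightSector t _) hd
      (hcov' w hw (mem_ball_iff_norm.1 hwb)) (hcov' w₀ hw₀ (mem_ball_iff_norm.1 hw₀b))
  · obtain ⟨ε', hε', hb'⟩ := Metric.isOpen_iff.1 P.isOpen_inner z ⟨hz, hzb⟩
    refine ⟨N z, ?_⟩
    filter_upwards [mem_nhdsWithin_of_mem_nhds (Metric.ball_mem_nhds z (lt_min hε hε'))] with w hw
    refine winding_const_of_isPreconnected hc hN (convex_ball z (min ε ε')).isPreconnected
      (Set.disjoint_left.2 fun y hy hyL => ?_) hw (Metric.mem_ball_self (lt_min hε hε'))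
    rcases hLS hyL with h | h
    · exact (hb' (Metric.ball_subset_ball (min_le_right _ _) hy)).2 h
    · exact hb (Metric.ball_subset_ball (min_le_left _ _) hy) h

/-- Let `N` be a winding function of a loop in the region which consists of the boundary part
from `s` to `t` and of `S`.  Then `N` vanishes on the side of `S` of the other boundary part. -/
theorem side_eq_zero {S L : Set ℂ} (hS : IsClosed S) (hLR : L ⊆ P.region) {s t : ℝ}
    (hLS : L = P.bdryPoint '' Icc s t ∪ S)
    {N : ℂ → ℝ} (hc : ∀ z ∉ L, ContinuousAt N z) (hN : ∀ z ∉ L, (N z : Real.Angle) = 0)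
    (h0 : ∀ z c, (∀ w ∈ L, 0 < (c * (w - z)).re) → N z = 0)
    {C : Set ℂ} (hC : IsPreconnected C) (hCR : C ⊆ P.region) (hCS : Disjoint C S)
    {t₂ : ℝ} (ht : t₂ ∈ Ioo t (s + n)) (htC : P.bdryPoint t₂ ∈ C) {z : ℂ} (hz : z ∈ C) :
    ∀ᶠ w in 𝓝[P.inner] z, N w = 0 := by
  have hLc : IsClosed L := by
    rw [hLS]; exact (isCompact_Icc.image P.continuous_bdryPoint).isClosed.union hS
  have hLS' : L ⊆ P.boundary ∪ S := by
    rw [hLS]; refine union_subset_union_left _ ?_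
    rintro _ ⟨u, -, rfl⟩; exact P.bdryPoint_mem u
  -- Points outside the region accumulate at the boundary point; `N` is 0 there and locally constant
  -- off the loop.
  have hstart : ∀ᶠ w in 𝓝[P.inner] (P.bdryPoint t₂), N w = 0 := by
    have hnL : P.bdryPoint t₂ ∉ L := by
      rw [hLS]
      rintro (⟨u, hu, he⟩ | h)
      · have := P.bdryPoint_inj he (by linarith [hu.2, ht.1, natCast_pos (n := n)])
          (by linarith [hu.1, ht.2])
        linarith [hu.2, ht.1]
      · exact Set.disjoint_left.1 hCS htC h
    have hev := winding_eventually_eq hLc hc hN hnL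
    obtain ⟨w, hw, hwR⟩ := ((P.frequently_notMem_region t₂).and_eventually hev).exists
    rw [P.winding_eq_zero hLR hc hN h0 hw] at hwR
    rw [← hwR] at hev
    exact hev.filter_mono nhdsWithin_le_nhds
  have hopen : ∀ p : ℂ → Prop, IsOpen {z | ∀ᶠ w in 𝓝[P.inner] z, p w} := by
    intro p
    simp only [eventually_nhdsWithin_iff]
    exact isOpen_setOfPred_eventually_nhds
  -- Whether `N` is zero or nonzero on the interior near a point are two open conditions. They cover
  -- `C`, are disjoint on it, and `C` is preconnected.
  have := isPreconnected_iff_subset_of_disjoint.1 hC {z | ∀ᶠ w in 𝓝[P.inner] z, N w = 0}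
    {z | ∀ᶠ w in 𝓝[P.inner] z, N w ≠ 0} (hopen _) (hopen _) (fun y hy => ?_) ?_
  · rcases this with h | h
    · exact h hz
    · have hneb := P.mem_closure_inner (hCR htC)
      have h' : ∀ᶠ w in 𝓝[P.inner] (P.bdryPoint t₂), N w ≠ 0 := h htC
      obtain ⟨w, hw1, hw2⟩ := (hstart.and h').exists
      exact absurd hw1 hw2
  · obtain ⟨c, hcc⟩ := P.exists_eventually_eq hS hLS' hc hN (hCR hy) (Set.disjoint_left.1 hCS hy)
    by_cases hc0 : c = 0
    · left; rw [hc0] at hcc; exact hcc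
    · right; exact hcc.mono fun w hw => by rw [hw]; exact hc0
  · refine eq_empty_of_forall_notMem ?_
    rintro y ⟨hy, h1, h2⟩
    have hneb := P.mem_closure_inner (hCR hy)
    have h1' : ∀ᶠ w in 𝓝[P.inner] y, N w = 0 := h1
    have h2' : ∀ᶠ w in 𝓝[P.inner] y, N w ≠ 0 := h2
    obtain ⟨w, hw1, hw2⟩ := (h1'.and h2').exists
    exact hw2 hw1

/-- A polygonal path in the region between two boundary points separates the two parts of the
boundary. -/
theorem separation {S : Set ℂ} (hSR : S ⊆ P.region) (hSc : IsClosed S) {s t : ℝ}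
    (htn : t < s + n) (hS : PolyJoined S (P.bdryPoint t) (P.bdryPoint s))
    {C : Set ℂ} (hC : IsPreconnected C) (hCR : C ⊆ P.region) (hCS : Disjoint C S) {t₁ t₂ : ℝ}
    (h₁ : t₁ ∈ Ioo s t) (h₂ : t₂ ∈ Ioo t (s + n)) (m₁ : P.bdryPoint t₁ ∈ C)
    (m₂ : P.bdryPoint t₂ ∈ C) : False := by
  have hn : (0 : ℝ) < n := natCast_pos
  obtain ⟨δ₀, hδ₀, -, hf₀, hb₀⟩ := P.exists_straight t₁
  obtain ⟨δ, hδ, hδ'⟩ := exists_between (lt_min hδ₀ (lt_min (sub_pos.2 h₁.1) (sub_pos.2 h₁.2)))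
  have hδ0 := hδ'.trans_le (min_le_left _ _)
  have hδs := hδ'.trans_le ((min_le_right _ _).trans (min_le_left _ _))
  have hδt := hδ'.trans_le ((min_le_right _ _).trans (min_le_right _ _))
  have hf0 := P.fwd_ne_zero t₁
  have hb0 := P.bwd_ne_zero t₁
  have hδc : (δ : ℂ) ≠ 0 := by exact_mod_cast hδ.ne'
  have hLR : P.bdryPoint '' Icc s t ∪ S ⊆ P.region := by
    refine union_subset ?_ hSR
    rintro _ ⟨u, -, rfl⟩; exact P.boundary_subset_region (P.bdryPoint_mem u)
  have ef := hf₀ δ ⟨hδ.le, hδ0.le⟩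
  have eb := hb₀ δ ⟨hδ.le, hδ0.le⟩
  -- The boundary arc from `s` to `t` is closed up by `S`, with `t₁` as the corner, so that the two
  -- sides at `t₁` are the region and its outside.
  have hloop : IsCornerLoop (P.bdryPoint '' Icc s t ∪ S) (P.bdryPoint t₁) (δ * P.bwd t₁)
      (δ * P.fwd t₁) := by
    refine ⟨mul_ne_zero hδc hb0, mul_ne_zero hδc hf0, ?_, ?_,
      P.bdryPoint '' Icc s (t₁ - δ) ∪ S ∪ P.bdryPoint '' Icc (t₁ + δ) t, ?_, ?_, ?_, ?_⟩
    · rw [← eb]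
      refine (segment_subset_image_of_left hδ.le fun h hh =>
        hb₀ h ⟨hh.1, hh.2.trans hδ0.le⟩).trans (subset_union_of_subset_left (image_mono ?_) _)
      exact Icc_subset_Icc (by linarith) h₁.2.le
    · rw [← ef]
      refine (segment_subset_image_of_right hδ.le fun h hh =>
        hf₀ h ⟨hh.1, hh.2.trans hδ0.le⟩).trans (subset_union_of_subset_left (image_mono ?_) _)
      exact Icc_subset_Icc h₁.1.le (by linarith)
    · exact ((isCompact_Icc.image P.continuous_bdryPoint).isClosed.union hSc).union
        (isCompact_Icc.image P.continuous_bdryPoint).isClosed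
    · rintro ((⟨u, hu, he⟩ | h) | ⟨u, hu, he⟩)
      · have := P.bdryPoint_inj he (by linarith [hu.2]) (by linarith [hu.1, h₁.2])
        linarith [hu.2]
      · exact Set.disjoint_left.1 hCS m₁ h
      · have := P.bdryPoint_inj he (by linarith [hu.2, h₁.1]) (by linarith [hu.1])
        linarith [hu.1]
    · refine union_subset (union_subset_union_left _ (image_mono ?_))
        (subset_union_of_subset_left (image_mono ?_) _)
      · exact Icc_subset_Icc le_rfl (by linarith [h₁.2])
      · exact Icc_subset_Icc (by linarith [h₁.1]) le_rfl
    · rw [← ef, ← eb]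
      refine (PolyJoined.mono subset_union_right
        ((P.isLocallyStraight_bdryPoint (t₁ + δ) t).polyJoined le_rfl (by linarith) le_rfl)).trans
        (PolyJoined.trans (PolyJoined.mono ?_ hS) (PolyJoined.mono ?_
          ((P.isLocallyStraight_bdryPoint s (t₁ - δ)).polyJoined le_rfl (by linarith) le_rfl)))
      · exact subset_union_of_subset_left subset_union_right _
      · exact subset_union_of_subset_left subset_union_left _
  obtain ⟨N, hc, hN, h0, hside⟩ := hloop.exists_side
  -- `C` connects `t₁` to the complementary arc without meeting `S`, so `N` vanishes on the inner
  -- side of `t₁`. It also vanishes on the outer side, which contradicts the jump.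
  have hzero := P.side_eq_zero hSc hLR rfl hc hN h0 hC hCR hCS h₂ m₂ m₁
  have hω0 := P.openAngle_pos t₁
  have hω1 := P.openAngle_lt t₁
  obtain ⟨z₁, hz₁, ha₁⟩ := exists_cwAng_eq hf0
    (α := (P.openAngle t₁ + 2 * Real.pi) / 2) (by linarith) (by linarith)
  obtain ⟨z₂, hz₂, ha₂⟩ := exists_cwAng_eq hf0 (α := P.openAngle t₁ / 2)
    (by linarith) (by linarith)
  have hscale : ∀ z : ℂ, cwAng (δ * P.fwd t₁) z = cwAng (P.fwd t₁) z := by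
    intro z
    rw [cwAng, cwAng]
    congr 2
    rw [show z / (δ * P.fwd t₁) = z / P.fwd t₁ * ((δ⁻¹ : ℝ) : ℂ) by push_cast; field_simp,
      arg_mul_real (inv_pos.2 hδ)]
  have hp : cwAng (δ * P.fwd t₁) (δ * P.bwd t₁) = P.openAngle t₁ := by
    rw [hscale, cwAng_smul hf0 hb0 hδ]; rfl
  have hout : ∀ᶠ r : ℝ in 𝓝[>] 0, N (P.bdryPoint t₁ + r * z₁) = 0 :=
    (P.eventually_notMem_region hz₁ (by rw [ha₁]; linarith)).mono fun r hr =>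
      P.winding_eq_zero hLR hc hN h0 hr
  have hin := (hside z₁ z₂ hz₁ hz₂ (by rw [hp, hscale, ha₁]; linarith)
    (by rw [hscale, ha₂]; linarith) (by rw [hp, hscale, ha₂]; linarith)).1 hout.frequently
  have hmem := P.eventually_mem_inner hz₂ (by rw [ha₂]; linarith) (by rw [ha₂]; linarith)
  have htend : Tendsto (fun r : ℝ => P.bdryPoint t₁ + r * z₂) (𝓝[>] 0)
      (𝓝[P.inner] (P.bdryPoint t₁)) :=
    tendsto_nhdsWithin_iff.2 ⟨tendsto_add_mul _ _, hmem⟩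
  obtain ⟨r, hr1, hr2⟩ := ((htend.eventually hzero).and hin).exists
  exact hr2 hr1

end SimplePolygon

end

/-! ### Taut curves and the absence of bigons -/

section
open Complex Set Filter Topology

namespace SimplePolygon
variable {n : ℕ} [NeZero n] (P : SimplePolygon n)

/-- A corner of a loop in the region which is extreme for a linear functional spans a cone that
belongs to the region near the corner. -/
theorem exists_cone_subset {L : Set ℂ} {v p q c : ℂ} (hL : IsCornerLoop L v p q)
    (hLR : L ⊆ P.region) (hpq : (q / p).im ≠ 0) (hc : ∀ w ∈ L, (c * (w - v)).re ≤ 0)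
    (hp : (c * p).re < 0) :
    ∃ ε > 0, ∀ α β : ℝ, 0 ≤ α → 0 ≤ β → α ≤ ε → β ≤ ε → v + (α * p + β * q) ∈ P.region := by
  obtain ⟨N, K, hNc, hN, h0, hlim⟩ := hL.exists_winding
  have hvL : v ∈ L := hL.left_subset (left_mem_segment _ _ _)
  have hq : (c * q).re ≤ 0 := by
    simpa using hc _ (hL.right_subset (right_mem_segment _ _ _))
  have hc0 : c ≠ 0 := by rintro rfl; simp at hp
  -- Beyond the extreme corner the loop is seen within a half-plane, so `N` is 0 there. By the jump
  -- it is nonzero just inside the cone, which therefore belongs to the region; the conical shape of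
  -- the region then gives a fixed size.
  have hzero : ∀ r : ℝ, 0 < r → N (v + r * starRingEnd ℂ c) = 0 := by
    intro r hr
    refine h0 _ (-c) fun w hw => ?_
    have h1 := hc w hw
    have h2 : (-c * (w - (v + r * starRingEnd ℂ c))).re = -(c * (w - v)).re + r * normSq c := by
      rw [show -c * (w - (v + r * starRingEnd ℂ c)) = -(c * (w - v)) + r * (c * starRingEnd ℂ c) by
        ring, mul_conj, add_re, neg_re, ← ofReal_mul, ofReal_re]
    have := mul_pos hr (normSq_pos.2 hc0)
    linarith
  obtain ⟨ρ, hρ, hcon⟩ := P.exists_conic v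
  have hpos : 0 < ‖p‖ + ‖q‖ := by
    have := norm_pos_iff.2 hL.left_ne
    positivity
  refine ⟨min 1 (ρ / 2 / (‖p‖ + ‖q‖)), lt_min one_pos (by positivity), ?_⟩
  intro α β hα hβ hα1 hβ1
  have hα2 := hα1.trans (min_le_left _ _)
  have hβ2 := hβ1.trans (min_le_left _ _)
  rcases hα.eq_or_lt with rfl | hα'
  · refine hLR (hL.right_subset ?_)
    rw [segment_eq_image']
    exact ⟨β, ⟨hβ, hβ2⟩, by simp⟩
  rcases hβ.eq_or_lt with rfl | hβ'
  · refine hLR (hL.left_subset ?_)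
    rw [segment_eq_image']
    exact ⟨α, ⟨hα, hα2⟩, by simp⟩
  obtain ⟨⟨a1, a2⟩, ⟨b1, b2⟩, hne⟩ := cornerAngle_ne hpq hp hq hα' hβ'
  have hK : K + cornerAngle p q (starRingEnd ℂ c) = 0 := by
    refine tendsto_nhds_unique (hlim _ a1 a2) (tendsto_const_nhds.congr' ?_)
    filter_upwards [self_mem_nhdsWithin] with r hr
    exact (hzero r hr).symm
  have hev := (hlim _ b1 b2).eventually_ne
    (show K + cornerAngle p q (α * p + β * q) ≠ 0 from fun h => hne (by linarith))
  obtain ⟨r, hr, hr1⟩ := (hev.and (Ioo_mem_nhdsGT one_pos)).exists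
  refine (hcon _ ?_ r hr1.1 hr1.2.le).1 ?_
  · have h1 : ‖(α : ℂ) * p + β * q‖ ≤ α * ‖p‖ + β * ‖q‖ := by
      refine (norm_add_le _ _).trans_eq ?_
      rw [norm_mul, norm_mul, norm_real, norm_real, Real.norm_of_nonneg hα, Real.norm_of_nonneg hβ]
    have h2 : α * ‖p‖ + β * ‖q‖ ≤ ρ / 2 / (‖p‖ + ‖q‖) * (‖p‖ + ‖q‖) := by
      have := hα1.trans (min_le_right _ _)
      have := hβ1.trans (min_le_right _ _)
      rw [mul_add]
      gcongr
    rw [div_mul_cancel₀ _ hpos.ne'] at h2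
    linarith
  · by_contra hR
    exact hr (P.winding_eq_zero hLR hNc hN h0 hR)

/-- A simple curve in the region with straight pieces and unit speed that cannot be shortened
locally. -/
structure IsTautOn (γ : ℝ → ℂ) (a b : ℝ) : Prop where
  mapsTo : MapsTo γ (Icc a b) P.region
  continuousOn : ContinuousOn γ (Icc a b)
  injOn : InjOn γ (Icc a b)
  right : ∀ r ∈ Ico a b, ∃ δ > 0, ∃ x : ℂ, ‖x‖ = 1 ∧ r + δ ≤ b ∧
    ∀ h ∈ Icc 0 δ, γ (r + h) = γ r + h * x
  left : ∀ r ∈ Ioc a b, ∃ δ > 0, ∃ d : ℂ, ‖d‖ = 1 ∧ a ≤ r - δ ∧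
    ∀ h ∈ Icc 0 δ, γ (r - h) = γ r + h * d
  bend : ∀ r δ : ℝ, ∀ d x : ℂ, 0 < δ → a ≤ r - δ → r + δ ≤ b → ‖d‖ = 1 → ‖x‖ = 1 →
    (∀ h ∈ Icc 0 δ, γ (r + h) = γ r + h * x) → (∀ h ∈ Icc 0 δ, γ (r - h) = γ r + h * d) →
    (∀ h ∈ Ioc 0 δ, segment ℝ (γ (r - h)) (γ (r + h)) ⊆ P.region) → x = -d

variable {P}

theorem IsTautOn.isLocallyStraight {γ : ℝ → ℂ} {a b : ℝ} (h : P.IsTautOn γ a b) :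
    IsLocallyStraight γ a b where
  right r hr := by
    obtain ⟨δ, hδ, x, -, h1, h2⟩ := h.right r hr
    exact ⟨δ, hδ, x, h1, h2⟩
  left r hr := by
    obtain ⟨δ, hδ, x, -, h1, h2⟩ := h.left r hr
    exact ⟨δ, hδ, x, h1, h2⟩

theorem IsTautOn.mono {γ : ℝ → ℂ} {a b a' b' : ℝ} (h : P.IsTautOn γ a b) (ha : a ≤ a')
    (hb : b' ≤ b) : P.IsTautOn γ a' b' where
  mapsTo := h.mapsTo.mono_left (Icc_subset_Icc ha hb)
  continuousOn := h.continuousOn.mono (Icc_subset_Icc ha hb)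
  injOn := h.injOn.mono (Icc_subset_Icc ha hb)
  right r hr := by
    obtain ⟨δ, hδ, x, hx, -, h2⟩ := h.right r ⟨ha.trans hr.1, hr.2.trans_le hb⟩
    exact ⟨min δ (b' - r), lt_min hδ (sub_pos.2 hr.2), x, hx,
      by linarith [min_le_right δ (b' - r)], fun h hh => h2 h ⟨hh.1, hh.2.trans (min_le_left _ _)⟩⟩
  left r hr := by
    obtain ⟨δ, hδ, x, hx, -, h2⟩ := h.left r ⟨ha.trans_lt hr.1, hr.2.trans hb⟩
    exact ⟨min δ (r - a'), lt_min hδ (sub_pos.2 hr.1), x, hx,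
      by linarith [min_le_right δ (r - a')], fun h hh => h2 h ⟨hh.1, hh.2.trans (min_le_left _ _)⟩⟩
  bend r δ d x hδ h1 h2 := h.bend r δ d x hδ (ha.trans h1) (h2.trans hb)

theorem eq_or_eq_neg_of_im_div_eq_zero {d x : ℂ} (hd : ‖d‖ = 1) (hx : ‖x‖ = 1)
    (h : (x / d).im = 0) : x = d ∨ x = -d := by
  have hd0 : d ≠ 0 := by rintro rfl; simp at hd
  have h1 : x = ((x / d).re : ℂ) * d := by
    have : ((x / d).re : ℂ) = x / d := Complex.ext (by simp) (by simp [h])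
    rw [this, div_mul_cancel₀ _ hd0]
  have h2 : |(x / d).re| = 1 := by
    have := congrArg norm h1
    rwa [norm_mul, hd, hx, norm_real, mul_one, Real.norm_eq_abs, eq_comm] at this
  rcases (abs_eq zero_le_one).1 h2 with h3 | h3
  · left; rw [h1, h3]; simp
  · right; rw [h1, h3]; simp

/-- A taut curve which together with `S` forms a simple loop has no inner point that is extreme
for a linear functional. -/
theorem IsTautOn.re_lt {γ : ℝ → ℂ} {a b : ℝ} (h : P.IsTautOn γ a b) {S : Set ℂ} (hS : IsClosed S)
    (hSR : S ⊆ P.region) (hj : PolyJoined S (γ b) (γ a)) (hd : ∀ r ∈ Ioo a b, γ r ∉ S) {c : ℂ}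
    {M : ℝ} (hSM : ∀ w ∈ S, (c * w).re ≤ M) (hM : ∀ r ∈ Icc a b, (c * γ r).re ≤ M)
    (ha : (c * γ a).re < M) (hb : (c * γ b).re < M) : ∀ r ∈ Icc a b, (c * γ r).re < M := by
  by_contra! hex
  have hcont : ContinuousOn (fun r => (c * γ r).re) (Icc a b) :=
    continuous_re.comp_continuousOn (continuousOn_const.mul h.continuousOn)
  have hcomp : IsCompact (Icc a b ∩ (fun r => (c * γ r).re) ⁻¹' Ici M) :=
    isCompact_Icc.of_isClosed_subset (hcont.preimage_isClosed_of_isClosed isClosed_Icc isClosed_Ici)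
      inter_subset_left
  obtain ⟨r₀, hr₀, hr₀M⟩ := hex
  -- Taking the first parameter that attains the maximum makes the functional strictly smaller just
  -- before it.
  obtain ⟨r, ⟨hr, hrM⟩, hmin⟩ := hcomp.exists_isLeast ⟨r₀, hr₀, hr₀M⟩
  have hrM' : (c * γ r).re = M := le_antisymm (hM r hr) hrM
  have hra : a < r := hr.1.lt_of_ne (by rintro rfl; linarith)
  have hrb : r < b := hr.2.lt_of_ne (by rintro rfl; linarith)
  obtain ⟨δ₁, hδ₁, x, hx, hle₁, hγ₁⟩ := h.right r ⟨hr.1, hrb⟩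
  obtain ⟨δ₂, hδ₂, d, hdn, hle₂, hγ₂⟩ := h.left r ⟨hra, hr.2⟩
  obtain ⟨δ, hδ, h1, h2⟩ : ∃ δ > 0, δ ≤ δ₁ ∧ δ ≤ δ₂ :=
    ⟨min δ₁ δ₂, lt_min hδ₁ hδ₂, min_le_left _ _, min_le_right _ _⟩
  replace hγ₁ : ∀ h ∈ Icc 0 δ, γ (r + h) = γ r + h * x := fun h hh => hγ₁ h ⟨hh.1, hh.2.trans h1⟩
  replace hγ₂ : ∀ h ∈ Icc 0 δ, γ (r - h) = γ r + h * d := fun h hh => hγ₂ h ⟨hh.1, hh.2.trans h2⟩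
  replace hle₁ : r + δ ≤ b := by linarith
  replace hle₂ : a ≤ r - δ := by linarith
  have ex := hγ₁ δ ⟨hδ.le, le_rfl⟩
  have ed := hγ₂ δ ⟨hδ.le, le_rfl⟩
  have hx0 : x ≠ 0 := by rintro rfl; simp at hx
  have hd0 : d ≠ 0 := by rintro rfl; simp at hdn
  have hδc : (δ : ℂ) ≠ 0 := by exact_mod_cast hδ.ne'
  have hcd : (c * (δ * d)).re < 0 := by
    have : ¬ M ≤ (c * γ (r - δ)).re := fun hc => by
      linarith [hmin ⟨⟨hle₂, by linarith⟩, hc⟩]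
    rw [ed, mul_add, add_re, hrM'] at this
    linarith
  have hcx : (c * (δ * x)).re ≤ 0 := by
    have := hM (r + δ) ⟨by linarith, hle₁⟩
    rw [ex, mul_add, add_re, hrM'] at this
    linarith
  -- Parallel directions are impossible: `x = d` violates injectivity, and `x = -d` would carry the
  -- curve beyond the maximum.
  have hdx : (x / d).im ≠ 0 := by
    intro h0
    rcases eq_or_eq_neg_of_im_div_eq_zero hdn hx h0 with rfl | rfl
    · have := h.injOn ⟨by linarith, hle₁⟩ ⟨hle₂, by linarith⟩ (ex.trans ed.symm)
      linarith
    · rw [mul_neg, mul_neg, neg_re] at hcx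
      linarith
  have hcl : ∀ s t, a ≤ s → t ≤ b → IsClosed (γ '' Icc s t) := fun s t hs ht =>
    (isCompact_Icc.image_of_continuousOn
      (h.continuousOn.mono (Icc_subset_Icc hs ht))).isClosed
  have hloop : IsCornerLoop (γ '' Icc a b ∪ S) (γ r) (δ * d) (δ * x) := by
    refine ⟨mul_ne_zero hδc hd0, mul_ne_zero hδc hx0, ?_, ?_,
      γ '' Icc a (r - δ) ∪ S ∪ γ '' Icc (r + δ) b,
      ((hcl _ _ le_rfl (by linarith)).union hS).union (hcl _ _ (by linarith) le_rfl), ?_, ?_, ?_⟩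
    · rw [← ed]
      exact (segment_subset_image_of_left hδ.le hγ₂).trans
        (subset_union_of_subset_left (image_mono (Icc_subset_Icc hle₂ hr.2)) _)
    · rw [← ex]
      exact (segment_subset_image_of_right hδ.le hγ₁).trans
        (subset_union_of_subset_left (image_mono (Icc_subset_Icc hr.1 hle₁)) _)
    · rintro ((⟨u, hu, he⟩ | h') | ⟨u, hu, he⟩)
      · have := h.injOn ⟨hu.1, by linarith [hu.2]⟩ hr he
        linarith [hu.2]
      · exact hd r ⟨hra, hrb⟩ h'
      · have := h.injOn ⟨by linarith [hu.1], hu.2⟩ hr he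
        linarith [hu.1]
    · exact union_subset (union_subset_union_left _ (image_mono (Icc_subset_Icc le_rfl (by linarith))))
        (subset_union_of_subset_left (image_mono (Icc_subset_Icc (by linarith) le_rfl)) _)
    · rw [← ex, ← ed]
      refine (PolyJoined.mono subset_union_right
        (h.isLocallyStraight.polyJoined (by linarith) hle₁ le_rfl)).trans
        (PolyJoined.trans (PolyJoined.mono ?_ hj) (PolyJoined.mono ?_
          (h.isLocallyStraight.polyJoined le_rfl hle₂ (by linarith))))
      · exact subset_union_of_subset_left subset_union_right _
      · exact subset_union_of_subset_left subset_union_left _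
  have hLR : γ '' Icc a b ∪ S ⊆ P.region := union_subset (image_subset_iff.2 h.mapsTo) hSR
  obtain ⟨ε, hε, hcone⟩ := P.exists_cone_subset (c := c) hloop hLR
    (by rwa [mul_div_mul_left _ _ hδc]) (fun w hw => by
      rw [mul_sub, sub_re, hrM']
      rcases hw with ⟨u, hu, rfl⟩ | hw
      · linarith [hM u hu]
      · linarith [hSM w hw]) hcd
  obtain ⟨ε', hε', hε1, hε2⟩ : ∃ ε' > 0, ε' ≤ 1 ∧ ε' ≤ ε :=
    ⟨min 1 ε, lt_min one_pos hε, min_le_left _ _, min_le_right _ _⟩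
  have hm : ε' * δ ≤ δ := by nlinarith
  have hm0 : 0 < ε' * δ := mul_pos hε' hδ
  -- The cone at the extreme corner lies in the region, hence so do the short cuts across it, and
  -- tautness makes the corner straight. The cone is spanned by `δ * d` and `δ * x`, so arc length
  -- `k` has coordinate `k / δ`.
  have := h.bend r (ε' * δ) d x hm0 (by linarith) (by linarith) hdn hx
    (fun h hh => hγ₁ h ⟨hh.1, hh.2.trans hm⟩) (fun h hh => hγ₂ h ⟨hh.1, hh.2.trans hm⟩) (by
      intro k hk
      have hkε : k / δ ≤ ε := ((div_le_iff₀ hδ).2 hk.2).trans hε2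
      have hk0 : 0 ≤ k / δ := div_nonneg hk.1.le hδ.le
      rw [hγ₁ _ ⟨hk.1.le, hk.2.trans hm⟩, hγ₂ _ ⟨hk.1.le, hk.2.trans hm⟩, segment_eq_image]
      rintro _ ⟨θ, hθ, rfl⟩
      have := hcone ((1 - θ) * (k / δ)) (θ * (k / δ)) (mul_nonneg (by linarith [hθ.2]) hk0)
        (mul_nonneg hθ.1 hk0) ((mul_le_of_le_one_left hk0 (by linarith [hθ.1])).trans hkε)
        ((mul_le_of_le_one_left hk0 hθ.2).trans hkε)
      convert this using 1
      simp only [real_smul]; push_cast; field_simp; ring)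
  rw [this, neg_div, div_self hd0] at hdx
  simp at hdx

theorem exists_re_mul (f : StrongDual ℝ ℂ) : ∃ c : ℂ, ∀ w, f w = (c * w).re := by
  refine ⟨f 1 - f I * I, fun w => ?_⟩
  have : w = w.re • (1 : ℂ) + w.im • I := by simp
  conv_lhs => rw [this]
  rw [map_add, map_smul, map_smul]
  simp; ring

/-- Two taut curves from the same point, which together with the segment between their endpoints
form a simple loop, stay in the triangle of the corners. -/
theorem IsTautOn.mem_convexHull {γ₁ γ₂ : ℝ → ℂ} {a b₁ b₂ : ℝ} (h₁ : P.IsTautOn γ₁ a b₁)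
    (h₂ : P.IsTautOn γ₂ a b₂) (hab₁ : a ≤ b₁) (hab₂ : a ≤ b₂) (hst : γ₁ a = γ₂ a)
    (hd : ∀ r₁ ∈ Icc a b₁, ∀ r₂ ∈ Icc a b₂, γ₁ r₁ = γ₂ r₂ → r₁ = a ∨ r₁ = b₁ ∧ r₂ = b₂)
    (hseg : segment ℝ (γ₁ b₁) (γ₂ b₂) ⊆ P.region)
    (hs₁ : ∀ r ∈ Icc a b₁, γ₁ r ∈ segment ℝ (γ₁ b₁) (γ₂ b₂) → r = b₁)
    (hs₂ : ∀ r ∈ Icc a b₂, γ₂ r ∈ segment ℝ (γ₁ b₁) (γ₂ b₂) → r = b₂) :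
    (∀ r ∈ Icc a b₁, γ₁ r ∈ convexHull ℝ {γ₁ a, γ₁ b₁, γ₂ b₂}) ∧
      ∀ r ∈ Icc a b₂, γ₂ r ∈ convexHull ℝ {γ₁ a, γ₁ b₁, γ₂ b₂} := by
  set T : Set ℂ := {γ₁ a, γ₁ b₁, γ₂ b₂} with hT
  set L : Set ℂ := γ₁ '' Icc a b₁ ∪ γ₂ '' Icc a b₂ ∪ segment ℝ (γ₁ b₁) (γ₂ b₂) with hLdef
  have hTc : IsCompact (convexHull ℝ T) := (by simp [hT] : T.Finite).isCompact_convexHull ℝ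
  have hsegc : IsCompact (segment ℝ (γ₁ b₁) (γ₂ b₂)) := by
    rw [← convexHull_pair]
    exact (by simp : ({γ₁ b₁, γ₂ b₂} : Set ℂ).Finite).isCompact_convexHull ℝ
  have hLc : IsCompact L := ((isCompact_Icc.image_of_continuousOn h₁.continuousOn).union
    (isCompact_Icc.image_of_continuousOn h₂.continuousOn)).union hsegc
  suffices hmain : ∀ z ∈ L, z ∈ convexHull ℝ T from
    ⟨fun r hr => hmain _ (Or.inl (Or.inl ⟨r, hr, rfl⟩)),
      fun r hr => hmain _ (Or.inl (Or.inr ⟨r, hr, rfl⟩))⟩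
  by_contra! hex
  obtain ⟨z, hzL, hz⟩ := hex
  -- A functional separating a point of the loop from the triangle has its maximum over the loop
  -- above its values on the triangle. The maximum would be attained in the interior of one of the
  -- curves, which `IsTautOn.re_lt` excludes.
  obtain ⟨f, u, hfu, huf⟩ := geometric_hahn_banach_closed_point (convex_convexHull ℝ T)
    hTc.isClosed hz
  obtain ⟨c, hc⟩ := exists_re_mul f
  obtain ⟨m, hmL, hmax⟩ := hLc.exists_isMaxOn ⟨z, hzL⟩ f.continuous.continuousOn
  have hmax' : ∀ w ∈ L, (c * w).re ≤ (c * m).re := fun w hw => by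
    have : f w ≤ f m := hmax hw
    rwa [hc, hc] at this
  have hlt : ∀ w ∈ convexHull ℝ T, (c * w).re < (c * m).re := fun w hw => by
    have : f z ≤ f m := hmax hzL
    have := hfu w hw
    rw [← hc, ← hc]; linarith
  have hTs : ∀ w ∈ T, (c * w).re < (c * m).re := fun w hw => hlt w (subset_convexHull ℝ T hw)
  have hsegT : segment ℝ (γ₁ b₁) (γ₂ b₂) ⊆ convexHull ℝ T := by
    rw [← convexHull_pair]
    exact convexHull_mono (by rw [hT]; exact subset_insert _ _)
  have key₁ := h₁.re_lt (S := γ₂ '' Icc a b₂ ∪ segment ℝ (γ₁ b₁) (γ₂ b₂)) (c := c) (M := (c * m).re)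
    ((isCompact_Icc.image_of_continuousOn h₂.continuousOn).union hsegc).isClosed
    (union_subset (image_subset_iff.2 h₂.mapsTo) hseg)
    (by
      refine (PolyJoined.of_segment subset_union_right).trans (y := γ₂ b₂) ?_
      rw [hst]
      exact (PolyJoined.mono subset_union_left
        (h₂.isLocallyStraight.polyJoined le_rfl hab₂ le_rfl)).symm)
    (by
      rintro r hr (⟨r₂, hr₂, he⟩ | h)
      · rcases hd r (Ioo_subset_Icc_self hr) r₂ hr₂ he.symm with h | h
        · exact hr.1.ne' h
        · exact hr.2.ne h.1
      · exact hr.2.ne (hs₁ r (Ioo_subset_Icc_self hr) h))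
    (fun w hw => hmax' w (by
      rw [hLdef, union_assoc]; exact Or.inr hw))
    (fun r hr => hmax' _ (Or.inl (Or.inl ⟨r, hr, rfl⟩)))
    (hTs _ (by simp [hT])) (hTs _ (by simp [hT]))
  have key₂ := h₂.re_lt (S := γ₁ '' Icc a b₁ ∪ segment ℝ (γ₁ b₁) (γ₂ b₂)) (c := c) (M := (c * m).re)
    ((isCompact_Icc.image_of_continuousOn h₁.continuousOn).union hsegc).isClosed
    (union_subset (image_subset_iff.2 h₁.mapsTo) hseg)
    (by
      refine (PolyJoined.of_segment ((segment_symm ℝ _ _).trans_subset subset_union_right)).trans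
        (y := γ₁ b₁) ?_
      rw [← hst]
      exact (PolyJoined.mono subset_union_left
        (h₁.isLocallyStraight.polyJoined le_rfl hab₁ le_rfl)).symm)
    (by
      rintro r hr (⟨r₁, hr₁, he⟩ | h)
      · rcases hd r₁ hr₁ r (Ioo_subset_Icc_self hr) he with h | h
        · rw [h, hst] at he
          exact hr.1.ne (h₂.injOn ⟨le_rfl, hab₂⟩ (Ioo_subset_Icc_self hr) he)
        · exact hr.2.ne h.2
      · exact hr.2.ne (hs₂ r (Ioo_subset_Icc_self hr) h))
    (fun w hw => hmax' w (by
      rcases hw with h | h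
      · exact Or.inl (Or.inl h)
      · exact Or.inr h))
    (fun r hr => hmax' _ (Or.inl (Or.inr ⟨r, hr, rfl⟩)))
    (hst ▸ hTs _ (by simp [hT])) (hTs _ (by simp [hT]))
  rcases hmL with (⟨r, hr, h⟩ | ⟨r, hr, h⟩) | h
  · exact (h ▸ key₁ r hr).false
  · exact (h ▸ key₂ r hr).false
  · exact (hlt m (hsegT h)).false

/-- Two taut curves do not form a bigon. -/
theorem IsTautOn.no_bigon {γ₁ γ₂ : ℝ → ℂ} {a b₁ b₂ : ℝ} (h₁ : P.IsTautOn γ₁ a b₁)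
    (h₂ : P.IsTautOn γ₂ a b₂) (hab₁ : a < b₁) (hab₂ : a < b₂) (hst : γ₁ a = γ₂ a)
    (hen : γ₁ b₁ = γ₂ b₂)
    (hd : ∀ r₁ ∈ Icc a b₁, ∀ r₂ ∈ Icc a b₂, γ₁ r₁ = γ₂ r₂ → r₁ = a ∨ r₁ = b₁ ∧ r₂ = b₂) :
    False := by
  have hs : segment ℝ (γ₁ b₁) (γ₂ b₂) = {γ₁ b₁} := by rw [← hen, segment_same]
  obtain ⟨k₁, k₂⟩ := h₁.mem_convexHull h₂ hab₁.le hab₂.le hst hd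
    (by rw [hs]; exact singleton_subset_iff.2 (h₁.mapsTo ⟨hab₁.le, le_rfl⟩))
    (fun r hr h => by
      rw [hs] at h
      exact h₁.injOn hr ⟨hab₁.le, le_rfl⟩ h)
    (fun r hr h => by
      rw [hs, hen] at h
      exact h₂.injOn hr ⟨hab₂.le, le_rfl⟩ h)
  -- For coinciding ends the triangle degenerates to a segment, so both curves pass through its
  -- midpoint.
  have hhull : convexHull ℝ {γ₁ a, γ₁ b₁, γ₂ b₂} = segment ℝ (γ₁ a) (γ₁ b₁) := by
    rw [← hen, pair_eq_singleton, convexHull_pair]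
  rw [hhull] at k₁ k₂
  have hne : γ₁ b₁ - γ₁ a ≠ 0 := sub_ne_zero.2 fun h =>
    hab₁.ne' (h₁.injOn ⟨hab₁.le, le_rfl⟩ ⟨le_rfl, hab₁.le⟩ h)
  have hmid : ∀ (γ : ℝ → ℂ) (b : ℝ), a ≤ b → ContinuousOn γ (Icc a b) → γ a = γ₁ a → γ b = γ₁ b₁ →
      (∀ r ∈ Icc a b, γ r ∈ segment ℝ (γ₁ a) (γ₁ b₁)) →
      ∃ r ∈ Icc a b, γ r = γ₁ a + (1 / 2 : ℝ) * (γ₁ b₁ - γ₁ a) := by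
    intro γ b hab hc ha hb hseg
    have hcont : ContinuousOn (fun r => (starRingEnd ℂ (γ₁ b₁ - γ₁ a) * (γ r - γ₁ a)).re) (Icc a b) :=
      continuous_re.comp_continuousOn (continuousOn_const.mul (hc.sub continuousOn_const))
    have hp : 0 < normSq (γ₁ b₁ - γ₁ a) := normSq_pos.2 hne
    have hin : normSq (γ₁ b₁ - γ₁ a) / 2 ∈ Icc
        ((starRingEnd ℂ (γ₁ b₁ - γ₁ a) * (γ a - γ₁ a)).re)
        ((starRingEnd ℂ (γ₁ b₁ - γ₁ a) * (γ b - γ₁ a)).re) := by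
      rw [ha, hb, sub_self, mul_zero, ← normSq_eq_conj_mul_self, ofReal_re]
      constructor
      · simp; linarith
      · linarith
    obtain ⟨r, hr, he⟩ := intermediate_value_Icc hab hcont hin
    refine ⟨r, hr, ?_⟩
    have := hseg r hr
    rw [segment_eq_image'] at this
    obtain ⟨θ, -, hθ⟩ := this
    simp only [real_smul] at hθ
    simp only [← hθ, add_sub_cancel_left] at he
    rw [mul_left_comm, ← normSq_eq_conj_mul_self, ← ofReal_mul, ofReal_re] at he
    have : θ = 1 / 2 := by
      field_simp at he; linarith
    rw [← hθ, this]
  obtain ⟨r₁, hr₁, e₁⟩ := hmid γ₁ b₁ hab₁.le h₁.continuousOn rfl rfl k₁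
  obtain ⟨r₂, hr₂, e₂⟩ := hmid γ₂ b₂ hab₂.le h₂.continuousOn hst.symm hen.symm k₂
  rcases hd r₁ hr₁ r₂ hr₂ (e₁.trans e₂.symm) with h | ⟨h, -⟩
  · rw [h, left_eq_add] at e₁
    simp [hne] at e₁
  · rw [h] at e₁
    have : γ₁ b₁ - γ₁ a = (1 / 2 : ℝ) * (γ₁ b₁ - γ₁ a) := by
      nth_rw 1 [e₁]; ring
    apply hne
    push_cast at this
    linear_combination 2 * this

/-- Taut curves that leave a point in different directions do not meet again. -/
theorem IsTautOn.ne_of_leaves {γ₁ γ₂ : ℝ → ℂ} {a b₁ b₂ : ℝ} (h₁ : P.IsTautOn γ₁ a b₁)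
    (h₂ : P.IsTautOn γ₂ a b₂) (hst : γ₁ a = γ₂ a) {x y : ℂ} (hx : ‖x‖ = 1) (hy : ‖y‖ = 1)
    (hxy : x ≠ y) {δ : ℝ} (hδ : 0 < δ) (hx' : ∀ h ∈ Icc 0 δ, γ₁ (a + h) = γ₁ a + h * x)
    (hy' : ∀ h ∈ Icc 0 δ, γ₂ (a + h) = γ₂ a + h * y) {r₁ r₂ : ℝ} (hr₁ : r₁ ∈ Ioc a b₁)
    (hr₂ : r₂ ∈ Ioc a b₂) : γ₁ r₁ ≠ γ₂ r₂ := by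
  intro he
  have hx0 : x ≠ 0 := by rintro rfl; simp at hx
  have hy0 : y ≠ 0 := by rintro rfl; simp at hy
  -- near the common starting point there is no other common point
  have hloc : ∃ ε > 0, ∀ s ∈ Icc a b₁, ∀ t ∈ Icc a b₂, γ₁ s = γ₂ t → s < a + ε → s = a := by
    have hcomp : IsCompact (γ₂ '' Icc (a + δ) b₂) := isCompact_Icc.image_of_continuousOn
      (h₂.continuousOn.mono (Icc_subset_Icc (by linarith) le_rfl))
    have hmem : γ₁ a ∈ (γ₂ '' Icc (a + δ) b₂)ᶜ := by
      rintro ⟨t, ht, hta⟩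
      have := h₂.injOn ⟨by linarith [ht.1], ht.2⟩ ⟨le_rfl, (hr₂.1.le.trans hr₂.2)⟩ (hta.trans hst)
      linarith [ht.1]
    obtain ⟨ρ, hρ, hb⟩ := Metric.isOpen_iff.1 hcomp.isClosed.isOpen_compl _ hmem
    refine ⟨min δ ρ, lt_min hδ hρ, fun s hs t ht hst' hlt => ?_⟩
    have e1 := hx' (s - a) ⟨by linarith [hs.1], by linarith [min_le_left δ ρ]⟩
    rw [add_sub_cancel] at e1
    have htδ : t < a + δ := by
      by_contra! hge
      refine absurd ?_ (fun h => hb h ⟨t, ⟨hge, ht.2⟩, hst'.symm⟩)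
      rw [mem_ball_iff_norm, e1, add_sub_cancel_left, norm_mul, hx, mul_one, norm_real,
        Real.norm_of_nonneg (by linarith [hs.1])]
      linarith [min_le_right δ ρ]
    have e2 := hy' (t - a) ⟨by linarith [ht.1], by linarith⟩
    rw [add_sub_cancel] at e2
    have e3 : ((s - a : ℝ) : ℂ) * x = ((t - a : ℝ) : ℂ) * y := by
      have : γ₁ a + ((s - a : ℝ) : ℂ) * x = γ₁ a + ((t - a : ℝ) : ℂ) * y := by
        rw [← e1, hst', e2, hst]
      exact add_left_cancel this
    have e4 := congrArg norm e3
    rw [norm_mul, norm_mul, hx, hy, norm_real, norm_real, Real.norm_of_nonneg (by linarith [hs.1]),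
      Real.norm_of_nonneg (by linarith [ht.1]), mul_one, mul_one] at e4
    rw [← e4] at e3
    by_contra hne
    exact hxy (mul_left_cancel₀ (by exact_mod_cast sub_ne_zero.2 hne) e3)
  obtain ⟨ε, hε, hloc⟩ := hloc
  have hcl : IsClosed (γ₂ '' Icc a b₂) :=
    (isCompact_Icc.image_of_continuousOn h₂.continuousOn).isClosed
  have hcont : ContinuousOn γ₁ (Icc (a + ε) b₁) :=
    h₁.continuousOn.mono (Icc_subset_Icc (by linarith) le_rfl)
  have hcomp : IsCompact (Icc (a + ε) b₁ ∩ γ₁ ⁻¹' (γ₂ '' Icc a b₂)) :=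
    isCompact_Icc.of_isClosed_subset (hcont.preimage_isClosed_of_isClosed isClosed_Icc hcl)
      inter_subset_left
  have hge : a + ε ≤ r₁ := by
    by_contra! hlt
    exact hr₁.1.ne' (hloc r₁ ⟨hr₁.1.le, hr₁.2⟩ r₂ ⟨hr₂.1.le, hr₂.2⟩ he hlt)
  -- The first common point along `γ₁` after the start closes a bigon.
  obtain ⟨s, ⟨hs, t, ht, hts⟩, hmin⟩ := hcomp.exists_isLeast
    ⟨r₁, ⟨hge, hr₁.2⟩, r₂, ⟨hr₂.1.le, hr₂.2⟩, he.symm⟩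
  have has : a < s := by linarith [hs.1]
  have hat : a < t := by
    refine ht.1.lt_of_ne ?_
    rintro rfl
    have := h₁.injOn ⟨has.le, hs.2⟩ ⟨le_rfl, has.le.trans hs.2⟩ (hts.symm.trans hst.symm)
    linarith
  refine (h₁.mono le_rfl hs.2).no_bigon (h₂.mono le_rfl ht.2) has hat hst hts.symm ?_
  intro s' hs' t' ht' he'
  by_cases hlt : s' < a + ε
  · exact Or.inl (hloc s' ⟨hs'.1, hs'.2.trans hs.2⟩ t' ⟨ht'.1, ht'.2.trans ht.2⟩ he' hlt)
  · right
    have h1 : s' = s := le_antisymm hs'.2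
      (hmin ⟨⟨not_lt.1 hlt, hs'.2.trans hs.2⟩, t', ⟨ht'.1, ht'.2.trans ht.2⟩, he'.symm⟩)
    refine ⟨h1, h₂.injOn ⟨ht'.1, ht'.2.trans ht.2⟩ ht ?_⟩
    rw [← he', h1, hts]

end SimplePolygon

end

/-! ### Angles in triangles bounded by taut curves -/

section
open Complex Set Filter Topology

theorem exists_coord_of_mem_convexHull {c e w z : ℂ} (h : z ∈ convexHull ℝ {c, e, w}) :
    ∃ α β : ℝ, 0 ≤ α ∧ 0 ≤ β ∧ z - e = α * (c - e) + β * (w - e) := by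
  rw [convexHull_insert (insert_nonempty _ _), convexHull_pair, mem_convexJoin] at h
  obtain ⟨c', hc', y, hy, hz⟩ := h
  rw [mem_singleton_iff] at hc'
  subst hc'
  rw [segment_eq_image'] at hy hz
  obtain ⟨s, hs, rfl⟩ := hy
  obtain ⟨t, ht, rfl⟩ := hz
  refine ⟨1 - t, t * s, by linarith [ht.2], mul_nonneg ht.1 hs.1, ?_⟩
  simp only [real_smul]; push_cast; ring

theorem re_conj_mul_eq (u w : ℂ) : (starRingEnd ℂ u * w).re = u.re * w.re + u.im * w.im := by
  simp

namespace SimplePolygon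
variable {n : ℕ} [NeZero n] {P : SimplePolygon n}

/-- In a triangle formed by two taut curves and a segment, let the first curve be a shortest
connection to the segment.  Then the angle at its endpoint is not acute, and the other angle at the
segment is acute. -/
theorem IsTautOn.triangle_angles {γ₁ γ₂ : ℝ → ℂ} {a b₁ b₂ : ℝ} (h₁ : P.IsTautOn γ₁ a b₁)
    (h₂ : P.IsTautOn γ₂ a b₂) (hst : γ₁ a = γ₂ a)
    (hd : ∀ r₁ ∈ Icc a b₁, ∀ r₂ ∈ Icc a b₂, γ₁ r₁ = γ₂ r₂ → r₁ = a)
    (hseg : segment ℝ (γ₁ b₁) (γ₂ b₂) ⊆ P.region)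
    (hs₁ : ∀ r ∈ Icc a b₁, γ₁ r ∈ segment ℝ (γ₁ b₁) (γ₂ b₂) → r = b₁)
    (hs₂ : ∀ r ∈ Icc a b₂, γ₂ r ∈ segment ℝ (γ₁ b₁) (γ₂ b₂) → r = b₂)
    {d₁ d₂ : ℂ} {δ : ℝ} (hδ : 0 < δ) (hδ₁ : a ≤ b₁ - δ) (hδ₂ : a ≤ b₂ - δ) (hn₁ : ‖d₁‖ = 1)
    (hn₂ : ‖d₂‖ = 1) (hd₁ : ∀ h ∈ Icc 0 δ, γ₁ (b₁ - h) = γ₁ b₁ + h * d₁)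
    (hd₂ : ∀ h ∈ Icc 0 δ, γ₂ (b₂ - h) = γ₂ b₂ + h * d₂)
    (hnear : ∀ h ∈ Ioc 0 δ, ∀ y ∈ segment ℝ (γ₁ b₁) (γ₂ b₂),
      segment ℝ (γ₁ (b₁ - h)) y ⊆ P.region → h ≤ ‖γ₁ (b₁ - h) - y‖) :
    (starRingEnd ℂ (γ₂ b₂ - γ₁ b₁) * d₁).re ≤ 0 ∧
      0 < (starRingEnd ℂ (γ₁ b₁ - γ₂ b₂) * d₂).re := by
  have hab₁ : a < b₁ := by linarith
  have hab₂ : a < b₂ := by linarith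
  obtain ⟨k₁, k₂⟩ := h₁.mem_convexHull h₂ hab₁.le hab₂.le hst
    (fun r₁ hr₁ r₂ hr₂ he => Or.inl (hd r₁ hr₁ r₂ hr₂ he)) hseg hs₁ hs₂
  have hne : γ₁ b₁ ≠ γ₂ b₂ := fun he =>
    hab₁.ne' (hd b₁ ⟨hab₁.le, le_rfl⟩ b₂ ⟨hab₂.le, le_rfl⟩ he)
  set c := γ₁ a with hc
  set e₁ := γ₁ b₁ with he₁
  set e₂ := γ₂ b₂ with he₂
  set u := e₂ - e₁ with hu
  have hu0 : u ≠ 0 := sub_ne_zero.2 hne.symm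
  have hN : 0 < normSq u := normSq_pos.2 hu0
  have hδc : (δ : ℂ) ≠ 0 := by exact_mod_cast hδ.ne'
  have hd₁0 : d₁ ≠ 0 := by rintro rfl; simp at hn₁
  have hd₂0 : d₂ ≠ 0 := by rintro rfl; simp at hn₂
  have hsegc : IsClosed (segment ℝ e₁ e₂) := by
    rw [← convexHull_pair]
    exact ((by simp : ({e₁, e₂} : Set ℂ).Finite).isCompact_convexHull ℝ).isClosed
  have hq : e₁ + u = e₂ := by rw [hu]; ring
  obtain ⟨α, β, hα, hβ, hαβ⟩ := exists_coord_of_mem_convexHull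
    (k₁ (b₁ - δ) ⟨hδ₁, by linarith⟩)
  rw [hd₁ δ ⟨hδ.le, le_rfl⟩, add_sub_cancel_left] at hαβ
  -- If the angle at `e₁` were acute, the perpendicular dropped from a point of `γ₁` near `e₁` to
  -- the chord would lie in the cone at this corner, hence in the region, and would be shorter than
  -- the remaining part of `γ₁`, against `hnear`.
  have hV1 : (starRingEnd ℂ u * d₁).re ≤ 0 := by
    by_contra! ht
    set t := (starRingEnd ℂ u * d₁).re with ht'
    have hdet : planeDet d₁ u ≠ 0 := by
      intro h0
      have him : (u / d₁).im = 0 := by rw [im_div_eq_planeDet, h0, zero_div]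
      set k := (u / d₁).re with hk
      have huk : u = k * d₁ := by
        have : (k : ℂ) = u / d₁ := Complex.ext (by simp [hk]) (by simp [him])
        rw [this, div_mul_cancel₀ _ hd₁0]
      have hk0 : 0 < k := by
        have : t = k * normSq d₁ := by
          rw [ht', huk, re_conj_mul_eq, normSq_apply]; simp; ring
        rw [this] at ht
        exact pos_of_mul_pos_left ht (normSq_nonneg _)
      have hm : 0 < min δ k := lt_min hδ hk0
      have := hs₁ (b₁ - min δ k) ⟨by linarith [min_le_left δ k], by linarith⟩ (by
        rw [hd₁ _ ⟨hm.le, min_le_left _ _⟩, segment_eq_image']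
        refine ⟨min δ k / k, ⟨by positivity, (div_le_one hk0).2 (min_le_right _ _)⟩, ?_⟩
        have hkc : (k : ℂ) ≠ 0 := by exact_mod_cast hk0.ne'
        simp only [real_smul]
        rw [← hu, huk]
        push_cast
        field_simp)
      linarith
    set D := planeDet (c - e₁) u with hD
    -- This functional is constant along the chord and takes its maximum over the triangle there, so
    -- `e₁` is an extreme corner of the loop.
    have hfun : ∀ z : ℂ, (((-D : ℝ) : ℂ) * (I * starRingEnd ℂ u) * z).re = -D * planeDet z u := by
      intro z; rw [planeDet_apply]; simp; ring
    have hcomb : ∀ α' β' : ℝ, planeDet (α' * (c - e₁) + β' * u) u = α' * D := by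
      intro α' β'; rw [hD, planeDet_apply, planeDet_apply]; simp; ring
    have hαD : δ * planeDet d₁ u = α * D := by
      rw [← hcomb α β, ← hαβ, planeDet_apply, planeDet_apply]; simp; ring
    have hαD0 : α * D ≠ 0 := by rw [← hαD]; exact mul_ne_zero hδ.ne' hdet
    have hα0 : 0 < α := hα.lt_of_ne (by rintro rfl; simp at hαD0)
    have hD0 : D ≠ 0 := right_ne_zero_of_mul hαD0
    have hLR : γ₁ '' Icc a b₁ ∪ (γ₂ '' Icc a b₂ ∪ segment ℝ e₁ e₂) ⊆ P.region :=
      union_subset (image_subset_iff.2 h₁.mapsTo)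
        (union_subset (image_subset_iff.2 h₂.mapsTo) hseg)
    have hloop : IsCornerLoop (γ₁ '' Icc a b₁ ∪ (γ₂ '' Icc a b₂ ∪ segment ℝ e₁ e₂)) e₁
        (δ * d₁) u := by
      have ed := hd₁ δ ⟨hδ.le, le_rfl⟩
      refine ⟨mul_ne_zero hδc hd₁0, hu0, ?_, ?_, γ₁ '' Icc a (b₁ - δ) ∪ γ₂ '' Icc a b₂,
        ((isCompact_Icc.image_of_continuousOn (h₁.continuousOn.mono
          (Icc_subset_Icc le_rfl (by linarith)))).union
          (isCompact_Icc.image_of_continuousOn h₂.continuousOn)).isClosed, ?_, ?_, ?_⟩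
      · rw [← ed]
        exact (segment_subset_image_of_left hδ.le hd₁).trans
          (subset_union_of_subset_left (image_mono (Icc_subset_Icc hδ₁ le_rfl)) _)
      · rw [hq]
        exact subset_union_right.trans subset_union_right
      · rintro (⟨r, hr, he⟩ | ⟨r, hr, he⟩)
        · have := h₁.injOn ⟨hr.1, by linarith [hr.2]⟩ ⟨hab₁.le, le_rfl⟩ he
          linarith [hr.2]
        · exact hab₁.ne' (hd b₁ ⟨hab₁.le, le_rfl⟩ r hr he.symm)
      · refine union_subset (subset_union_of_subset_left
          (image_mono (Icc_subset_Icc le_rfl (by linarith))) _) ?_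
        exact subset_union_left.trans subset_union_right
      · rw [hq, ← ed]
        refine PolyJoined.trans (y := c) ?_ (PolyJoined.mono subset_union_left
          (h₁.isLocallyStraight.polyJoined le_rfl hδ₁ (by linarith)))
        rw [hst]
        exact (PolyJoined.mono subset_union_right
          (h₂.isLocallyStraight.polyJoined le_rfl hab₂.le le_rfl)).symm
    have hhull : ∀ w ∈ γ₁ '' Icc a b₁ ∪ (γ₂ '' Icc a b₂ ∪ segment ℝ e₁ e₂),
        w ∈ convexHull ℝ {c, e₁, e₂} := by
      rintro w (⟨r, hr, rfl⟩ | ⟨r, hr, rfl⟩ | h)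
      · exact k₁ r hr
      · exact k₂ r hr
      · rw [← convexHull_pair] at h
        exact convexHull_mono (subset_insert _ _) h
    obtain ⟨ε, hε, hcone⟩ := P.exists_cone_subset (c := ((-D : ℝ) : ℂ) * (I * starRingEnd ℂ u))
      hloop hLR (by
        rw [im_div_eq_planeDet]
        refine div_ne_zero ?_ (normSq_pos.2 (mul_ne_zero hδc hd₁0)).ne'
        have : planeDet (δ * d₁) u = δ * planeDet d₁ u := by
          rw [planeDet_apply, planeDet_apply]; simp; ring
        rw [this, hαD]
        exact hαD0)
      (fun w hw => by
        obtain ⟨α', β', hα', -, he⟩ := exists_coord_of_mem_convexHull (hhull w hw)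
        rw [hfun, he, hcomb]
        nlinarith [mul_nonneg hα' (sq_nonneg D)])
      (by
        rw [hfun, hαβ, hcomb]
        have : 0 < D * D := mul_self_pos.2 hD0
        nlinarith)
    set Nu := normSq u with hNu
    obtain ⟨h, hh0, hhδ, hhε, hhε', hh1⟩ : ∃ h > 0, h ≤ δ ∧ h / δ ≤ ε ∧ h * t / Nu ≤ ε ∧
        h * t / Nu ≤ 1 := by
      -- The point at distance `h` must lie on the straight piece, both cone coordinates must be at
      -- most `ε`, and the foot must lie within the chord.
      refine ⟨min δ (min (ε * δ) (min ε 1 * Nu / t)), ?_, min_le_left _ _, ?_, ?_, ?_⟩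
      · have : 0 < min ε 1 := lt_min hε one_pos
        positivity
      · rw [div_le_iff₀ hδ]
        exact (min_le_right _ _).trans (min_le_left _ _)
      all_goals
        rw [div_le_iff₀ hN, ← le_div_iff₀ ht]
        refine ((min_le_right _ _).trans (min_le_right _ _)).trans ?_
        gcongr
      · exact min_le_left _ _
      · exact min_le_right _ _
    have hs0 : 0 ≤ h * t / Nu := by positivity
    have hγ := hd₁ h ⟨hh0.le, hhδ⟩
    -- `e₁ + (h * t / Nu) * u` is the foot of the perpendicular from `γ₁ (b₁ - h)` to the chord
    -- line.
    have hfin := hnear h ⟨hh0, hhδ⟩ (e₁ + (h * t / Nu : ℝ) * u) (by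
        rw [segment_eq_image']
        exact ⟨h * t / Nu, ⟨hs0, hh1⟩, by simp [hu]⟩) (by
        rw [hγ, segment_eq_image]
        rintro _ ⟨θ, hθ, rfl⟩
        have := hcone ((1 - θ) * (h / δ)) (θ * (h * t / Nu))
          (mul_nonneg (by linarith [hθ.2]) (by positivity)) (mul_nonneg hθ.1 hs0)
          ((mul_le_of_le_one_left (by positivity) (by linarith [hθ.1])).trans hhε)
          ((mul_le_of_le_one_left hs0 hθ.2).trans hhε')
        convert this using 1
        simp only [real_smul]; push_cast; field_simp; ring)
    rw [hγ, add_sub_add_left_eq_sub] at hfin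
    have h2 : h ^ 2 ≤ normSq (h * d₁ - (h * t / Nu : ℝ) * u) := by
      rw [normSq_eq_norm_sq]
      exact pow_le_pow_left₀ hh0.le hfin 2
    have h3 : normSq d₁ = 1 := by rw [normSq_eq_norm_sq, hn₁]; norm_num
    have h4 : normSq (h * d₁ - (h * t / Nu : ℝ) * u) =
        h ^ 2 * normSq d₁ - 2 * h * (h * t / Nu) * t + (h * t / Nu) ^ 2 * Nu := by
      rw [hNu, ht', re_conj_mul_eq]
      simp only [normSq_apply, sub_re, sub_im, re_ofReal_mul, im_ofReal_mul]
      ring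
    rw [h4, h3] at h2
    have h5 : 2 * h * (h * t / Nu) * t = 2 * (h ^ 2 * t ^ 2 / Nu) := by ring
    have h6 : (h * t / Nu) ^ 2 * Nu = h ^ 2 * t ^ 2 / Nu := by field_simp
    have : 0 < h ^ 2 * t ^ 2 / Nu := by positivity
    linarith
  refine ⟨hV1, ?_⟩
  -- The non-acute angle of `γ₁` makes the angle of the straight triangle `c`, `e₁`, `e₂` at `e₁`
  -- non-acute as well. So both sides at `e₂` have positive scalar product with `e₁ - e₂`, and `d₂`
  -- points between them.
  obtain ⟨α', β', hα', hβ', hαβ'⟩ := exists_coord_of_mem_convexHull (c := c) (e := e₂) (w := e₁)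
    (z := γ₂ (b₂ - δ)) (by rw [pair_comm]; exact k₂ (b₂ - δ) ⟨hδ₂, by linarith⟩)
  rw [hd₂ δ ⟨hδ.le, le_rfl⟩, add_sub_cancel_left] at hαβ'
  have hp1 : δ * (starRingEnd ℂ u * d₁).re =
      α * (starRingEnd ℂ u * (c - e₁)).re + β * normSq u := by
    have := congrArg (fun z => (starRingEnd ℂ u * z).re) hαβ
    simp only [re_conj_mul_eq, add_re, add_im, re_ofReal_mul, im_ofReal_mul] at this
    rw [re_conj_mul_eq, re_conj_mul_eq, normSq_apply]
    linarith
  have hα0 : 0 < α := by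
    refine hα.lt_of_ne ?_
    rintro rfl
    have hβ0 : β = 0 := by
      have : β * normSq u ≤ 0 := by nlinarith
      exact le_antisymm (nonpos_of_mul_nonpos_left this hN) hβ
    rw [hβ0] at hαβ
    simp [hδ.ne', hd₁0] at hαβ
  have hx : (starRingEnd ℂ u * (c - e₁)).re ≤ 0 := by
    have : α * (starRingEnd ℂ u * (c - e₁)).re ≤ 0 := by nlinarith
    exact nonpos_of_mul_nonpos_right this hα0
  have hA : (starRingEnd ℂ (e₁ - e₂) * (c - e₂)).re =
      normSq u - (starRingEnd ℂ u * (c - e₁)).re := by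
    rw [re_conj_mul_eq, re_conj_mul_eq, normSq_apply, hu]
    simp only [sub_re, sub_im]; ring
  have hp2 : δ * (starRingEnd ℂ (e₁ - e₂) * d₂).re =
      α' * (starRingEnd ℂ (e₁ - e₂) * (c - e₂)).re + β' * normSq u := by
    have := congrArg (fun z => (starRingEnd ℂ (e₁ - e₂) * z).re) hαβ'
    simp only [re_conj_mul_eq, add_re, add_im, re_ofReal_mul, im_ofReal_mul] at this
    rw [re_conj_mul_eq, re_conj_mul_eq, normSq_apply, hu]
    simp only [sub_re, sub_im] at this ⊢
    linarith
  refine pos_of_mul_pos_right (a := δ) ?_ hδ.le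
  rw [hp2, hA]
  rcases hα'.eq_or_lt with rfl | hα0'
  · have : 0 < β' := hβ'.lt_of_ne (by
      rintro rfl
      simp [hδ.ne', hd₂0] at hαβ')
    nlinarith [mul_pos this hN]
  · nlinarith [mul_pos hα0' hN, mul_nonneg hβ' hN.le]

end SimplePolygon

end

/-! ### Turning at boundary points and the order of endpoints -/

section
open Complex Set Filter Topology

theorem cwAng_smul_left {q z : ℂ} {r : ℝ} (hr : 0 < r) : cwAng (r * q) z = cwAng q z := by
  rw [cwAng, cwAng]
  congr 2
  rw [show z / (r * q) = ((r⁻¹ : ℝ) : ℂ) * (z / q) by push_cast; rw [mul_comm, div_mul_eq_div_div_swap]; ring,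
    arg_real_mul _ (inv_pos.2 hr)]

theorem cwAng_neg {q z : ℂ} (hq : q ≠ 0) (hz : z ≠ 0) (h : cwAng q z < Real.pi) :
    cwAng q (-z) = cwAng q z + Real.pi := by
  have := cwAng_rotate hq hz (r := 1) (η := Real.pi) one_pos
    (by linarith [cwAng_nonneg q z, Real.pi_pos]) (by linarith)
  rwa [exp_neg, exp_pi_mul_I, ofReal_one, one_mul, inv_neg, inv_one, neg_one_mul] at this

theorem cwAng_neg_of_pi_le {q z : ℂ} (hq : q ≠ 0) (hz : z ≠ 0) (h : Real.pi ≤ cwAng q z) :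
    cwAng q (-z) = cwAng q z - Real.pi := by
  have := cwAng_rotate hq hz (r := 1) (η := -Real.pi) one_pos (by linarith)
    (by linarith [cwAng_lt q z, Real.pi_pos])
  rwa [ofReal_neg, neg_mul, neg_neg, exp_pi_mul_I, ofReal_one, one_mul, neg_one_mul] at this

theorem exists_eq_rotate {q d x : ℂ} (hq : q ≠ 0) (hd : d ≠ 0) (hx : x ≠ 0) :
    ∃ k : ℝ, 0 < k ∧ x = k * exp (-((cwAng q x - cwAng q d : ℝ) * I)) * d := by
  refine ⟨‖x‖ / ‖d‖, div_pos (norm_pos_iff.2 hx) (norm_pos_iff.2 hd), ?_⟩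
  have h1 := cwAng_spec hq x
  have h2 := cwAng_spec hq d
  have e1 : exp (-((cwAng q x - cwAng q d : ℝ) * I)) =
      exp (-(cwAng q x * I)) * exp (cwAng q d * I) := by
    rw [← exp_add]; congr 1; push_cast; ring
  have e2 : exp (cwAng q d * I) * exp (-(cwAng q d * I)) = 1 := by
    rw [← exp_add, add_neg_cancel, exp_zero]
  have hdn : (‖d‖ : ℂ) ≠ 0 := by exact_mod_cast (norm_pos_iff.2 hd).ne'
  have hqn : (‖q‖ : ℂ) ≠ 0 := by exact_mod_cast (norm_pos_iff.2 hq).ne'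
  rw [e1]
  calc x = ((‖x‖ / ‖q‖ : ℝ) : ℂ) * exp (-(cwAng q x * I)) * q := h1
    _ = ((‖x‖ / ‖d‖ : ℝ) : ℂ) * (exp (-(cwAng q x * I)) * exp (cwAng q d * I)) *
        (((‖d‖ / ‖q‖ : ℝ) : ℂ) * exp (-(cwAng q d * I)) * q) := by
      rw [show ∀ A E F B G : ℂ, A * (E * F) * (B * G * q) = A * B * E * (F * G) * q by
        intros; ring, e2]
      push_cast
      field_simp
    _ = _ := by rw [← h2]

theorem cwAng_eq_sub {q d x : ℂ} (hq : q ≠ 0) (hd : d ≠ 0) (hx : x ≠ 0)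
    (h : cwAng q d ≤ cwAng q x) : cwAng d x = cwAng q x - cwAng q d := by
  obtain ⟨k, hk, hxd⟩ := exists_eq_rotate hq hd hx
  nth_rw 1 [hxd]
  exact cwAng_eq hd hk (by linarith) (by linarith [cwAng_lt q x, cwAng_nonneg q d])

theorem cwAng_eq_sub_add {q d x : ℂ} (hq : q ≠ 0) (hd : d ≠ 0) (hx : x ≠ 0)
    (h : cwAng q x < cwAng q d) : cwAng d x = cwAng q x - cwAng q d + 2 * Real.pi := by
  obtain ⟨k, hk, hxd⟩ := exists_eq_rotate hq hd hx
  have e : exp (-((cwAng q x - cwAng q d : ℝ) * I)) =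
      exp (-((cwAng q x - cwAng q d + 2 * Real.pi : ℝ) * I)) := by
    rw [exp_eq_exp_iff_exists_int]
    exact ⟨1, by push_cast; ring⟩
  rw [e] at hxd
  nth_rw 1 [hxd]
  exact cwAng_eq hd hk (by linarith [cwAng_lt q d, cwAng_nonneg q x]) (by linarith)

/-- With `φ < π` the clockwise angle from `d` to `x`, the combination is `ζ * d` for a `ζ` whose
argument lies between `-φ` and 0, so it points between `d` and `x`. -/
theorem cwAng_combination_le {q d x : ℂ} (hq : q ≠ 0) (hd : d ≠ 0) (hx : x ≠ 0)
    (h : cwAng q d ≤ cwAng q x) (h' : cwAng q x < cwAng q d + Real.pi) {α β : ℝ} (hα : 0 ≤ α)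
    (hβ : 0 ≤ β) (hne : (α : ℂ) * d + β * x ≠ 0) : cwAng q (α * d + β * x) ≤ cwAng q x := by
  rcases hα.eq_or_lt with rfl | hα'
  · rcases hβ.eq_or_lt with rfl | hβ'
    · simp at hne
    · rw [ofReal_zero, zero_mul, zero_add, cwAng_smul hq hx hβ']
  rcases hβ.eq_or_lt with rfl | hβ'
  · rwa [ofReal_zero, zero_mul, add_zero, cwAng_smul hq hd hα']
  rcases h.eq_or_lt with he | hlt
  · obtain ⟨k, hk, rfl⟩ := exists_pos_mul_of_cwAng_eq hq hd hx he
    rw [show (α : ℂ) * (k * x) + β * x = ((α * k + β : ℝ) : ℂ) * x by push_cast; ring,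
      cwAng_smul hq hx (by positivity)]
  set φ := cwAng q x - cwAng q d with hφ
  obtain ⟨k, hk, hxd⟩ := exists_eq_rotate hq hd hx
  rw [← hφ] at hxd
  set ζ : ℂ := α + (β * k : ℝ) * exp (-(φ * I)) with hζ
  have hw : (α : ℂ) * d + β * x = ζ * d := by rw [hxd, hζ]; push_cast; ring
  have hζ0 : ζ ≠ 0 := by rintro h0; rw [hw, h0, zero_mul] at hne; exact hne rfl
  have hφ0 : 0 < φ := sub_pos.2 hlt
  have hφ1 : φ < Real.pi := by linarith
  have hsin := Real.sin_pos_of_pos_of_lt_pi hφ0 hφ1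
  have him : ζ.im = -(β * k * Real.sin φ) := by
    rw [hζ, add_im, ofReal_im, im_ofReal_mul, ← neg_mul, ← ofReal_neg, exp_ofReal_mul_I_im,
      Real.sin_neg]; ring
  have hψ0 : arg ζ < 0 := arg_neg_iff.2 (by rw [him]; have := mul_pos hβ' hk; nlinarith)
  have hpol : ζ = (‖ζ‖ : ℝ) * exp (-(((-arg ζ : ℝ) : ℂ) * I)) := by
    conv_lhs => rw [← norm_mul_exp_arg_mul_I ζ]
    push_cast; ring_nf
  -- Turning `ζ` back by `φ` leaves the imaginary part `α sin φ > 0`, which rules out an argument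
  -- below `-φ`.
  have hψφ : -arg ζ ≤ φ := by
    by_contra! hgt
    have h1 : (ζ * exp (φ * I)).im = α * Real.sin φ := by
      rw [hζ, add_mul, mul_assoc, ← exp_add, neg_add_cancel, exp_zero, mul_one, add_im,
        im_ofReal_mul, exp_ofReal_mul_I_im, ofReal_im, add_zero]
    have h2 : (ζ * exp (φ * I)).im = ‖ζ‖ * Real.sin (φ + arg ζ) := by
      conv_lhs => rw [← norm_mul_exp_arg_mul_I ζ]
      rw [mul_assoc, ← exp_add, ← add_mul, ← ofReal_add, im_ofReal_mul, exp_ofReal_mul_I_im,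
        add_comm]
    have h3 : Real.sin (φ + arg ζ) < 0 :=
      Real.sin_neg_of_neg_of_neg_pi_lt (by linarith) (by linarith [neg_pi_lt_arg ζ])
    have h4 := mul_pos hα' hsin
    rw [← h1, h2] at h4
    nlinarith [norm_nonneg ζ]
  have hrot := cwAng_rotate hq hd (r := ‖ζ‖) (η := -arg ζ) (norm_pos_iff.2 hζ0)
    (by linarith [cwAng_nonneg q d]) (by linarith [cwAng_lt q x])
  rw [hw]
  nth_rw 1 [hpol]
  rw [hrot]
  linarith

namespace SimplePolygon
variable {n : ℕ} [NeZero n] (P : SimplePolygon n)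

theorem exists_mem_region_iff (t : ℝ) : ∃ ρ > 0, ∀ z : ℂ, ‖z‖ < ρ → z ≠ 0 →
    (P.bdryPoint t + z ∈ P.region ↔ cwAng (P.fwd t) z ≤ P.openAngle t) := by
  obtain ⟨ρ₁, hρ₁, hr, -, -, hle⟩ := P.exists_local_region t
  obtain ⟨ρ₂, hρ₂, hb⟩ := P.exists_sectors t
  refine ⟨min ρ₁ ρ₂, lt_min hρ₁ hρ₂, fun z hz hz0 => ⟨fun h => ?_, fun h => ?_⟩⟩
  · simpa using hle _ h (by simpa using hz.trans_le (min_le_left _ _))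
  · have hb' := hb (P.bdryPoint t + z) (by simpa using hz0)
      (by simpa using hz.trans_le (min_le_right _ _))
    rw [add_sub_cancel_left] at hb'
    rcases (cwAng_nonneg (P.fwd t) z).eq_or_lt with h0 | h0
    · exact P.boundary_subset_region (hb'.2 (Or.inl h0.symm))
    rcases h.eq_or_lt with h1 | h1
    · exact P.boundary_subset_region (hb'.2 (Or.inr h1))
    · exact (hr (mem_sector_add hz0 (hz.trans_le (min_le_left _ _)) h0 h1)).1

theorem cwAng_le_openAngle {t δ : ℝ} {x : ℂ} (hx : x ≠ 0) (hδ : 0 < δ)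
    (h : ∀ r ∈ Icc 0 δ, P.bdryPoint t + r * x ∈ P.region) :
    cwAng (P.fwd t) x ≤ P.openAngle t := by
  obtain ⟨ρ, hρ, hiff⟩ := P.exists_mem_region_iff t
  have hxn := norm_pos_iff.2 hx
  obtain ⟨r, hr0, hrδ, hrρ⟩ : ∃ r > 0, r ≤ δ ∧ r * ‖x‖ < ρ := by
    refine ⟨min δ (ρ / 2 / ‖x‖), lt_min hδ (by positivity), min_le_left _ _, ?_⟩
    calc _ ≤ ρ / 2 / ‖x‖ * ‖x‖ := by gcongr; exact min_le_right _ _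
      _ = ρ / 2 := div_mul_cancel₀ _ hxn.ne'
      _ < ρ := by linarith
  have hrc : (r : ℂ) ≠ 0 := by exact_mod_cast hr0.ne'
  have := (hiff (r * x) (by rwa [norm_mul, norm_real, Real.norm_of_nonneg hr0.le])
    (mul_ne_zero hrc hx)).1 (h r ⟨hr0.le, hrδ⟩)
  rwa [cwAng_smul (P.fwd_ne_zero t) hx hr0] at this

variable {P}

/-- A taut curve turns at a boundary point by reflex angles only. -/
theorem IsTautOn.pi_le_abs_sub {γ : ℝ → ℂ} {a b r δ : ℝ} (hγ : P.IsTautOn γ a b) {d x : ℂ}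
    (hδ : 0 < δ) (ha : a ≤ r - δ) (hb : r + δ ≤ b) (hd : ‖d‖ = 1) (hx : ‖x‖ = 1)
    (hx' : ∀ h ∈ Icc 0 δ, γ (r + h) = γ r + h * x) (hd' : ∀ h ∈ Icc 0 δ, γ (r - h) = γ r + h * d)
    {t : ℝ} (ht : γ r = P.bdryPoint t) :
    Real.pi ≤ |cwAng (P.fwd t) x - cwAng (P.fwd t) d| := by
  have hx0 : x ≠ 0 := by rintro rfl; simp at hx
  have hd0 : d ≠ 0 := by rintro rfl; simp at hd
  have hq := P.fwd_ne_zero t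
  by_contra! hlt
  have hθx : cwAng (P.fwd t) x ≤ P.openAngle t := P.cwAng_le_openAngle hx0 hδ fun h hh => by
    rw [← ht, ← hx' h hh]; exact hγ.mapsTo ⟨by linarith [hh.1], by linarith [hh.2]⟩
  have hθd : cwAng (P.fwd t) d ≤ P.openAngle t := P.cwAng_le_openAngle hd0 hδ fun h hh => by
    rw [← ht, ← hd' h hh]; exact hγ.mapsTo ⟨by linarith [hh.2], by linarith [hh.1]⟩
  -- Directions less than π apart span a cone within the closed interior angle, so the short cuts
  -- lie in the region and tautness gives `x = -d`. But opposite directions are exactly π apart.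
  have hcomb : ∀ α β : ℝ, 0 ≤ α → 0 ≤ β → (α : ℂ) * d + β * x ≠ 0 →
      cwAng (P.fwd t) (α * d + β * x) ≤ P.openAngle t := by
    intro α β hα hβ hne
    rw [abs_lt] at hlt
    rcases le_total (cwAng (P.fwd t) d) (cwAng (P.fwd t) x) with h | h
    · exact (cwAng_combination_le hq hd0 hx0 h (by linarith) hα hβ hne).trans hθx
    · rw [add_comm] at hne ⊢
      exact (cwAng_combination_le hq hx0 hd0 h (by linarith) hβ hα hne).trans hθd
  obtain ⟨ρ, hρ, hiff⟩ := P.exists_mem_region_iff t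
  obtain ⟨h, hh0, hhδ, hhρ⟩ : ∃ h > 0, h ≤ δ ∧ h < ρ :=
    ⟨min δ (ρ / 2), lt_min hδ (by linarith), min_le_left _ _,
      (min_le_right _ _).trans_lt (by linarith)⟩
  have hxd := hγ.bend r h d x hh0 (by linarith) (by linarith) hd hx
    (fun k hk => hx' k ⟨hk.1, hk.2.trans hhδ⟩) (fun k hk => hd' k ⟨hk.1, hk.2.trans hhδ⟩) (by
      intro k hk
      rw [hx' k ⟨hk.1.le, hk.2.trans hhδ⟩, hd' k ⟨hk.1.le, hk.2.trans hhδ⟩, segment_eq_image]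
      rintro _ ⟨θ, hθ, rfl⟩
      have e : (1 - θ) • (γ r + k * d) + θ • (γ r + k * x) =
          P.bdryPoint t + (((1 - θ) * k : ℝ) * d + (θ * k : ℝ) * x) := by
        rw [← ht]; simp only [real_smul]; push_cast; ring
      have h1 : 0 ≤ (1 - θ) * k := mul_nonneg (by linarith [hθ.2]) hk.1.le
      have h2 : 0 ≤ θ * k := mul_nonneg hθ.1 hk.1.le
      change (1 - θ) • (γ r + k * d) + θ • (γ r + k * x) ∈ P.region
      rw [e]
      by_cases hne : (((1 - θ) * k : ℝ) : ℂ) * d + (θ * k : ℝ) * x = 0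
      · rw [hne, add_zero]; exact P.boundary_subset_region (P.bdryPoint_mem t)
      · refine (hiff _ ?_ hne).2 (hcomb _ _ h1 h2 hne)
        refine (norm_add_le _ _).trans_lt ?_
        rw [norm_mul, norm_mul, norm_real, norm_real, hd, hx, Real.norm_of_nonneg h1,
          Real.norm_of_nonneg h2]
        linarith [hk.2])
  rw [hxd, abs_lt] at hlt
  rcases lt_or_ge (cwAng (P.fwd t) d) Real.pi with h1 | h1
  · rw [cwAng_neg hq hd0 h1] at hlt
    linarith [hlt.2]
  · rw [cwAng_neg_of_pi_le hq hd0 h1] at hlt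
    linarith [hlt.1]

theorem IsTautOn.reverse {γ : ℝ → ℂ} {a b : ℝ} (h : P.IsTautOn γ a b) (k : ℝ) :
    P.IsTautOn (fun r => γ (k - r)) (k - b) (k - a) where
  mapsTo r hr := h.mapsTo ⟨by linarith [hr.2], by linarith [hr.1]⟩
  continuousOn := h.continuousOn.comp (by fun_prop)
    fun r hr => ⟨by linarith [hr.2], by linarith [hr.1]⟩
  injOn r hr s hs he := by
    have := h.injOn ⟨by linarith [hr.2], by linarith [hr.1]⟩
      ⟨by linarith [hs.2], by linarith [hs.1]⟩ he
    linarith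
  right r hr := by
    obtain ⟨δ, hδ, d, hd, h1, h2⟩ := h.left (k - r) ⟨by linarith [hr.2], by linarith [hr.1]⟩
    refine ⟨δ, hδ, d, hd, by linarith, fun s hs => ?_⟩
    rw [← h2 s hs]; congr 1; ring
  left r hr := by
    obtain ⟨δ, hδ, d, hd, h1, h2⟩ := h.right (k - r) ⟨by linarith [hr.2], by linarith [hr.1]⟩
    refine ⟨δ, hδ, d, hd, by linarith, fun s hs => ?_⟩
    rw [← h2 s hs]; congr 1; ring
  bend r δ d x hδ h1 h2 hd hx h3 h4 h5 := by
    have := h.bend (k - r) δ x d hδ (by linarith) (by linarith) hx hd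
      (fun s hs => by rw [← h4 s hs]; congr 1; ring) (fun s hs => by rw [← h3 s hs]; congr 1; ring)
      (by
        intro k hk
        rw [segment_symm]
        convert h5 k hk using 3 <;> ring)
    rw [this, neg_neg]

/-- Two simple curves from a boundary point to boundary points which do not meet again, reach
the boundary in the clockwise order of their initial directions. -/
theorem IsTautOn.lt_of_cwAng_lt {γ₁ γ₂ : ℝ → ℂ} {a b₁ b₂ s t₁ t₂ δ : ℝ} {x y : ℂ}
    (h₁ : P.IsTautOn γ₁ a b₁) (h₂ : P.IsTautOn γ₂ a b₂) (hab₂ : a < b₂) (hs₁ : γ₁ a = P.bdryPoint s)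
    (hs₂ : γ₂ a = P.bdryPoint s) (hd : ∀ r₁ ∈ Ioc a b₁, ∀ r₂ ∈ Ioc a b₂, γ₁ r₁ ≠ γ₂ r₂)
    (hx : x ≠ 0) (hy : y ≠ 0) (hδ : 0 < δ) (hδ₁ : a + δ ≤ b₁) (hδ₂ : a + δ ≤ b₂)
    (hx' : ∀ h ∈ Icc 0 δ, γ₁ (a + h) = γ₁ a + h * x)
    (hy' : ∀ h ∈ Icc 0 δ, γ₂ (a + h) = γ₂ a + h * y)
    (ht₁ : t₁ ∈ Ioo s (s + n)) (ht₂ : t₂ ∈ Ioo s (s + n)) (he₁ : γ₁ b₁ = P.bdryPoint t₁)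
    (he₂ : γ₂ b₂ = P.bdryPoint t₂) (hxy : cwAng (P.fwd s) y < cwAng (P.fwd s) x) : t₂ < t₁ := by
  have hab₁ : a < b₁ := by linarith
  have hne : t₂ ≠ t₁ := by
    rintro rfl
    exact hd b₁ ⟨hab₁, le_rfl⟩ b₂ ⟨hab₂, le_rfl⟩ (he₁.trans he₂.symm)
  by_contra! hle
  have hlt : t₁ < t₂ := hle.lt_of_ne hne.symm
  have hq := P.fwd_ne_zero s
  have hScomp : IsCompact (γ₁ '' Icc a b₁) := isCompact_Icc.image_of_continuousOn h₁.continuousOn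
  have hSR : γ₁ '' Icc a b₁ ⊆ P.region := image_subset_iff.2 h₁.mapsTo
  have hC : IsPreconnected (γ₂ '' Ioc a b₂) :=
    isPreconnected_Ioc.image _ (h₂.continuousOn.mono Ioc_subset_Icc_self)
  have hCR : γ₂ '' Ioc a b₂ ⊆ P.region :=
    image_subset_iff.2 (h₂.mapsTo.mono_left Ioc_subset_Icc_self)
  have hCS : Disjoint (γ₂ '' Ioc a b₂) (γ₁ '' Icc a b₁) := by
    refine Set.disjoint_left.2 ?_
    rintro _ ⟨r₂, hr₂, rfl⟩ ⟨r₁, hr₁, he⟩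
    rcases hr₁.1.eq_or_lt with rfl | h
    · have := h₂.injOn (Ioc_subset_Icc_self hr₂) ⟨le_rfl, hab₂.le⟩ (he.symm.trans (hs₁.trans hs₂.symm))
      exact hr₂.1.ne' this
    · exact hd r₁ ⟨h, hr₁.2⟩ r₂ hr₂ he
  have hj : PolyJoined (γ₁ '' Icc a b₁) (P.bdryPoint t₁) (P.bdryPoint s) := by
    rw [← hs₁, ← he₁]
    exact (h₁.isLocallyStraight.polyJoined le_rfl hab₁.le le_rfl).symm
  have hm₂ : P.bdryPoint t₂ ∈ γ₂ '' Ioc a b₂ := ⟨b₂, ⟨hab₂, le_rfl⟩, he₂⟩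
  obtain ⟨η₀, hη₀, -, hf₀, -⟩ := P.exists_straight s
  obtain ⟨η, hη, hη₀', hηt⟩ : ∃ η > 0, η ≤ η₀ ∧ s + η < t₁ := by
    refine ⟨min η₀ ((t₁ - s) / 2), lt_min hη₀ (by linarith [ht₁.1]), min_le_left _ _, ?_⟩
    linarith [min_le_right η₀ ((t₁ - s) / 2), ht₁.1]
  have hf : ∀ h ∈ Icc 0 η, P.bdryPoint (s + h) = P.bdryPoint s + h * P.fwd s :=
    fun h hh => hf₀ h ⟨hh.1, hh.2.trans hη₀'⟩
  -- If `y` points along the boundary edge, `γ₂` passes through boundary points just after `s`, and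
  -- `separation` applies directly. Otherwise `γ₂` starts into the interior, inside the corner
  -- between the edge and `γ₁`.
  rcases (cwAng_nonneg (P.fwd s) y).eq_or_lt with h0 | h0
  · obtain ⟨k, hk, hky⟩ := exists_pos_mul_of_cwAng_eq hq hq hy ((cwAng_self hq).trans h0)
    have hm : 0 < min η (δ / k) := lt_min hη (by positivity)
    have hmk : min η (δ / k) * k ≤ δ := by
      rw [← le_div_iff₀ hk]; exact min_le_right _ _
    refine P.separation hSR hScomp.isClosed ht₁.2 hj hC hCR hCS (t₁ := s + min η (δ / k))
      ⟨by linarith, by linarith [min_le_left η (δ / k)]⟩ ⟨hlt, ht₂.2⟩ ?_ hm₂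
    refine ⟨a + min η (δ / k) * k, ⟨by linarith [mul_pos hm hk], by linarith⟩, ?_⟩
    rw [hy' _ ⟨(mul_pos hm hk).le, hmk⟩, hf _ ⟨hm.le, min_le_left _ _⟩, hs₂, hky]
    push_cast; ring
  · have hδc : (δ : ℂ) ≠ 0 := by exact_mod_cast hδ.ne'
    have hηc : (η : ℂ) ≠ 0 := by exact_mod_cast hη.ne'
    have ex := hx' δ ⟨hδ.le, le_rfl⟩
    have ef := hf η ⟨hη.le, le_rfl⟩
    -- The loop runs along the boundary from `s` to `t₁` and back along `γ₁`. The curve `γ₂` ends on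
    -- the other arc, so `N` is 0 along it on the interior; the jump at the corner makes `N` nonzero
    -- just where `γ₂` starts.
    have hloop : IsCornerLoop (P.bdryPoint '' Icc s t₁ ∪ γ₁ '' Icc a b₁) (P.bdryPoint s) (δ * x)
        (η * P.fwd s) := by
      refine ⟨mul_ne_zero hδc hx, mul_ne_zero hηc hq, ?_, ?_,
        P.bdryPoint '' Icc (s + η) t₁ ∪ γ₁ '' Icc (a + δ) b₁, ?_, ?_, ?_, ?_⟩
      · rw [← hs₁, ← ex]
        exact (segment_subset_image_of_right hδ.le hx').trans
          (subset_union_of_subset_right (image_mono (Icc_subset_Icc le_rfl hδ₁)) _)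
      · rw [← ef]
        exact (segment_subset_image_of_right hη.le hf).trans
          (subset_union_of_subset_left (image_mono (Icc_subset_Icc le_rfl hηt.le)) _)
      · exact ((isCompact_Icc.image P.continuous_bdryPoint).union
          (isCompact_Icc.image_of_continuousOn (h₁.continuousOn.mono
            (Icc_subset_Icc (by linarith) le_rfl)))).isClosed
      · rintro (⟨u, hu, he⟩ | ⟨u, hu, he⟩)
        · have := P.bdryPoint_inj he (by linarith [hu.2, ht₁.2])
            (by linarith [hu.1, natCast_pos (n := n)])
          linarith [hu.1]
        · have := h₁.injOn ⟨by linarith [hu.1], hu.2⟩ ⟨le_rfl, hab₁.le⟩ (he.trans hs₁.symm)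
          linarith [hu.1]
      · exact union_subset_union (image_mono (Icc_subset_Icc (by linarith) le_rfl))
          (image_mono (Icc_subset_Icc (by linarith) le_rfl))
      · rw [← ef, ← hs₁, ← ex]
        refine (PolyJoined.mono subset_union_left
          ((P.isLocallyStraight_bdryPoint (s + η) t₁).polyJoined le_rfl hηt.le le_rfl)).trans
          (PolyJoined.mono subset_union_right ?_)
        rw [← he₁]
        exact ((h₁.mono (by linarith) le_rfl).isLocallyStraight.polyJoined le_rfl hδ₁ le_rfl).symm
    have hLR : P.bdryPoint '' Icc s t₁ ∪ γ₁ '' Icc a b₁ ⊆ P.region := by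
      refine union_subset ?_ hSR
      rintro _ ⟨u, -, rfl⟩; exact P.boundary_subset_region (P.bdryPoint_mem u)
    obtain ⟨N, hc, hN, hz0, hside⟩ := hloop.exists_side
    have hzero := fun z hz => P.side_eq_zero hScomp.isClosed hLR rfl hc hN hz0 hC hCR hCS
      ⟨hlt, ht₂.2⟩ hm₂ (z := z) hz
    have hθx : cwAng (P.fwd s) x ≤ P.openAngle s := P.cwAng_le_openAngle hx hδ fun h hh => by
      rw [← hs₁, ← hx' h hh]; exact h₁.mapsTo ⟨by linarith [hh.1], by linarith [hh.2]⟩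
    have hω0 := P.openAngle_pos s
    have hω1 := P.openAngle_lt s
    obtain ⟨z₁, hz₁, ha₁⟩ := exists_cwAng_eq hq
      (α := (P.openAngle s + 2 * Real.pi) / 2) (by linarith) (by linarith)
    have hp : cwAng (η * P.fwd s) (δ * x) = cwAng (P.fwd s) x := by
      rw [cwAng_smul_left hη, cwAng_smul hq hx hδ]
    have hout : ∀ᶠ r : ℝ in 𝓝[>] 0, N (P.bdryPoint s + r * z₁) = 0 :=
      (P.eventually_notMem_region hz₁ (by rw [ha₁]; linarith)).mono fun r hr =>
        P.winding_eq_zero hLR hc hN hz0 hr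
    have hin := (hside z₁ y hz₁ hy (by rw [hp, cwAng_smul_left hη, ha₁]; linarith)
      (by rwa [cwAng_smul_left hη]) (by rwa [hp, cwAng_smul_left hη])).1 hout.frequently
    have hmem := P.eventually_mem_inner hy h0 (hxy.trans_le hθx)
    obtain ⟨r, ⟨hr1, hr2⟩, hr3⟩ := ((hin.and hmem).and (Ioo_mem_nhdsGT hδ)).exists
    refine hr1 ((hzero _ ?_).self_of_nhdsWithin hr2)
    refine ⟨a + r, ⟨by linarith [hr3.1], by linarith [hr3.2]⟩, ?_⟩
    rw [hy' r ⟨hr3.1.le, hr3.2.le⟩, hs₂]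

end SimplePolygon

end

/-! ### Geodesic distance, and shortest paths as taut curves -/

section
open Complex Set Filter Topology

theorem geodesicDist_le_eVariationOn {S : Set ℂ} {γ : ℝ → ℂ} {s t : ℝ} (hst : s ≤ t)
    (hc : ContinuousOn γ (Icc s t)) (hm : MapsTo γ (Icc s t) S) :
    geodesicDist S (γ s) (γ t) ≤ eVariationOn γ (Icc s t) := by
  have hmap : MapsTo (fun u : ℝ => s + u * (t - s)) (Icc 0 1) (Icc s t) := fun u hu =>
    ⟨by nlinarith [hu.1], by nlinarith [hu.2]⟩
  refine (iInf₂_le (γ ∘ fun u : ℝ => s + u * (t - s))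
    ⟨hc.comp (by fun_prop) hmap, hm.comp hmap, by simp, by simp⟩).trans ?_
  exact eVariationOn.comp_le_of_monotoneOn _ _
    (fun u _ v _ huv => by
      have := mul_le_mul_of_nonneg_right huv (sub_nonneg.2 hst)
      simpa using this) hmap

theorem geodesicDist_triangle (S : Set ℂ) (x y z : ℂ) :
    geodesicDist S x z ≤ geodesicDist S x y + geodesicDist S y z := by
  simp only [geodesicDist, ENNReal.iInf_add, ENNReal.add_iInf]
  refine le_iInf₂ fun γ₂ h₂ => le_iInf₂ fun γ₁ h₁ => ?_
  set γ : ℝ → ℂ := fun r => if r ≤ 1 then γ₁ r else γ₂ (r - 1) with hγ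
  have e₁ : EqOn γ γ₁ (Icc 0 1) := fun r hr => if_pos hr.2
  have e₂ : EqOn γ (γ₂ ∘ fun r => r - 1) (Icc 1 2) := fun r hr => by
    rcases hr.1.eq_or_lt with rfl | h
    · simp [hγ, h₁.2.2.2, h₂.2.2.1]
    · simp [hγ, not_le.2 h]
  have hmap : MapsTo (fun r : ℝ => r - 1) (Icc 1 2) (Icc 0 1) := fun r hr =>
    ⟨by linarith [hr.1], by linarith [hr.2]⟩
  have hu : Icc (0 : ℝ) 2 = Icc 0 1 ∪ Icc 1 2 :=
    (Icc_union_Icc_eq_Icc zero_le_one one_le_two).symm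
  have hc : ContinuousOn γ (Icc 0 2) := by
    rw [hu]
    refine ContinuousOn.union_of_isClosed (h₁.1.congr e₁) ?_ isClosed_Icc isClosed_Icc
    exact (h₂.1.comp (by fun_prop) hmap).congr e₂
  have hm : MapsTo γ (Icc 0 2) S := by
    rw [hu]
    refine MapsTo.union (h₁.2.1.congr e₁.symm) ?_
    exact (h₂.2.1.comp hmap).congr e₂.symm
  have h0 : γ 0 = x := by simp [hγ, h₁.2.2.1]
  have h2 : γ 2 = z := by
    rw [e₂ ⟨one_le_two, le_rfl⟩]
    simp only [Function.comp]; norm_num; exact h₂.2.2.2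
  have key := geodesicDist_le_eVariationOn zero_le_two hc hm
  rw [h0, h2] at key
  refine key.trans ?_
  have hadd := eVariationOn.Icc_add_Icc γ (s := Icc 0 2) (a := 0) (b := 1) (c := 2) zero_le_one
    one_le_two ⟨zero_le_one, one_le_two⟩
  rw [inter_self, inter_eq_self_of_subset_right (Icc_subset_Icc le_rfl one_le_two),
    inter_eq_self_of_subset_right (Icc_subset_Icc zero_le_one le_rfl)] at hadd
  rw [← hadd, eVariationOn.eq_of_eqOn e₁, eVariationOn.eq_of_eqOn e₂]
  gcongr
  exact eVariationOn.comp_le_of_monotoneOn _ _ (fun u _ v _ huv => by simpa using huv) hmap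

theorem geodesicDist_le_of_segment_subset {S : Set ℂ} {x y : ℂ} (h : segment ℝ x y ⊆ S) :
    geodesicDist S x y ≤ ENNReal.ofReal ‖y - x‖ := by
  have hm : MapsTo (fun u : ℝ => x + u • (y - x)) (Icc 0 1) S := fun u hu => h (by
    rw [segment_eq_image']; exact ⟨u, hu, rfl⟩)
  have key := geodesicDist_le_eVariationOn (γ := fun u : ℝ => x + u • (y - x)) zero_le_one
    (by fun_prop) hm
  simp only [zero_smul, add_zero, one_smul, add_sub_cancel] at key
  refine key.trans ?_
  have hlip : LipschitzOnWith ‖y - x‖₊ (fun u : ℝ => x + u • (y - x)) (Icc 0 1) := by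
    refine LipschitzOnWith.of_dist_le_mul fun u _ v _ => ?_
    rw [dist_eq_norm, add_sub_add_left_eq_sub, ← sub_smul, norm_smul, mul_comm, coe_nnnorm,
      dist_eq_norm]
  refine (hlip.comp_eVariationOn_le (g := id) (s := Icc 0 1) (mapsTo_id _)).trans ?_
  have : eVariationOn (id : ℝ → ℝ) (Icc 0 1) ≤ 1 := by simp
  calc _ ≤ (‖y - x‖₊ : ENNReal) * 1 := by gcongr
    _ = _ := by rw [mul_one, ENNReal.ofReal, norm_toNNReal]

namespace IsShortestPath
variable {S : Set ℂ} {x : ℂ} {T : Set ℂ} {σ : PlanePath}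

theorem eVariationOn_eq (h : IsShortestPath S x T σ) {s t : ℝ} (hs : 0 ≤ s) (hst : s ≤ t)
    (ht : t ≤ σ.length) : eVariationOn σ.curve (Icc s t) = ENNReal.ofReal (t - s) := by
  have := h.unitSpeed ⟨hs, hst.trans ht⟩ ⟨hs.trans hst, ht⟩
  rwa [inter_eq_self_of_subset_right (Icc_subset_Icc hs ht), NNReal.coe_one, one_mul] at this

theorem norm_sub_le (h : IsShortestPath S x T σ) {s t : ℝ} (hs : 0 ≤ s) (hst : s ≤ t)
    (ht : t ≤ σ.length) : ‖σ.curve t - σ.curve s‖ ≤ t - s := by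
  have := eVariationOn.edist_le σ.curve (s := Icc s t) ⟨hst, le_rfl⟩ ⟨le_rfl, hst⟩
  rw [h.eVariationOn_eq hs hst ht, edist_dist, dist_eq_norm] at this
  exact (ENNReal.ofReal_le_ofReal_iff (by linarith)).1 this

theorem geodesicDist_le (h : IsShortestPath S x T σ) {s t : ℝ} (hs : 0 ≤ s) (hst : s ≤ t)
    (ht : t ≤ σ.length) : geodesicDist S (σ.curve s) (σ.curve t) ≤ ENNReal.ofReal (t - s) := by
  rw [← h.eVariationOn_eq hs hst ht]
  exact geodesicDist_le_eVariationOn hst (h.continuousOn.mono (Icc_subset_Icc hs ht))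
    (h.mapsTo.mono_left (Icc_subset_Icc hs ht))

theorem length_le (h : IsShortestPath S x T σ) {y : ℂ} (hy : y ∈ T) :
    ENNReal.ofReal σ.length ≤ geodesicDist S x y := by
  rw [h.minimal]; exact iInf₂_le y hy

theorem le_geodesicDist_target (h : IsShortestPath S x T σ) {s : ℝ} (hs : 0 ≤ s)
    (hs' : s ≤ σ.length) {y : ℂ} (hy : y ∈ T) :
    ENNReal.ofReal (σ.length - s) ≤ geodesicDist S (σ.curve s) y := by
  have h1 := h.geodesicDist_le le_rfl hs hs'
  rw [h.source, sub_zero] at h1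
  have h2 := (h.length_le hy).trans ((geodesicDist_triangle S x (σ.curve s) y).trans
    (add_le_add_left h1 _))
  rw [ENNReal.ofReal_sub _ hs]
  exact tsub_le_iff_left.2 h2

/-- Every subpath of a shortest path is shortest: a shorter connection of two of its points would
also shorten the connection to `T`. -/
theorem le_geodesicDist (h : IsShortestPath S x T σ) {s t : ℝ} (hs : 0 ≤ s) (hst : s ≤ t)
    (ht : t ≤ σ.length) : ENNReal.ofReal (t - s) ≤ geodesicDist S (σ.curve s) (σ.curve t) := by
  have h1 := h.geodesicDist_le (hs.trans hst) ht le_rfl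
  have h2 := (h.le_geodesicDist_target hs (hst.trans ht) h.target).trans
    ((geodesicDist_triangle S _ (σ.curve t) _).trans (add_le_add_right h1 _))
  rw [show t - s = (σ.length - s) - (σ.length - t) by ring,
    ENNReal.ofReal_sub _ (by linarith)]
  exact tsub_le_iff_right.2 h2

/-- A target point visible from the path is at least as far away as the remaining length. This
supplies the nearness condition of the angle argument. -/
theorem sub_le_norm_target (h : IsShortestPath S x T σ) {s : ℝ} (hs : 0 ≤ s)
    (hs' : s ≤ σ.length) {y : ℂ} (hy : y ∈ T) (hseg : segment ℝ (σ.curve s) y ⊆ S) :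
    σ.length - s ≤ ‖σ.curve s - y‖ := by
  have := (h.le_geodesicDist_target hs hs' hy).trans (geodesicDist_le_of_segment_subset hseg)
  rw [norm_sub_rev]
  exact (ENNReal.ofReal_le_ofReal_iff (norm_nonneg _)).1 this

theorem le_of_mem_target (h : IsShortestPath S x T σ) {s : ℝ} (hs : 0 ≤ s)
    (hs' : s ≤ σ.length) (hy : σ.curve s ∈ T) (hS : σ.curve s ∈ S) : σ.length ≤ s := by
  have := h.sub_le_norm_target hs hs' hy (by rw [segment_same]; exact singleton_subset_iff.2 hS)
  rw [sub_self, norm_zero] at this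
  linarith

theorem initial (h : IsShortestPath S x T σ) {s : ℝ} (hs : 0 ≤ s) (hs' : s ≤ σ.length) :
    IsShortestPath S x {σ.curve s} ⟨s, σ.curve⟩ where
  length_nonneg := hs
  continuousOn := h.continuousOn.mono (Icc_subset_Icc le_rfl hs')
  mapsTo := h.mapsTo.mono_left (Icc_subset_Icc le_rfl hs')
  source := h.source
  target := rfl
  unitSpeed u hu v hv := by
    rw [← h.unitSpeed ⟨hu.1, hu.2.trans hs'⟩ ⟨hv.1, hv.2.trans hs'⟩]
    congr 1
    ext r
    constructor
    · rintro ⟨h1, h2⟩; exact ⟨⟨h1.1, h1.2.trans hs'⟩, h2⟩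
    · rintro ⟨h1, h2⟩; exact ⟨⟨h1.1, h2.2.trans hv.2⟩, h2⟩
  minimal := by
    rw [geodesicDistTo]
    simp only [mem_singleton_iff, iInf_iInf_eq_left]
    have h1 := h.geodesicDist_le le_rfl hs hs'
    have h2 := h.le_geodesicDist le_rfl hs hs'
    rw [h.source, sub_zero] at h1 h2
    exact le_antisymm h2 h1

/-- If the connecting segment lies in `S`, its length equals the parameter difference. An
intermediate point is then in the equality case of the triangle inequality, so it lies on the
segment at the proportional position. -/
theorem straight (h : IsShortestPath S x T σ) {s t : ℝ} (hs : 0 ≤ s) (hst : s < t)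
    (ht : t ≤ σ.length) (hseg : segment ℝ (σ.curve s) (σ.curve t) ⊆ S) :
    ∃ u : ℂ, ‖u‖ = 1 ∧ ∀ k ∈ Icc 0 (t - s), σ.curve (s + k) = σ.curve s + k * u := by
  set D := t - s with hD
  have hD0 : 0 < D := sub_pos.2 hst
  set v := σ.curve t - σ.curve s with hv
  have hvn : ‖v‖ = D := by
    refine le_antisymm (h.norm_sub_le hs hst.le ht) ?_
    have := (h.le_geodesicDist hs hst.le ht).trans (geodesicDist_le_of_segment_subset hseg)
    exact (ENNReal.ofReal_le_ofReal_iff (norm_nonneg _)).1 this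
  refine ⟨((1 / D : ℝ) : ℂ) * v, ?_, fun k hk => ?_⟩
  · rw [norm_mul, hvn, norm_real, Real.norm_of_nonneg (by positivity)]
    field_simp
  · set w := σ.curve (s + k) - σ.curve s with hw
    have h1 : ‖w‖ ≤ k := by
      have := h.norm_sub_le hs (show s ≤ s + k by linarith [hk.1]) (by linarith [hk.2])
      linarith
    have h2 : ‖v - w‖ ≤ D - k := by
      have := h.norm_sub_le (show 0 ≤ s + k by linarith [hk.1])
        (show s + k ≤ t by linarith [hk.2]) ht
      rw [hv, hw, sub_sub_sub_cancel_right]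
      linarith
    have h1' : normSq w ≤ k ^ 2 := by
      rw [normSq_eq_norm_sq]; exact pow_le_pow_left₀ (norm_nonneg _) h1 2
    have h2' : normSq (v - w) ≤ (D - k) ^ 2 := by
      rw [normSq_eq_norm_sq]; exact pow_le_pow_left₀ (norm_nonneg _) h2 2
    have h3 : normSq v = D ^ 2 := by rw [normSq_eq_norm_sq, hvn]
    -- Stewart's identity for the distance from `w` to the point dividing `v` in the ratio `k : D -
    -- k`.
    have h4 : D * normSq (w - (k / D : ℝ) * v) ≤ 0 := by
      have e : D * normSq (w - (k / D : ℝ) * v) =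
          (D - k) * normSq w + k * normSq (v - w) - k * normSq v + k ^ 2 / D * normSq v := by
        simp only [normSq_apply, sub_re, sub_im, re_ofReal_mul, im_ofReal_mul]
        field_simp
        ring
      rw [e, h3]
      have e2 : k ^ 2 / D * D ^ 2 = k ^ 2 * D := by field_simp
      rw [e2]
      nlinarith [mul_le_mul_of_nonneg_left h1' (sub_nonneg.2 hk.2),
        mul_le_mul_of_nonneg_left h2' hk.1]
    have h5 : normSq (w - (k / D : ℝ) * v) = 0 :=
      le_antisymm (nonpos_of_mul_nonpos_right h4 hD0) (normSq_nonneg _)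
    have h6 := sub_eq_zero.1 (normSq_eq_zero.1 h5)
    rw [hw, sub_eq_iff_eq_add'] at h6
    rw [h6]
    push_cast
    ring

end IsShortestPath

namespace SimplePolygon
variable {n : ℕ} [NeZero n] {P : SimplePolygon n}

/-- Local star-shapedness of the region; it makes nearby points of a shortest path visible from each
other. -/
theorem exists_segment_subset {c : ℂ} (hc : c ∈ P.region) :
    ∃ ρ > 0, ∀ z ∈ P.region, ‖z - c‖ < ρ → segment ℝ c z ⊆ P.region := by
  obtain ⟨ρ, hρ, h⟩ := P.exists_conic c
  refine ⟨ρ, hρ, fun z hz hzn => ?_⟩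
  rw [segment_eq_image']
  rintro _ ⟨θ, hθ, rfl⟩
  rcases hθ.1.eq_or_lt with rfl | h0
  · simpa using hc
  · have := (h (z - c) hzn θ h0 hθ.2).2 (by rwa [add_sub_cancel])
    simpa only [real_smul] using this

/-- Close points of the path see each other, so the path is straight on both sides of each
parameter. A repeated point would have positive geodesic distance from itself. A chord of the path
inside the region forces the path to follow it, so bends cannot be cut off. -/
theorem isTautOn_of_isShortestPath {x : ℂ} {T : Set ℂ} {σ : PlanePath}
    (h : IsShortestPath P.region x T σ) : P.IsTautOn σ.curve 0 σ.length where
  mapsTo := h.mapsTo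
  continuousOn := h.continuousOn
  injOn := by
    have : ∀ s t, 0 ≤ s → s < t → t ≤ σ.length → σ.curve s ≠ σ.curve t := by
      intro s t hs hst ht he
      have h1 := (h.le_geodesicDist hs hst.le ht).trans (geodesicDist_le_of_segment_subset (by
        rw [he, segment_same]; exact singleton_subset_iff.2 (h.mapsTo ⟨hs.trans hst.le, ht⟩)))
      have := (ENNReal.ofReal_le_ofReal_iff (norm_nonneg _)).1 h1
      rw [he, sub_self, norm_zero] at this
      linarith
    intro s hs t ht he
    rcases lt_trichotomy s t with hlt | hlt | hlt
    · exact absurd he (this s t hs.1 hlt ht.2)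
    · exact hlt
    · exact absurd he.symm (this t s ht.1 hlt hs.2)
  right r hr := by
    obtain ⟨ρ, hρ, hc⟩ := P.exists_segment_subset (h.mapsTo ⟨hr.1, hr.2.le⟩)
    obtain ⟨δ, hδ, hδρ, hδl⟩ : ∃ δ > 0, δ < ρ ∧ r + δ ≤ σ.length := by
      refine ⟨min (ρ / 2) (σ.length - r), lt_min (by linarith) (by linarith [hr.2]),
        (min_le_left _ _).trans_lt (by linarith), ?_⟩
      linarith [min_le_right (ρ / 2) (σ.length - r)]
    have hn := h.norm_sub_le hr.1 (show r ≤ r + δ by linarith) hδl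
    obtain ⟨u, hu, hs⟩ := h.straight hr.1 (show r < r + δ by linarith) hδl
      (hc _ (h.mapsTo ⟨by linarith [hr.1], hδl⟩) (by linarith))
    rw [add_sub_cancel_left] at hs
    exact ⟨δ, hδ, u, hu, hδl, hs⟩
  left r hr := by
    obtain ⟨ρ, hρ, hc⟩ := P.exists_segment_subset (h.mapsTo ⟨hr.1.le, hr.2⟩)
    obtain ⟨δ, hδ, hδρ, hδl⟩ : ∃ δ > 0, δ < ρ ∧ 0 ≤ r - δ := by
      refine ⟨min (ρ / 2) r, lt_min (by linarith) hr.1,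
        (min_le_left _ _).trans_lt (by linarith), ?_⟩
      linarith [min_le_right (ρ / 2) r]
    have hn := h.norm_sub_le hδl (show r - δ ≤ r by linarith) hr.2
    obtain ⟨u, hu, hs⟩ := h.straight hδl (show r - δ < r by linarith) hr.2
      (by
        rw [segment_symm]
        exact hc _ (h.mapsTo ⟨hδl, by linarith [hr.2]⟩) (by rw [norm_sub_rev]; linarith))
    rw [sub_sub_cancel] at hs
    refine ⟨δ, hδ, -u, by rwa [norm_neg], hδl, fun k hk => ?_⟩
    have e1 := hs δ ⟨hδ.le, le_rfl⟩
    have e2 := hs (δ - k) ⟨by linarith [hk.2], by linarith [hk.1]⟩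
    rw [sub_add_cancel] at e1
    rw [show r - δ + (δ - k) = r - k by ring] at e2
    rw [e2, e1]
    push_cast; ring
  bend r δ d x hδ h1 h2 hd hx hr hl hseg := by
    obtain ⟨u, hu, hs⟩ := h.straight h1 (show r - δ < r + δ by linarith) h2
      (hseg δ ⟨hδ, le_rfl⟩)
    have e1 := hs δ ⟨hδ.le, by linarith⟩
    have e2 := hs (δ + δ) ⟨by linarith, by linarith⟩
    rw [sub_add_cancel] at e1
    rw [show r - δ + (δ + δ) = r + δ by ring, hr δ ⟨hδ.le, le_rfl⟩] at e2
    rw [hl δ ⟨hδ.le, le_rfl⟩] at e1 e2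
    have hδc : (δ : ℂ) ≠ 0 := by exact_mod_cast hδ.ne'
    push_cast at e2
    refine mul_left_cancel₀ hδc ?_
    linear_combination e2 - 2 * e1

end SimplePolygon

end

/-! ### Half-polygons and straight extension to the boundary -/

section
open Complex Set Filter Topology

theorem joinedIn_of_continuousOn {γ : ℝ → ℂ} {a b : ℝ} {F : Set ℂ} (hc : ContinuousOn γ (Icc a b))
    (hF : MapsTo γ (Icc a b) F) {r s : ℝ} (hr : r ∈ Icc a b) (hs : s ∈ Icc a b) :
    JoinedIn F (γ r) (γ s) :=
  (((convex_Icc a b).isPathConnected ⟨r, hr⟩).image' hc |>.joinedIn _ ⟨r, hr, rfl⟩ _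
    ⟨s, hs, rfl⟩).mono (image_subset_iff.2 hF)

theorem joinedIn_of_segment_subset {F : Set ℂ} {x y : ℂ} (h : segment ℝ x y ⊆ F) :
    JoinedIn F x y :=
  ((convex_segment x y).isPathConnected ⟨x, left_mem_segment ℝ x y⟩ |>.joinedIn _
    (left_mem_segment ℝ x y) _ (right_mem_segment ℝ x y)).mono h

theorem isClosed_segment (x y : ℂ) : IsClosed (segment ℝ x y) := by
  rw [← convexHull_pair]
  exact ((by simp : ({x, y} : Set ℂ).Finite).isCompact_convexHull ℝ).isClosed

namespace SimplePolygon
variable {n : ℕ} [NeZero n] {P : SimplePolygon n}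

/-- A ray from a point of the region stays in the region until it meets the boundary. -/
theorem exists_ray_exit {c x : ℂ} (hc : c ∈ P.region) (hx : x ≠ 0) :
    ∃ h : ℝ, 0 ≤ h ∧ (∀ k ∈ Icc 0 h, c + k * x ∈ P.region) ∧ c + h * x ∈ P.boundary := by
  obtain ⟨M, hM, hR⟩ := P.exists_norm_lt_of_mem_region
  have hcont : Continuous fun k : ℝ => c + k * x := by fun_prop
  set A : Set ℝ := Ici 0 ∩ (fun k : ℝ => c + k * x) ⁻¹' P.innerᶜ with hA
  have hAc : IsClosed A := isClosed_Ici.inter (P.isOpen_inner.isClosed_compl.preimage hcont)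
  have hxn := norm_pos_iff.2 hx
  have hAne : A.Nonempty := by
    refine ⟨(M + ‖c‖) / ‖x‖, by have := norm_nonneg c; simp only [mem_Ici]; positivity, fun h => ?_⟩
    have h1 := hR _ h.1
    have h2 : ‖(((M + ‖c‖) / ‖x‖ : ℝ) : ℂ) * x‖ = M + ‖c‖ := by
      rw [norm_mul, norm_real, Real.norm_of_nonneg (by have := norm_nonneg c; positivity),
        div_mul_cancel₀ _ hxn.ne']
    have h3 := norm_sub_le (c + (((M + ‖c‖) / ‖x‖ : ℝ) : ℂ) * x) c
    rw [add_sub_cancel_left, h2] at h3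
    linarith
  have hbdd : BddBelow A := ⟨0, fun k hk => hk.1⟩
  have hmem := hAc.csInf_mem hAne hbdd
  set h := sInf A
  have hlt : ∀ k, 0 ≤ k → k < h → c + k * x ∈ P.inner := by
    intro k hk0 hkh
    by_contra hn
    exact absurd (csInf_le hbdd ⟨hk0, hn⟩) (not_le.2 hkh)
  have hh0 : 0 ≤ h := hmem.1
  have hhR : c + h * x ∈ P.region := by
    rcases hh0.eq_or_lt with he | h0
    · rw [← he]; simpa using hc
    · have hcl : h ∈ closure (Ico 0 h) := by
        rw [closure_Ico h0.ne]; exact ⟨h0.le, le_rfl⟩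
      have := map_mem_closure hcont hcl (t := P.region) fun k hk => (hlt k hk.1 hk.2).1
      rwa [P.isClosed_region.closure_eq] at this
  refine ⟨h, hh0, fun k hk => ?_, ?_⟩
  · rcases hk.2.eq_or_lt with rfl | hkh
    · exact hhR
    · exact (hlt k hk.1 hkh).1
  · by_contra hb
    exact hmem.2 ⟨hhR, hb⟩

/-- Simplicity makes the parameters of an arc unique up to a common multiple of the period, so arcs
become parameter intervals. -/
theorem cwArc_eq {p q : ℂ} {s t : ℝ} (hp : P.bdryPoint s = p) (hq : P.bdryPoint t = q)
    (hst : s ≤ t) (htn : t < s + n) : P.cwArc p q = P.bdryPoint '' Icc s t := by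
  ext x
  constructor
  · rintro ⟨s', t', u', h1, h2, h3, e1, e2, e3⟩
    obtain ⟨m, hm⟩ := P.bdryPoint_eq_iff.1 (hp.trans e1.symm)
    have e4 : P.bdryPoint (u' + m * n) = P.bdryPoint t := by rw [P.bdryPoint_add_int, e3, hq]
    have e5 := P.bdryPoint_inj e4 (by linarith) (by linarith)
    exact ⟨t' + m * n, ⟨by linarith, by linarith⟩, by rw [P.bdryPoint_add_int, e2]⟩
  · rintro ⟨u, hu, rfl⟩
    exact ⟨s, u, t, hu.1, hu.2, htn, hp, rfl, hq⟩

namespace HalfPolygon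
variable {H : P.HalfPolygon}

theorem cwArc_subset_carrier (H : P.HalfPolygon) : P.cwArc H.p H.q ⊆ H.carrier := by
  intro x hx
  by_cases h : x ∈ segment ℝ H.p H.q
  · exact Or.inl h
  · refine Or.inr ⟨x, hx, JoinedIn.refl ⟨?_, h⟩⟩
    obtain ⟨s, t, u, -, -, -, -, e, -⟩ := hx
    rw [← e]; exact P.boundary_subset_region (P.bdryPoint_mem t)

theorem mem_carrier_of_joinedIn {x y : ℂ} (h : JoinedIn (P.region \ segment ℝ H.p H.q) x y)
    (hy : y ∈ H.carrier) : x ∈ H.carrier := by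
  rcases hy with hy | ⟨z, hz, hyz⟩
  · exact absurd hy h.target_mem.2
  · exact Or.inr ⟨z, hz, h.trans hyz⟩

/-- A curve enters a half-polygon through its chord. -/
theorem exists_first_hit {γ : ℝ → ℂ} {a b : ℝ} (hc : ContinuousOn γ (Icc a b)) (hab : a ≤ b)
    (hR : MapsTo γ (Icc a b) P.region) (ha : γ a ∉ H.carrier) (hb : γ b ∈ H.carrier) :
    ∃ r ∈ Ioc a b, γ r ∈ segment ℝ H.p H.q ∧ ∀ s ∈ Ico a r, γ s ∉ H.carrier := by
  have hcomp : IsCompact (Icc a b ∩ γ ⁻¹' segment ℝ H.p H.q) :=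
    isCompact_Icc.of_isClosed_subset
      (hc.preimage_isClosed_of_isClosed isClosed_Icc (isClosed_segment _ _)) inter_subset_left
  have hne : (Icc a b ∩ γ ⁻¹' segment ℝ H.p H.q).Nonempty := by
    by_contra hn
    rw [not_nonempty_iff_eq_empty, eq_empty_iff_forall_notMem] at hn
    have hF : MapsTo γ (Icc a b) (P.region \ segment ℝ H.p H.q) :=
      fun r hr => ⟨hR hr, fun h => hn r ⟨hr, h⟩⟩
    exact ha (mem_carrier_of_joinedIn (joinedIn_of_continuousOn hc hF ⟨le_rfl, hab⟩ ⟨hab, le_rfl⟩) hb)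
  obtain ⟨r, ⟨hr, hrs⟩, hmin⟩ := hcomp.exists_isLeast hne
  refine ⟨r, ⟨hr.1.lt_of_ne ?_, hr.2⟩, hrs, fun s hs hsc => ?_⟩
  · rintro rfl; exact ha (Or.inl hrs)
  · refine ha (mem_carrier_of_joinedIn (joinedIn_of_continuousOn (a := a) (b := s)
      (hc.mono (Icc_subset_Icc le_rfl (hs.2.le.trans hr.2))) (fun u hu => ?_) ⟨le_rfl, hs.1⟩
      ⟨hs.1, le_rfl⟩) hsc)
    have hu' : u ∈ Icc a b := ⟨hu.1, (hu.2.trans hs.2.le).trans hr.2⟩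
    refine ⟨hR hu', fun h => ?_⟩
    linarith [hmin ⟨hu', h⟩, hu.2, hs.2]

/-- The arc belongs to the half-polygon and hence avoids the root; clockwise from the root, `p` and
`q` therefore come in this order before the root recurs. -/
theorem exists_params {s : ℝ} (H : P.HalfPolygon) (ha : P.bdryPoint s ∉ H.carrier) :
    ∃ t u : ℝ, s < t ∧ t < u ∧ u < s + n ∧ P.bdryPoint t = H.p ∧ P.bdryPoint u = H.q := by
  obtain ⟨t, ht, hp⟩ := P.exists_param H.p_mem s
  obtain ⟨u, hu, hq⟩ := P.exists_param H.q_mem t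
  have harc := cwArc_eq hp hq hu.1 hu.2
  have hn : ∀ r ∈ Icc t u, P.bdryPoint r ≠ P.bdryPoint s := fun r hr he =>
    ha (H.cwArc_subset_carrier (by rw [harc, ← he]; exact ⟨r, hr, rfl⟩))
  refine ⟨t, u, ht.1.lt_of_ne ?_, hu.1.lt_of_ne ?_, ?_, hp, hq⟩
  · rintro rfl; exact hn s ⟨le_rfl, hu.1⟩ rfl
  · rintro rfl; exact H.ne (hp.symm.trans hq)
  · by_contra! h
    exact hn (s + n) ⟨ht.2.le, h⟩ (P.bdryPoint_add s)

/-- A shortest path to a half-polygon, extended straight beyond the chord to the boundary. -/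
structure IsExtension (H : P.HalfPolygon) (σ : PlanePath) (γ : ℝ → ℂ) (M : ℝ) : Prop where
  length_pos : 0 < σ.length
  length_le : σ.length ≤ M
  eqOn : EqOn γ σ.curve (Icc 0 σ.length)
  taut : P.IsTautOn γ 0 M
  mem_segment_iff : ∀ r ∈ Icc 0 M, γ r ∈ segment ℝ H.p H.q ↔ r = σ.length
  mem_carrier_iff : ∀ r ∈ Icc 0 M, γ r ∈ H.carrier ↔ σ.length ≤ r
  straight : ∃ d : ℂ, ‖d‖ = 1 ∧ (∀ h ∈ Icc 0 (M - σ.length), γ (σ.length + h) =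
    γ σ.length + h * -d) ∧ ∃ δ > 0, δ ≤ σ.length ∧
      ∀ h ∈ Icc 0 δ, γ (σ.length - h) = γ σ.length + h * d
  end_mem : γ M ∈ P.cwArc H.p H.q

theorem _root_.IsShortestPath.notMem_carrier {a : ℂ} {σ : PlanePath}
    (h : IsShortestPath P.region a H.carrier σ) {r : ℝ} (hr : r ∈ Ico 0 σ.length) :
    σ.curve r ∉ H.carrier := fun hm => by
  linarith [h.le_of_mem_target hr.1 hr.2.le hm (h.mapsTo ⟨hr.1, hr.2.le⟩), hr.2]

theorem _root_.IsShortestPath.length_pos {a : ℂ} {σ : PlanePath}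
    (h : IsShortestPath P.region a H.carrier σ) (ha : a ∉ H.carrier) : 0 < σ.length := by
  refine h.length_nonneg.lt_of_ne fun he => ha ?_
  have := h.target
  rwa [← he, h.source] at this

theorem _root_.IsShortestPath.mem_segment {a : ℂ} {σ : PlanePath}
    (h : IsShortestPath P.region a H.carrier σ) (ha : a ∉ H.carrier) :
    σ.curve σ.length ∈ segment ℝ H.p H.q := by
  obtain ⟨r, hr, hs, -⟩ := exists_first_hit h.continuousOn h.length_nonneg h.mapsTo
    (by rwa [h.source]) h.target
  rcases hr.2.eq_or_lt with rfl | hlt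
  · exact hs
  · exact absurd (Or.inl hs) (h.notMem_carrier ⟨hr.1.le, hlt⟩)

/-- The straight extension of a shortest path beyond the chord of a half-polygon hits the boundary
in the boundary part of the half-polygon. -/
theorem _root_.IsShortestPath.exists_exit {s : ℝ} {σ : PlanePath}
    (h : IsShortestPath P.region (P.bdryPoint s) H.carrier σ) (ha : P.bdryPoint s ∉ H.carrier)
    {d : ℂ} (hd1 : ‖d‖ = 1) {δ : ℝ} (hδ : 0 < δ) (hδl : δ ≤ σ.length)
    (hd : ∀ k ∈ Icc 0 δ, σ.curve (σ.length - k) = σ.curve σ.length + k * d) :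
    ∃ m : ℝ, 0 ≤ m ∧ (∀ k ∈ Icc 0 m, σ.curve σ.length + k * -d ∈ P.region) ∧
      (∀ k ∈ Ioc 0 m, σ.curve σ.length + k * -d ∉ segment ℝ H.p H.q) ∧
      σ.curve σ.length + m * -d ∈ P.cwArc H.p H.q := by
  set c := σ.curve σ.length with hc
  -- If the path already ends on the arc, nothing is added. Otherwise `c` is an interior point of
  -- the chord.
  by_cases harc : c ∈ P.cwArc H.p H.q
  · refine ⟨0, le_rfl, fun k hk => ?_, fun k hk => absurd hk.1 (not_lt.2 hk.2), by simpa⟩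
    obtain rfl : k = 0 := le_antisymm hk.2 hk.1
    simpa using h.mapsTo ⟨h.length_nonneg, le_rfl⟩
  have hd0 : d ≠ 0 := by rintro rfl; simp at hd1
  obtain ⟨t, u, hst, htu, hus, hp, hq⟩ := H.exists_params ha
  rw [cwArc_eq hp hq htu.le (by linarith)] at harc ⊢
  have hcseg := h.mem_segment ha
  have hcR : c ∈ P.region := h.mapsTo ⟨h.length_nonneg, le_rfl⟩
  obtain ⟨θ, hθ, hcθ⟩ : ∃ θ ∈ Ioo (0 : ℝ) 1, c = H.p + θ * (H.q - H.p) := by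
    have := hcseg
    rw [segment_eq_image'] at this
    obtain ⟨θ, hθ, e⟩ := this
    simp only [real_smul] at e
    refine ⟨θ, ⟨hθ.1.lt_of_ne ?_, hθ.2.lt_of_ne ?_⟩, e.symm⟩
    · rintro rfl
      exact harc ⟨t, ⟨le_rfl, htu.le⟩, by rw [hp, hc, ← e]; simp⟩
    · rintro rfl
      exact harc ⟨u, ⟨htu.le, le_rfl⟩, by rw [hq, hc, ← e]; simp⟩
  set w := H.q - H.p with hw
  have hsegw : ∀ k : ℝ, 0 ≤ θ + k → θ + k ≤ 1 → c + k * w ∈ segment ℝ H.p H.q := by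
    intro k h1 h2
    rw [segment_eq_image']
    refine ⟨θ + k, ⟨h1, h2⟩, ?_⟩
    simp only [real_smul]; rw [hcθ]; push_cast; ring
  -- Arriving along the chord would mean having met it earlier.
  have hpar : ∀ k : ℝ, d ≠ k * w := by
    intro k hk
    obtain ⟨r, hr0, hrδ, h1, h2⟩ : ∃ r > 0, r ≤ δ ∧ 0 ≤ θ + r * k ∧ θ + r * k ≤ 1 := by
      have hm : 0 < min θ (1 - θ) := lt_min hθ.1 (by linarith [hθ.2])
      have hk1 : 0 < 1 + |k| := by positivity
      refine ⟨min δ (min θ (1 - θ) / (1 + |k|)), lt_min hδ (by positivity), min_le_left _ _, ?_⟩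
      set r := min δ (min θ (1 - θ) / (1 + |k|))
      have hr0 : 0 < r := lt_min hδ (by positivity)
      have h3 : r * (1 + |k|) ≤ min θ (1 - θ) := by
        rw [← le_div_iff₀ hk1]; exact min_le_right _ _
      have h4 : |r * k| ≤ min θ (1 - θ) := by
        rw [abs_mul, abs_of_pos hr0]; nlinarith
      have h5 := abs_le.1 h4
      constructor
      · linarith [h5.1, min_le_left θ (1 - θ)]
      · linarith [h5.2, min_le_right θ (1 - θ)]
    have := hsegw (r * k) h1 h2
    refine h.notMem_carrier (r := σ.length - r) ⟨by linarith, by linarith⟩ (Or.inl ?_)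
    rw [hd r ⟨hr0.le, hrδ⟩, hk]
    convert this using 1
    push_cast; ring
  have hoff : ∀ k : ℝ, k ≠ 0 → c + k * -d ∉ segment ℝ H.p H.q := by
    intro k hk hmem
    rw [segment_eq_image'] at hmem
    obtain ⟨θ', -, e⟩ := hmem
    simp only [real_smul] at e
    have hkc : (k : ℂ) ≠ 0 := by exact_mod_cast hk
    refine hpar ((θ - θ') / k) ?_
    rw [hcθ] at e
    push_cast
    field_simp
    linear_combination e
  have hθ1 : (0 : ℝ) < 1 - θ := by linarith [hθ.2]
  have eP : H.p - c = -θ * w := by rw [hcθ]; ring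
  have eQ : H.q - c = (1 - θ : ℝ) * w := by rw [hcθ, hw]; push_cast; ring
  have hw0 : w ≠ 0 := sub_ne_zero.2 H.ne.symm
  have hPc : H.p - c ≠ 0 := by
    rw [eP]; exact mul_ne_zero (neg_ne_zero.2 (by exact_mod_cast hθ.1.ne')) hw0
  have hQc : H.q - c ≠ 0 := by
    rw [eQ]; exact mul_ne_zero (by exact_mod_cast hθ1.ne') hw0
  have harcc : IsCompact (P.bdryPoint '' Icc t u) := isCompact_Icc.image P.continuous_bdryPoint
  -- The arc and the chord form a loop, with `c` as a corner whose angle is π.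
  have hloop : IsCornerLoop (P.bdryPoint '' Icc t u ∪ segment ℝ H.p H.q) c (H.p - c)
      (H.q - c) := by
    refine ⟨hPc, hQc, ?_, ?_, P.bdryPoint '' Icc t u, harcc.isClosed, harc,
      subset_union_left, ?_⟩
    · rw [add_sub_cancel]
      exact ((convex_segment _ _).segment_subset hcseg (left_mem_segment _ _ _)).trans
        subset_union_right
    · rw [add_sub_cancel]
      exact ((convex_segment _ _).segment_subset hcseg (right_mem_segment _ _ _)).trans
        subset_union_right
    · rw [add_sub_cancel, add_sub_cancel, ← hp, ← hq]
      exact ((P.isLocallyStraight_bdryPoint t u).polyJoined le_rfl htu.le le_rfl).symm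
  have hLR : P.bdryPoint '' Icc t u ∪ segment ℝ H.p H.q ⊆ P.region := by
    refine union_subset ?_ H.chord_subset
    rintro _ ⟨r, -, rfl⟩; exact P.boundary_subset_region (P.bdryPoint_mem r)
  have hLc : IsClosed (P.bdryPoint '' Icc t u ∪ segment ℝ H.p H.q) :=
    harcc.isClosed.union (isClosed_segment _ _)
  obtain ⟨N, hNc, hN, hz0, hside⟩ := hloop.exists_side
  -- The path comes from the root, which lies on the other arc, without meeting the chord before its
  -- end, so `N` is 0 just before `c`.
  have hbelow : ∀ k ∈ Ioc 0 δ, N (c + k * d) = 0 := by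
    intro k hk
    rw [← hd k ⟨hk.1.le, hk.2⟩]
    have hmem : σ.length - k ∈ Ico 0 σ.length := ⟨by linarith [hk.2], by linarith [hk.1]⟩
    have hzR := h.mapsTo (Ico_subset_Icc_self hmem)
    have hev := P.side_eq_zero (isClosed_segment _ _) hLR rfl hNc hN hz0
      (C := σ.curve '' Ico 0 σ.length)
      (isPreconnected_Ico.image _ (h.continuousOn.mono Ico_subset_Icc_self))
      (image_subset_iff.2 (h.mapsTo.mono_left Ico_subset_Icc_self))
      (Set.disjoint_left.2 (by
        rintro _ ⟨r, hr, rfl⟩ hs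
        exact h.notMem_carrier hr (Or.inl hs)))
      (t₂ := s + n) ⟨hus, by linarith⟩
      ⟨0, ⟨le_rfl, hδ.trans_le hδl⟩, by rw [P.bdryPoint_add, h.source]⟩
      (z := σ.curve (σ.length - k)) ⟨_, hmem, rfl⟩
    have hnL : σ.curve (σ.length - k) ∉ P.bdryPoint '' Icc t u ∪ segment ℝ H.p H.q := by
      intro hL
      refine h.notMem_carrier hmem ?_
      rcases hL with hL | hL
      · exact H.cwArc_subset_carrier (by rwa [cwArc_eq hp hq htu.le (by linarith)])
      · exact Or.inl hL
    have hev2 := (winding_eventually_eq hLc hNc hN hnL).filter_mono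
      (nhdsWithin_le_nhds (s := P.inner))
    have := P.mem_closure_inner hzR
    obtain ⟨z, hz1, hz2⟩ := (hev.and hev2).exists
    exact hz2 ▸ hz1
  have hangP : cwAng (H.q - c) (H.p - c) = Real.pi := by
    have : H.p - c = (θ / (1 - θ) : ℝ) * -(H.q - c) := by
      have : ((1 - θ : ℝ) : ℂ) ≠ 0 := by exact_mod_cast hθ1.ne'
      rw [eP, eQ]; push_cast at this ⊢; field_simp
    rw [this, cwAng_smul hQc (neg_ne_zero.2 hQc) (div_pos hθ.1 hθ1), cwAng_neg_self hQc]
  have hang0 : cwAng (H.q - c) d ≠ 0 := by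
    intro h0
    obtain ⟨k, -, hk⟩ := exists_pos_mul_of_cwAng_eq hQc hd0 hQc (h0.trans (cwAng_self hQc).symm)
    exact hpar (k * (1 - θ)) (by rw [hk, eQ]; push_cast; ring)
  have hangpi : cwAng (H.q - c) d ≠ Real.pi := by
    intro h0
    obtain ⟨k, -, hk⟩ := exists_pos_mul_of_cwAng_eq hQc hd0 hPc (h0.trans hangP.symm)
    exact hpar (k * -θ) (by rw [hk, eP]; push_cast; ring)
  have hfreq : ∃ᶠ r : ℝ in 𝓝[>] 0, N (c + r * d) = 0 := by
    refine Eventually.frequently ?_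
    filter_upwards [Ioc_mem_nhdsGT hδ] with r hr using hbelow r hr
  have hnd0 : -d ≠ 0 := neg_ne_zero.2 hd0
  -- The jump makes `N` nonzero just beyond the chord; such points lie in the region, so the
  -- extension can start.
  have habove : ∀ᶠ r : ℝ in 𝓝[>] 0, N (c + r * -d) ≠ 0 := by
    rcases lt_or_gt_of_ne hangpi with hlt | hgt
    · have := cwAng_neg hQc hd0 hlt
      have hpos := (cwAng_nonneg (H.q - c) d).lt_of_ne hang0.symm
      exact (hside (-d) d hnd0 hd0 (by rw [hangP, this]; linarith) hpos (by rwa [hangP])).2 hfreq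
    · have := cwAng_neg_of_pi_le hQc hd0 hgt.le
      exact (hside d (-d) hd0 hnd0 (by rwa [hangP]) (by rw [this]; linarith)
        (by rw [hangP, this]; linarith [cwAng_lt (H.q - c) d])).1 hfreq
  have hnarc : ∀ᶠ r : ℝ in 𝓝[>] 0, c + r * -d ∉ P.bdryPoint '' Icc t u :=
    (tendsto_add_mul c (-d)).eventually (harcc.isClosed.isOpen_compl.mem_nhds harc)
  obtain ⟨h₀, hh₀, hh₀'⟩ := mem_nhdsGT_iff_exists_Ioc_subset.1 (habove.and hnarc)
  have hh₀pos : (0 : ℝ) < h₀ := hh₀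
  have hnear : ∀ k ∈ Icc 0 h₀, c + k * -d ∈ P.region := by
    intro k hk
    rcases hk.1.eq_or_lt with rfl | hk0
    · simpa using hcR
    · by_contra hR
      exact (hh₀' ⟨hk0, hk.2⟩).1 (P.winding_eq_zero hLR hNc hN hz0 hR)
  obtain ⟨m, hm0, hmR, hmb⟩ := P.exists_ray_exit (hnear h₀ ⟨hh₀pos.le, le_rfl⟩) hnd0
  have hall : ∀ k ∈ Icc 0 (h₀ + m), c + k * -d ∈ P.region := by
    intro k hk
    rcases le_total k h₀ with hle | hle
    · exact hnear k ⟨hk.1, hle⟩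
    · have := hmR (k - h₀) ⟨by linarith, by linarith [hk.2]⟩
      convert this using 1
      push_cast; ring
  have hend : c + (h₀ + m : ℝ) * -d = c + h₀ * -d + m * -d := by push_cast; ring
  refine ⟨h₀ + m, by linarith, hall, fun k hk => hoff k hk.1.ne', ?_⟩
  rw [← hend] at hmb
  obtain ⟨r, hr, hre⟩ := P.exists_param hmb t
  rcases le_or_gt r u with hru | hru
  · exact ⟨r, ⟨hr.1, hru⟩, hre⟩
  exfalso
  -- An exit on the other arc would force `N` to vanish along the ray, against its nonzero value
  -- just beyond the chord.
  have hev := P.side_eq_zero (isClosed_segment _ _) hLR rfl hNc hN hz0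
    (C := (fun k : ℝ => c + k * -d) '' Ioc 0 (h₀ + m))
    (isPreconnected_Ioc.image _ (Continuous.continuousOn (by fun_prop)))
    (image_subset_iff.2 fun k hk => hall k (Ioc_subset_Icc_self hk))
    (Set.disjoint_left.2 (by
      rintro _ ⟨k, hk, rfl⟩ hs
      exact hoff k hk.1.ne' hs))
    (t₂ := r) ⟨hru, hr.2⟩ ⟨h₀ + m, ⟨by linarith, le_rfl⟩, hre.symm⟩
    (z := c + h₀ * -d) ⟨h₀, ⟨hh₀pos, by linarith⟩, rfl⟩
  have hh := hh₀' (show h₀ ∈ Ioc 0 h₀ from ⟨hh₀pos, le_rfl⟩)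
  have hnL : c + h₀ * -d ∉ P.bdryPoint '' Icc t u ∪ segment ℝ H.p H.q := by
    rintro (hL | hL)
    · exact hh.2 hL
    · exact hoff h₀ hh₀pos.ne' hL
  have hev2 := (winding_eventually_eq hLc hNc hN hnL).filter_mono
    (nhdsWithin_le_nhds (s := P.inner))
  have := P.mem_closure_inner (hnear h₀ ⟨hh₀pos.le, le_rfl⟩)
  obtain ⟨z, hz1, hz2⟩ := (hev.and hev2).exists
  exact hh.1 (hz2 ▸ hz1)

/-- The extension continues in the direction of arrival, so it creates no bend at the chord or after
it. Injectivity holds because the path avoids the half-polygon before the chord and the extension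
stays in it. -/
theorem _root_.IsShortestPath.exists_isExtension {s : ℝ} {σ : PlanePath}
    (h : IsShortestPath P.region (P.bdryPoint s) H.carrier σ) (ha : P.bdryPoint s ∉ H.carrier) :
    ∃ γ M, H.IsExtension σ γ M := by
  have hl := h.length_pos ha
  have ht := isTautOn_of_isShortestPath h
  obtain ⟨δ, hδ, d, hd1, hδl, hd⟩ := ht.left σ.length ⟨hl, le_rfl⟩
  rw [sub_nonneg] at hδl
  obtain ⟨m, hm, hmR, hmseg, hmarc⟩ := h.exists_exit ha hd1 hδ hδl hd
  set ℓ := σ.length with hℓ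
  set c := σ.curve ℓ with hc
  have hd0 : d ≠ 0 := by rintro rfl; simp at hd1
  set γ : ℝ → ℂ := fun r => if r ≤ ℓ then σ.curve r else c + (r - ℓ : ℝ) * -d with hγ
  have e1 : ∀ r ≤ ℓ, γ r = σ.curve r := fun r hr => if_pos hr
  have e2 : ∀ r, ℓ ≤ r → γ r = c + (r - ℓ : ℝ) * -d := fun r hr => by
    rcases hr.eq_or_lt with rfl | h
    · rw [e1 ℓ le_rfl]; simp [hc]
    · exact if_neg (not_le.2 h)
  have e3 : ∀ r, ℓ ≤ r → ∀ k, 0 ≤ k → γ (r + k) = γ r + k * -d := fun r hr k hk => by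
    rw [e2 r hr, e2 (r + k) (by linarith)]; push_cast; ring
  have e4 : ∀ r, ℓ < r → ∀ k, k ≤ r - ℓ → γ (r - k) = γ r + k * d := fun r hr k hk => by
    rw [e2 r hr.le, e2 (r - k) (by linarith)]; push_cast; ring
  have e5 : ∀ k ∈ Icc 0 δ, γ (ℓ - k) = γ ℓ + k * d := fun k hk => by
    rw [e1 _ (by linarith [hk.1]), e1 ℓ le_rfl, hd k hk]
  have hcseg := h.mem_segment ha
  have hcar1 : ∀ r ∈ Ico 0 ℓ, γ r ∉ H.carrier := fun r hr => by
    rw [e1 r hr.2.le]; exact h.notMem_carrier hr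
  have hseg2 : ∀ r ∈ Ioc ℓ (ℓ + m), γ r ∉ segment ℝ H.p H.q := fun r hr => by
    rw [e2 r hr.1.le]; exact hmseg _ ⟨by linarith [hr.1], by linarith [hr.2]⟩
  have hR2 : ∀ r ∈ Icc ℓ (ℓ + m), γ r ∈ P.region := fun r hr => by
    rw [e2 r hr.1]; exact hmR _ ⟨by linarith [hr.1], by linarith [hr.2]⟩
  have hcont2 : ContinuousOn γ (Icc ℓ (ℓ + m)) :=
    (Continuous.continuousOn (f := fun r : ℝ => c + (r - ℓ : ℝ) * -d) (by fun_prop)).congr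
      fun r hr => e2 r hr.1
  have hM : γ (ℓ + m) ∈ P.cwArc H.p H.q := by
    rw [e2 _ (by linarith), add_sub_cancel_left]; exact hmarc
  -- Beyond the chord the ray is joined, off the chord, to its end on the arc.
  have hcar2 : ∀ r ∈ Icc ℓ (ℓ + m), γ r ∈ H.carrier := by
    intro r hr
    rcases hr.1.eq_or_lt with rfl | hlt
    · rw [e1 ℓ le_rfl]; exact Or.inl hcseg
    · refine mem_carrier_of_joinedIn (joinedIn_of_continuousOn (a := r) (b := ℓ + m)
        (hcont2.mono (Icc_subset_Icc hlt.le le_rfl)) (fun u hu => ?_) ⟨le_rfl, hr.2⟩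
        ⟨hr.2, le_rfl⟩) (H.cwArc_subset_carrier hM)
      exact ⟨hR2 u ⟨hlt.le.trans hu.1, hu.2⟩, hseg2 u ⟨hlt.trans_le hu.1, hu.2⟩⟩
  have hU : Icc 0 (ℓ + m) = Icc 0 ℓ ∪ Icc ℓ (ℓ + m) :=
    (Icc_union_Icc_eq_Icc hl.le (by linarith)).symm
  have hE1 : EqOn γ σ.curve (Icc 0 ℓ) := fun r hr => e1 r hr.2
  refine ⟨γ, ℓ + m, ⟨hl, by linarith, hE1, ?_, ?_, ?_, ⟨d, hd1, ?_, δ, hδ, hδl, e5⟩, hM⟩⟩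
  · constructor
    · rw [hU]
      exact (h.mapsTo.congr hE1.symm).union hR2
    · rw [hU]
      exact (h.continuousOn.congr hE1).union_of_isClosed hcont2 isClosed_Icc isClosed_Icc
    · have key : ∀ r s, 0 ≤ r → r < s → s ≤ ℓ + m → γ r ≠ γ s := by
        intro r s hr hrs hs he
        rcases lt_or_ge r ℓ with h1 | h1
        · rcases le_or_gt s ℓ with h2 | h2
          · rw [e1 r h1.le, e1 s h2] at he
            exact hrs.ne (ht.injOn ⟨hr, h1.le⟩ ⟨hr.trans hrs.le, h2⟩ he)
          · exact hcar1 r ⟨hr, h1⟩ (he ▸ hcar2 s ⟨h2.le, hs⟩)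
        · have := e3 r h1 (s - r) (by linarith)
          rw [add_sub_cancel, ← he, left_eq_add, mul_eq_zero] at this
          rcases this with h2 | h2
          · have : s - r = 0 := by exact_mod_cast h2
            linarith
          · exact neg_ne_zero.2 hd0 h2
      intro r hr s hs he
      rcases lt_trichotomy r s with hlt | hlt | hlt
      · exact absurd he (key r s hr.1 hlt hs.2)
      · exact hlt
      · exact absurd he.symm (key s r hs.1 hlt hr.2)
    · intro r hr
      rcases lt_or_ge r ℓ with h1 | h1
      · obtain ⟨η, hη, x, hx, hle, hf⟩ := ht.right r ⟨hr.1, h1⟩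
        refine ⟨η, hη, x, hx, by linarith, fun k hk => ?_⟩
        rw [e1 r h1.le, e1 _ (by linarith [hk.2]), hf k hk]
      · exact ⟨ℓ + m - r, by linarith [hr.2], -d, by rwa [norm_neg], by linarith,
          fun k hk => e3 r h1 k hk.1⟩
    · intro r hr
      rcases le_or_gt r ℓ with h1 | h1
      · obtain ⟨η, hη, x, hx, hle, hf⟩ := ht.left r ⟨hr.1, h1⟩
        refine ⟨η, hη, x, hx, hle, fun k hk => ?_⟩
        rw [e1 r h1, e1 _ (by linarith [hk.1]), hf k hk]
      · exact ⟨r - ℓ, by linarith, d, hd1, by linarith, fun k hk => e4 r h1 k hk.2⟩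
    · intro r η d' x' hη h1 h2 hd' hx' hr' hl' hseg
      rcases lt_or_ge r ℓ with h3 | h3
      · obtain ⟨η', hη', hle, hle'⟩ : ∃ η' > 0, η' ≤ η ∧ η' ≤ ℓ - r :=
          ⟨min η (ℓ - r), lt_min hη (by linarith), min_le_left _ _, min_le_right _ _⟩
        refine ht.bend r η' d' x' hη' (by linarith) (by linarith) hd' hx' (fun k hk => ?_)
          (fun k hk => ?_) (fun k hk => ?_)
        · rw [← e1 r h3.le, ← e1 _ (by linarith [hk.2]), hr' k ⟨hk.1, hk.2.trans hle⟩]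
        · rw [← e1 r h3.le, ← e1 _ (by linarith [hk.1]), hl' k ⟨hk.1, hk.2.trans hle⟩]
        · rw [← e1 _ (by linarith [hk.1]), ← e1 _ (by linarith [hk.2])]
          exact hseg k ⟨hk.1, hk.2.trans hle⟩
      · have hηc : (η : ℂ) ≠ 0 := by exact_mod_cast hη.ne'
        have hx'd : x' = -d := by
          have := (hr' η ⟨hη.le, le_rfl⟩).symm.trans (e3 r h3 η hη.le)
          exact mul_left_cancel₀ hηc (add_left_cancel this)
        have hd'd : d' = d := by
          rcases h3.eq_or_lt with he | hlt
          · rw [← he] at hl'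
            have hmin : 0 < min η δ := lt_min hη hδ
            have := (hl' _ ⟨hmin.le, min_le_left _ _⟩).symm.trans (e5 _ ⟨hmin.le, min_le_right _ _⟩)
            exact mul_left_cancel₀ (by exact_mod_cast hmin.ne') (add_left_cancel this)
          · have hmin : 0 < min η (r - ℓ) := lt_min hη (by linarith)
            have := (hl' _ ⟨hmin.le, min_le_left _ _⟩).symm.trans (e4 r hlt _ (min_le_right _ _))
            exact mul_left_cancel₀ (by exact_mod_cast hmin.ne') (add_left_cancel this)
        rw [hx'd, hd'd]
  · intro r hr
    constructor
    · intro hs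
      rcases lt_trichotomy r ℓ with hlt | hlt | hlt
      · exact absurd (Or.inl hs) (hcar1 r ⟨hr.1, hlt⟩)
      · exact hlt
      · exact absurd hs (hseg2 r ⟨hlt, hr.2⟩)
    · rintro rfl
      rw [e1 _ le_rfl]; exact hcseg
  · intro r hr
    constructor
    · intro hs
      by_contra! hlt
      exact hcar1 r ⟨hr.1, hlt⟩ hs
    · exact fun hle => hcar2 r ⟨hle, hr.2⟩
  · exact fun k hk => e3 ℓ le_rfl k hk.1

end HalfPolygon
end SimplePolygon

end

/-! ### Nested half-polygons and crossing chords -/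

section
open Complex Set Filter Topology

namespace SimplePolygon
variable {n : ℕ} [NeZero n] {P : SimplePolygon n}

namespace HalfPolygon
variable {H K : P.HalfPolygon}

/-- A point of the chord of `K` outside `H` must be cut off by the chord of `H` from each end of the
chord of `K`. It then lies between two points of the chord of `H`, hence on it. -/
theorem segment_subset_carrier_of_mem (hp : K.p ∈ H.carrier) (hq : K.q ∈ H.carrier) :
    segment ℝ K.p K.q ⊆ H.carrier := by
  intro z hz
  by_contra hzc
  have hmeet : ∀ e, e ∈ segment ℝ K.p K.q → e ∈ H.carrier →
      ∃ y ∈ segment ℝ z e, y ∈ segment ℝ H.p H.q := by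
    intro e he hec
    by_contra! hn
    refine hzc (mem_carrier_of_joinedIn (joinedIn_of_segment_subset fun y hy => ⟨?_, hn y hy⟩) hec)
    exact K.chord_subset ((convex_segment _ _).segment_subset hz he hy)
  obtain ⟨y₁, hy₁, hy₁'⟩ := hmeet _ (left_mem_segment _ _ _) hp
  obtain ⟨y₂, hy₂, hy₂'⟩ := hmeet _ (right_mem_segment _ _ _) hq
  refine hzc (Or.inl ((convex_segment _ _).segment_subset hy₁' hy₂' ?_))
  rw [segment_eq_image'] at hz hy₁ hy₂ ⊢
  obtain ⟨θ, hθ, rfl⟩ := hz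
  obtain ⟨α, hα, rfl⟩ := hy₁
  obtain ⟨β, hβ, rfl⟩ := hy₂
  simp only [real_smul]
  have h1 : 0 ≤ α * θ := mul_nonneg hα.1 hθ.1
  have h2 : 0 ≤ β * (1 - θ) := mul_nonneg hβ.1 (by linarith [hθ.2])
  rcases (add_nonneg h1 h2).eq_or_lt with h0 | h0
  · refine ⟨0, ⟨le_rfl, zero_le_one⟩, ?_⟩
    have : α * θ = 0 := by linarith
    have h3 : (α : ℂ) * θ = 0 := by exact_mod_cast this
    push_cast
    linear_combination (K.p - K.q) * h3
  · obtain ⟨t, ht⟩ : ∃ t, t = α * θ / (α * θ + β * (1 - θ)) := ⟨_, rfl⟩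
    have ht1 : t * (α * θ + β * (1 - θ)) = α * θ := by rw [ht, div_mul_cancel₀ _ h0.ne']
    refine ⟨t, ⟨ht ▸ by positivity, ht ▸ (div_le_one h0).2 (by linarith)⟩, ?_⟩
    have htc : (t : ℂ) * (α * θ + β * (1 - θ)) = α * θ := by exact_mod_cast ht1
    linear_combination (K.q - K.p) * htc

/-- Every point of the region off a chord is joined to the boundary off the chord. -/
theorem exists_joinedIn_bdryPoint (H : P.HalfPolygon) {x : ℂ} (hx : x ∈ P.region)
    (hxs : x ∉ segment ℝ H.p H.q) :
    ∃ t, JoinedIn (P.region \ segment ℝ H.p H.q) x (P.bdryPoint t) := by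
  -- A ray on which a functional separating `x` from the chord increases reaches the boundary
  -- without meeting the chord.
  obtain ⟨f, u, hfu, huf⟩ := geometric_hahn_banach_closed_point (convex_segment H.p H.q)
    (isClosed_segment _ _) hxs
  obtain ⟨c, hc⟩ := exists_re_mul f
  have hc0 : c ≠ 0 := by
    rintro rfl
    have h1 := hfu _ (left_mem_segment ℝ H.p H.q)
    rw [hc] at h1 huf
    simp only [zero_mul, zero_re] at h1 huf
    linarith
  have hcc : starRingEnd ℂ c ≠ 0 := by simpa using hc0
  obtain ⟨h, hh, hR, hb⟩ := exists_ray_exit hx hcc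
  obtain ⟨t, -, ht⟩ := P.exists_param hb 0
  refine ⟨t, ?_⟩
  rw [ht]
  have := joinedIn_of_continuousOn (γ := fun k : ℝ => x + k * starRingEnd ℂ c) (a := 0) (b := h)
    (F := P.region \ segment ℝ H.p H.q) (Continuous.continuousOn (by fun_prop))
    (fun k hk => ⟨hR k hk, fun hs => ?_⟩) ⟨le_rfl, hh⟩ ⟨hh, le_rfl⟩
  · simpa using this
  · have h1 := hfu _ hs
    rw [hc] at h1 huf
    rw [mul_add, mul_left_comm, mul_conj, ← ofReal_mul, add_re, ofReal_re] at h1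
    nlinarith [mul_nonneg hk.1 (normSq_nonneg c)]

/-- A point of `K` outside `H` would be joined off the chord of `H` to a boundary point outside the
arc of `H`. All of this stays outside `H` and so misses the chord of `K`, which lies in `H`. As the
point is also joined to the arc of `K` off that chord, the chord of `K` would fail to separate its
two arcs. -/
theorem carrier_subset_carrier {t u t' u' : ℝ} (ht : P.bdryPoint t = H.p)
    (hu : P.bdryPoint u = H.q) (ht' : P.bdryPoint t' = K.p) (hu' : P.bdryPoint u' = K.q)
    (htt : t ≤ t') (htu' : t' ≤ u') (huu : u' ≤ u) (hun : u < t + n) : K.carrier ⊆ H.carrier := by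
  have htu : t ≤ u := htt.trans (htu'.trans huu)
  have harcH : ∀ r ∈ Icc t u, P.bdryPoint r ∈ H.carrier := fun r hr =>
    H.cwArc_subset_carrier (by rw [cwArc_eq ht hu htu hun]; exact ⟨r, hr, rfl⟩)
  have hseg : segment ℝ K.p K.q ⊆ H.carrier := segment_subset_carrier_of_mem
    (ht' ▸ harcH t' ⟨htt, htu'.trans huu⟩) (hu' ▸ harcH u' ⟨htt.trans htu', huu⟩)
  intro x hx
  by_contra hxH
  rcases hx with hx | ⟨y, hy, hxy⟩
  · exact hxH (hseg hx)
  have hxR := hxy.source_mem.1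
  obtain ⟨r₀, hr₀⟩ := H.exists_joinedIn_bdryPoint hxR fun h => hxH (Or.inl h)
  obtain ⟨r, hr, hre, -⟩ := P.exists_bdryPoint_Ico r₀ t
  rw [← hre] at hr₀
  have hru : u < r := by
    by_contra! hle
    exact hxH (mem_carrier_of_joinedIn hr₀ (harcH r ⟨hr.1, hle⟩))
  have hsub : pathComponentIn (P.region \ segment ℝ H.p H.q) x ⊆
      P.region \ segment ℝ K.p K.q := fun w hw => by
    have hw' : JoinedIn (P.region \ segment ℝ H.p H.q) x w := hw
    exact ⟨hw'.target_mem.1, fun h => hxH (mem_carrier_of_joinedIn hw' (hseg h))⟩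
  have hxr : JoinedIn (P.region \ segment ℝ K.p K.q) x (P.bdryPoint r) :=
    ((isPathConnected_pathComponentIn hr₀.source_mem).joinedIn _
      (mem_pathComponentIn_self hr₀.source_mem) _ hr₀).mono hsub
  rw [cwArc_eq ht' hu' htu' (by linarith)] at hy
  obtain ⟨v, hv, rfl⟩ := hy
  have hvK := hxy.target_mem.2
  have hv' : v ∈ Ioo t' u' := by
    refine ⟨hv.1.lt_of_ne ?_, hv.2.lt_of_ne ?_⟩
    · rintro rfl; exact hvK (ht' ▸ left_mem_segment _ _ _)
    · rintro rfl; exact hvK (hu' ▸ right_mem_segment _ _ _)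
  refine P.separation (S := segment ℝ K.p K.q) K.chord_subset (isClosed_segment _ _)
    (s := t') (t := u') (by linarith) ?_
    (C := pathComponentIn (P.region \ segment ℝ K.p K.q) x)
    (isPathConnected_pathComponentIn hxy.source_mem).isConnected.isPreconnected
    (pathComponentIn_subset.trans sdiff_subset) ?_ hv' ⟨huu.trans_lt hru, by linarith [hr.2]⟩ hxy hxr
  · rw [ht', hu', segment_symm]
    exact PolyJoined.of_segment Subset.rfl
  · exact Set.disjoint_left.2 fun w hw hs => (pathComponentIn_subset hw).2 hs

end HalfPolygon

/-- A taut curve that crosses a chord at the parameter `ℓ`, straight, such that its part up to `ℓ`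
is a shortest connection to the chord. -/
structure IsChordCurve (P : SimplePolygon n) (p q : ℂ) (γ : ℝ → ℂ) (ℓ M : ℝ) : Prop where
  chord_subset : segment ℝ p q ⊆ P.region
  le : ℓ ≤ M
  taut : P.IsTautOn γ 0 M
  mem_segment_iff : ∀ r ∈ Icc 0 M, γ r ∈ segment ℝ p q ↔ r = ℓ
  straight : ∃ d : ℂ, ‖d‖ = 1 ∧ (∀ h ∈ Icc 0 (M - ℓ), γ (ℓ + h) = γ ℓ + h * -d) ∧
    ∃ δ > 0, δ ≤ ℓ ∧ ∀ h ∈ Icc 0 δ, γ (ℓ - h) = γ ℓ + h * d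
  near : ∀ h ∈ Ioc 0 ℓ, ∀ y ∈ segment ℝ p q, segment ℝ (γ (ℓ - h)) y ⊆ P.region →
    h ≤ ‖γ (ℓ - h) - y‖

theorem IsChordCurve.symm {p q : ℂ} {γ : ℝ → ℂ} {ℓ M : ℝ} (h : P.IsChordCurve p q γ ℓ M) :
    P.IsChordCurve q p γ ℓ M := by
  obtain ⟨h1, h2, h3, h4, h5, h6⟩ := h
  rw [segment_symm] at h1 h4 h6
  exact ⟨h1, h2, h3, h4, h5, h6⟩

theorem HalfPolygon.IsExtension.isChordCurve {H : P.HalfPolygon} {a : ℂ} {σ : PlanePath}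
    {γ : ℝ → ℂ} {M : ℝ} (h : H.IsExtension σ γ M) (hσ : IsShortestPath P.region a H.carrier σ) :
    P.IsChordCurve H.p H.q γ σ.length M where
  chord_subset := H.chord_subset
  le := h.length_le
  taut := h.taut
  mem_segment_iff := h.mem_segment_iff
  straight := h.straight
  near k hk y hy hs := by
    have hm : σ.length - k ∈ Icc 0 σ.length := ⟨by linarith [hk.2], by linarith [hk.1]⟩
    rw [h.eqOn hm] at hs ⊢
    have := hσ.sub_le_norm_target hm.1 hm.2 (Or.inl hy) hs
    linarith

/-- Two curves that branch at the parameter `s` and cross both chords. -/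
structure IsCrossing (P : SimplePolygon n) (p q p' q' : ℂ) (γ η : ℝ → ℂ) (s ℓ M r' ℓ' M' r : ℝ) :
    Prop where
  left : P.IsChordCurve p q γ ℓ M
  right : P.IsChordCurve p' q' η ℓ' M'
  nonneg : 0 ≤ s
  eq : γ s = η s
  lt_left : s < ℓ
  lt_right : s < ℓ'
  ne_left : ∀ t ∈ Ioc s M, ∀ t' ∈ Icc 0 M', γ t ≠ η t'
  ne_right : ∀ t ∈ Icc 0 M, ∀ t' ∈ Ioc s M', γ t ≠ η t'
  hit_left : r' ∈ Ioc s M ∧ γ r' ∈ segment ℝ p' q' ∧ ∀ t ∈ Ico 0 r', γ t ∉ segment ℝ p' q'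
  hit_right : r ∈ Ioc s M' ∧ η r ∈ segment ℝ p q ∧ ∀ t ∈ Ico 0 r, η t ∉ segment ℝ p q
  order_left : γ ℓ ∈ segment ℝ (η r) q
  order_right : η ℓ' ∈ segment ℝ (γ r') p'

namespace IsCrossing
variable {p q p' q' : ℂ} {γ η : ℝ → ℂ} {s ℓ M r' ℓ' M' r : ℝ}

/-- Mirror image: exchanging the curves also reverses the chords, since the two order conditions
refer to `q` and to `p'`. -/
theorem symm (h : P.IsCrossing p q p' q' γ η s ℓ M r' ℓ' M' r) :
    P.IsCrossing q' p' q p η γ s ℓ' M' r ℓ M r' where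
  left := h.right.symm
  right := h.left.symm
  nonneg := h.nonneg
  eq := h.eq.symm
  lt_left := h.lt_right
  lt_right := h.lt_left
  ne_left t ht t' ht' he := h.ne_right t' ht' t ht he.symm
  ne_right t ht t' ht' he := h.ne_left t' ht' t ht he.symm
  hit_left := by rw [segment_symm ℝ q p]; exact h.hit_right
  hit_right := by rw [segment_symm ℝ q' p']; exact h.hit_left
  order_left := h.order_right
  order_right := h.order_left

/-- `triangle_angles` for the triangle formed by `γ` from `s` to `ℓ`, `η` from `s` to `r`, and the
chord piece between their ends. -/
theorem angles (h : P.IsCrossing p q p' q' γ η s ℓ M r' ℓ' M' r) {d₁ d₂ : ℂ} {δ : ℝ} (hδ : 0 < δ)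
    (hδ₁ : s ≤ ℓ - δ) (hδ₂ : s ≤ r - δ) (hn₁ : ‖d₁‖ = 1) (hn₂ : ‖d₂‖ = 1)
    (hd₁ : ∀ k ∈ Icc 0 δ, γ (ℓ - k) = γ ℓ + k * d₁)
    (hd₂ : ∀ k ∈ Icc 0 δ, η (r - k) = η r + k * d₂) :
    (starRingEnd ℂ (η r - γ ℓ) * d₁).re ≤ 0 ∧ 0 < (starRingEnd ℂ (γ ℓ - η r) * d₂).re := by
  have hs := h.nonneg
  have hℓ := h.lt_left
  have hM := h.left.le
  have hr := h.hit_right.1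
  have hc : γ ℓ ∈ segment ℝ p q := (h.left.mem_segment_iff ℓ ⟨by linarith, hM⟩).2 rfl
  have hsub : segment ℝ (γ ℓ) (η r) ⊆ segment ℝ p q :=
    (convex_segment _ _).segment_subset hc h.hit_right.2.1
  refine (h.left.taut.mono hs hM).triangle_angles (h.right.taut.mono hs hr.2) h.eq
    (fun t ht t' ht' he => ?_) (hsub.trans h.left.chord_subset) (fun t ht hm => ?_)
    (fun t ht hm => ?_) hδ hδ₁ hδ₂ hn₁ hn₂ hd₁ hd₂ (fun k hk y hy hseg => ?_)
  · by_contra hne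
    exact h.ne_left t ⟨ht.1.lt_of_ne (Ne.symm hne), ht.2.trans hM⟩ t'
      ⟨hs.trans ht'.1, ht'.2.trans hr.2⟩ he
  · exact (h.left.mem_segment_iff t ⟨hs.trans ht.1, ht.2.trans hM⟩).1 (hsub hm)
  · by_contra hne
    exact h.hit_right.2.2 t ⟨hs.trans ht.1, ht.2.lt_of_ne hne⟩ (hsub hm)
  · exact h.left.near k ⟨hk.1, by linarith [hk.2]⟩ y (hsub hy) hseg

theorem re_nonpos (h : P.IsCrossing p q p' q' γ η s ℓ M r' ℓ' M' r) {d : ℂ} {δ : ℝ} (hδ : 0 < δ)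
    (hn : ‖d‖ = 1) (hd : ∀ k ∈ Icc 0 δ, γ (ℓ - k) = γ ℓ + k * d) :
    (starRingEnd ℂ (η r - γ ℓ) * d).re ≤ 0 := by
  have hr := h.hit_right.1
  obtain ⟨δ', hδ', d', hn', -, hd'⟩ := h.right.taut.left r ⟨h.nonneg.trans_lt hr.1, hr.2⟩
  obtain ⟨ε, hε, h1, h2, h3, h4⟩ : ∃ ε > 0, ε ≤ δ ∧ ε ≤ δ' ∧ ε ≤ ℓ - s ∧ ε ≤ r - s :=
    ⟨min (min δ δ') (min (ℓ - s) (r - s)),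
      lt_min (lt_min hδ hδ') (lt_min (sub_pos.2 h.lt_left) (sub_pos.2 hr.1)),
      (min_le_left _ _).trans (min_le_left _ _), (min_le_left _ _).trans (min_le_right _ _),
      (min_le_right _ _).trans (min_le_left _ _), (min_le_right _ _).trans (min_le_right _ _)⟩
  exact (h.angles hε (by linarith) (by linarith) hn hn'
    (fun k hk => hd k ⟨hk.1, hk.2.trans h1⟩) (fun k hk => hd' k ⟨hk.1, hk.2.trans h2⟩)).1

theorem re_pos (h : P.IsCrossing p q p' q' γ η s ℓ M r' ℓ' M' r) {d : ℂ} {δ : ℝ} (hδ : 0 < δ)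
    (hn : ‖d‖ = 1) (hd : ∀ k ∈ Icc 0 δ, η (r - k) = η r + k * d) :
    0 < (starRingEnd ℂ (γ ℓ - η r) * d).re := by
  have hr := h.hit_right.1
  obtain ⟨d', hn', -, δ', hδ', -, hd'⟩ := h.left.straight
  obtain ⟨ε, hε, h1, h2, h3, h4⟩ : ∃ ε > 0, ε ≤ δ ∧ ε ≤ δ' ∧ ε ≤ ℓ - s ∧ ε ≤ r - s :=
    ⟨min (min δ δ') (min (ℓ - s) (r - s)),
      lt_min (lt_min hδ hδ') (lt_min (sub_pos.2 h.lt_left) (sub_pos.2 hr.1)),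
      (min_le_left _ _).trans (min_le_left _ _), (min_le_left _ _).trans (min_le_right _ _),
      (min_le_right _ _).trans (min_le_left _ _), (min_le_right _ _).trans (min_le_right _ _)⟩
  exact (h.angles hε (by linarith) (by linarith) hn' hn
    (fun k hk => hd' k ⟨hk.1, hk.2.trans h2⟩) (fun k hk => hd k ⟨hk.1, hk.2.trans h1⟩)).2

/-- The curves cannot cross the second chord each at the nearest point of the other. -/
theorem false_of_eq (h : P.IsCrossing p q p' q' γ η s ℓ M r' ℓ' M' r) (hr : r = ℓ')
    (hr' : r' = ℓ) : False := by
  obtain ⟨d, hn, -, δ, hδ, -, hd⟩ := h.right.straight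
  -- The direction `d` at `η ℓ'` makes an acute angle with the direction to `γ ℓ` on the first
  -- chord, but a non-acute one with the direction to `γ r'` on the second; under the equalities
  -- these are the same angle.
  have h1 := h.re_pos hδ hn (by rw [hr]; exact hd)
  have h2 := h.symm.re_nonpos hδ hn hd
  rw [hr] at h1
  rw [hr'] at h2
  linarith

set_option maxHeartbeats 1000000 in
/-- If the second curve crosses its own chord before the other one, the chords separate points
that are not separated by the curves. -/
theorem false_of_lt (h : P.IsCrossing p q p' q' γ η s ℓ M r' ℓ' M' r) (hlt : ℓ' < r)
    (hchord : ∀ C, IsPreconnected C → C ⊆ P.region → Disjoint C (segment ℝ p' q') → p ∈ C →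
      η M' ∉ C)
    (hcurve : ∀ C, IsPreconnected C → C ⊆ P.region → Disjoint C (η '' Icc 0 M') → p ∈ C → q' ∉ C) :
    False := by
  obtain ⟨hr, hrm, hrf⟩ := h.hit_right
  obtain ⟨hr', hrm', hrf'⟩ := h.hit_left
  have hs := h.nonneg
  have hℓ0 : 0 ≤ ℓ' := by linarith [h.lt_right]
  have hMI : ∀ {t}, ℓ' ≤ t → t ≤ M' → t ∈ Icc 0 M' := fun h1 h2 => ⟨hℓ0.trans h1, h2⟩
  obtain ⟨d, hn, hfwd, δ, hδ, -, hd⟩ := h.right.straight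
  have hd0 : d ≠ 0 := by rintro rfl; simp at hn
  have hη : ∀ t, ℓ' ≤ t → t ≤ M' → η t = η ℓ' - (t - ℓ' : ℝ) * d := fun t h1 h2 => by
    have := hfwd (t - ℓ') ⟨by linarith, by linarith⟩
    rw [add_sub_cancel] at this
    rw [this]; ring
  have hηr : ∀ t, ℓ' ≤ t → t ≤ M' → η t = η r - (t - r : ℝ) * d := fun t h1 h2 => by
    rw [hη t h1 h2, hη r hlt.le hr.2]; push_cast; ring
  have hback : ∀ k ∈ Icc 0 (r - ℓ'), η (r - k) = η r + k * d := fun k hk => by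
    rw [hηr (r - k) (by linarith [hk.2]) (by linarith [hk.1, hr.2])]; push_cast; ring
  -- `η` is straight from just before `ℓ'` up to `M'`, so the acute angle at `η r` and the non-acute
  -- angle at `η ℓ'` concern the same direction `d`.
  have hpos := h.re_pos (sub_pos.2 hlt) hn hback
  have hneg := h.symm.re_nonpos hδ hn hd
  have hne1 : η r ≠ γ ℓ := fun he => h.ne_right ℓ ⟨by linarith [h.lt_left], h.left.le⟩ r hr he.symm
  have hne2 : γ r' ≠ η ℓ' := h.ne_left r' hr' ℓ' (hMI le_rfl h.right.le)
  have hoff : ∀ t, ℓ' < t → t ≤ M' → η t ∉ segment ℝ p' q' := fun t h1 h2 hm =>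
    h1.ne' ((h.right.mem_segment_iff t (hMI h1.le h2)).1 hm)
  have hc' : η ℓ' ∈ segment ℝ p' q' :=
    (h.right.mem_segment_iff ℓ' (hMI le_rfl h.right.le)).2 rfl
  -- coordinates on the chord `p q`
  set D := q - p with hD
  have hrm₀ := hrm
  rw [segment_eq_image'] at hrm
  obtain ⟨ω, hω, hωe⟩ := hrm
  simp only [real_smul, ← hD] at hωe
  have horder := h.order_left
  rw [segment_eq_image'] at horder
  obtain ⟨φ, hφ, hφe⟩ := horder
  simp only [real_smul] at hφe
  have hφD : γ ℓ - η r = (φ * (1 - ω) : ℝ) * D := by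
    rw [← hφe, ← hωe, hD]; push_cast; ring
  have hφω : 0 < φ * (1 - ω) := by
    refine (mul_nonneg hφ.1 (by linarith [hω.2])).lt_of_ne fun h0 => hne1 ?_
    rw [← h0, ofReal_zero, zero_mul, sub_eq_zero] at hφD
    exact hφD.symm
  have hω1 : 0 < 1 - ω := pos_of_mul_pos_right hφω hφ.1
  set X := (starRingEnd ℂ D * d).re with hX
  have hXpos : 0 < X := by
    rw [hφD, map_mul, conj_ofReal, mul_assoc, re_ofReal_mul] at hpos
    exact pos_of_mul_pos_right hpos hφω.le
  -- a point of the second chord between `p` and the crossing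
  have hwseg : segment ℝ p (η r) ⊆ segment ℝ p q :=
    (convex_segment _ _).segment_subset (left_mem_segment _ _ _) hrm₀
  -- Otherwise the chord piece from `p` to `η r`, followed by the tail of `η`, would join `p` to the
  -- end of `η` without meeting the second chord.
  obtain ⟨z, hz, hzK⟩ : ∃ z ∈ segment ℝ p (η r), z ∈ segment ℝ p' q' := by
    by_contra! hno
    refine hchord (segment ℝ p (η r) ∪ η '' Icc r M') ?_ ?_ ?_ (Or.inl (left_mem_segment _ _ _))
      (Or.inr ⟨M', ⟨hr.2, le_rfl⟩, rfl⟩)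
    · refine IsPreconnected.union (η r) (right_mem_segment _ _ _) ⟨r, ⟨le_rfl, hr.2⟩, rfl⟩
        (convex_segment _ _).isPreconnected (isPreconnected_Icc.image _ ?_)
      exact h.right.taut.continuousOn.mono (Icc_subset_Icc (hℓ0.trans hlt.le) le_rfl)
    · refine union_subset (hwseg.trans h.left.chord_subset) ?_
      exact image_subset_iff.2 (h.right.taut.mapsTo.mono_left
        (Icc_subset_Icc (hℓ0.trans hlt.le) le_rfl))
    · refine Set.disjoint_left.2 ?_
      rintro w (hw | ⟨t, ht, rfl⟩) hwK
      · exact hno w hw hwK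
      · exact hoff t (hlt.trans_le ht.1) ht.2 hwK
  have hzw : z ≠ η r := fun he => hoff r hlt hr.2 (he ▸ hzK)
  have hzseg := hwseg hz
  rw [segment_eq_image'] at hz
  obtain ⟨θ, hθ, hθe⟩ := hz
  simp only [real_smul] at hθe
  have hzD : z = p + (θ * ω : ℝ) * D := by rw [← hθe, ← hωe]; push_cast; ring
  have hθω : θ * ω < ω := by
    have h1 : θ * ω ≤ ω := mul_le_of_le_one_left hω.1 hθ.2
    refine h1.lt_of_ne fun he => hzw ?_
    rw [hzD, he, ← hωe]
  -- From `η ℓ'` to `η r` the curve moves against `d`, and from `η r` to `z` the first chord does so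
  -- too, by the acute angle.
  have hzneg : (starRingEnd ℂ (z - η ℓ') * d).re < 0 := by
    have e1 : z - η ℓ' = ((θ * ω - ω : ℝ) : ℂ) * D - (r - ℓ' : ℝ) * d := by
      have := hη r hlt.le hr.2
      rw [← hωe] at this
      rw [hzD]
      push_cast at this ⊢
      linear_combination this
    have e2 : normSq d = 1 := by rw [normSq_eq_norm_sq, hn]; norm_num
    rw [e1, map_sub, map_mul, map_mul, conj_ofReal, conj_ofReal, sub_mul, mul_assoc, mul_assoc,
      ← normSq_eq_conj_mul_self, sub_re, re_ofReal_mul, re_ofReal_mul, ofReal_re, e2, ← hX]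
    nlinarith
  -- coordinates on the chord `p' q'`
  set D' := q' - p' with hD'
  set Y := (starRingEnd ℂ D' * d).re with hY
  rw [segment_eq_image'] at hzK hc' hrm'
  obtain ⟨ζ, hζ, hζe⟩ := hzK
  obtain ⟨μ, hμ, hμe⟩ := hc'
  obtain ⟨ν, hν, hνe⟩ := hrm'
  simp only [real_smul, ← hD'] at hζe hμe hνe
  have hD'0 : D' ≠ 0 := by
    intro h0
    rw [h0, mul_zero, add_zero] at hμe hνe
    exact hne2 (hνe.symm.trans hμe)
  have horder' := h.order_right
  rw [segment_eq_image'] at horder'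
  obtain ⟨κ, hκ, hκe⟩ := horder'
  simp only [real_smul] at hκe
  have hinj : ∀ x y : ℝ, p' + x * D' = p' + y * D' → x = y := fun x y hxy => by
    exact_mod_cast mul_right_cancel₀ hD'0 (add_left_cancel hxy)
  have hμν : μ < ν := by
    have e : μ = ν - κ * ν := by
      refine hinj _ _ ?_
      rw [hμe, ← hκe, ← hνe]; push_cast; ring
    have h1 : μ ≤ ν := by nlinarith [mul_nonneg hκ.1 hν.1]
    refine h1.lt_of_ne fun he => hne2 ?_
    rw [← hνe, ← hμe, he]
  have hYneg : (ν - μ) * Y ≤ 0 := by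
    have e : γ r' - η ℓ' = ((ν - μ : ℝ) : ℂ) * D' := by rw [← hνe, ← hμe]; push_cast; ring
    rwa [e, map_mul, conj_ofReal, mul_assoc, re_ofReal_mul, ← hY] at hneg
  have hY0 : Y ≤ 0 := nonpos_of_mul_nonpos_right hYneg (sub_pos.2 hμν)
  -- The scalar product with `d` does not increase along the second chord towards `q'`, by the
  -- non-acute angle; being smaller at `z` than at `η ℓ'`, it places `z` on the side of `q'`.
  have hμζ : μ < ζ := by
    have e : z - η ℓ' = ((ζ - μ : ℝ) : ℂ) * D' := by rw [← hζe, ← hμe]; push_cast; ring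
    rw [e, map_mul, conj_ofReal, mul_assoc, re_ofReal_mul, ← hY] at hzneg
    by_contra! hle
    nlinarith [mul_nonneg (sub_nonneg.2 hle) (neg_nonneg.2 hY0)]
  -- the bent connection of the chord ends
  refine hcurve (segment ℝ p z ∪ segment ℝ z q') ?_ ?_ ?_ (Or.inl (left_mem_segment _ _ _))
    (Or.inr (right_mem_segment _ _ _))
  · exact IsPreconnected.union z (right_mem_segment _ _ _) (left_mem_segment _ _ _)
      (convex_segment _ _).isPreconnected (convex_segment _ _).isPreconnected
  · refine union_subset (((convex_segment _ _).segment_subset (left_mem_segment _ _ _)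
      hzseg).trans h.left.chord_subset) (((convex_segment _ _).segment_subset ?_
      (right_mem_segment _ _ _)).trans h.right.chord_subset)
    rw [segment_eq_image']
    exact ⟨ζ, hζ, by simp only [real_smul]; rw [← hζe]⟩
  · refine Set.disjoint_left.2 ?_
    rintro w (hw | hw) ⟨t, ht, rfl⟩
    · have hwH := (convex_segment _ _).segment_subset (left_mem_segment _ _ _) hzseg hw
      -- `η` does not meet the first chord before `r`. A meeting after `r` on the side of `p` would
      -- make `d` parallel to this chord, and then `η` would run on the chord already just before
      -- `r`.
      have hrt : r ≤ t := by
        by_contra! hlt'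
        exact hrf t ⟨ht.1, hlt'⟩ hwH
      rw [segment_eq_image'] at hw
      obtain ⟨x, hx, hxe⟩ := hw
      simp only [real_smul] at hxe
      have hxD : η t = p + (x * (θ * ω) : ℝ) * D := by rw [← hxe, hzD]; push_cast; ring
      have hxω : x * (θ * ω) < ω :=
        (mul_le_of_le_one_left (mul_nonneg hθ.1 hω.1) hx.2).trans_lt hθω
      have hD0 : D ≠ 0 := by
        intro h0
        rw [h0, mul_zero, add_zero] at hωe hzD
        exact hzw (hzD.trans hωe)
      have hkD : ((t - r : ℝ) : ℂ) * d = ((ω - x * (θ * ω) : ℝ) : ℂ) * D := by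
        have := hηr t (hlt.le.trans hrt) ht.2
        rw [hxD, ← hωe] at this
        push_cast at this ⊢
        linear_combination this
      have htr : r < t := by
        refine hrt.lt_of_ne fun he => ?_
        rw [he, sub_self, ofReal_zero, zero_mul, eq_comm, mul_eq_zero] at hkD
        rcases hkD with h1 | h1
        · have : ω - x * (θ * ω) = 0 := by exact_mod_cast h1
          linarith
        · exact hD0 h1
      set k := (ω - x * (θ * ω)) / (t - r) with hk
      have htr0 : 0 < t - r := sub_pos.2 htr
      have hk0 : 0 < k := div_pos (by linarith) htr0
      have hdk : d = k * D := by
        have : ((t - r : ℝ) : ℂ) ≠ 0 := by exact_mod_cast htr0.ne'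
        refine mul_left_cancel₀ this ?_
        have hkr : ω - x * (θ * ω) = (t - r) * k := by rw [hk, mul_div_cancel₀ _ htr0.ne']
        rw [hkD, hkr, ofReal_mul, mul_assoc]
      have hm : 0 < min (r - ℓ') ((1 - ω) / k) := lt_min (sub_pos.2 hlt) (div_pos hω1 hk0)
      have hmk : min (r - ℓ') ((1 - ω) / k) * k ≤ 1 - ω := by
        rw [← le_div_iff₀ hk0]; exact min_le_right _ _
      refine hrf (r - min (r - ℓ') ((1 - ω) / k))
        ⟨by linarith [min_le_left (r - ℓ') ((1 - ω) / k)], by linarith⟩ ?_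
      rw [hback _ ⟨hm.le, min_le_left _ _⟩, segment_eq_image']
      refine ⟨ω + min (r - ℓ') ((1 - ω) / k) * k, ⟨by have := mul_pos hm hk0; linarith [hω.1],
        by linarith⟩, ?_⟩
      simp only [real_smul]
      rw [← hωe, ← hD, hdk]; push_cast; ring
    · rw [segment_eq_image'] at hw
      obtain ⟨x, hx, hxe⟩ := hw
      simp only [real_smul] at hxe
      have hxD : η t = p' + (ζ + x * (1 - ζ) : ℝ) * D' := by
        rw [← hxe, ← hζe, hD']; push_cast; ring
      have h1 : 0 ≤ x * (1 - ζ) := mul_nonneg hx.1 (by linarith [hζ.2])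
      have hmem : η t ∈ segment ℝ p' q' := by
        rw [segment_eq_image']
        refine ⟨ζ + x * (1 - ζ), ⟨by linarith [hζ.1], by nlinarith [hx.2, hζ.2]⟩, ?_⟩
        simp only [real_smul]; rw [hxD]
      have := (h.right.mem_segment_iff t ht).1 hmem
      rw [this, ← hμe] at hxD
      have := hinj _ _ hxD
      linarith

end IsCrossing
end SimplePolygon

end

/-! ### Order of the boundary hits, and branching at vertices -/

section
open Complex Set Filter Topology

theorem clockwiseBefore_of_lt {d x y : ℂ} (hd : d ≠ 0) (hx : x ≠ 0) (hy : y ≠ 0)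
    (h : cwAng d x < cwAng d y) : ClockwiseBefore d x y :=
  ⟨hd, cwAng d x, cwAng d y, ‖x‖ / ‖d‖, ‖y‖ / ‖d‖, cwAng_nonneg d x, h, cwAng_lt d y,
    div_pos (norm_pos_iff.2 hx) (norm_pos_iff.2 hd), div_pos (norm_pos_iff.2 hy) (norm_pos_iff.2 hd),
    cwAng_spec hd x, cwAng_spec hd y⟩

namespace SimplePolygon
variable {n : ℕ} [NeZero n] {P : SimplePolygon n}

namespace HalfPolygon
variable {H K : P.HalfPolygon}

theorem separation_chord (H : P.HalfPolygon) {t u : ℝ} (ht : P.bdryPoint t = H.p)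
    (hu : P.bdryPoint u = H.q) (hun : u < t + n) {C : Set ℂ} (hC : IsPreconnected C)
    (hCR : C ⊆ P.region) (hCS : Disjoint C (segment ℝ H.p H.q)) {t₁ t₂ : ℝ} (h₁ : t₁ ∈ Ioo t u)
    (h₂ : t₂ ∈ Ioo u (t + n)) (m₁ : P.bdryPoint t₁ ∈ C) (m₂ : P.bdryPoint t₂ ∈ C) : False := by
  refine P.separation H.chord_subset (isClosed_segment _ _) hun ?_ hC hCR hCS h₁ h₂ m₁ m₂
  rw [ht, hu, segment_symm]
  exact PolyJoined.of_segment Subset.rfl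

theorem _root_.SimplePolygon.IsTautOn.separation {γ : ℝ → ℂ} {M s v : ℝ} (h : P.IsTautOn γ 0 M)
    (hM : 0 ≤ M) (hs : γ 0 = P.bdryPoint s) (hv : γ M = P.bdryPoint v) (hvn : v < s + n) {C : Set ℂ}
    (hC : IsPreconnected C) (hCR : C ⊆ P.region) (hCS : Disjoint C (γ '' Icc 0 M)) {t₁ t₂ : ℝ}
    (h₁ : t₁ ∈ Ioo s v) (h₂ : t₂ ∈ Ioo v (s + n)) (m₁ : P.bdryPoint t₁ ∈ C)
    (m₂ : P.bdryPoint t₂ ∈ C) : False := by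
  refine P.separation (image_subset_iff.2 h.mapsTo)
    (isCompact_Icc.image_of_continuousOn h.continuousOn).isClosed hvn ?_ hC hCR hCS h₁ h₂ m₁ m₂
  rw [← hs, ← hv]
  exact (h.isLocallyStraight.polyJoined le_rfl hM le_rfl).symm

/-- The extended shortest paths to two half-polygons in clockwise order do not hit the boundary
in the opposite order within the common part of the boundary. -/
theorem false_of_order {s₀ t u t' u' v v' : ℝ} {σ τ : PlanePath} {γ η : ℝ → ℂ} {M M' s : ℝ}
    (hσ : IsShortestPath P.region (P.bdryPoint s₀) H.carrier σ)
    (hτ : IsShortestPath P.region (P.bdryPoint s₀) K.carrier τ)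
    (hγ : H.IsExtension σ γ M) (hη : K.IsExtension τ η M')
    (ht : P.bdryPoint t = H.p) (hu : P.bdryPoint u = H.q)
    (ht' : P.bdryPoint t' = K.p) (hu' : P.bdryPoint u' = K.q)
    (hv : γ M = P.bdryPoint v) (hv' : η M' = P.bdryPoint v')
    (h₀ : s₀ < t) (h₁ : t < t') (h₂ : t' ≤ v') (h₃ : v' < v) (h₄ : v ≤ u) (h₅ : u < u')
    (h₆ : u' < s₀ + n) (hs : 0 ≤ s) (hsσ : s < σ.length) (hsτ : s < τ.length)
    (hag : ∀ r ∈ Icc 0 s, γ r = η r)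
    (hne : ∀ r₁ ∈ Ioc s M, ∀ r₂ ∈ Ioc s M', γ r₁ ≠ η r₂) : False := by
  have hsM : s < M := hsσ.trans_le hγ.length_le
  have hsM' : s < M' := hsτ.trans_le hη.length_le
  have hn : (0 : ℝ) < n := natCast_pos
  have hγ0 : γ 0 = P.bdryPoint s₀ := by
    rw [hγ.eqOn ⟨le_rfl, hγ.length_pos.le⟩, hσ.source]
  have hη0 : η 0 = P.bdryPoint s₀ := by
    rw [hη.eqOn ⟨le_rfl, hη.length_pos.le⟩, hτ.source]
  have harcH : ∀ r ∈ Icc t u, P.bdryPoint r ∈ H.carrier := fun r hr =>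
    H.cwArc_subset_carrier (by
      rw [cwArc_eq ht hu (hr.1.trans hr.2) (by linarith)]; exact ⟨r, hr, rfl⟩)
  have harcK : ∀ r ∈ Icc t' u', P.bdryPoint r ∈ K.carrier := fun r hr =>
    K.cwArc_subset_carrier (by
      rw [cwArc_eq ht' hu' (hr.1.trans hr.2) (by linarith)]; exact ⟨r, hr, rfl⟩)
  have hneL : ∀ r₁ ∈ Ioc s M, ∀ r₂ ∈ Icc 0 M', γ r₁ ≠ η r₂ := by
    intro r₁ hr₁ r₂ hr₂ he
    rcases le_or_gt r₂ s with h | h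
    · rw [← hag r₂ ⟨hr₂.1, h⟩] at he
      have := hγ.taut.injOn ⟨hs.trans hr₁.1.le, hr₁.2⟩ ⟨hr₂.1, h.trans hsM.le⟩ he
      linarith [hr₁.1]
    · exact hne r₁ hr₁ r₂ ⟨h, hr₂.2⟩ he
  have hneR : ∀ r₁ ∈ Icc 0 M, ∀ r₂ ∈ Ioc s M', γ r₁ ≠ η r₂ := by
    intro r₁ hr₁ r₂ hr₂ he
    rcases le_or_gt r₁ s with h | h
    · rw [hag r₁ ⟨hr₁.1, h⟩] at he
      have := hη.taut.injOn ⟨hr₁.1, h.trans hsM'.le⟩ ⟨hs.trans hr₂.1.le, hr₂.2⟩ he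
      linarith [hr₂.1]
    · exact hne r₁ ⟨h, hr₁.2⟩ r₂ hr₂ he
  have hγK : ∀ r ∈ Icc 0 s, γ r ∉ K.carrier := fun r hr h => by
    rw [hag r hr] at h
    linarith [(hη.mem_carrier_iff r ⟨hr.1, hr.2.trans hsM'.le⟩).1 h, hr.2]
  have hηH : ∀ r ∈ Icc 0 s, η r ∉ H.carrier := fun r hr h => by
    rw [← hag r hr] at h
    linarith [(hγ.mem_carrier_iff r ⟨hr.1, hr.2.trans hsM.le⟩).1 h, hr.2]
  -- The end of `η` lies in the arc overlap, hence in `H`, so `η` enters `H` through its chord; the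
  -- same holds for `γ` and `K`.
  obtain ⟨r, hr, hrm, hrf⟩ := exists_first_hit (H := H) (γ := η) (a := s) (b := M')
    (hη.taut.continuousOn.mono (Icc_subset_Icc hs le_rfl)) hsM'.le
    (hη.taut.mapsTo.mono_left (Icc_subset_Icc hs le_rfl)) (hηH s ⟨hs, le_rfl⟩)
    (hv' ▸ harcH v' ⟨by linarith, by linarith⟩)
  obtain ⟨r', hr', hrm', hrf'⟩ := exists_first_hit (H := K) (γ := γ) (a := s) (b := M)
    (hγ.taut.continuousOn.mono (Icc_subset_Icc hs le_rfl)) hsM.le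
    (hγ.taut.mapsTo.mono_left (Icc_subset_Icc hs le_rfl)) (hγK s ⟨hs, le_rfl⟩)
    (hv ▸ harcK v ⟨by linarith, by linarith⟩)
  have hMs : M = σ.length ↔ γ M ∈ segment ℝ H.p H.q :=
    (hγ.mem_segment_iff M ⟨hs.trans hsM.le, le_rfl⟩).symm
  have hMs' : M' = τ.length ↔ η M' ∈ segment ℝ K.p K.q :=
    (hη.mem_segment_iff M' ⟨hs.trans hsM'.le, le_rfl⟩).symm
  have hsepγ : ∀ C, IsPreconnected C → C ⊆ P.region → Disjoint C (γ '' Icc 0 M) → ∀ t₁ t₂,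
      t₁ ∈ Ioo s₀ v → t₂ ∈ Ioo v (s₀ + n) → P.bdryPoint t₁ ∈ C → P.bdryPoint t₂ ∈ C → False :=
    fun C hC hCR hCS t₁ t₂ h1 h2 => hγ.taut.separation (hs.trans hsM.le) hγ0 hv (by linarith) hC hCR
      hCS h1 h2
  have hsepη : ∀ C, IsPreconnected C → C ⊆ P.region → Disjoint C (η '' Icc 0 M') → ∀ t₁ t₂,
      t₁ ∈ Ioo s₀ v' → t₂ ∈ Ioo v' (s₀ + n) → P.bdryPoint t₁ ∈ C → P.bdryPoint t₂ ∈ C → False :=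
    fun C hC hCR hCS t₁ t₂ h1 h2 => hη.taut.separation (hs.trans hsM'.le) hη0 hv' (by linarith) hC
      hCR hCS h1 h2
  have hX : P.IsCrossing H.p H.q K.p K.q γ η s σ.length M r' τ.length M' r := by
    refine ⟨hγ.isChordCurve hσ, hη.isChordCurve hτ, hs, hag s ⟨hs, le_rfl⟩, hsσ, hsτ, hneL, hneR,
      ⟨hr', hrm', fun x hx h => ?_⟩, ⟨hr, hrm, fun x hx h => ?_⟩, ?_, ?_⟩
    · rcases le_or_gt x s with h' | h'
      · exact hγK x ⟨hx.1, h'⟩ (Or.inl h)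
      · exact hrf' x ⟨h'.le, hx.2⟩ (Or.inl h)
    · rcases le_or_gt x s with h' | h'
      · exact hηH x ⟨hx.1, h'⟩ (Or.inl h)
      · exact hrf x ⟨h'.le, hx.2⟩ (Or.inl h)
    -- If `γ` did not cross the chord of `H` between `η r` and `q`, the later part of `η` together
    -- with this chord piece would join the boundary points `v'` and `u` without meeting `γ`, which
    -- separates them.
    · by_contra hord
      have hsub : segment ℝ (η r) H.q ⊆ segment ℝ H.p H.q :=
        (convex_segment _ _).segment_subset hrm (right_mem_segment _ _ _)
      refine hsepγ (η '' Ioc s M' ∪ segment ℝ (η r) H.q) ?_ ?_ ?_ v' u ⟨by linarith, h₃⟩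
        ⟨h₄.lt_of_ne ?_, by linarith⟩ (Or.inl ⟨M', ⟨hsM', le_rfl⟩, hv'⟩)
        (Or.inr (hu ▸ right_mem_segment _ _ _))
      · exact IsPreconnected.union (η r) ⟨r, hr, rfl⟩ (left_mem_segment _ _ _)
          (isPreconnected_Ioc.image _ (hη.taut.continuousOn.mono
            fun x hx => ⟨hs.trans hx.1.le, hx.2⟩)) (convex_segment _ _).isPreconnected
      · exact union_subset (image_subset_iff.2 fun x hx =>
          hη.taut.mapsTo ⟨hs.trans hx.1.le, hx.2⟩) (hsub.trans H.chord_subset)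
      · refine Set.disjoint_left.2 ?_
        rintro w (⟨x, hx, rfl⟩ | hw) ⟨y, hy, he⟩
        · exact hneR y hy x hx he
        · rw [← he] at hw
          have := (hγ.mem_segment_iff y hy).1 (hsub hw)
          exact hord (this ▸ hw)
      · rintro rfl
        have hM : M = σ.length := hMs.2 (by rw [hv, hu]; exact right_mem_segment _ _ _)
        rw [← hM, hv, hu] at hord
        exact hord (right_mem_segment _ _ _)
    · by_contra hord
      have hsub : segment ℝ (γ r') K.p ⊆ segment ℝ K.p K.q :=
        (convex_segment _ _).segment_subset hrm' (left_mem_segment _ _ _)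
      refine hsepη (γ '' Ioc s M ∪ segment ℝ (γ r') K.p) ?_ ?_ ?_ t' v
        ⟨by linarith, h₂.lt_of_ne ?_⟩ ⟨h₃, by linarith⟩
        (Or.inr (ht' ▸ right_mem_segment _ _ _)) (Or.inl ⟨M, ⟨hsM, le_rfl⟩, hv⟩)
      · exact IsPreconnected.union (γ r') ⟨r', hr', rfl⟩ (left_mem_segment _ _ _)
          (isPreconnected_Ioc.image _ (hγ.taut.continuousOn.mono
            fun x hx => ⟨hs.trans hx.1.le, hx.2⟩)) (convex_segment _ _).isPreconnected
      · exact union_subset (image_subset_iff.2 fun x hx =>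
          hγ.taut.mapsTo ⟨hs.trans hx.1.le, hx.2⟩) (hsub.trans K.chord_subset)
      · refine Set.disjoint_left.2 ?_
        rintro w (⟨x, hx, rfl⟩ | hw) ⟨y, hy, he⟩
        · exact hneL x hx y hy he.symm
        · rw [← he] at hw
          have := (hη.mem_segment_iff y hy).1 (hsub hw)
          exact hord (this ▸ hw)
      · rintro rfl
        have hM : M' = τ.length := hMs'.2 (by rw [hv', ht']; exact left_mem_segment _ _ _)
        rw [← hM, hv', ht'] at hord
        exact hord (right_mem_segment _ _ _)
  -- A curve meeting its own chord strictly before the foreign one is excluded by `false_of_lt`, for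
  -- `γ` through the mirror image. In the remaining case each foreign chord is met no later than the
  -- own one.
  rcases lt_or_ge τ.length r with hlt | hge
  · refine hX.false_of_lt hlt (fun C hC hCR hCS hp hq => ?_) (fun C hC hCR hCS hp hq => ?_)
    · have hvt : t' ≠ v' := by
        rintro rfl
        have hM : M' = τ.length := hMs'.2 (by rw [hv', ht']; exact left_mem_segment _ _ _)
        linarith [hr.2]
      refine K.separation_chord ht' hu' (by linarith) hC hCR hCS (t₁ := v') (t₂ := t + n)
        ⟨h₂.lt_of_ne hvt, by linarith⟩ ⟨by linarith, by linarith⟩ (hv' ▸ hq) ?_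
      rwa [P.bdryPoint_add, ht]
    · exact hsepη C hC hCR hCS t u' ⟨h₀, by linarith⟩ ⟨by linarith, h₆⟩ (ht ▸ hp) (hu' ▸ hq)
  rcases lt_or_ge σ.length r' with hlt' | hge'
  · refine hX.symm.false_of_lt hlt' (fun C hC hCR hCS hp hq => ?_) (fun C hC hCR hCS hp hq => ?_)
    · have hvu : v ≠ u := by
        rintro rfl
        have hM : M = σ.length := hMs.2 (by rw [hv, hu]; exact right_mem_segment _ _ _)
        linarith [hr'.2]
      rw [segment_symm] at hCS
      exact H.separation_chord ht hu (by linarith) hC hCR hCS (t₁ := v) (t₂ := u')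
        ⟨by linarith, h₄.lt_of_ne hvu⟩ ⟨h₅, by linarith⟩ (hv ▸ hq) (hu' ▸ hp)
    · exact hsepγ C hC hCR hCS t u' ⟨h₀, by linarith⟩ ⟨by linarith, h₆⟩ (ht ▸ hq) (hu' ▸ hp)
  -- Up to `r` the curve `η` is a connection from the root to `H`, so it is no shorter than `σ`; the
  -- same holds with the roles exchanged. With `r ≤ τ.length` and `r' ≤ σ.length`, all four lengths
  -- coincide.
  have k₁ : σ.length ≤ r := by
    have hr0 : 0 ≤ r := hs.trans hr.1.le
    have h1 := hτ.geodesicDist_le le_rfl hr0 hge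
    rw [hτ.source, sub_zero, ← hη.eqOn ⟨hr0, hge⟩] at h1
    exact (ENNReal.ofReal_le_ofReal_iff hr0).1 ((hσ.length_le (Or.inl hrm)).trans h1)
  have k₂ : τ.length ≤ r' := by
    have hr0 : 0 ≤ r' := hs.trans hr'.1.le
    have h1 := hσ.geodesicDist_le le_rfl hr0 hge'
    rw [hσ.source, sub_zero, ← hγ.eqOn ⟨hr0, hge'⟩] at h1
    exact (ENNReal.ofReal_le_ofReal_iff hr0).1 ((hτ.length_le (Or.inl hrm')).trans h1)
  exact hX.false_of_eq (by linarith) (by linarith)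

end HalfPolygon

/-- Two curves from the boundary point with parameter `s₀` branch at the parameter `s > 0`.  If the
second one branches off first in clockwise order from the common part, it ends first. -/
theorem IsTautOn.lt_of_branch {γ η : ℝ → ℂ} {M M' s s₀ c v v' δ : ℝ} {d x y : ℂ}
    (hγ : P.IsTautOn γ 0 M) (hη : P.IsTautOn η 0 M') (hag : ∀ r ∈ Icc 0 s, γ r = η r)
    (hne : ∀ r₁ ∈ Ioc s M, ∀ r₂ ∈ Ioc s M', γ r₁ ≠ η r₂)
    (h0 : γ 0 = P.bdryPoint s₀) (hc : γ s = P.bdryPoint c) (hv : γ M = P.bdryPoint v)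
    (hv' : η M' = P.bdryPoint v') (hcI : c ∈ Ioo s₀ (s₀ + n)) (hvI : v ∈ Ioo s₀ (s₀ + n))
    (hvI' : v' ∈ Ioo s₀ (s₀ + n)) (hδ : 0 < δ) (hδs : δ ≤ s) (hδM : s + δ ≤ M) (hδM' : s + δ ≤ M')
    (hd : ‖d‖ = 1) (hx : ‖x‖ = 1) (hy : ‖y‖ = 1)
    (hx' : ∀ h ∈ Icc 0 δ, γ (s + h) = γ s + h * x) (hy' : ∀ h ∈ Icc 0 δ, η (s + h) = η s + h * y)
    (hd' : ∀ h ∈ Icc 0 δ, γ (s - h) = γ s + h * d) (hlt : cwAng d y < cwAng d x) : v' < v := by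
  have hs : 0 < s := hδ.trans_le hδs
  have hd0 : d ≠ 0 := by rintro rfl; simp at hd
  have hx0 : x ≠ 0 := by rintro rfl; simp at hx
  have hy0 : y ≠ 0 := by rintro rfl; simp at hy
  have hq := P.fwd_ne_zero c
  have hpi := Real.pi_pos
  have hags : γ s = η s := hag s ⟨hs.le, le_rfl⟩
  have ax := hγ.pi_le_abs_sub hδ (by linarith) hδM hd hx hx' hd' hc
  have ay := hη.pi_le_abs_sub hδ (by linarith) hδM' hd hy hy' (fun h hh => by
    rw [← hags, ← hag (s - h) ⟨by linarith [hh.2], by linarith [hh.1]⟩, hd' h hh])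
    (hags.symm.trans hc)
  -- parameters after `c`
  have hlift : ∀ w ∈ Ioo s₀ (s₀ + n), P.bdryPoint w ≠ P.bdryPoint c →
      ∃ w' ∈ Ioo c (c + n), P.bdryPoint w' = P.bdryPoint w ∧
        (w' < s₀ + n ∧ w' = w ∨ s₀ + n < w' ∧ w' = w + n) := by
    intro w hw hwc
    rcases lt_trichotomy w c with h | h | h
    · exact ⟨w + n, ⟨by linarith [hw.1, hcI.2], by linarith⟩, P.bdryPoint_add w,
        Or.inr ⟨by linarith [hw.1], rfl⟩⟩
    · exact absurd (h ▸ rfl) hwc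
    · exact ⟨w, ⟨h, by linarith [hw.2, hcI.1]⟩, rfl, Or.inl ⟨hw.2, rfl⟩⟩
  obtain ⟨w, hwI, hw, hwv⟩ := hlift v hvI (by
    rw [← hv, ← hc]
    intro he
    have := hγ.injOn ⟨by linarith, le_rfl⟩ ⟨hs.le, by linarith⟩ he
    linarith)
  obtain ⟨w', hwI', hw', hwv'⟩ := hlift v' hvI' (by
    rw [← hv', ← hc, hags]
    intro he
    have := hη.injOn ⟨by linarith, le_rfl⟩ ⟨hs.le, by linarith⟩ he
    linarith)
  have hγs := hγ.mono hs.le le_rfl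
  have hηs := hη.mono hs.le le_rfl
  -- The common part, run backwards from the branching point to the root, is a third taut curve from
  -- the boundary point `c`; it ends at the parameter `s₀ + n`.
  have hρ : P.IsTautOn (fun r => γ (2 * s - r)) s (2 * s) := by
    have := (hγ.mono le_rfl (show s ≤ M by linarith)).reverse (2 * s)
    rwa [show 2 * s - s = s by ring, sub_zero] at this
  have e0 : (fun r => γ (2 * s - r)) s = P.bdryPoint c := by
    rw [← hc]; simp only; congr 1; ring
  have e1 : (fun r => γ (2 * s - r)) (2 * s) = P.bdryPoint (s₀ + n) := by
    rw [P.bdryPoint_add, ← h0]; simp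
  have e2 : ∀ h ∈ Icc 0 δ, (fun r => γ (2 * s - r)) (s + h) = (fun r => γ (2 * s - r)) s + h * d := by
    intro h hh
    simp only
    rw [show 2 * s - (s + h) = s - h by ring, show 2 * s - s = s by ring, hd' h hh]
  have hdγ : ∀ r₁ ∈ Ioc s M, ∀ r₂ ∈ Ioc s (2 * s), γ r₁ ≠ (fun r => γ (2 * s - r)) r₂ := by
    intro r₁ hr₁ r₂ hr₂ he
    have := hγ.injOn ⟨by linarith [hr₁.1], hr₁.2⟩
      ⟨by linarith [hr₂.2], by linarith [hr₂.1]⟩ he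
    linarith [hr₁.1, hr₂.1]
  have hdη : ∀ r₁ ∈ Ioc s M', ∀ r₂ ∈ Ioc s (2 * s), η r₁ ≠ (fun r => γ (2 * s - r)) r₂ := by
    intro r₁ hr₁ r₂ hr₂ he
    simp only at he
    rw [hag _ ⟨by linarith [hr₂.2], by linarith [hr₂.1]⟩] at he
    have := hη.injOn ⟨by linarith [hr₁.1], hr₁.2⟩
      ⟨by linarith [hr₂.2], by linarith [hr₂.1]⟩ he
    linarith [hr₁.1, hr₂.1]
  have hsn : s₀ + n ∈ Ioo c (c + n) := ⟨hcI.2, by linarith [hcI.1]⟩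
  have hcη : η s = P.bdryPoint c := hags.symm.trans hc
  have kγη : cwAng (P.fwd c) y < cwAng (P.fwd c) x → w' < w := fun h =>
    hγs.lt_of_cwAng_lt hηs (by linarith) hc hcη hne hx0 hy0 hδ hδM hδM' hx' hy' hwI hwI'
      (hv.trans hw.symm) (hv'.trans hw'.symm) h
  have hbx := cwAng_nonneg (P.fwd c) x
  have hby := cwAng_nonneg (P.fwd c) y
  have hcx := cwAng_lt (P.fwd c) x
  have hcy := cwAng_lt (P.fwd c) y
  -- Both branches make an angle of at least π with `d`, and on the same side of it, since on
  -- opposite sides their angles would be 2π apart. Comparison with the backward curve then puts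
  -- both lifted ends on the same side of `s₀ + n`, so their order is that of `v` and `v'`.
  rcases le_abs.1 ax with hx1 | hx1 <;> rcases le_abs.1 ay with hy1 | hy1
  · rw [cwAng_eq_sub hq hd0 hx0 (by linarith), cwAng_eq_sub hq hd0 hy0 (by linarith)] at hlt
    have k1 := hγs.lt_of_cwAng_lt hρ (by linarith) hc e0 hdγ hx0 hd0 hδ hδM (by linarith) hx' e2 hwI
      hsn (hv.trans hw.symm) e1 (by linarith)
    have k2 := hηs.lt_of_cwAng_lt hρ (by linarith) hcη e0 hdη hy0 hd0 hδ hδM' (by linarith) hy' e2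
      hwI' hsn (hv'.trans hw'.symm) e1 (by linarith)
    have k3 := kγη (by linarith)
    rcases hwv with h | h <;> rcases hwv' with h' | h' <;> linarith [h.1, h.2, h'.1, h'.2]
  · linarith
  · linarith
  · rw [cwAng_eq_sub_add hq hd0 hx0 (by linarith), cwAng_eq_sub_add hq hd0 hy0 (by linarith)] at hlt
    have k1 := hρ.lt_of_cwAng_lt hγs (by linarith) e0 hc (fun r₁ h₁ r₂ h₂ he => hdγ r₂ h₂ r₁ h₁ he.symm)
      hd0 hx0 hδ (by linarith) hδM e2 hx' hsn hwI e1 (hv.trans hw.symm) (by linarith)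
    have k2 := hρ.lt_of_cwAng_lt hηs (by linarith) e0 hcη
      (fun r₁ h₁ r₂ h₂ he => hdη r₂ h₂ r₁ h₁ he.symm)
      hd0 hy0 hδ (by linarith) hδM' e2 hy' hsn hwI' e1 (hv'.trans hw'.symm) (by linarith)
    have k3 := kγη (by linarith)
    rcases hwv with h | h <;> rcases hwv' with h' | h' <;> linarith [h.1, h.2, h'.1, h'.2]

theorem openAngle_eq_pi {t : ℝ} (ht : ∀ k : ℤ, (k : ℝ) ≠ t) : P.openAngle t = Real.pi := by
  have h0 : 0 < Int.fract t :=
    (Int.fract_nonneg t).lt_of_ne fun h => ht ⌊t⌋ (by linarith [Int.floor_add_fract t])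
  have := P.openAngle_add (t := (⌊t⌋ : ℝ)) h0 (by
    rw [Int.floor_intCast]; linarith [Int.fract_lt_one t])
  rwa [Int.floor_add_fract] at this

theorem IsTautOn.eq_neg_of_mem_inner {γ : ℝ → ℂ} {a b r δ : ℝ} (hγ : P.IsTautOn γ a b) {d x : ℂ}
    (hδ : 0 < δ) (ha : a ≤ r - δ) (hb : r + δ ≤ b) (hd : ‖d‖ = 1) (hx : ‖x‖ = 1)
    (hx' : ∀ h ∈ Icc 0 δ, γ (r + h) = γ r + h * x) (hd' : ∀ h ∈ Icc 0 δ, γ (r - h) = γ r + h * d)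
    (hi : γ r ∈ P.inner) : x = -d := by
  obtain ⟨ε, hε, hball⟩ := Metric.isOpen_iff.1 P.isOpen_inner _ hi
  obtain ⟨h, hh, hhδ, hhε⟩ : ∃ h > 0, h ≤ δ ∧ h < ε :=
    ⟨min δ (ε / 2), lt_min hδ (by linarith), min_le_left _ _,
      (min_le_right _ _).trans_lt (by linarith)⟩
  refine hγ.bend r h d x hh (by linarith) (by linarith) hd hx
    (fun k hk => hx' k ⟨hk.1, hk.2.trans hhδ⟩) (fun k hk => hd' k ⟨hk.1, hk.2.trans hhδ⟩)
    fun k hk => ((convex_ball (γ r) ε).segment_subset ?_ ?_).trans (hball.trans sdiff_subset)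
  · rw [hd' k ⟨hk.1.le, hk.2.trans hhδ⟩, mem_ball_iff_norm, add_sub_cancel_left, norm_mul, hd,
      mul_one, norm_real, Real.norm_of_nonneg hk.1.le]
    linarith [hk.2]
  · rw [hx' k ⟨hk.1.le, hk.2.trans hhδ⟩, mem_ball_iff_norm, add_sub_cancel_left, norm_mul, hx,
      mul_one, norm_real, Real.norm_of_nonneg hk.1.le]
    linarith [hk.2]

theorem eq_of_cwAng_eq {q x y : ℂ} (hq : q ≠ 0) (hx : ‖x‖ = 1) (hy : ‖y‖ = 1)
    (h : cwAng q x = cwAng q y) : x = y := by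
  have hx0 : x ≠ 0 := by rintro rfl; simp at hx
  have hy0 : y ≠ 0 := by rintro rfl; simp at hy
  obtain ⟨r, hr, he⟩ := exists_pos_mul_of_cwAng_eq hq hx0 hy0 h
  have := congrArg norm he
  rw [norm_mul, hx, hy, norm_real, Real.norm_of_nonneg hr.le, mul_one] at this
  rw [he, ← this, ofReal_one, one_mul]

/-- Two taut curves branch at vertices only. -/
theorem IsTautOn.exists_vertex {γ η : ℝ → ℂ} {M M' s δ : ℝ} {d x y : ℂ}
    (hγ : P.IsTautOn γ 0 M) (hη : P.IsTautOn η 0 M') (hag : ∀ r ∈ Icc 0 s, γ r = η r)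
    (hδ : 0 < δ) (hδs : δ ≤ s) (hδM : s + δ ≤ M) (hδM' : s + δ ≤ M')
    (hd : ‖d‖ = 1) (hx : ‖x‖ = 1) (hy : ‖y‖ = 1) (hxy : x ≠ y)
    (hx' : ∀ h ∈ Icc 0 δ, γ (s + h) = γ s + h * x) (hy' : ∀ h ∈ Icc 0 δ, η (s + h) = η s + h * y)
    (hd' : ∀ h ∈ Icc 0 δ, γ (s - h) = γ s + h * d) :
    ∃ k : ℤ, γ s = P.bdryPoint k := by
  have hags : γ s = η s := hag s ⟨by linarith, le_rfl⟩
  have hd'' : ∀ h ∈ Icc 0 δ, η (s - h) = η s + h * d := fun h hh => by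
    rw [← hags, ← hag (s - h) ⟨by linarith [hh.2], by linarith [hh.1]⟩, hd' h hh]
  have hR : γ s ∈ P.region := hγ.mapsTo ⟨by linarith, by linarith⟩
  by_cases hb : γ s ∈ P.boundary
  · obtain ⟨t, -, ht⟩ := P.exists_param hb 0
    by_contra! hk
    -- Inside an edge the interior angle is π. Directions that are at least π apart then lie along
    -- the edge in opposite senses, so `x` and `y` are both opposite to `d`.
    have hω := P.openAngle_eq_pi (t := t) fun k hkt => hk k (by rw [hkt, ht])
    have hx0 : x ≠ 0 := by rintro rfl; simp at hx
    have hy0 : y ≠ 0 := by rintro rfl; simp at hy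
    have hd0 : d ≠ 0 := by rintro rfl; simp at hd
    have ax := hγ.pi_le_abs_sub hδ (by linarith) hδM hd hx hx' hd' ht.symm
    have ay := hη.pi_le_abs_sub hδ (by linarith) hδM' hd hy hy' hd'' (hags.symm.trans ht.symm)
    have bx := P.cwAng_le_openAngle hx0 hδ fun h hh => by
      rw [ht, ← hx' h hh]; exact hγ.mapsTo ⟨by linarith [hh.1], by linarith [hh.2]⟩
    have bY := P.cwAng_le_openAngle hy0 hδ fun h hh => by
      rw [ht, hags, ← hy' h hh]; exact hη.mapsTo ⟨by linarith [hh.1], by linarith [hh.2]⟩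
    have bd := P.cwAng_le_openAngle hd0 hδ fun h hh => by
      rw [ht, ← hd' h hh]; exact hγ.mapsTo ⟨by linarith [hh.2], by linarith [hh.1]⟩
    have cx := cwAng_nonneg (P.fwd t) x
    have cy := cwAng_nonneg (P.fwd t) y
    have cd := cwAng_nonneg (P.fwd t) d
    have hpi := Real.pi_pos
    rw [hω] at bx bY bd
    refine hxy (eq_of_cwAng_eq (P.fwd_ne_zero t) hx hy ?_)
    rcases le_abs.1 ax with h1 | h1 <;> rcases le_abs.1 ay with h2 | h2 <;> linarith
  · exfalso
    have h1 := hγ.eq_neg_of_mem_inner hδ (by linarith) hδM hd hx hx' hd' ⟨hR, hb⟩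
    have h2 := hη.eq_neg_of_mem_inner hδ (by linarith) hδM' hd hy hy' hd'' (hags ▸ ⟨hR, hb⟩)
    exact hxy (h1.trans h2.symm)

/-- Two curves with straight pieces from the same point branch, unless one continues the other. -/
theorem exists_branch {σ τ : PlanePath} (hσ : P.IsTautOn σ.curve 0 σ.length)
    (hτ : P.IsTautOn τ.curve 0 τ.length) (h0 : σ.curve 0 = τ.curve 0) (hσ0 : 0 ≤ σ.length)
    (hτ0 : 0 ≤ τ.length) :
    σ.IsInitialPart τ ∨ τ.IsInitialPart σ ∨ ∃ s δ : ℝ, ∃ x y : ℂ, 0 ≤ s ∧ 0 < δ ∧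
      s + δ ≤ σ.length ∧ s + δ ≤ τ.length ∧ (∀ r ∈ Icc 0 s, σ.curve r = τ.curve r) ∧ ‖x‖ = 1 ∧
      ‖y‖ = 1 ∧ x ≠ y ∧ (∀ h ∈ Icc 0 δ, σ.curve (s + h) = σ.curve s + h * x) ∧
      ∀ h ∈ Icc 0 δ, τ.curve (s + h) = τ.curve s + h * y := by
  set m := min σ.length τ.length with hm
  set A : Set ℝ := {r | r ∈ Icc 0 m ∧ ∀ u ∈ Icc 0 r, σ.curve u = τ.curve u} with hA
  have hm0 : 0 ≤ m := le_min hσ0 hτ0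
  have h0A : (0 : ℝ) ∈ A := ⟨⟨le_rfl, hm0⟩, fun u hu => by
    rw [le_antisymm hu.2 hu.1]; exact h0⟩
  have hbdd : BddAbove A := ⟨m, fun r hr => hr.1.2⟩
  set s := sSup A
  have hs0 : 0 ≤ s := le_csSup hbdd h0A
  have hsm : s ≤ m := csSup_le ⟨0, h0A⟩ fun r hr => hr.1.2
  have hlt : ∀ u, 0 ≤ u → u < s → σ.curve u = τ.curve u := fun u hu hus => by
    obtain ⟨r, hr, hur⟩ := exists_lt_of_lt_csSup ⟨0, h0A⟩ hus
    exact hr.2 u ⟨hu, hur.le⟩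
  have hsσ : s ≤ σ.length := hsm.trans (min_le_left _ _)
  have hsτ : s ≤ τ.length := hsm.trans (min_le_right _ _)
  have hag : ∀ u ∈ Icc 0 s, σ.curve u = τ.curve u := by
    intro u hu
    rcases hu.2.lt_or_eq with h | rfl
    · exact hlt u hu.1 h
    rcases hs0.eq_or_lt with h | h
    · rw [← h]; exact h0
    · have hsc : s ∈ closure (Ico 0 s) := by rw [closure_Ico h.ne]; exact ⟨hs0, le_rfl⟩
      have hne : (𝓝[Ico 0 s] s).NeBot := mem_closure_iff_nhdsWithin_neBot.1 hsc
      have c1 := (hσ.continuousOn s ⟨hs0, hsσ⟩).mono_left (nhdsWithin_mono _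
        (show Ico 0 s ⊆ Icc 0 σ.length from fun u hu => ⟨hu.1, hu.2.le.trans hsσ⟩))
      have c2 := (hτ.continuousOn s ⟨hs0, hsτ⟩).mono_left (nhdsWithin_mono _
        (show Ico 0 s ⊆ Icc 0 τ.length from fun u hu => ⟨hu.1, hu.2.le.trans hsτ⟩))
      refine tendsto_nhds_unique c1 (c2.congr' ?_)
      filter_upwards [self_mem_nhdsWithin] with u hu
      exact (hlt u hu.1 hu.2).symm
  rcases hsm.eq_or_lt with he | hlt'
  · rcases le_total σ.length τ.length with h | h
    · exact Or.inl ⟨h, fun r hr => hag r (by rwa [he, hm, min_eq_left h])⟩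
    · exact Or.inr (Or.inl ⟨h, fun r hr => (hag r (by rwa [he, hm, min_eq_right h])).symm⟩)
  right; right
  have hsσ' : s < σ.length := hlt'.trans_le (min_le_left _ _)
  have hsτ' : s < τ.length := hlt'.trans_le (min_le_right _ _)
  obtain ⟨δ₁, hδ₁, x, hx, hle₁, hx'⟩ := hσ.right s ⟨hs0, hsσ'⟩
  obtain ⟨δ₂, hδ₂, y, hy, hle₂, hy'⟩ := hτ.right s ⟨hs0, hsτ'⟩
  have hd : 0 < min δ₁ δ₂ := lt_min hδ₁ hδ₂
  have m1 := min_le_left δ₁ δ₂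
  have m2 := min_le_right δ₁ δ₂
  refine ⟨s, min δ₁ δ₂, x, y, hs0, hd, by linarith, by linarith, hag, hx, hy, ?_,
    fun h hh => hx' h ⟨hh.1, hh.2.trans m1⟩, fun h hh => hy' h ⟨hh.1, hh.2.trans m2⟩⟩
  -- Equal directions would prolong the agreement beyond its supremum.
  rintro rfl
  have : s + min δ₁ δ₂ ∈ A := by
    refine ⟨⟨by linarith, le_min (by linarith) (by linarith)⟩, fun u hu => ?_⟩
    rcases le_total u s with h | h
    · exact hag u ⟨hu.1, h⟩
    · have e1 := hx' (u - s) ⟨by linarith, by linarith [hu.2]⟩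
      have e2 := hy' (u - s) ⟨by linarith, by linarith [hu.2]⟩
      rw [add_sub_cancel] at e1 e2
      rw [e1, e2, hag s ⟨hs0, le_rfl⟩]
  linarith [le_csSup hbdd this]

end SimplePolygon

end

/-! ### Assembling the order of the paths -/

section
open Complex Set Filter Topology

namespace SimplePolygon
variable {n : ℕ} [NeZero n] {P : SimplePolygon n}

namespace HalfPolygon
variable {H K : P.HalfPolygon}

/-- The chord parameters of two half-polygons avoiding `P.bdryPoint s₀`, neither of which contains
the other, are ordered in the same way. -/
theorem exists_params_of_mem_cwArc {s₀ : ℝ} (hH : P.bdryPoint s₀ ∉ H.carrier)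
    (hK : P.bdryPoint s₀ ∉ K.carrier) (hHK : ¬ H.carrier ⊆ K.carrier)
    (hKH : ¬ K.carrier ⊆ H.carrier) (hp : H.p ∈ P.cwArc (P.bdryPoint s₀) K.p) :
    ∃ t u t' u' : ℝ, s₀ < t ∧ t < u ∧ t < t' ∧ t' < u' ∧ u < u' ∧ u' < s₀ + n ∧
      P.bdryPoint t = H.p ∧ P.bdryPoint u = H.q ∧ P.bdryPoint t' = K.p ∧ P.bdryPoint u' = K.q := by
  obtain ⟨t, u, h1, h2, h3, ht, hu⟩ := H.exists_params hH
  obtain ⟨t', u', h1', h2', h3', ht', hu'⟩ := K.exists_params hK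
  rw [cwArc_eq rfl ht' h1'.le (by linarith)] at hp
  obtain ⟨r, hr, hre⟩ := hp
  have hrt : r = t := P.bdryPoint_inj (hre.trans ht.symm) (by linarith [hr.2]) (by linarith [hr.1])
  subst hrt
  -- Otherwise the arc of `K` would be nested in that of `H`, and with it the half-polygon.
  have huu : u < u' := by
    by_contra! h
    exact hKH (carrier_subset_carrier ht hu ht' hu' hr.2 h2'.le h (by linarith))
  refine ⟨r, u, t', u', h1, h2, hr.2.lt_of_ne ?_, h2', huu, h3', ht, hu, ht', hu'⟩
  rintro rfl
  exact hHK (carrier_subset_carrier ht' hu' ht hu le_rfl h2.le huu.le (by linarith))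

/-- Two shortest paths to half-polygons in clockwise order branch in clockwise order. -/
theorem cwAng_lt_of_branch {s₀ s δ c₀ : ℝ} {σ τ : PlanePath} {d x y : ℂ}
    (hH : P.bdryPoint s₀ ∉ H.carrier) (hK : P.bdryPoint s₀ ∉ K.carrier)
    (hHK : ¬ H.carrier ⊆ K.carrier) (hKH : ¬ K.carrier ⊆ H.carrier)
    (hp : H.p ∈ P.cwArc (P.bdryPoint s₀) K.p)
    (hσ : IsShortestPath P.region (P.bdryPoint s₀) H.carrier σ)
    (hτ : IsShortestPath P.region (P.bdryPoint s₀) K.carrier τ)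
    (hs : 0 ≤ s) (hδ : 0 < δ) (hδσ : s + δ ≤ σ.length) (hδτ : s + δ ≤ τ.length)
    (hag : ∀ r ∈ Icc 0 s, σ.curve r = τ.curve r) (hx : ‖x‖ = 1) (hy : ‖y‖ = 1) (hxy : x ≠ y)
    (hx' : ∀ h ∈ Icc 0 δ, σ.curve (s + h) = σ.curve s + h * x)
    (hy' : ∀ h ∈ Icc 0 δ, τ.curve (s + h) = τ.curve s + h * y)
    (hd : s = 0 ∧ d = P.fwd s₀ ∨ δ ≤ s ∧ ‖d‖ = 1 ∧ σ.curve s = P.bdryPoint c₀ ∧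
      ∀ h ∈ Icc 0 δ, σ.curve (s - h) = σ.curve s + h * d) :
    cwAng d x < cwAng d y := by
  obtain ⟨t, u, t', u', h1, h2, h3, h4, h5, h6, ht, hu, ht', hu'⟩ :=
    exists_params_of_mem_cwArc hH hK hHK hKH hp
  obtain ⟨γ, M, hγ⟩ := hσ.exists_isExtension hH
  obtain ⟨η, M', hη⟩ := hτ.exists_isExtension hK
  have hx0 : x ≠ 0 := by rintro rfl; simp at hx
  have hy0 : y ≠ 0 := by rintro rfl; simp at hy
  obtain ⟨v, hv, hve⟩ := (cwArc_eq ht hu h2.le (by linarith)) ▸ hγ.end_mem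
  obtain ⟨v', hv', hve'⟩ := (cwArc_eq ht' hu' h4.le (by linarith)) ▸ hη.end_mem
  have eγ : ∀ r, 0 ≤ r → r ≤ s + δ → γ r = σ.curve r := fun r h h' =>
    hγ.eqOn ⟨h, h'.trans hδσ⟩
  have eη : ∀ r, 0 ≤ r → r ≤ s + δ → η r = τ.curve r := fun r h h' =>
    hη.eqOn ⟨h, h'.trans hδτ⟩
  have hM : s + δ ≤ M := hδσ.trans hγ.length_le
  have hM' : s + δ ≤ M' := hδτ.trans hη.length_le
  have hag' : ∀ r ∈ Icc 0 s, γ r = η r := fun r hr => by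
    rw [eγ r hr.1 (by linarith [hr.2]), eη r hr.1 (by linarith [hr.2]), hag r hr]
  have hxγ : ∀ h ∈ Icc 0 δ, γ (s + h) = γ s + h * x := fun h hh => by
    rw [eγ _ (by linarith [hh.1]) (by linarith [hh.2]), eγ s hs (by linarith), hx' h hh]
  have hyη : ∀ h ∈ Icc 0 δ, η (s + h) = η s + h * y := fun h hh => by
    rw [eη _ (by linarith [hh.1]) (by linarith [hh.2]), eη s hs (by linarith), hy' h hh]
  have hγ0 : γ 0 = P.bdryPoint s₀ := by rw [eγ 0 le_rfl (by linarith), hσ.source]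
  have hη0 : η 0 = P.bdryPoint s₀ := by rw [eη 0 le_rfl (by linarith), hτ.source]
  have hγs := hγ.taut.mono hs le_rfl
  have hηs := hη.taut.mono hs le_rfl
  have hne : ∀ r₁ ∈ Ioc s M, ∀ r₂ ∈ Ioc s M', γ r₁ ≠ η r₂ := fun r₁ hr₁ r₂ hr₂ =>
    hγs.ne_of_leaves hηs (hag' s ⟨hs, le_rfl⟩) hx hy hxy hδ hxγ hyη hr₁ hr₂
  have hvI : v ∈ Ioo s₀ (s₀ + n) := ⟨by linarith [hv.1], by linarith [hv.2]⟩
  have hvI' : v' ∈ Ioo s₀ (s₀ + n) := ⟨by linarith [hv'.1], by linarith [hv'.2]⟩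
  -- A reversed order `v' < v` would place both ends in the overlap of the two arcs, from `t'` to
  -- `u`, the situation excluded by `false_of_order`.
  have hvv : v ≤ v' := by
    by_contra! h
    exact false_of_order hσ hτ hγ hη ht hu ht' hu' hve.symm hve'.symm h1 h3 hv'.1 h hv.2 h5 h6 hs
      (by linarith) (by linarith) hag' hne
  -- At the root the angles are measured from the boundary edge, elsewhere from the edge back to the
  -- parent. In both cases the wrong order of the branches would reverse the ends.
  rcases hd with ⟨rfl, rfl⟩ | ⟨hδs, hd1, hc₀, hd⟩
  · refine lt_of_le_of_ne ?_ fun he => hxy (eq_of_cwAng_eq (P.fwd_ne_zero s₀) hx hy he)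
    by_contra! hlt
    exact hvv.not_gt (hγs.lt_of_cwAng_lt hηs (by linarith) hγ0 hη0 hne hx0 hy0 hδ hM hM' hxγ hyη
      hvI hvI' hve.symm hve'.symm hlt)
  · have hd0 : d ≠ 0 := by rintro rfl; simp at hd1
    refine lt_of_le_of_ne ?_ fun he => hxy (eq_of_cwAng_eq hd0 hx hy he)
    by_contra! hlt
    obtain ⟨c, hc, hce⟩ := P.exists_param (P.bdryPoint_mem c₀) s₀
    have hsc : γ s = P.bdryPoint c := by rw [eγ s hs (by linarith), hc₀, hce]
    have hcs : s₀ ≠ c := by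
      rintro rfl
      have := hγ.taut.injOn ⟨hs, by linarith⟩ ⟨le_rfl, by linarith⟩ (hsc.trans hγ0.symm)
      linarith
    refine hvv.not_gt (hγ.taut.lt_of_branch hη.taut hag' hne hγ0 hsc hve.symm hve'.symm
      ⟨hc.1.lt_of_ne hcs, hc.2⟩ hvI hvI' hδ hδs hM hM' hd1 hx hy hxγ hyη (fun h hh => ?_) hlt)
    rw [eγ _ (by linarith [hh.2]) (by linarith [hh.1]), eγ s hs (by linarith), hd h hh]

end HalfPolygon

/-- The shortest paths to two half-polygons in clockwise order occur in the tree in this order. -/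
theorem treeLE_of_mem_cwArc {s₀ : ℝ} {k : ℕ} (H : Fin k → P.HalfPolygon) {σ τ : PlanePath}
    {i j : Fin k} (hi : P.bdryPoint s₀ ∉ (H i).carrier) (hj : P.bdryPoint s₀ ∉ (H j).carrier)
    (hij : ¬ (H i).carrier ⊆ (H j).carrier) (hji : ¬ (H j).carrier ⊆ (H i).carrier)
    (hp : (H i).p ∈ P.cwArc (P.bdryPoint s₀) (H j).p)
    (hσ : IsShortestPath P.region (P.bdryPoint s₀) (H i).carrier σ)
    (hτ : IsShortestPath P.region (P.bdryPoint s₀) (H j).carrier τ) :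
    P.TreeLE (P.bdryPoint s₀) (P.augmentedTree (P.bdryPoint s₀) H) σ τ := by
  refine ⟨Or.inr (Or.inr (Or.inr (Or.inr ⟨i, hσ⟩))), Or.inr (Or.inr (Or.inr (Or.inr ⟨j, hτ⟩))), ?_⟩
  have kσ := isTautOn_of_isShortestPath hσ
  have kτ := isTautOn_of_isShortestPath hτ
  rcases exists_branch kσ kτ (hσ.source.trans hτ.source.symm) hσ.length_nonneg hτ.length_nonneg with
    h | h | ⟨s, δ, x, y, hs, hδ, hδσ, hδτ, hag, hx, hy, hxy, hx', hy'⟩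
  · exact Or.inr (Or.inl h)
  · exact Or.inr (Or.inr h)
  have hx0 : x ≠ 0 := by rintro rfl; simp at hx
  have hy0 : y ≠ 0 := by rintro rfl; simp at hy
  have hI := hσ.initial hs (by linarith)
  left
  rcases hs.eq_or_lt with rfl | hs0
  · rw [hσ.source] at hI
    exact ⟨0, le_rfl, by linarith, by linarith, Or.inl hI, hag, P.fwd s₀, x, y,
      ⟨δ, hδ, hδσ, hx'⟩, ⟨δ, hδ, hδτ, hy'⟩, Or.inl ⟨rfl, s₀, rfl, rfl⟩,
      clockwiseBefore_of_lt (P.fwd_ne_zero s₀) hx0 hy0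
        (HalfPolygon.cwAng_lt_of_branch (c₀ := 0) hi hj hij hji hp hσ hτ le_rfl hδ hδσ hδτ hag hx hy
          hxy hx' hy' (Or.inl ⟨rfl, rfl⟩))⟩
  · obtain ⟨ε, hε, d, hd, hεs, hd'⟩ := kσ.left s ⟨hs0, by linarith⟩
    have hd0 : d ≠ 0 := by rintro rfl; simp at hd
    have m1 := min_le_left δ ε
    have m2 := min_le_right δ ε
    have hm := lt_min hδ hε
    have kx : ∀ h ∈ Icc 0 (min δ ε), σ.curve (s + h) = σ.curve s + h * x := fun h hh =>
      hx' h ⟨hh.1, hh.2.trans m1⟩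
    have ky : ∀ h ∈ Icc 0 (min δ ε), τ.curve (s + h) = τ.curve s + h * y := fun h hh =>
      hy' h ⟨hh.1, hh.2.trans m1⟩
    have kd : ∀ h ∈ Icc 0 (min δ ε), σ.curve (s - h) = σ.curve s + h * d := fun h hh =>
      hd' h ⟨hh.1, hh.2.trans m2⟩
    -- The branching point is a vertex of the polygon, so the common part is one of the root paths
    -- of the tree.
    obtain ⟨c, hc⟩ := kσ.exists_vertex kτ hag hm (by linarith) (by linarith) (by linarith) hd hx hy
      hxy kx ky kd
    refine ⟨s, hs, by linarith, by linarith, Or.inr (Or.inl ?_), hag, d, x, y,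
      ⟨δ, hδ, hδσ, hx'⟩, ⟨δ, hδ, hδτ, hy'⟩, Or.inr ⟨hs0, ε, hε, by linarith, hd'⟩,
      clockwiseBefore_of_lt hd0 hx0 hy0
        (HalfPolygon.cwAng_lt_of_branch (c₀ := c) hi hj hij hji hp hσ hτ hs hm (by linarith)
          (by linarith) hag hx hy hxy kx ky (Or.inr ⟨by linarith, hd, hc, kd⟩))⟩
    rw [hc, P.bdryPoint_intCast] at hI
    exact ⟨_, hI⟩

end SimplePolygon

end

theorem lemma3 {n : ℕ} [NeZero n] (P : SimplePolygon n) (a : ℂ) (ha : a ∈ P.boundary)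
    {k : ℕ} (H : Fin k → P.HalfPolygon)
    (h_avoid : ∀ i, a ∉ (H i).carrier)
    (h_minimal : ∀ i j, i ≠ j → ¬ (H i).carrier ⊆ (H j).carrier)
    (h_sorted : ∀ i j, i < j → (H i).p ∈ P.cwArc a (H j).p)
    (π : Fin k → PlanePath)
    (h_path : ∀ i, IsShortestPath P.region a (H i).carrier (π i)) :
    ∀ i j, i < j → P.TreeLE a (P.augmentedTree a H) (π i) (π j) := by
  intro i j hij
  obtain ⟨s₀, -, rfl⟩ := P.exists_param ha 0
  exact SimplePolygon.treeLE_of_mem_cwArc H (h_avoid i) (h_avoid j) (h_minimal i j hij.ne)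
    (h_minimal j i hij.ne') (h_sorted i j hij) (h_path i) (h_path j)
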